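/- Let $N\ge 0$ be an integer and let $q,c_0,c_1,c_2,c_3,c_4$ be nonzero complex numbers with $q^{2N+3}c_0c_1c_2c_3c_4=1$. Fix square roots $q^{1/2},c_0^{1/2},\dots,c_4^{1/2}$ with $q^{N+3/2}c_0^{1/2}c_1^{1/2}c_2^{1/2}c_3^{1/2}c_4^{1/2}=1$; all half-integer powers of monomials in $q,c_0,\dots,c_4$ below are formed multiplicatively from these roots. Write $(a;q)_k=\prod_{l=0}^{k-1}(1-aq^l)$ and $\binom{N}{n}_q=\frac{(q;q)_N}{(q;q)_n(q;q)_{N-n}}$ for $0\le n\le N$. For parameters $a_1,\dots,a_4$ and a nonnegative integer $K$ put $$\Omega(n;a_1,a_2,a_3;K)=\binom{K}{n}_q\frac{(1-a_2a_3q^{2n+1})(qa_2;q)_n(a_1a_2a_3q^{K+2};q)_n(qa_1;q)_{K-n}}{(qa_2)^{n-K/2}(a_2a_3q^{n+1};q)_{K+1}(qa_3;q)_n},$$ $$\Lambda(x;a_1,a_2,a_3,a_4;K)=(-1)^x\binom{K}{x}_q\frac{(1-a_1a_2q^{2x+1})(qa_2;q)_x(qa_2)^{K/2}}{(qa_1;q)_x(a_1a_2q^{x+1};q)_{K+1}}\Big(\frac{a_1a_3q^{x-1}}{a_2a_4}\Big)^{x/2},$$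 where the factor $1-a_2a_3q^{2n+1}$ (resp. $1-a_1a_2q^{2x+1}$) is understood to be cancelled against the equal factor of the Pochhammer symbol in the denominator, and $$\xi_n(a_1,a_2)=\frac{(qa_1;q)_n}{(qa_2;q)_n}\Big(\frac{a_2}{a_1}\Big)^{n/2},\qquad \omega_n(a)=(-1)^na^{n/2}q^{\binom{n+1}{2}}.$$ The normalized $q$-Racah polynomials are, for $0\le n,x\le K$, $$p_n(x;a_1,a_2,a_3;K)=\Omega(n;a_1,a_2,a_3;K)\,{}_4\phi_3\!\left(\begin{matrix}q^{-n},\,a_2a_3q^{n+1},\,q^{-x},\,a_1a_2q^{x+1}\\ qa_2,\,a_1a_2a_3q^{K+2},\,q^{-K}\end{matrix};q;q\right)$$ (the terminating basic hypergeometric sum over $0\le k\le n$), and $p_n(x;a_1,a_2,a_3;K)=0$ if $n>K$ or $x>K$. The Griffiths polynomials of $q$-Racah type are $$G_{i,j}(x,y;c_1,c_2,c_3,c_4;N)=\sum_{a=0}^{\min(N-j,N-y)}\omega_a\Big(\frac{c_1c_2c_3}{c_4}\Big)p_i(a;c_1,c_2,c_3;N-j)\,p_j(y;c_3,c_0,c_4;N-a)\,p_a(x;c_4,c_2,c_1;N-y),$$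 where $c_0$ is determined (with its root) by $c_1,\dots,c_4$ through the constraint above; accordingly, in $G_{k,\ell}(y,x;c_1,c_3,c_2,c_0;N)$ the role of $c_0$ is played by $c_4$. Assume the constraints under which both families are defined: $q^m\neq1$ for $1\le m\le N$; $c_0,c_1,c_2,c_3,c_4\notin\{q^{-1},\dots,q^{-N}\}$; and $$c_1c_2,\ c_2c_3,\ c_0c_3,\ c_0c_4,\ c_2c_4,\ qc_1c_2c_3,\ qc_0c_3c_4,\ qc_1c_2c_4,\ c_1c_3,\ qc_0c_2c_4\ \notin\{q^{-2},q^{-3},\dots,q^{-2N}\}.$$ Then the Griffiths polynomials are biorthogonal: for all nonnegative integers $i,j,k,\ell$ with $i+j\le N$ and $k+\ell\le N$, $$\sum_{\substack{x,y\ge0\\x+y\le N}}\frac{\Omega(x;c_1,c_2,c_4;N-y)\,\Lambda(y;c_3,c_0,c_4,c_1;N)}{\xi_x(c_2,c_4)\,\xi_y(c_0,c_3)\,(c_1/c_0)^{x/2}(c_4/c_1)^{y/2}}\,G_{i,j}(x,y;c_1,c_2,c_3,c_4;N)\,G_{k,\ell}(y,x;c_1,c_3,c_2,c_0;N)$$ $$=\delta_{i,k}\,\delta_{j,\ell}\,\frac{\omega_j\big(\tfrac{c_2c_0c_4}{c_3}\big)\,\omega_N(qc_1c_2c_3)}{\omega_i(c_2c_3)}\,\frac{\Omega(i;c_1,c_2,c_3;N-j)\,\Lambda(j;c_4,c_0,c_3,c_1;N)}{\xi_i(c_2,c_3)\,\xi_j(c_0,c_4)}.$$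 On the other hand, if $N\ge1$ they are not orthogonal: there are no functions $w(x,y)$ and $h_{i,j}\ne0$ with complex values such that $$\sum_{\substack{x,y\ge0\\x+y\le N}}w(x,y)\,G_{i,j}(x,y;c_1,c_2,c_3,c_4;N)\,G_{k,\ell}(x,y;c_1,c_2,c_3,c_4;N)=\delta_{i,k}\,\delta_{j,\ell}\,h_{i,j}$$ for all $i+j\le N$, $k+\ell\le N$. -/

import Mathlib

/-!
Half-integer powers of the parameters occur throughout. They are handled by working with square
roots: below, `r` is a square root of `q` (so `q = r ^ 2`, `q ^ (n / 2) = r ^ n`), and `sᵢ` is a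
square root of the parameter `cᵢ` (so `cᵢ = sᵢ ^ 2`, `cᵢ ^ (n / 2) = sᵢ ^ n`). The root of a product
or quotient of parameters is the product or quotient of their roots.
-/

noncomputable section

namespace QGriffiths

/-- The `q`-Pochhammer symbol `(a; q)_k = ∏_{l < k} (1 - a q ^ l)`. -/
def qPoch (a q : ℂ) (k : ℕ) : ℂ := ∏ l ∈ Finset.range k, (1 - a * q ^ l)

/-- The `q`-binomial coefficient; it vanishes for `n > N`. -/
def qBinom (q : ℂ) (N n : ℕ) : ℂ :=
  if n ≤ N then qPoch q q N / (qPoch q q n * qPoch q q (N - n)) else 0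

/-- The terminating basic hypergeometric series
`₄φ₃(q ^ (-n), a₂, a₃, a₄; b₁, b₂, b₃; q; z)`. -/
def phi43 (n : ℕ) (a2 a3 a4 b1 b2 b3 q z : ℂ) : ℂ :=
  ∑ k ∈ Finset.range (n + 1),
    (qPoch ((q ^ n)⁻¹) q k * qPoch a2 q k * qPoch a3 q k * qPoch a4 q k) /
      (qPoch b1 q k * qPoch b2 q k * qPoch b3 q k) * (z ^ k / qPoch q q k)

/-- For `0 ≤ n ≤ N`, the quotient `(c q ^ (n + 1); q)_{N + 1} / (1 - c q ^ (2 n + 1))`, with the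
factor of index `l = n` of the Pochhammer symbol, which is `1 - c q ^ (2 n + 1)`, cancelled. -/
def reducedPoch (c q : ℂ) (n N : ℕ) : ℂ :=
  ∏ l ∈ (Finset.range (N + 1)).erase n, (1 - c * q ^ (n + 1) * q ^ l)

theorem inv_reducedPoch (c q : ℂ) {n N : ℕ} (hn : n ≤ N) (h : 1 - c * q ^ (2 * n + 1) ≠ 0) :
    (reducedPoch c q n N)⁻¹ = (1 - c * q ^ (2 * n + 1)) / qPoch (c * q ^ (n + 1)) q (N + 1) := by
  have hmem : n ∈ Finset.range (N + 1) := Finset.mem_range.2 (Nat.lt_succ_of_le hn)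
  have hfac : 1 - c * q ^ (n + 1) * q ^ n = 1 - c * q ^ (2 * n + 1) := by ring
  have hprod : qPoch (c * q ^ (n + 1)) q (N + 1)
      = (1 - c * q ^ (2 * n + 1)) * reducedPoch c q n N := by
    rw [qPoch, reducedPoch, ← Finset.mul_prod_erase _ _ hmem, hfac]
  rw [hprod, div_mul_eq_div_div, div_self h, one_div]

/-- The function `Ω(n; c₁, c₂, c₃; N)`, for `0 ≤ n ≤ N`. The quotient
`(1 - c₂ c₃ q ^ (2 n + 1)) / (c₂ c₃ q ^ (n + 1); q)_{N + 1}` is written in reduced form, which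
removes its apparent poles at `c₂ c₃ = q ^ (-1)` and `c₂ c₃ = q ^ (-2 N - 1)`. -/
def Omega (r : ℂ) (n : ℕ) (s1 s2 s3 : ℂ) (N : ℕ) : ℂ :=
  qBinom (r ^ 2) N n *
    (qPoch (r ^ 2 * s2 ^ 2) (r ^ 2) n *
      qPoch (s1 ^ 2 * s2 ^ 2 * s3 ^ 2 * (r ^ 2) ^ (N + 2)) (r ^ 2) n *
      qPoch (r ^ 2 * s1 ^ 2) (r ^ 2) (N - n)) /
    ((r * s2) ^ (2 * (n : ℤ) - (N : ℤ)) * reducedPoch (s2 ^ 2 * s3 ^ 2) (r ^ 2) n N *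
      qPoch (r ^ 2 * s3 ^ 2) (r ^ 2) n)

/-- The function `Λ(x; c₁, c₂, c₃, c₄; N)`, for `0 ≤ x ≤ N`, with
`(1 - c₁ c₂ q ^ (2 x + 1)) / (c₁ c₂ q ^ (x + 1); q)_{N + 1}` in reduced form. -/
def Lambda (r : ℂ) (x : ℕ) (s1 s2 s3 s4 : ℂ) (N : ℕ) : ℂ :=
  (-1) ^ x * qBinom (r ^ 2) N x *
    (qPoch (r ^ 2 * s2 ^ 2) (r ^ 2) x * (r * s2) ^ N) /
    (qPoch (r ^ 2 * s1 ^ 2) (r ^ 2) x * reducedPoch (s1 ^ 2 * s2 ^ 2) (r ^ 2) x N) *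
    (s1 * s3 * r ^ ((x : ℤ) - 1) / (s2 * s4)) ^ x

/-- The function `ξ_n(c₁, c₂)`. -/
def xi (r : ℂ) (n : ℕ) (s1 s2 : ℂ) : ℂ :=
  qPoch (r ^ 2 * s1 ^ 2) (r ^ 2) n / qPoch (r ^ 2 * s2 ^ 2) (r ^ 2) n * (s2 / s1) ^ n

/-- The function `ω_n(c) = (-1) ^ n c ^ (n / 2) q ^ (n + 1 choose 2)`, with `c = s ^ 2`. -/
def omega (r : ℂ) (n : ℕ) (s : ℂ) : ℂ :=
  (-1) ^ n * s ^ n * (r ^ 2) ^ ((n + 1).choose 2)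

/-- The normalized univariate `q`-Racah polynomial `p_n(x; c₁, c₂, c₃; N)`, with the convention that
it vanishes for `n > N` or `x > N`. -/
def qRacah (r : ℂ) (n x : ℕ) (s1 s2 s3 : ℂ) (N : ℕ) : ℂ :=
  if n ≤ N ∧ x ≤ N then
    Omega r n s1 s2 s3 N *
      phi43 n (s2 ^ 2 * s3 ^ 2 * (r ^ 2) ^ (n + 1)) (((r ^ 2) ^ x)⁻¹)
        (s1 ^ 2 * s2 ^ 2 * (r ^ 2) ^ (x + 1))
        (r ^ 2 * s2 ^ 2) (s1 ^ 2 * s2 ^ 2 * s3 ^ 2 * (r ^ 2) ^ (N + 2)) (((r ^ 2) ^ N)⁻¹)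
        (r ^ 2) (r ^ 2)
  else 0

/-- The root of `c₀` determined by the roots of `q, c₁, …, c₄` through
`q ^ (N + 3 / 2) (c₀ c₁ c₂ c₃ c₄) ^ (1 / 2) = 1`; in particular
`q ^ (2 N + 3) c₀ c₁ c₂ c₃ c₄ = 1`. -/
def rootC0 (r s1 s2 s3 s4 : ℂ) (N : ℕ) : ℂ := (r ^ (2 * N + 3) * s1 * s2 * s3 * s4)⁻¹

/-- The bivariate Griffiths polynomial of `q`-Racah type `G_{i,j}(x, y; c₁, c₂, c₃, c₄; N)`. -/
def griffiths (r : ℂ) (i j x y : ℕ) (s1 s2 s3 s4 : ℂ) (N : ℕ) : ℂ :=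
  ∑ a ∈ Finset.range (min (N - j) (N - y) + 1),
    omega r a (s1 * s2 * s3 / s4) * qRacah r i a s1 s2 s3 (N - j) *
      qRacah r j y s3 (rootC0 r s1 s2 s3 s4 N) s4 (N - a) * qRacah r a x s4 s2 s1 (N - y)

/-- `c ∉ {q ^ (-1), …, q ^ (-N)}`. -/
def Avoids1 (q c : ℂ) (N : ℕ) : Prop := ∀ m : ℕ, 1 ≤ m → m ≤ N → c ≠ (q ^ m)⁻¹

/-- `c ∉ {q ^ (-2), …, q ^ (-2 N)}`. -/
def Avoids2 (q c : ℂ) (N : ℕ) : Prop := ∀ m : ℕ, 2 ≤ m → m ≤ 2 * N → c ≠ (q ^ m)⁻¹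

/-- The constraints on the parameters `q, c₀, c₁, c₂, c₃, c₄` under which the Griffiths polynomials
`G_{i,j}(x, y; c₁, c₂, c₃, c₄; N)` are considered. -/
structure Admissible (q c0 c1 c2 c3 c4 : ℂ) (N : ℕ) : Prop where
  q_ne : q ≠ 0
  c_ne : c0 ≠ 0 ∧ c1 ≠ 0 ∧ c2 ≠ 0 ∧ c3 ≠ 0 ∧ c4 ≠ 0
  constr : q ^ (2 * N + 3) * c0 * c1 * c2 * c3 * c4 = 1
  q_pow : ∀ m : ℕ, 1 ≤ m → m ≤ N → q ^ m ≠ 1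
  c12 : Avoids2 q (c1 * c2) N
  c23 : Avoids2 q (c2 * c3) N
  c03 : Avoids2 q (c0 * c3) N
  c04 : Avoids2 q (c0 * c4) N
  c24 : Avoids2 q (c2 * c4) N
  c123 : Avoids2 q (q * c1 * c2 * c3) N
  c034 : Avoids2 q (q * c0 * c3 * c4) N
  c124 : Avoids2 q (q * c1 * c2 * c4) N
  single : Avoids1 q c0 N ∧ Avoids1 q c1 N ∧ Avoids1 q c2 N ∧ Avoids1 q c3 N ∧ Avoids1 q c4 N

/-- Sum of `f x y` over all nonnegative integers `x, y` with `x + y ≤ N`. -/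
def simplexSum (N : ℕ) (f : ℕ → ℕ → ℂ) : ℂ :=
  ∑ x ∈ Finset.range (N + 1), ∑ y ∈ Finset.range (N - x + 1), f x y

/-- The family `P_{i,j}(x, y)` (`i + j ≤ N`) is orthogonal on the grid `x + y ≤ N` with respect to
some weight function, with nonzero norms. -/
def IsOrthogonalFamily (N : ℕ) (P : ℕ → ℕ → ℕ → ℕ → ℂ) : Prop :=
  ∃ w h : ℕ → ℕ → ℂ, (∀ i j : ℕ, i + j ≤ N → h i j ≠ 0) ∧
    ∀ i j k l : ℕ, i + j ≤ N → k + l ≤ N →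
      simplexSum N (fun x y => w x y * P i j x y * P k l x y) =
        if i = k ∧ j = l then h i j else 0

end QGriffiths

end

noncomputable section

namespace QGriffiths

theorem qPoch_zero (a q : ℂ) : qPoch a q 0 = 1 := by simp [qPoch]

theorem qPoch_succ (a q : ℂ) (k : ℕ) : qPoch a q (k + 1) = qPoch a q k * (1 - a * q ^ k) := by
  simp [qPoch, Finset.prod_range_succ]

theorem qPoch_succ' (a q : ℂ) (k : ℕ) : qPoch a q (k + 1) = (1 - a) * qPoch (q * a) q k := by
  simp only [qPoch, Finset.prod_range_succ', pow_zero, mul_one]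
  rw [mul_comm]
  congr 1
  exact Finset.prod_congr rfl fun l _ => by ring

theorem qPoch_shift (a q : ℂ) (k : ℕ) :
    (1 - a) * qPoch (q * a) q k = qPoch a q k * (1 - a * q ^ k) := by
  rw [← qPoch_succ', qPoch_succ]

theorem qPoch_ne_zero {a q : ℂ} {k : ℕ} (h : ∀ l < k, 1 - a * q ^ l ≠ 0) : qPoch a q k ≠ 0 :=
  Finset.prod_ne_zero_iff.2 fun l hl => h l (Finset.mem_range.1 hl)

theorem qPoch_add (a q : ℂ) (m n : ℕ) :
    qPoch a q (m + n) = qPoch a q m * qPoch (a * q ^ m) q n := by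
  simp only [qPoch, Finset.prod_range_add]
  congr 1
  exact Finset.prod_congr rfl fun l _ => by rw [pow_add]; ring

theorem qPoch_inv_pow_eq_zero {q : ℂ} (hq : q ≠ 0) {n k : ℕ} (h : n < k) :
    qPoch (q ^ n)⁻¹ q k = 0 :=
  Finset.prod_eq_zero (Finset.mem_range.2 h) (by field_simp; simp)

/-- The `k`-th term of the `q`-Racah series, as a function of `X = q ^ x`. -/
def coreTerm (q C D e1 e2 e3 : ℂ) (n : ℕ) (X : ℂ) (k : ℕ) : ℂ :=
  qPoch ((q ^ n)⁻¹) q k * qPoch (D * q ^ (n + 1)) q k * (qPoch X⁻¹ q k * qPoch (C * q * X) q k) /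
    (qPoch e1 q k * qPoch e2 q k * qPoch e3 q k) * (q ^ k / qPoch q q k)

/-- The `q`-Racah series `₄φ₃(q ^ (-n), D q ^ (n + 1), X⁻¹, C q X; e₁, e₂, e₃; q; q)`. -/
def core (q C D e1 e2 e3 : ℂ) (n : ℕ) (X : ℂ) : ℂ :=
  ∑ k ∈ Finset.range (n + 1), coreTerm q C D e1 e2 e3 n X k

theorem core_zero (q C D e1 e2 e3 X : ℂ) : core q C D e1 e2 e3 0 X = 1 := by
  simp [core, coreTerm, qPoch_zero]

theorem core_one {q C D e1 e2 e3 : ℂ} (n : ℕ) : core q C D e1 e2 e3 n 1 = 1 := by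
  rw [core, Finset.sum_eq_single 0]
  · simp [coreTerm, qPoch_zero]
  · intro k _ hk
    obtain ⟨k, rfl⟩ := Nat.exists_eq_succ_of_ne_zero hk
    have : qPoch (1 : ℂ)⁻¹ q (k + 1) = 0 := by rw [qPoch_succ']; simp
    rw [coreTerm, Nat.succ_eq_add_one, this]
    simp
  · simp

theorem core_perm23 (q C D e1 e2 e3 : ℂ) (n : ℕ) (X : ℂ) :
    core q C D e1 e2 e3 n X = core q C D e1 e3 e2 n X := by
  simp only [core, coreTerm, mul_right_comm (qPoch e1 q _)]

theorem core_eq_sum_of_le {q : ℂ} (hq : q ≠ 0) (C D e1 e2 e3 : ℂ) {n M : ℕ} (h : n ≤ M) (X : ℂ) :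
    core q C D e1 e2 e3 n X = ∑ k ∈ Finset.range (M + 1), coreTerm q C D e1 e2 e3 n X k := by
  refine Finset.sum_subset (Finset.range_mono (by omega)) fun k _ hk => ?_
  have : n < k := by simpa using hk
  simp [coreTerm, qPoch_inv_pow_eq_zero hq this]

theorem core_symm {q : ℂ} (hq : q ≠ 0) (C D e1 e2 e3 : ℂ) (n x : ℕ) :
    core q C D e1 e2 e3 n (q ^ x) = core q D C e1 e2 e3 x (q ^ n) := by
  rw [core_eq_sum_of_le hq _ _ _ _ _ (le_max_left n x),
    core_eq_sum_of_le hq _ _ _ _ _ (le_max_right n x)]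
  refine Finset.sum_congr rfl fun k _ => ?_
  simp only [coreTerm, pow_succ']
  rw [mul_assoc D, mul_assoc C]
  ring

/-- Lowering one of the lower parameters. -/
theorem core_rel {q C D e1 e2 e X : ℂ} {n : ℕ} (hX : X ≠ 0) (hq : q ≠ 0)
    (hC : C * q * X ^ 2 - 1 ≠ 0) (he : ∀ k ≤ n, 1 - e * q ^ k ≠ 0) :
    core q C D e1 e2 e n X =
      (C * q * X - 1) * (1 - e * X) / ((1 - e) * (C * q * X ^ 2 - 1)) *
        core q (q * C) D e1 e2 (q * e) n X +
      (X - 1) * (C * q * X - e) / ((1 - e) * (C * q * X ^ 2 - 1)) *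
        core q (q * C) D e1 e2 (q * e) n (X / q) := by
  simp only [core, Finset.mul_sum, ← Finset.sum_add_distrib]
  refine Finset.sum_congr rfl fun k hk => ?_
  have hk : k ≤ n := by simpa [Nat.lt_succ_iff] using hk
  have he0 : 1 - e ≠ 0 := by simpa using he 0 (Nat.zero_le _)
  have hek : qPoch e q k ≠ 0 := qPoch_ne_zero fun l hl => he l (by omega)
  have h3 := qPoch_shift e q k
  have hqek : qPoch (q * e) q k = qPoch e q k * (1 - e * q ^ k) / (1 - e) := by
    rw [← h3]; field_simp
  have h1 := qPoch_shift X⁻¹ q k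
  have h2 := qPoch_shift (C * q * X) q k
  have e1' : (X / q)⁻¹ = q * X⁻¹ := by rw [inv_div]; ring
  have e2' : q * C * q * X = q * (C * q * X) := by ring
  have e3' : q * C * q * (X / q) = C * q * X := by field_simp
  have hh1 : (X - 1) * qPoch (q * X⁻¹) q k = qPoch X⁻¹ q k * (X - q ^ k) := by
    have hxx : X * X⁻¹ = 1 := mul_inv_cancel₀ hX
    linear_combination X * h1 + (qPoch (q * X⁻¹) q k - qPoch X⁻¹ q k * q ^ k) * hxx
  simp only [coreTerm, e1', e2', e3', hqek]
  have hk1 := he k hk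
  generalize hA : qPoch ((q ^ n)⁻¹) q k * qPoch (D * q ^ (n + 1)) q k = A
  generalize hB : q ^ k / qPoch q q k = B
  generalize hE : qPoch e1 q k * qPoch e2 q k = E
  have key : (C * q * X - 1) * (1 - e * X) * (qPoch X⁻¹ q k * qPoch (q * (C * q * X)) q k) +
      (X - 1) * (C * q * X - e) * (qPoch (q * X⁻¹) q k * qPoch (C * q * X) q k) =
      (C * q * X ^ 2 - 1) * (1 - e * q ^ k) * (qPoch X⁻¹ q k * qPoch (C * q * X) q k) := by
    linear_combination (-(1 - e * X) * qPoch X⁻¹ q k) * h2 +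
      (C * q * X - e) * qPoch (C * q * X) q k * hh1
  have : qPoch X⁻¹ q k * qPoch (C * q * X) q k =
      ((C * q * X - 1) * (1 - e * X) * (qPoch X⁻¹ q k * qPoch (q * (C * q * X)) q k) +
      (X - 1) * (C * q * X - e) * (qPoch (q * X⁻¹) q k * qPoch (C * q * X) q k)) /
      ((C * q * X ^ 2 - 1) * (1 - e * q ^ k)) := by
    rw [eq_div_iff (mul_ne_zero hC hk1), key]; ring
  rw [this]
  generalize qPoch X⁻¹ q k * qPoch (q * (C * q * X)) q k = U
  generalize qPoch (q * X⁻¹) q k * qPoch (C * q * X) q k = V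
  generalize qPoch e q k = W at hek ⊢
  by_cases hE0 : E = 0
  · simp [hE0]
  field_simp

theorem raise_bracket {q C D e1 e2 e3 X Q : ℂ} (hX : X ≠ 0) (hq : q ≠ 0) (hC0 : C ≠ 0)
    (hQ : Q ≠ 0) (hC : C * q * X ^ 2 - 1 ≠ 0) (hbal : e1 * e2 * e3 = C * D * q ^ 3) :
    (C * q * X * Q - 1) * ((1 - e1 * X) * (1 - e2 * X) * (1 - e3 * X)) /
        (X * (C * q * X ^ 2 - 1)) +
      (X - Q) * ((C * q * X - e1) * (C * q * X - e2) * (C * q * X - e3)) /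
        (C * q * X * (C * q * X ^ 2 - 1)) =
    ((1 - e1 * Q) * (1 - e2 * Q) * (1 - e3 * Q) -
      (1 - D * q ^ 2 * Q) * ((1 - Q / X) * (1 - C * q * X * Q))) / Q := by
  have : D = e1 * e2 * e3 / (C * q ^ 3) := by rw [hbal]; field_simp
  subst this
  field_simp
  ring

/-- Raising the index by one. -/
theorem core_raise {q C D e1 e2 e3 X : ℂ} {n : ℕ} (hX : X ≠ 0) (hq : q ≠ 0) (hC0 : C ≠ 0)
    (hC : C * q * X ^ 2 - 1 ≠ 0) (h1 : ∀ k ≤ n, 1 - e1 * q ^ k ≠ 0)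
    (h2 : ∀ k ≤ n, 1 - e2 * q ^ k ≠ 0) (h3 : ∀ k ≤ n, 1 - e3 * q ^ k ≠ 0)
    (hqn : ∀ k ≤ n, 1 - q ^ (k + 1) ≠ 0) (hbal : e1 * e2 * e3 = C * D * q ^ 3) :
    core q C D e1 e2 e3 (n + 1) X =
      (C * q * X - 1) * ((1 - e1 * X) * (1 - e2 * X) * (1 - e3 * X)) /
        (X * ((1 - e1) * (1 - e2) * (1 - e3)) * (C * q * X ^ 2 - 1)) *
        core q (q * C) (q ^ 2 * D) (q * e1) (q * e2) (q * e3) n X +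
      (X - 1) * ((C * q * X - e1) * (C * q * X - e2) * (C * q * X - e3)) /
        (C * q * X * ((1 - e1) * (1 - e2) * (1 - e3)) * (C * q * X ^ 2 - 1)) *
        core q (q * C) (q ^ 2 * D) (q * e1) (q * e2) (q * e3) n (X / q) := by
  set b : ℕ → ℂ := fun k => qPoch X⁻¹ q k * qPoch (C * q * X) q k with hb
  set G : ℕ → ℂ := fun k => qPoch ((q ^ n)⁻¹) q k * qPoch (D * q ^ (n + 3)) q k /
    (qPoch e1 q k * qPoch e2 q k * qPoch e3 q k * qPoch q q k) with hG
  set H : ℕ → ℂ := fun k => qPoch ((q ^ n)⁻¹) q k * qPoch (D * q ^ (n + 3)) q k *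
    (1 - D * q ^ (k + 2)) / (qPoch e1 q (k + 1) * qPoch e2 q (k + 1) * qPoch e3 q (k + 1) *
      qPoch q q k) with hH
  have z1 : 1 - e1 ≠ 0 := by simpa using h1 0 (Nat.zero_le _)
  have z2 : 1 - e2 ≠ 0 := by simpa using h2 0 (Nat.zero_le _)
  have z3 : 1 - e3 ≠ 0 := by simpa using h3 0 (Nat.zero_le _)
  have rhs : ∀ k ∈ Finset.range (n + 1),
      (C * q * X - 1) * ((1 - e1 * X) * (1 - e2 * X) * (1 - e3 * X)) /
        (X * ((1 - e1) * (1 - e2) * (1 - e3)) * (C * q * X ^ 2 - 1)) *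
        coreTerm q (q * C) (q ^ 2 * D) (q * e1) (q * e2) (q * e3) n X k +
      (X - 1) * ((C * q * X - e1) * (C * q * X - e2) * (C * q * X - e3)) /
        (C * q * X * ((1 - e1) * (1 - e2) * (1 - e3)) * (C * q * X ^ 2 - 1)) *
        coreTerm q (q * C) (q ^ 2 * D) (q * e1) (q * e2) (q * e3) n (X / q) k =
      G k * b k - H k * b (k + 1) := by
    intro k hk
    have hk : k ≤ n := by simpa [Nat.lt_succ_iff] using hk
    have y1 : qPoch e1 q k ≠ 0 := qPoch_ne_zero fun l hl => h1 l (by omega)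
    have y2 : qPoch e2 q k ≠ 0 := qPoch_ne_zero fun l hl => h2 l (by omega)
    have y3 : qPoch e3 q k ≠ 0 := qPoch_ne_zero fun l hl => h3 l (by omega)
    have yq : qPoch q q k ≠ 0 := qPoch_ne_zero fun l hl => by
      rw [← pow_succ']; exact hqn l (by omega)
    have s1 : qPoch (q * e1) q k = qPoch e1 q k * (1 - e1 * q ^ k) / (1 - e1) := by
      rw [← qPoch_shift]; field_simp
    have s2 : qPoch (q * e2) q k = qPoch e2 q k * (1 - e2 * q ^ k) / (1 - e2) := by
      rw [← qPoch_shift]; field_simp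
    have s3 : qPoch (q * e3) q k = qPoch e3 q k * (1 - e3 * q ^ k) / (1 - e3) := by
      rw [← qPoch_shift]; field_simp
    have t1 := qPoch_shift X⁻¹ q k
    have t2 := qPoch_shift (C * q * X) q k
    have hh1 : (X - 1) * qPoch (q * X⁻¹) q k = qPoch X⁻¹ q k * (X - q ^ k) := by
      have hxx : X * X⁻¹ = 1 := mul_inv_cancel₀ hX
      linear_combination X * t1 + (qPoch (q * X⁻¹) q k - qPoch X⁻¹ q k * q ^ k) * hxx
    have e1' : (X / q)⁻¹ = q * X⁻¹ := by rw [inv_div]; ring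
    have e2' : q * C * q * X = q * (C * q * X) := by ring
    have e3' : q * C * q * (X / q) = C * q * X := by field_simp
    have e4' : q ^ 2 * D * q ^ (n + 1) = D * q ^ (n + 3) := by ring
    have br := raise_bracket (Q := q ^ k) hX hq hC0 (pow_ne_zero k hq) hC hbal
    simp only [coreTerm, e1', e2', e3', e4', s1, s2, s3, hG, hH, hb]
    have w1 := h1 k hk
    have w2 := h2 k hk
    have w3 := h3 k hk
    simp only [qPoch_succ]
    have hXi : (1 - X⁻¹ * q ^ k) = 1 - q ^ k / X := by ring
    rw [hXi]
    have hDk : D * q ^ (k + 2) = D * q ^ 2 * q ^ k := by ring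
    rw [hDk]
    have hQ : q ^ k ≠ 0 := pow_ne_zero k hq
    generalize qPoch ((q ^ n)⁻¹) q k * qPoch (D * q ^ (n + 3)) q k = A
    generalize qPoch X⁻¹ q k = a at *
    generalize qPoch (C * q * X) q k = c at *
    generalize qPoch (q * X⁻¹) q k = a' at *
    generalize qPoch (q * (C * q * X)) q k = c' at *
    generalize qPoch e1 q k = p1 at *
    generalize qPoch e2 q k = p2 at *
    generalize qPoch e3 q k = p3 at *
    generalize qPoch q q k = pq at *
    generalize q ^ k = Q at *
    set B1 := (1 - e1 * X) * (1 - e2 * X) * (1 - e3 * X)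
    set B2 := (C * q * X - e1) * (C * q * X - e2) * (C * q * X - e3)
    set B3 := 1 - D * q ^ 2 * Q
    have key : (C * q * X - 1) * B1 / (X * (C * q * X ^ 2 - 1)) * (a * c') +
        (X - 1) * B2 / (C * q * X * (C * q * X ^ 2 - 1)) * (a' * c) =
        ((1 - e1 * Q) * (1 - e2 * Q) * (1 - e3 * Q) -
          B3 * ((1 - Q / X) * (1 - C * q * X * Q))) / Q * (a * c) := by
      rw [← br]
      linear_combination (-B1 / (X * (C * q * X ^ 2 - 1)) * a) * t2 +
        (B2 / (C * q * X * (C * q * X ^ 2 - 1)) * c) * hh1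
    have lhs : ∀ U V : ℂ, U = V → A * Q / (p1 * p2 * p3 * ((1 - e1 * Q) * (1 - e2 * Q) *
        (1 - e3 * Q)) * pq) * U = A * Q / (p1 * p2 * p3 * ((1 - e1 * Q) * (1 - e2 * Q) *
        (1 - e3 * Q)) * pq) * V := fun U V h => by rw [h]
    have := lhs _ _ key
    clear_value B1 B2 B3
    clear br t2 hh1 key lhs h1 h2 h3
    generalize 1 - e1 * Q = W1 at *
    generalize 1 - e2 * Q = W2 at *
    generalize 1 - e3 * Q = W3 at *
    convert this using 1
    · field_simp
    · field_simp
  simp only [core, Finset.mul_sum]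
  rw [← Finset.sum_add_distrib, Finset.sum_congr rfl rhs, Finset.sum_sub_distrib]
  have hGn : G (n + 1) = 0 := by
    simp only [hG]; rw [qPoch_inv_pow_eq_zero hq (Nat.lt_succ_self n)]; simp
  have : ∑ k ∈ Finset.range (n + 1), G k * b k = ∑ k ∈ Finset.range (n + 1 + 1), G k * b k := by
    rw [Finset.sum_range_succ _ (n + 1), hGn]; simp
  rw [this, Finset.sum_range_succ', Finset.sum_range_succ' _ (n + 1), add_sub_right_comm,
    ← Finset.sum_sub_distrib]
  congr 1
  · refine Finset.sum_congr rfl fun k hk => ?_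
    have hk : k ≤ n := by simpa [Nat.lt_succ_iff] using hk
    have y1 : qPoch e1 q (k + 1) ≠ 0 := qPoch_ne_zero fun l hl => h1 l (by omega)
    have y2 : qPoch e2 q (k + 1) ≠ 0 := qPoch_ne_zero fun l hl => h2 l (by omega)
    have y3 : qPoch e3 q (k + 1) ≠ 0 := qPoch_ne_zero fun l hl => h3 l (by omega)
    have yq : qPoch q q k ≠ 0 := qPoch_ne_zero fun l hl => by
      rw [← pow_succ']; exact hqn l (by omega)
    simp only [coreTerm, hG, hH]
    rw [← sub_mul]
    change _ = _ * (qPoch X⁻¹ q (k + 1) * qPoch (C * q * X) q (k + 1))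
    have g1 : qPoch ((q ^ (n + 1))⁻¹) q (k + 1) = (1 - (q ^ (n + 1))⁻¹) * qPoch ((q ^ n)⁻¹) q k := by
      rw [qPoch_succ']; congr 2; rw [pow_succ]; field_simp
    have g2 : qPoch (D * q ^ (n + 1 + 1)) q (k + 1) =
        (1 - D * q ^ (n + 2)) * qPoch (D * q ^ (n + 3)) q k := by
      rw [qPoch_succ']; congr 2; ring
    rw [g1, g2, qPoch_succ ((q ^ n)⁻¹), qPoch_succ (D * q ^ (n + 3)), qPoch_succ q]
    generalize qPoch ((q ^ n)⁻¹) q k = A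
    generalize qPoch (D * q ^ (n + 3)) q k = B
    generalize qPoch X⁻¹ q (k + 1) * qPoch (C * q * X) q (k + 1) = b'
    have w := hqn k hk
    have w' : 1 - q * q ^ k ≠ 0 := by rwa [← pow_succ']
    have hn : q ^ n ≠ 0 := pow_ne_zero n hq
    simp only [pow_succ]
    field_simp
    ring
  · simp [coreTerm, hG, hb, qPoch_zero]

/-- The `q`-Racah polynomial with parameters `a₁, a₂, a₃` and `Z = q ^ K`, without its
normalization. -/
def pR (q a1 a2 a3 Z : ℂ) (n x : ℕ) : ℂ :=
  core q (a1 * a2) (a2 * a3) (q * a2) (a1 * a2 * a3 * q ^ 2 * Z) Z⁻¹ n (q ^ x)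

/-- The first coefficient in `core_rel`. -/
def relU (q C e X : ℂ) : ℂ := (C * q * X - 1) * (1 - e * X) / ((1 - e) * (C * q * X ^ 2 - 1))

/-- The second coefficient in `core_rel`. -/
def relV (q C e X : ℂ) : ℂ := (X - 1) * (C * q * X - e) / ((1 - e) * (C * q * X ^ 2 - 1))

/-- The first coefficient in `core_raise`. -/
def raiseU (q C e1 e2 e3 X : ℂ) : ℂ :=
  (C * q * X - 1) * ((1 - e1 * X) * (1 - e2 * X) * (1 - e3 * X)) /
    (X * ((1 - e1) * (1 - e2) * (1 - e3)) * (C * q * X ^ 2 - 1))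

/-- The second coefficient in `core_raise`. -/
def raiseV (q C e1 e2 e3 X : ℂ) : ℂ :=
  (X - 1) * ((C * q * X - e1) * (C * q * X - e2) * (C * q * X - e3)) /
    (C * q * X * ((1 - e1) * (1 - e2) * (1 - e3)) * (C * q * X ^ 2 - 1))

theorem relV_one (q C e : ℂ) : relV q C e 1 = 0 := by simp [relV]

theorem raiseV_one (q C e1 e2 e3 : ℂ) : raiseV q C e1 e2 e3 1 = 0 := by simp [raiseV]

theorem pR_symm {q : ℂ} (hq : q ≠ 0) (a1 a2 a3 Z : ℂ) (n x : ℕ) :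
    pR q a1 a2 a3 Z n x = pR q a3 a2 a1 Z x n := by
  rw [pR, core_symm hq, pR]
  congr 1 <;> ring

theorem pR_zero_left (q a1 a2 a3 Z : ℂ) (x : ℕ) : pR q a1 a2 a3 Z 0 x = 1 := core_zero ..

theorem pR_zero_right (q a1 a2 a3 Z : ℂ) (n : ℕ) : pR q a1 a2 a3 Z n 0 = 1 := by
  rw [pR, pow_zero, core_one]

theorem mul_pred {q : ℂ} (hq : q ≠ 0) {c : ℕ → ℂ} (f : ℂ → ℂ) (h : c 0 = 0) (x : ℕ) :
    c x * f (q ^ x / q) = c x * f (q ^ (x - 1)) := by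
  cases x with
  | zero => simp [h]
  | succ x => rw [pow_succ, mul_div_cancel_right₀ _ hq, Nat.add_sub_cancel]

theorem pR_rel {q a1 a2 a3 Z : ℂ} {n : ℕ} (x : ℕ) (hq : q ≠ 0)
    (hC : a1 * a2 * q * (q ^ x) ^ 2 - 1 ≠ 0) (he : ∀ k ≤ n, 1 - Z⁻¹ * q ^ k ≠ 0) :
    pR q a1 a2 a3 Z n x =
      relU q (a1 * a2) Z⁻¹ (q ^ x) * pR q (q * a1) a2 a3 (Z / q) n x +
      relV q (a1 * a2) Z⁻¹ (q ^ x) * pR q (q * a1) a2 a3 (Z / q) n (x - 1) := by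
  have h1 : q * a1 * a2 = q * (a1 * a2) := by ring
  have h2 : q * (a1 * a2) * a3 * q ^ 2 * (Z / q) = a1 * a2 * a3 * q ^ 2 * Z := by field_simp
  have h3 : (Z / q)⁻¹ = q * Z⁻¹ := by rw [inv_div]; ring
  simp only [pR, h1, h2, h3]
  rw [core_rel (pow_ne_zero x hq) hq hC he,
    ← mul_pred hq (c := fun x => relV q (a1 * a2) Z⁻¹ (q ^ x)) (fun X => core q _ _ _ _ _ n X)
      (by simp [relV_one])]
  rfl

theorem pR_rel' {q a1 a2 a3 Z : ℂ} {n : ℕ} (x : ℕ) (hq : q ≠ 0)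
    (hC : a1 * a2 * q * (q ^ x) ^ 2 - 1 ≠ 0)
    (he : ∀ k ≤ n, 1 - a1 * a2 * a3 * q ^ 2 * Z * q ^ k ≠ 0) :
    pR q a1 a2 a3 Z n x =
      relU q (a1 * a2) (a1 * a2 * a3 * q ^ 2 * Z) (q ^ x) * pR q (q * a1) a2 a3 Z n x +
      relV q (a1 * a2) (a1 * a2 * a3 * q ^ 2 * Z) (q ^ x) * pR q (q * a1) a2 a3 Z n (x - 1) := by
  have h1 : q * a1 * a2 = q * (a1 * a2) := by ring
  have h2 : q * (a1 * a2) * a3 * q ^ 2 * Z = q * (a1 * a2 * a3 * q ^ 2 * Z) := by ring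
  simp only [pR, h1, h2]
  rw [core_perm23, core_rel (pow_ne_zero x hq) hq hC he,
    ← mul_pred hq (c := fun x => relV q (a1 * a2) (a1 * a2 * a3 * q ^ 2 * Z) (q ^ x))
      (fun X => core q _ _ _ _ _ n X) (by simp [relV_one])]
  simp only [core_perm23 q _ _ _ Z⁻¹]
  rfl

theorem pR_raise {q a1 a2 a3 Z : ℂ} {n : ℕ} (x : ℕ) (hq : q ≠ 0) (hC0 : a1 * a2 ≠ 0) (hZ : Z ≠ 0)
    (hC : a1 * a2 * q * (q ^ x) ^ 2 - 1 ≠ 0) (h1 : ∀ k ≤ n, 1 - q * a2 * q ^ k ≠ 0)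
    (h2 : ∀ k ≤ n, 1 - a1 * a2 * a3 * q ^ 2 * Z * q ^ k ≠ 0) (h3 : ∀ k ≤ n, 1 - Z⁻¹ * q ^ k ≠ 0)
    (hqn : ∀ k ≤ n, 1 - q ^ (k + 1) ≠ 0) :
    pR q a1 a2 a3 Z (n + 1) x =
      raiseU q (a1 * a2) (q * a2) (a1 * a2 * a3 * q ^ 2 * Z) Z⁻¹ (q ^ x) *
        pR q a1 (q * a2) (q * a3) (Z / q) n x +
      raiseV q (a1 * a2) (q * a2) (a1 * a2 * a3 * q ^ 2 * Z) Z⁻¹ (q ^ x) *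
        pR q a1 (q * a2) (q * a3) (Z / q) n (x - 1) := by
  have e1 : a1 * (q * a2) = q * (a1 * a2) := by ring
  have e2 : q * (a1 * a2) * (q * a3) * q ^ 2 * (Z / q) = q * (a1 * a2 * a3 * q ^ 2 * Z) := by
    field_simp
  have e3 : (Z / q)⁻¹ = q * Z⁻¹ := by rw [inv_div]; ring
  have e4 : q * a2 * (q * a3) = q ^ 2 * (a2 * a3) := by ring
  simp only [pR, e1, e2, e3, e4]
  rw [core_raise (pow_ne_zero x hq) hq hC0 hC h1 h2 h3 hqn (by field_simp),
    ← mul_pred hq (c := fun x => raiseV q (a1 * a2) (q * a2) (a1 * a2 * a3 * q ^ 2 * Z) Z⁻¹ (q ^ x))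
      (fun X => core q _ _ _ _ _ n X) (by simp [raiseV_one])]
  rfl

/-- Summation by parts. -/
theorem sum_shift {K : ℕ} {f g A B c : ℕ → ℂ} (h : ∀ x ≤ K + 1, f x = A x * g x + B x * g (x - 1))
    (hB : B 0 = 0) (hA : A (K + 1) = 0) (hc : ∀ x ≤ K, A x + B (x + 1) = c x) :
    ∑ x ∈ Finset.range (K + 2), f x = ∑ x ∈ Finset.range (K + 1), c x * g x := by
  rw [Finset.sum_congr rfl fun x hx => h x (by simp at hx; omega), Finset.sum_add_distrib,
    Finset.sum_range_succ, Finset.sum_range_succ' (fun x => B x * g (x - 1)), hA, hB]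
  simp only [zero_mul, add_zero, Nat.add_sub_cancel]
  rw [← Finset.sum_add_distrib]
  exact Finset.sum_congr rfl fun x hx => by rw [← hc x (by simp at hx; omega), add_mul]

/-- The factor `(b; q)_x / (C q² / b; q)_x` of a very-well-poised series. -/
def pr (q C b : ℂ) (x : ℕ) : ℂ := qPoch b q x / qPoch (C * q ^ 2 / b) q x

/-- The very-well-poised factor `(1 - C q ^ (2 x + 1)) (C q; q)_x / ((1 - C q) (q; q)_x)`. -/
def vwp (q C : ℂ) (x : ℕ) : ℂ :=
  (1 - C * q * (q ^ x) ^ 2) / (1 - C * q) * (qPoch (C * q) q x / qPoch q q x)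

theorem pr_zero (q C b : ℂ) : pr q C b 0 = 1 := by simp [pr, qPoch_zero]

theorem pr_succ (q C b : ℂ) (x : ℕ) :
    pr q C b (x + 1) = pr q C b x * ((1 - b * q ^ x) / (1 - C * q ^ 2 / b * q ^ x)) := by
  rw [pr, qPoch_succ, qPoch_succ, pr, div_mul_div_comm]

theorem vwp_zero {q C : ℂ} (h : 1 - C * q ≠ 0) : vwp q C 0 = 1 := by
  simp [vwp, qPoch_zero, h]

theorem vwp_succ {q C : ℂ} {x : ℕ} (h : 1 - C * q * (q ^ x) ^ 2 ≠ 0) :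
    vwp q C (x + 1) = vwp q C x * ((1 - C * q ^ 3 * (q ^ x) ^ 2) * (1 - C * q * q ^ x) /
      ((1 - C * q * (q ^ x) ^ 2) * (1 - q * q ^ x))) := by
  rw [vwp, qPoch_succ, qPoch_succ, vwp, show C * q * (q ^ (x + 1)) ^ 2 = C * q ^ 3 * (q ^ x) ^ 2 by ring]
  field_simp

/-- Shifting `C` in `vwp`. -/
theorem vwp_shift {q C : ℂ} {x : ℕ} (h : 1 - C * q * (q ^ x) ^ 2 ≠ 0) (h1 : 1 - C * q ≠ 0) :
    vwp q (q * C) x = vwp q C x * ((1 - C * q ^ 2 * (q ^ x) ^ 2) * (1 - C * q * q ^ x) /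
      ((1 - C * q * (q ^ x) ^ 2) * (1 - C * q ^ 2))) := by
  have := qPoch_shift (C * q) q x
  have h2 : qPoch (q * C * q) q x = qPoch (C * q) q x * (1 - C * q * q ^ x) / (1 - C * q) := by
    rw [eq_div_iff h1, ← this]; ring_nf
  rw [vwp, h2, vwp]
  rw [show q * C * q = C * q ^ 2 by ring]
  field_simp

/-- Shifting both `b` and `C` in `pr`. -/
theorem pr_shift_both {q C b : ℂ} {x : ℕ} (hq : q ≠ 0) (h : 1 - b ≠ 0) :
    pr q (q * C) (q * b) x = pr q C b x * ((1 - b * q ^ x) / (1 - b)) := by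
  have : q * C * q ^ 2 / (q * b) = C * q ^ 2 / b := by field_simp
  have h2 : qPoch (q * b) q x = qPoch b q x * (1 - b * q ^ x) / (1 - b) := by
    rw [eq_div_iff h, ← qPoch_shift]; ring
  rw [pr, this, h2, pr]; ring

/-- Shifting `C` in `pr`. -/
theorem pr_shift_base {q C b : ℂ} {x : ℕ} (hb : 1 - C * q ^ 2 / b ≠ 0) :
    pr q (q * C) b x = pr q C b x * ((1 - C * q ^ 2 / b) / (1 - C * q ^ 2 / b * q ^ x)) := by
  have h2 : qPoch (q * C * q ^ 2 / b) q x =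
      qPoch (C * q ^ 2 / b) q x * (1 - C * q ^ 2 / b * q ^ x) / (1 - C * q ^ 2 / b) := by
    rw [eq_div_iff hb, ← qPoch_shift]; ring_nf
  rw [pr, h2, pr]
  field_simp

/-- Shifting `b` in `pr`. -/
theorem pr_shift {q C b : ℂ} {x : ℕ} (hq : q ≠ 0) (h : 1 - b ≠ 0)
    (h' : 1 - C * q / b ≠ 0) (hx : ∀ l ≤ x, 1 - C * q / b * q ^ l ≠ 0) :
    pr q C (q * b) x = pr q C b x *
      ((1 - b * q ^ x) * (1 - C * q / b * q ^ x) / ((1 - b) * (1 - C * q / b))) := by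
  have h0 : C * q ^ 2 / (q * b) = C * q / b := by field_simp
  have h2 : qPoch (q * b) q x = qPoch b q x * (1 - b * q ^ x) / (1 - b) := by
    rw [eq_div_iff h, ← qPoch_shift]; ring
  have h3 : qPoch (C * q ^ 2 / b) q x =
      qPoch (C * q / b) q x * (1 - C * q / b * q ^ x) / (1 - C * q / b) := by
    rw [eq_div_iff h', ← qPoch_shift]; ring_nf
  have h4 := hx x le_rfl
  have h5 : qPoch (C * q / b) q x ≠ 0 := qPoch_ne_zero fun l hl => hx l hl.le
  rw [pr, h0, h2, pr, h3]
  generalize C * q / b = β at *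
  generalize 1 - β * q ^ x = γ at *
  field_simp

/-- The factor `∏_{l < x} (d - q ^ l) / (C q² d; q)_x` of a very-well-poised series. -/
def dpr (q C d : ℂ) (x : ℕ) : ℂ :=
  (∏ l ∈ Finset.range x, (d - q ^ l)) / qPoch (C * q ^ 2 * d) q x

/-- The weight of a terminating very-well-poised `₆φ₅` series, with `Z = q ^ K`. -/
def wt (q C Z b d : ℂ) (x : ℕ) : ℂ :=
  vwp q C x * pr q C Z⁻¹ x * pr q C b x * dpr q C d x * (C * q ^ 2 * Z / b) ^ x

theorem dpr_zero (q C d : ℂ) : dpr q C d 0 = 1 := by simp [dpr, qPoch_zero]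

theorem dpr_succ (q C d : ℂ) (x : ℕ) :
    dpr q C d (x + 1) = dpr q C d x * ((d - q ^ x) / (1 - C * q ^ 2 * d * q ^ x)) := by
  rw [dpr, qPoch_succ, Finset.prod_range_succ, dpr, div_mul_div_comm]

theorem dpr_shift_base {q C d : ℂ} {x : ℕ} (hb : 1 - C * q ^ 2 * d ≠ 0) :
    dpr q (q * C) d x =
      dpr q C d x * ((1 - C * q ^ 2 * d) / (1 - C * q ^ 2 * d * q ^ x)) := by
  have h2 : qPoch (q * C * q ^ 2 * d) q x =
      qPoch (C * q ^ 2 * d) q x * (1 - C * q ^ 2 * d * q ^ x) / (1 - C * q ^ 2 * d) := by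
    rw [eq_div_iff hb, ← qPoch_shift]; ring_nf
  rw [dpr, h2, dpr]
  field_simp

theorem wt_zero {q C : ℂ} (Z b d : ℂ) (h : 1 - C * q ≠ 0) : wt q C Z b d 0 = 1 := by
  simp [wt, vwp_zero h, pr_zero, dpr_zero]

theorem one_sub_inv_pow {q : ℂ} (hq : q ≠ 0) (hqn : ∀ k : ℕ, 1 - q ^ (k + 1) ≠ 0) {K k : ℕ}
    (h : k < K) : 1 - (q ^ K)⁻¹ * q ^ k ≠ 0 := by
  obtain ⟨m, rfl⟩ : ∃ m, K = k + (m + 1) := ⟨K - k - 1, by omega⟩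
  intro h0
  apply hqn m
  have := pow_ne_zero k hq
  have := pow_ne_zero (m + 1) hq
  rw [pow_add] at h0
  have h1 : 1 - (q ^ k * q ^ (m + 1))⁻¹ * q ^ k = (q ^ (m + 1) - 1) / q ^ (m + 1) := by field_simp
  rw [h1, div_eq_zero_iff] at h0
  rcases h0 with h0 | h0
  · linear_combination -h0
  · contradiction

theorem wt_step_aux {q C X Z d β b : ℂ} (hq : q ≠ 0) (hC : C ≠ 0) (hZ : Z ≠ 0) (hb : b ≠ 0)
    (hβ : C * q ^ 2 / b = β) (hZ1 : 1 - Z⁻¹ ≠ 0)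
    (h1 : 1 - C * q * X ^ 2 ≠ 0) (h2 : 1 - C * q ^ 3 * X ^ 2 ≠ 0) (h3 : 1 - q * X ≠ 0)
    (h4 : 1 - C * q ^ 2 * Z * X ≠ 0) (h5 : 1 - β * X ≠ 0) (h6 : 1 - C * q ^ 2 * d * X ≠ 0)
    (h7 : 1 - C * q ^ 2 ≠ 0) (h8 : 1 - β ≠ 0) (h9 : 1 - C * q ^ 2 * d ≠ 0) :
    relU q C Z⁻¹ X + relV q C Z⁻¹ (X * q) *
      ((1 - C * q ^ 3 * X ^ 2) * (1 - C * q * X) / ((1 - C * q * X ^ 2) * (1 - q * X)) *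
        ((1 - Z⁻¹ * X) / (1 - C * q ^ 2 * Z * X)) * ((1 - b * X) / (1 - β * X)) *
        ((d - X) / (1 - C * q ^ 2 * d * X)) * (C * q ^ 2 * Z / b)) =
    (1 - C * q ^ 2 * d / b) * (1 - C * q ^ 2) / ((1 - β) * (1 - C * q ^ 2 * d)) *
      ((1 - C * q ^ 2 * X ^ 2) * (1 - C * q * X) / ((1 - C * q * X ^ 2) * (1 - C * q ^ 2)) *
        ((1 - Z⁻¹ * X) / (1 - Z⁻¹)) * ((1 - β) / (1 - β * X)) *
        ((1 - C * q ^ 2 * d) / (1 - C * q ^ 2 * d * X))) := by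
  have hbb : b = C * q ^ 2 / β := by rw [← hβ]; field_simp
  have hβ0 : β ≠ 0 := by rw [← hβ]; positivity
  have e1 : relU q C Z⁻¹ X = (1 - C * q * X) * (1 - Z⁻¹ * X) / ((1 - Z⁻¹) * (1 - C * q * X ^ 2)) := by
    rw [relU, ← neg_sub, ← neg_sub _ (C * q * X ^ 2), mul_neg, neg_mul, neg_div_neg_eq]
  have e2 : relV q C Z⁻¹ (X * q) =
      (1 - q * X) * (C * q ^ 2 * X - Z⁻¹) / ((1 - Z⁻¹) * (1 - C * q ^ 3 * X ^ 2)) := by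
    rw [relV, ← neg_sub, show C * q * (X * q) ^ 2 - 1 = - (1 - C * q ^ 3 * X ^ 2) by ring, mul_neg,
      neg_mul, neg_div_neg_eq]
    ring_nf
  have e3 : C * q ^ 2 * d / b = β * d := by rw [← hβ]; ring
  have e4 : C * q ^ 2 * Z / b = β * Z := by rw [← hβ]; ring
  rw [e1, e2, e3, e4, hbb]
  have e5 : C * q ^ 2 * X - Z⁻¹ = - (1 - C * q ^ 2 * Z * X) / Z := by field_simp; ring
  have e6 : 1 - C * q ^ 2 / β * X = (β - C * q ^ 2 * X) / β := by field_simp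
  rw [e5, e6]
  clear e1 e2 e3 e4 e5 e6 hbb hβ
  obtain ⟨W1, hW1⟩ : ∃ W, W = 1 - C * q * X ^ 2 := ⟨_, rfl⟩
  obtain ⟨W2, hW2⟩ : ∃ W, W = 1 - C * q ^ 3 * X ^ 2 := ⟨_, rfl⟩
  obtain ⟨W3, hW3⟩ : ∃ W, W = 1 - q * X := ⟨_, rfl⟩
  obtain ⟨W4, hW4⟩ : ∃ W, W = 1 - C * q ^ 2 * Z * X := ⟨_, rfl⟩
  obtain ⟨W5, hW5⟩ : ∃ W, W = 1 - β * X := ⟨_, rfl⟩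
  obtain ⟨W6, hW6⟩ : ∃ W, W = 1 - C * q ^ 2 * d * X := ⟨_, rfl⟩
  obtain ⟨W7, hW7⟩ : ∃ W, W = 1 - C * q ^ 2 := ⟨_, rfl⟩
  obtain ⟨W8, hW8⟩ : ∃ W, W = 1 - β := ⟨_, rfl⟩
  obtain ⟨W9, hW9⟩ : ∃ W, W = 1 - C * q ^ 2 * d := ⟨_, rfl⟩
  obtain ⟨W0, hW0⟩ : ∃ W, W = 1 - Z⁻¹ := ⟨_, rfl⟩
  obtain ⟨V0, hV0⟩ : ∃ W, W = 1 - Z⁻¹ * X := ⟨_, rfl⟩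
  obtain ⟨V1, hV1⟩ : ∃ W, W = 1 - C * q * X := ⟨_, rfl⟩
  simp only [← hW1, ← hW2, ← hW3, ← hW4, ← hW5, ← hW6, ← hW7, ← hW8, ← hW9, ← hW0, ← hV0, ← hV1] at h1 h2 h3 h4 h5 h6 h7 h8 h9 hZ1 ⊢
  field_simp
  rw [hW5, hW6]
  ring

/-- The terminating `₆φ₅` summation. -/
theorem sum_wt {q : ℂ} (hq : q ≠ 0) (hqn : ∀ k : ℕ, 1 - q ^ (k + 1) ≠ 0) (K : ℕ) :
    ∀ {C b d : ℂ}, C ≠ 0 → b ≠ 0 → (∀ k : ℕ, 1 - C * q * q ^ k ≠ 0) →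
      (∀ k : ℕ, 1 - C * q ^ 2 / b * q ^ k ≠ 0) → (∀ k : ℕ, 1 - C * q ^ 2 * d * q ^ k ≠ 0) →
      ∑ x ∈ Finset.range (K + 1), wt q C (q ^ K) b d x =
        qPoch (C * q ^ 2) q K * qPoch (C * q ^ 2 * d / b) q K /
          (qPoch (C * q ^ 2 / b) q K * qPoch (C * q ^ 2 * d) q K) := by
  induction K with
  | zero =>
    intro C b d hC hb h1 h2 h3
    simp [wt_zero _ _ _ (show 1 - C * q ≠ 0 by simpa using h1 0), qPoch_zero]
  | succ K ih =>
    intro C b d hC hb h1 h2 h3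
    have a1 : 1 - C * q ≠ 0 := by simpa using h1 0
    have a1' : 1 - C * q ^ 2 ≠ 0 := by convert h1 1 using 2; ring
    have a2 : 1 - C * q ^ 2 / b ≠ 0 := by simpa using h2 0
    have a3 : 1 - C * q ^ 2 * d ≠ 0 := by simpa using h3 0
    have aX : ∀ x : ℕ, 1 - C * q * (q ^ x) ^ 2 ≠ 0 := fun x => by
      convert h1 (2 * x) using 2; ring
    have aX2 : ∀ x : ℕ, 1 - C * q ^ 2 * (q ^ x) ^ 2 ≠ 0 := fun x => by
      convert h1 (2 * x + 1) using 2; ring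
    have aX3 : ∀ x : ℕ, 1 - C * q ^ 3 * (q ^ x) ^ 2 ≠ 0 := fun x => by
      convert h1 (2 * x + 2) using 2; ring
    have hX : ∀ x : ℕ, q ^ x ≠ 0 := fun x => pow_ne_zero x hq
    have hZ : 1 - (q ^ (K + 1))⁻¹ ≠ 0 := by
      simpa using one_sub_inv_pow hq hqn (Nat.succ_pos K)
    have hZc : ∀ x : ℕ, 1 - C * q ^ 2 * q ^ (K + 1) * q ^ x ≠ 0 := fun x => by
      convert h1 (K + 2 + x) using 2; ring
    have hrec : ∑ x ∈ Finset.range (K + 1 + 1), wt q C (q ^ (K + 1)) b d x =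
        ∑ x ∈ Finset.range (K + 1), ((1 - C * q ^ 2 * d / b) * (1 - C * q ^ 2) /
          ((1 - C * q ^ 2 / b) * (1 - C * q ^ 2 * d)) * wt q (q * C) (q ^ K) b d x) * 1 := by
      refine sum_shift
        (A := fun x => relU q C (q ^ (K + 1))⁻¹ (q ^ x) * wt q C (q ^ (K + 1)) b d x)
        (B := fun x => relV q C (q ^ (K + 1))⁻¹ (q ^ x) * wt q C (q ^ (K + 1)) b d x)
        (fun x _ => ?_) ?_ ?_ fun x hx => ?_
      · have : relU q C (q ^ (K + 1))⁻¹ (q ^ x) + relV q C (q ^ (K + 1))⁻¹ (q ^ x) = 1 := by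
          have := core_rel (q := q) (C := C) (D := 1) (e1 := 1) (e2 := 1) (e := (q ^ (K + 1))⁻¹)
            (n := 0) (hX x) hq (by rw [← neg_ne_zero]; simpa using aX x)
            (fun k hk => by rw [Nat.le_zero.1 hk]; simpa using hZ)
          simpa [core_zero, relU, relV] using this.symm
        linear_combination -wt q C (q ^ (K + 1)) b d x * this
      · simp [relV_one]
      · simp [relU, hq]
      · have hxx : 1 - (q ^ (K + 1))⁻¹ * q ^ x ≠ 0 := one_sub_inv_pow hq hqn (by omega)
        have hqx := hqn x
        have hbx := h2 x
        have hdx := h3 x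
        have hzx := hZc x
        have hC1 := aX x
        have hC2 := aX2 x
        have hC3 := aX3 x
        have hx1 := h1 x
        have hz' : (q ^ K)⁻¹ = q * (q ^ (K + 1))⁻¹ := by rw [pow_succ]; field_simp
        have hz'' : q * C * q ^ 2 * q ^ K / b = C * q ^ 2 * q ^ (K + 1) / b := by ring
        have hinv : C * q ^ 2 / (q ^ (K + 1))⁻¹ = C * q ^ 2 * q ^ (K + 1) := by
          rw [div_inv_eq_mul]
        simp only [wt, hz', hz'', vwp_shift hC1 a1, pr_shift_both hq hZ, pr_shift_base a2,
          dpr_shift_base a3, vwp_succ hC1, pr_succ, dpr_succ, hinv]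
        generalize vwp q C x = V at *
        generalize pr q C (q ^ (K + 1))⁻¹ x = P1
        generalize pr q C b x = P2
        generalize dpr q C d x = P3
        have hZ0 := hX (K + 1)
        have hX0 := hX x
        have := wt_step_aux hq hC hZ0 hb rfl hZ hC1 hC3
          (by rwa [← pow_succ']) hzx hbx hdx a1' a2 a3
        simp only [pow_succ _ x]
        linear_combination (V * P1 * P2 * P3 * (C * q ^ 2 * q ^ (K + 1) / b) ^ x) * this
    rw [hrec]
    simp only [mul_one]
    rw [← Finset.mul_sum, ih (mul_ne_zero hq hC) hb (fun k => by convert h1 (k + 1) using 2; ring)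
      (fun k => by convert h2 (k + 1) using 2; ring) (fun k => by convert h3 (k + 1) using 2; ring)]
    rw [qPoch_succ', qPoch_succ', qPoch_succ', qPoch_succ']
    have g1 : q * C * q ^ 2 = q * (C * q ^ 2) := by ring
    have g2 : q * (C * q ^ 2) * d / b = q * (C * q ^ 2 * d / b) := by ring
    have g3 : q * (C * q ^ 2) / b = q * (C * q ^ 2 / b) := by ring
    have g4 : q * (C * q ^ 2) * d = q * (C * q ^ 2 * d) := by ring
    rw [g1, g2, g3, g4, div_mul_div_comm]
    ring_nf
theorem wt_raise_aux {q C X Z d b e : ℂ} (hq : q ≠ 0) (hC : C ≠ 0) (hX : X ≠ 0) (hZ : Z ≠ 0)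
    (hb : b ≠ 0) (hZ1 : 1 - Z⁻¹ ≠ 0) (hb1 : 1 - b ≠ 0) (he : 1 - e ≠ 0)
    (h1 : 1 - C * q * X ^ 2 ≠ 0) (h2 : 1 - C * q ^ 3 * X ^ 2 ≠ 0) (h3 : 1 - q * X ≠ 0)
    (h4 : 1 - C * q ^ 2 * Z * X ≠ 0) (h5 : 1 - C * q ^ 2 / b * X ≠ 0)
    (h6 : 1 - C * q ^ 2 * d * X ≠ 0) (h7 : 1 - C * q ^ 2 ≠ 0) (h9 : 1 - C * q ^ 2 * d ≠ 0) :
    raiseU q C e b Z⁻¹ X + raiseV q C e b Z⁻¹ (X * q) *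
      ((1 - C * q ^ 3 * X ^ 2) * (1 - C * q * X) / ((1 - C * q * X ^ 2) * (1 - q * X)) *
        ((1 - Z⁻¹ * X) / (1 - C * q ^ 2 * Z * X)) * ((1 - b * X) / (1 - C * q ^ 2 / b * X)) *
        ((d - X) / (1 - C * q ^ 2 * d * X)) * (C * q ^ 2 * Z / b)) =
    (1 - C * q ^ 2) / ((1 - e) * (1 - C * q ^ 2 * d)) * (1 - e * d) *
      ((1 - C * q ^ 2 * X ^ 2) * (1 - C * q * X) / ((1 - C * q * X ^ 2) * (1 - C * q ^ 2)) *
        ((1 - Z⁻¹ * X) / (1 - Z⁻¹)) * ((1 - b * X) / (1 - b)) *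
        ((1 - C * q ^ 2 * d) / (1 - C * q ^ 2 * d * X)) / X) := by
  have e1 : raiseU q C e b Z⁻¹ X = (1 - C * q * X) * ((1 - e * X) * (1 - b * X) * (1 - Z⁻¹ * X)) /
      (X * ((1 - e) * (1 - b) * (1 - Z⁻¹)) * (1 - C * q * X ^ 2)) := by
    rw [raiseU, ← neg_sub, ← neg_sub _ (C * q * X ^ 2), mul_neg, neg_mul, neg_div_neg_eq]
  have e5 : C * q ^ 2 * X - Z⁻¹ = - (1 - C * q ^ 2 * Z * X) / Z := by field_simp; ring
  have e6 : C * q ^ 2 * X - b = - (b * (1 - C * q ^ 2 / b * X)) := by field_simp; ring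
  have e2 : raiseV q C e b Z⁻¹ (X * q) =
      (1 - q * X) * ((C * q ^ 2 * X - e) * -(b * (1 - C * q ^ 2 / b * X)) *
        (- (1 - C * q ^ 2 * Z * X) / Z)) /
      (C * q ^ 2 * X * ((1 - e) * (1 - b) * (1 - Z⁻¹)) * (1 - C * q ^ 3 * X ^ 2)) := by
    rw [raiseV, ← e5, ← e6, ← neg_sub, show C * q * (X * q) ^ 2 - 1 = - (1 - C * q ^ 3 * X ^ 2) by ring, mul_neg,
      neg_mul, neg_div_neg_eq]
    ring_nf
  rw [e1, e2]
  clear e1 e2 e5 e6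
  obtain ⟨W1, hW1⟩ : ∃ W, W = 1 - C * q * X ^ 2 := ⟨_, rfl⟩
  obtain ⟨W2, hW2⟩ : ∃ W, W = 1 - C * q ^ 3 * X ^ 2 := ⟨_, rfl⟩
  obtain ⟨W3, hW3⟩ : ∃ W, W = 1 - q * X := ⟨_, rfl⟩
  obtain ⟨W4, hW4⟩ : ∃ W, W = 1 - C * q ^ 2 * Z * X := ⟨_, rfl⟩
  obtain ⟨W5, hW5⟩ : ∃ W, W = 1 - C * q ^ 2 / b * X := ⟨_, rfl⟩
  obtain ⟨W6, hW6⟩ : ∃ W, W = 1 - C * q ^ 2 * d * X := ⟨_, rfl⟩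
  obtain ⟨W7, hW7⟩ : ∃ W, W = 1 - C * q ^ 2 := ⟨_, rfl⟩
  obtain ⟨W8, hW8⟩ : ∃ W, W = 1 - e := ⟨_, rfl⟩
  obtain ⟨W9, hW9⟩ : ∃ W, W = 1 - C * q ^ 2 * d := ⟨_, rfl⟩
  obtain ⟨W0, hW0⟩ : ∃ W, W = 1 - Z⁻¹ := ⟨_, rfl⟩
  obtain ⟨V0, hV0⟩ : ∃ W, W = 1 - Z⁻¹ * X := ⟨_, rfl⟩
  obtain ⟨V1, hV1⟩ : ∃ W, W = 1 - C * q * X := ⟨_, rfl⟩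
  obtain ⟨V2, hV2⟩ : ∃ W, W = 1 - b := ⟨_, rfl⟩
  obtain ⟨V3, hV3⟩ : ∃ W, W = 1 - b * X := ⟨_, rfl⟩
  simp only [← hW1, ← hW2, ← hW3, ← hW4, ← hW5, ← hW6, ← hW7, ← hW8, ← hW9, ← hW0, ← hV0, ← hV1,
    ← hV2, ← hV3] at h1 h2 h3 h4 h5 h6 h7 h9 hZ1 hb1 he ⊢
  field_simp
  rw [hW6]
  ring

/-- The sum of a `q`-Racah polynomial against a very-well-poised weight containing its second lower
parameter. -/
theorem sum_wt_pR {q : ℂ} (hq : q ≠ 0) (hqn : ∀ k : ℕ, 1 - q ^ (k + 1) ≠ 0) (m n : ℕ) :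
    ∀ {a1 a2 a3 d : ℂ}, a1 ≠ 0 → a2 ≠ 0 → a3 ≠ 0 → (∀ k : ℕ, 1 - a1 * a2 * q * q ^ k ≠ 0) →
      (∀ k : ℕ, 1 - q * a2 * q ^ k ≠ 0) →
      (∀ k : ℕ, 1 - a1 * a2 * a3 * q ^ 2 * q ^ (n + m) * q ^ k ≠ 0) →
      (∀ k : ℕ, 1 - (a3 * q ^ (n + m))⁻¹ * q ^ k ≠ 0) →
      (∀ k : ℕ, 1 - a1 * a2 * q ^ 2 * d * q ^ k ≠ 0) →
      ∑ x ∈ Finset.range (n + m + 1),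
        wt q (a1 * a2) (q ^ (n + m)) (a1 * a2 * a3 * q ^ 2 * q ^ (n + m)) d x *
          pR q a1 a2 a3 (q ^ (n + m)) n x =
        qPoch (a1 * a2 * q ^ 2) q (n + m) * qPoch (q * a2 * d) q n *
          qPoch (d * (a3 * q ^ (n + m))⁻¹) q m /
          (qPoch (q * a2) q n * qPoch (a3 * q ^ (n + m))⁻¹ q m *
            qPoch (a1 * a2 * q ^ 2 * d) q (n + m)) := by
  induction n with
  | zero =>
    intro a1 a2 a3 d p1 p2 p3 h1 h2 h3 h4 h5
    simp only [pR_zero_left, mul_one, zero_add, qPoch_zero, one_mul] at *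
    have hqm := pow_ne_zero m hq
    have hc : a1 * a2 * q ^ 2 / (a1 * a2 * a3 * q ^ 2 * q ^ m) = (a3 * q ^ m)⁻¹ := by field_simp
    have hc' : a1 * a2 * q ^ 2 * d / (a1 * a2 * a3 * q ^ 2 * q ^ m) = d * (a3 * q ^ m)⁻¹ := by
      field_simp
    rw [sum_wt hq hqn m (by positivity) (by positivity) h1 (by rwa [hc]) h5, hc, hc']
  | succ n ih =>
    intro a1 a2 a3 d p1 p2 p3 h1 h2 h3 h4 h5
    set Z := q ^ (n + 1 + m) with hZdef
    have hZq : q ^ (n + m) = Z / q := by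
      rw [hZdef, show n + 1 + m = n + m + 1 by ring, pow_succ]; field_simp
    have hZ0 : Z ≠ 0 := pow_ne_zero _ hq
    set b := a1 * a2 * a3 * q ^ 2 * Z with hb
    have hb0 : b ≠ 0 := by positivity
    have a1' : 1 - a1 * a2 * q ≠ 0 := by simpa using h1 0
    have a1'' : 1 - a1 * a2 * q ^ 2 ≠ 0 := by convert h1 1 using 2; ring
    have he : 1 - q * a2 ≠ 0 := by simpa using h2 0
    have hb1 : 1 - b ≠ 0 := by simpa using h3 0
    have a3' : 1 - a1 * a2 * q ^ 2 * d ≠ 0 := by simpa using h5 0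
    have aX : ∀ x : ℕ, 1 - a1 * a2 * q * (q ^ x) ^ 2 ≠ 0 := fun x => by
      convert h1 (2 * x) using 2; ring
    have aX3 : ∀ x : ℕ, 1 - a1 * a2 * q ^ 3 * (q ^ x) ^ 2 ≠ 0 := fun x => by
      convert h1 (2 * x + 2) using 2; ring
    have hX : ∀ x : ℕ, q ^ x ≠ 0 := fun x => pow_ne_zero x hq
    have hZ : 1 - Z⁻¹ ≠ 0 := by
      simpa using one_sub_inv_pow hq hqn (show 0 < n + 1 + m by omega)
    have hZc : ∀ x : ℕ, 1 - a1 * a2 * q ^ 2 * Z * q ^ x ≠ 0 := fun x => by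
      convert h1 (n + m + 2 + x) using 2; rw [hZdef]; ring
    have hβ : a1 * a2 * q ^ 2 / b = (a3 * Z)⁻¹ := by rw [hb]; field_simp
    have hrec : ∑ x ∈ Finset.range (n + m + 2), wt q (a1 * a2) Z b d x * pR q a1 a2 a3 Z (n + 1) x =
        ∑ x ∈ Finset.range (n + m + 1), ((1 - a1 * a2 * q ^ 2) /
          ((1 - q * a2) * (1 - a1 * a2 * q ^ 2 * d)) * (1 - q * a2 * d) *
          wt q (q * (a1 * a2)) (Z / q) (q * b) d x) * pR q a1 (q * a2) (q * a3) (Z / q) n x := by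
      refine sum_shift
        (A := fun x => raiseU q (a1 * a2) (q * a2) b Z⁻¹ (q ^ x) * wt q (a1 * a2) Z b d x)
        (B := fun x => raiseV q (a1 * a2) (q * a2) b Z⁻¹ (q ^ x) * wt q (a1 * a2) Z b d x)
        (fun x hx => ?_) ?_ ?_ fun x hx => ?_
      · rw [pR_raise x hq (by positivity) hZ0 (by rw [← neg_ne_zero]; simpa using aX x) (fun k _ => h2 k)
          (fun k _ => h3 k) (fun k hk => one_sub_inv_pow hq hqn (by omega)) (fun k _ => hqn k)]
        ring
      · simp [raiseV_one]
      · have : 1 - Z⁻¹ * q ^ (n + m + 1) = 0 := by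
          rw [hZdef, show n + 1 + m = n + m + 1 by ring, inv_mul_cancel₀ (hX _), sub_self]
        simp [raiseU, this]
      · have hC1 := aX x
        have hz' : (Z / q)⁻¹ = q * Z⁻¹ := by rw [inv_div]; ring
        have hz'' : q * (a1 * a2) * q ^ 2 * (Z / q) / (q * b) = a1 * a2 * q ^ 2 * Z / b / q := by
          field_simp
        have hinv : a1 * a2 * q ^ 2 / Z⁻¹ = a1 * a2 * q ^ 2 * Z := by
          rw [div_inv_eq_mul]
        have := wt_raise_aux hq (mul_ne_zero p1 p2) (hX x) hZ0 hb0 hZ hb1 he hC1 (aX3 x)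
          (by rw [← pow_succ']; exact hqn x) (hZc x) (by rw [hβ]; exact h4 x) (h5 x) a1'' a3'
        simp only [wt, hz', hz'', vwp_shift hC1 a1', pr_shift_both hq hZ, pr_shift_both hq hb1,
          dpr_shift_base a3', vwp_succ hC1, pr_succ, dpr_succ, hinv, div_pow _ q x]
        simp only [pow_succ _ x]
        linear_combination (vwp q (a1 * a2) x * pr q (a1 * a2) Z⁻¹ x * pr q (a1 * a2) b x *
          dpr q (a1 * a2) d x * (a1 * a2 * q ^ 2 * Z / b) ^ x) * this
    rw [show n + 1 + m + 1 = n + m + 2 by ring, hrec]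
    have ih' := @ih a1 (q * a2) (q * a3) d p1 (by positivity) (by positivity)
      (fun k => by convert h1 (k + 1) using 2; ring) (fun k => by convert h2 (k + 1) using 2; ring)
      (fun k => by rw [hZq]; convert h3 (k + 1) using 2; rw [hb]; field_simp; ring)
      (fun k => by rw [hZq]; convert h4 k using 4; field_simp)
      (fun k => by convert h5 (k + 1) using 2; ring)
    rw [hZq] at ih'
    simp only [mul_assoc _ (wt _ _ _ _ _ _)]
    have g1 : a1 * (q * a2) * (q * a3) * q ^ 2 * (Z / q) = q * b := by rw [hb]; field_simp
    have g2 : a1 * (q * a2) = q * (a1 * a2) := by ring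
    have g3 : q * a3 * (Z / q) = a3 * Z := by field_simp
    rw [g1, g2, g3] at ih'
    rw [← Finset.mul_sum, ih', show n + 1 + m = n + m + 1 by ring, qPoch_succ', qPoch_succ',
      qPoch_succ', qPoch_succ']
    have g4 : q * (a1 * a2) * q ^ 2 = q * (a1 * a2 * q ^ 2) := by ring
    have g5 : q * (q * a2) * d = q * (q * a2 * d) := by ring
    have g6 : q * (a1 * a2 * q ^ 2) * d = q * (a1 * a2 * q ^ 2 * d) := by ring
    rw [g4, g5, g6, div_mul_eq_mul_div, div_mul_div_comm]
    ring_nf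

/-- Reversal of a `q`-Pochhammer symbol. -/
theorem qPoch_reverse {q α : ℂ} (hq : q ≠ 0) (hα : α ≠ 0) (K : ℕ) :
    qPoch (α * q ^ K)⁻¹ q K = qPoch (q * α) q K * ((-1) ^ K * (α⁻¹) ^ K * (q ^ ((K + 1).choose 2))⁻¹) := by
  induction K with
  | zero => simp [qPoch_zero]
  | succ K ih =>
    have h : q * (α * q ^ (K + 1))⁻¹ = (α * q ^ K)⁻¹ := by rw [pow_succ]; field_simp
    rw [qPoch_succ', h, ih, qPoch_succ, Nat.choose_succ_succ (K + 1) 1, Nat.choose_one_right,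
      pow_add]
    have := pow_ne_zero K hq
    simp only [pow_succ]
    field_simp
    ring

/-- The orthogonality weight of the `q`-Racah polynomials, with `Z = q ^ K`. -/
def wo (q a1 a2 a3 Z : ℂ) (x : ℕ) : ℂ :=
  vwp q (a1 * a2) x * pr q (a1 * a2) Z⁻¹ x * pr q (a1 * a2) (q * a2) x *
    pr q (a1 * a2) (a1 * a2 * a3 * q ^ 2 * Z) x * ((q * (a2 * a3))⁻¹) ^ x

/-- The total mass of `wo`. -/
def woMass (q a1 a2 a3 : ℂ) (K : ℕ) : ℂ :=
  qPoch (a1 * a2 * q ^ 2) q K * qPoch (a2 * a3 * q ^ 2) q K /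
    (qPoch (q * a1) q K * qPoch (q * a3) q K * (q * a2) ^ K)

theorem dpr_eq_pr {q C d : ℂ} (hd : d ≠ 0) (x : ℕ) : dpr q C d x = pr q C d⁻¹ x * d ^ x := by
  have : ∏ l ∈ Finset.range x, (d - q ^ l) = qPoch d⁻¹ q x * d ^ x := by
    induction x with
    | zero => simp [qPoch_zero]
    | succ x ih => rw [Finset.prod_range_succ, ih, qPoch_succ, pow_succ]; field_simp
  rw [dpr, this, pr, div_inv_eq_mul]
  ring

theorem wt_eq_wo {q a1 a2 a3 Z : ℂ} (hq : q ≠ 0) (p1 : a1 ≠ 0) (p2 : a2 ≠ 0) (p3 : a3 ≠ 0)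
    (hZ : Z ≠ 0) (x : ℕ) :
    wt q (a1 * a2) Z (a1 * a2 * a3 * q ^ 2 * Z) (q * a2)⁻¹ x = wo q a1 a2 a3 Z x := by
  have : a1 * a2 * q ^ 2 * Z / (a1 * a2 * a3 * q ^ 2 * Z) * (q * a2)⁻¹ = (q * (a2 * a3))⁻¹ := by
    field_simp
  rw [wt, dpr_eq_pr (by positivity), wo, ← this, mul_pow, inv_inv]
  ring

theorem sum_wo {q : ℂ} (hq : q ≠ 0) (hqn : ∀ k : ℕ, 1 - q ^ (k + 1) ≠ 0) {a1 a2 a3 : ℂ} (K : ℕ)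
    (p1 : a1 ≠ 0) (p2 : a2 ≠ 0) (p3 : a3 ≠ 0) (h1 : ∀ k : ℕ, 1 - a1 * a2 * q * q ^ k ≠ 0)
    (h3 : ∀ k : ℕ, 1 - (a3 * q ^ K)⁻¹ * q ^ k ≠ 0) (h5 : ∀ k : ℕ, 1 - q * a1 * q ^ k ≠ 0) :
    ∑ x ∈ Finset.range (K + 1), wo q a1 a2 a3 (q ^ K) x = woMass q a1 a2 a3 K := by
  have hqK := pow_ne_zero K hq
  simp only [← wt_eq_wo hq p1 p2 p3 hqK]
  have hc : a1 * a2 * q ^ 2 / (a1 * a2 * a3 * q ^ 2 * q ^ K) = (a3 * q ^ K)⁻¹ := by field_simp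
  have hc' : a1 * a2 * q ^ 2 * (q * a2)⁻¹ = q * a1 := by field_simp
  have hc'' : q * a1 / (a1 * a2 * a3 * q ^ 2 * q ^ K) =
      (q * (a2 * a3) * q ^ K)⁻¹ := by field_simp
  rw [sum_wt hq hqn K (by positivity) (by positivity) h1 (by rwa [hc]) (by rwa [hc']), hc, hc',
    hc'', qPoch_reverse hq p3, qPoch_reverse hq (by positivity), woMass]
  have : q * (q * (a2 * a3)) = a2 * a3 * q ^ 2 := by ring
  rw [this]
  have := pow_ne_zero ((K + 1).choose 2) hq
  simp only [inv_pow, mul_pow]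
  field_simp

/-- The forward shift of `core`. -/
theorem core_forward {q C D e1 e2 e3 X : ℂ} {m : ℕ} (hX : X ≠ 0) (hq : q ≠ 0)
    (h1 : ∀ k ≤ m, 1 - e1 * q ^ k ≠ 0) (h2 : ∀ k ≤ m, 1 - e2 * q ^ k ≠ 0)
    (h3 : ∀ k ≤ m, 1 - e3 * q ^ k ≠ 0) (hqn : ∀ k ≤ m, 1 - q ^ (k + 1) ≠ 0) :
    core q C D e1 e2 e3 (m + 1) X - core q C D e1 e2 e3 (m + 1) (X * q) =
      (1 - C * q ^ 2 * X ^ 2) / X * ((1 - (q ^ (m + 1))⁻¹) * (1 - D * q ^ (m + 2)) /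
        ((1 - e1) * (1 - e2) * (1 - e3))) *
        core q (q * C) (q ^ 2 * D) (q * e1) (q * e2) (q * e3) m X := by
  have z1 : 1 - e1 ≠ 0 := by simpa using h1 0 (Nat.zero_le _)
  have z2 : 1 - e2 ≠ 0 := by simpa using h2 0 (Nat.zero_le _)
  have z3 : 1 - e3 ≠ 0 := by simpa using h3 0 (Nat.zero_le _)
  rw [core, core, ← Finset.sum_sub_distrib, Finset.sum_range_succ', core, Finset.mul_sum]
  have h0 : coreTerm q C D e1 e2 e3 (m + 1) X 0 - coreTerm q C D e1 e2 e3 (m + 1) (X * q) 0 = 0 := by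
    simp [coreTerm, qPoch_zero]
  rw [h0, add_zero]
  refine Finset.sum_congr rfl fun k hk => ?_
  have hk : k ≤ m := by simpa [Nat.lt_succ_iff] using hk
  have y1 : qPoch (q * e1) q k ≠ 0 := qPoch_ne_zero fun l hl => by
    convert h1 (l + 1) (by omega) using 2; ring
  have y2 : qPoch (q * e2) q k ≠ 0 := qPoch_ne_zero fun l hl => by
    convert h2 (l + 1) (by omega) using 2; ring
  have y3 : qPoch (q * e3) q k ≠ 0 := qPoch_ne_zero fun l hl => by
    convert h3 (l + 1) (by omega) using 2; ring
  have yq : qPoch q q k ≠ 0 := qPoch_ne_zero fun l hl => by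
    rw [← pow_succ']; exact hqn l (by omega)
  have w : 1 - q * q ^ k ≠ 0 := by rw [← pow_succ']; exact hqn k hk
  have g1 : qPoch ((q ^ (m + 1))⁻¹) q (k + 1) = (1 - (q ^ (m + 1))⁻¹) * qPoch ((q ^ m)⁻¹) q k := by
    rw [qPoch_succ']; congr 2; rw [pow_succ]; field_simp
  have g2 : qPoch (D * q ^ (m + 1 + 1)) q (k + 1) =
      (1 - D * q ^ (m + 2)) * qPoch (q ^ 2 * D * q ^ (m + 1)) q k := by
    rw [qPoch_succ']; congr 2; ring
  have b1 : qPoch (X * q)⁻¹ q (k + 1) = (1 - (X * q)⁻¹) * qPoch X⁻¹ q k := by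
    rw [qPoch_succ']; congr 2; field_simp
  have b2 : qPoch (C * q * (X * q)) q (k + 1) =
      qPoch (q * C * q * X) q k * (1 - C * q ^ 2 * X * q ^ k) := by
    rw [qPoch_succ]; ring_nf
  have b3 : qPoch X⁻¹ q (k + 1) = qPoch X⁻¹ q k * (1 - X⁻¹ * q ^ k) := qPoch_succ ..
  have b4 : qPoch (C * q * X) q (k + 1) = (1 - C * q * X) * qPoch (q * C * q * X) q k := by
    rw [qPoch_succ']; ring_nf
  simp only [coreTerm, g1, g2, b1, b2, b3, b4, qPoch_succ' e1, qPoch_succ' e2, qPoch_succ' e3,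
    qPoch_succ q]
  generalize qPoch ((q ^ m)⁻¹) q k = A
  generalize qPoch (q ^ 2 * D * q ^ (m + 1)) q k = B
  generalize qPoch X⁻¹ q k = E
  generalize qPoch (q * C * q * X) q k = F
  generalize qPoch (q * e1) q k = p1 at *
  generalize qPoch (q * e2) q k = p2 at *
  generalize qPoch (q * e3) q k = p3 at *
  generalize qPoch q q k = p4 at *
  generalize (q ^ (m + 1))⁻¹ = M
  generalize 1 - D * q ^ (m + 2) = D'
  generalize 1 - e1 = W1 at *
  generalize 1 - e2 = W2 at *
  generalize 1 - e3 = W3 at *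
  rw [pow_succ]
  clear h0 h1 h2 h3 hqn g1 g2 b1 b2 b3 b4
  generalize q ^ k = Q at *
  obtain ⟨W, hW⟩ : ∃ W, W = 1 - q * Q := ⟨_, rfl⟩
  rw [← hW] at w ⊢
  field_simp
  rw [hW]
  ring

theorem pR_forward {q a1 a2 a3 Z : ℂ} {m : ℕ} (x : ℕ) (hq : q ≠ 0)
    (h1 : ∀ k ≤ m, 1 - q * a2 * q ^ k ≠ 0)
    (h2 : ∀ k ≤ m, 1 - a1 * a2 * a3 * q ^ 2 * Z * q ^ k ≠ 0) (h3 : ∀ k ≤ m, 1 - Z⁻¹ * q ^ k ≠ 0)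
    (hqn : ∀ k ≤ m, 1 - q ^ (k + 1) ≠ 0) :
    pR q a1 a2 a3 Z (m + 1) x - pR q a1 a2 a3 Z (m + 1) (x + 1) =
      (1 - a1 * a2 * q ^ 2 * (q ^ x) ^ 2) / q ^ x *
        ((1 - (q ^ (m + 1))⁻¹) * (1 - a2 * a3 * q ^ (m + 2)) /
          ((1 - q * a2) * (1 - a1 * a2 * a3 * q ^ 2 * Z) * (1 - Z⁻¹))) *
        pR q a1 (q * a2) (q * a3) (Z / q) m x := by
  have e1 : a1 * (q * a2) = q * (a1 * a2) := by ring
  have e2 : q * (a1 * a2) * (q * a3) * q ^ 2 * (Z / q) = q * (a1 * a2 * a3 * q ^ 2 * Z) := by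
    field_simp
  have e3 : (Z / q)⁻¹ = q * Z⁻¹ := by rw [inv_div]; ring
  have e4 : q * a2 * (q * a3) = q ^ 2 * (a2 * a3) := by ring
  simp only [pR, e1, e2, e3, e4, pow_succ q x]
  exact core_forward (pow_ne_zero x hq) hq h1 h2 h3 hqn

theorem wo_raise_aux {q C X Z D b e : ℂ} (hq : q ≠ 0) (hC : C ≠ 0) (hX : X ≠ 0) (hZ : Z ≠ 0)
    (hb : b ≠ 0) (he0 : e ≠ 0) (hZ1 : 1 - Z⁻¹ ≠ 0) (hb1 : 1 - b ≠ 0) (he : 1 - e ≠ 0)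
    (h1 : 1 - C * q * X ^ 2 ≠ 0) (h8 : 1 - C * q ^ 2 * X ^ 2 ≠ 0) (h2 : 1 - C * q ^ 3 * X ^ 2 ≠ 0)
    (h3 : 1 - q * X ≠ 0) (h4 : 1 - C * q ^ 2 * Z * X ≠ 0) (h5 : 1 - C * q ^ 2 / b * X ≠ 0)
    (h6 : 1 - C * q ^ 2 / e * X ≠ 0) (h7 : 1 - C * q ^ 2 ≠ 0) (hD : e * b = C * D * q ^ 3 * Z)
    (hD0 : D ≠ 0) :
    raiseU q C e b Z⁻¹ X =
      (1 - C * q ^ 2) * X / (1 - C * q ^ 2 * X ^ 2) *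
        ((1 - C * q ^ 2 * X ^ 2) * (1 - C * q * X) / ((1 - C * q * X ^ 2) * (1 - C * q ^ 2)) *
          ((1 - Z⁻¹ * X) / (1 - Z⁻¹)) * ((1 - e * X) / (1 - e)) * ((1 - b * X) / (1 - b)) / X ^ 2) ∧
    raiseV q C e b Z⁻¹ (X * q) *
      ((1 - C * q ^ 3 * X ^ 2) * (1 - C * q * X) / ((1 - C * q * X ^ 2) * (1 - q * X)) *
        ((1 - Z⁻¹ * X) / (1 - C * q ^ 2 * Z * X)) * ((1 - e * X) / (1 - C * q ^ 2 / e * X)) *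
        ((1 - b * X) / (1 - C * q ^ 2 / b * X)) * (q * D)⁻¹) =
      - ((1 - C * q ^ 2) * X / (1 - C * q ^ 2 * X ^ 2) *
        ((1 - C * q ^ 2 * X ^ 2) * (1 - C * q * X) / ((1 - C * q * X ^ 2) * (1 - C * q ^ 2)) *
          ((1 - Z⁻¹ * X) / (1 - Z⁻¹)) * ((1 - e * X) / (1 - e)) * ((1 - b * X) / (1 - b)) / X ^ 2)) := by
  have e1 : raiseU q C e b Z⁻¹ X = (1 - C * q * X) * ((1 - e * X) * (1 - b * X) * (1 - Z⁻¹ * X)) /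
      (X * ((1 - e) * (1 - b) * (1 - Z⁻¹)) * (1 - C * q * X ^ 2)) := by
    rw [raiseU, ← neg_sub, ← neg_sub _ (C * q * X ^ 2), mul_neg, neg_mul, neg_div_neg_eq]
  have e5 : C * q ^ 2 * X - Z⁻¹ = - (1 - C * q ^ 2 * Z * X) / Z := by field_simp; ring
  have e6 : C * q ^ 2 * X - b = - (b * (1 - C * q ^ 2 / b * X)) := by field_simp; ring
  have e7 : C * q ^ 2 * X - e = - (e * (1 - C * q ^ 2 / e * X)) := by field_simp; ring
  have e2 : raiseV q C e b Z⁻¹ (X * q) =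
      (1 - q * X) * (-(e * (1 - C * q ^ 2 / e * X)) * -(b * (1 - C * q ^ 2 / b * X)) *
        (- (1 - C * q ^ 2 * Z * X) / Z)) /
      (C * q ^ 2 * X * ((1 - e) * (1 - b) * (1 - Z⁻¹)) * (1 - C * q ^ 3 * X ^ 2)) := by
    rw [raiseV, ← e5, ← e6, ← e7, ← neg_sub,
      show C * q * (X * q) ^ 2 - 1 = - (1 - C * q ^ 3 * X ^ 2) by ring, mul_neg,
      neg_mul, neg_div_neg_eq]
    ring_nf
  have hDD : D = e * b / (C * q ^ 3 * Z) := by rw [hD]; field_simp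
  rw [e1, e2, hDD]
  clear e1 e2 e5 e6 e7 hDD hD hD0
  obtain ⟨W1, hW1⟩ : ∃ W, W = 1 - C * q * X ^ 2 := ⟨_, rfl⟩
  obtain ⟨W2, hW2⟩ : ∃ W, W = 1 - C * q ^ 3 * X ^ 2 := ⟨_, rfl⟩
  obtain ⟨W3, hW3⟩ : ∃ W, W = 1 - q * X := ⟨_, rfl⟩
  obtain ⟨W4, hW4⟩ : ∃ W, W = 1 - C * q ^ 2 * Z * X := ⟨_, rfl⟩
  obtain ⟨W5, hW5⟩ : ∃ W, W = 1 - C * q ^ 2 / b * X := ⟨_, rfl⟩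
  obtain ⟨W6, hW6⟩ : ∃ W, W = 1 - C * q ^ 2 / e * X := ⟨_, rfl⟩
  obtain ⟨W7, hW7⟩ : ∃ W, W = 1 - C * q ^ 2 := ⟨_, rfl⟩
  obtain ⟨W8, hW8⟩ : ∃ W, W = 1 - e := ⟨_, rfl⟩
  obtain ⟨W9, hW9⟩ : ∃ W, W = 1 - C * q ^ 2 * X ^ 2 := ⟨_, rfl⟩
  obtain ⟨W0, hW0⟩ : ∃ W, W = 1 - Z⁻¹ := ⟨_, rfl⟩
  obtain ⟨V0, hV0⟩ : ∃ W, W = 1 - Z⁻¹ * X := ⟨_, rfl⟩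
  obtain ⟨V1, hV1⟩ : ∃ W, W = 1 - C * q * X := ⟨_, rfl⟩
  obtain ⟨V2, hV2⟩ : ∃ W, W = 1 - b := ⟨_, rfl⟩
  obtain ⟨V3, hV3⟩ : ∃ W, W = 1 - b * X := ⟨_, rfl⟩
  obtain ⟨V4, hV4⟩ : ∃ W, W = 1 - e * X := ⟨_, rfl⟩
  simp only [← hW1, ← hW2, ← hW3, ← hW4, ← hW5, ← hW6, ← hW7, ← hW8, ← hW9, ← hW0, ← hV0, ← hV1,
    ← hV2, ← hV3, ← hV4] at h1 h2 h3 h4 h5 h6 h7 h8 hZ1 hb1 he ⊢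
  constructor
  · field_simp
  · field_simp

/-- `a` is not a power of `q`. -/
def Av (q a : ℂ) : Prop := ∀ m : ℤ, q ^ m * a ≠ 1

theorem Av.ne {q a z : ℂ} (h : Av q a) (m : ℤ) (hz : z = q ^ m * a) : 1 - z ≠ 0 :=
  fun h0 => h m (by rw [← hz]; linear_combination -h0)

theorem Av.shift {q a b : ℂ} (hq : q ≠ 0) (h : Av q a) (m : ℤ) (hb : b = q ^ m * a) : Av q b :=
  fun k h0 => h (k + m) (by rw [zpow_add₀ hq, mul_assoc, ← hb, h0])

theorem Av.inv {q a b : ℂ} (hq : q ≠ 0) (h : Av q a) (m : ℤ) (hb : b = q ^ m * a⁻¹) : Av q b :=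
  fun k h0 => h (-(k + m)) (by
    rw [zpow_neg, ← inv_inj, mul_inv, inv_inv, zpow_add₀ hq, mul_assoc, ← hb, h0, inv_one])

/-- The parameters `a₁, a₂, a₃` are generic. -/
structure Gen3 (q a1 a2 a3 : ℂ) : Prop where
  hq : q ≠ 0
  hqn : ∀ k : ℕ, 1 - q ^ (k + 1) ≠ 0
  n1 : a1 ≠ 0
  n2 : a2 ≠ 0
  n3 : a3 ≠ 0
  A1 : Av q a1
  A2 : Av q a2
  A3 : Av q a3
  A12 : Av q (a1 * a2)
  A13 : Av q (a1 * a3)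
  A23 : Av q (a2 * a3)
  A123 : Av q (a1 * a2 * a3)

theorem Gen3.shift {q a1 a2 a3 : ℂ} (h : Gen3 q a1 a2 a3) (i j k : ℕ) :
    Gen3 q (q ^ i * a1) (q ^ j * a2) (q ^ k * a3) where
  hq := h.hq
  hqn := h.hqn
  n1 := mul_ne_zero (pow_ne_zero _ h.hq) h.n1
  n2 := mul_ne_zero (pow_ne_zero _ h.hq) h.n2
  n3 := mul_ne_zero (pow_ne_zero _ h.hq) h.n3
  A1 := h.A1.shift h.hq i (by simp)
  A2 := h.A2.shift h.hq j (by simp)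
  A3 := h.A3.shift h.hq k (by simp)
  A12 := h.A12.shift h.hq (i + j : ℕ) (by rw [zpow_natCast]; ring)
  A13 := h.A13.shift h.hq (i + k : ℕ) (by rw [zpow_natCast]; ring)
  A23 := h.A23.shift h.hq (j + k : ℕ) (by rw [zpow_natCast]; ring)
  A123 := h.A123.shift h.hq (i + j + k : ℕ) (by rw [zpow_natCast]; ring)

theorem Gen3.shift23 {q a1 a2 a3 : ℂ} (h : Gen3 q a1 a2 a3) : Gen3 q a1 (q * a2) (q * a3) := by
  simpa using h.shift 0 1 1

theorem Gen3.swap {q a1 a2 a3 : ℂ} (h : Gen3 q a1 a2 a3) : Gen3 q a3 a2 a1 where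
  hq := h.hq
  hqn := h.hqn
  n1 := h.n3
  n2 := h.n2
  n3 := h.n1
  A1 := h.A3
  A2 := h.A2
  A3 := h.A1
  A12 := by rw [mul_comm]; exact h.A23
  A13 := by rw [mul_comm]; exact h.A13
  A23 := by rw [mul_comm]; exact h.A12
  A123 := by convert h.A123 using 1; ring

/-- The orthogonality sum. -/
def orthSum (q a1 a2 a3 : ℂ) (K n m : ℕ) : ℂ :=
  ∑ x ∈ Finset.range (K + 1),
    wo q a1 a2 a3 (q ^ K) x * pR q a1 a2 a3 (q ^ K) n x * pR q a1 a2 a3 (q ^ K) m x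

theorem vwp_ne_zero {q C : ℂ} (hqn : ∀ k : ℕ, 1 - q ^ (k + 1) ≠ 0)
    (h1 : ∀ k : ℕ, 1 - C * q * q ^ k ≠ 0) (x : ℕ) : vwp q C x ≠ 0 := by
  have e1 : 1 - C * q * (q ^ x) ^ 2 ≠ 0 := by convert h1 (2 * x) using 2; ring
  have e2 : 1 - C * q ≠ 0 := by simpa using h1 0
  have e3 : qPoch (C * q) q x ≠ 0 := qPoch_ne_zero fun l _ => h1 l
  have e4 : qPoch q q x ≠ 0 := qPoch_ne_zero fun l _ => by rw [← pow_succ']; exact hqn l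
  rw [vwp]; positivity

theorem pr_ne_zero {q C b : ℂ} {x : ℕ} (h1 : ∀ k < x, 1 - b * q ^ k ≠ 0)
    (h2 : ∀ k < x, 1 - C * q ^ 2 / b * q ^ k ≠ 0) : pr q C b x ≠ 0 :=
  div_ne_zero (qPoch_ne_zero h1) (qPoch_ne_zero h2)

theorem sum_wo_pR_succ {q a1 a2 a3 : ℂ} (h : Gen3 q a1 a2 a3) {K n : ℕ} (hn : n ≤ K) (g : ℕ → ℂ) :
    ∑ x ∈ Finset.range (K + 2), wo q a1 a2 a3 (q ^ (K + 1)) x *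
        pR q a1 a2 a3 (q ^ (K + 1)) (n + 1) x * g x =
      ∑ x ∈ Finset.range (K + 1), ((1 - a1 * a2 * q ^ 2) * q ^ x / (1 - a1 * a2 * q ^ 2 * (q ^ x) ^ 2) *
        wo q a1 (q * a2) (q * a3) (q ^ K) x * (g x - g (x + 1))) *
          pR q a1 (q * a2) (q * a3) (q ^ K) n x := by
  have hq := h.hq
  have hqn := h.hqn
  have n1 := h.n1
  have n2 := h.n2
  have n3 := h.n3
  set Z := q ^ (K + 1) with hZdef
  have hZq : q ^ K = Z / q := by rw [hZdef, pow_succ]; field_simp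
  have hZ0 : Z ≠ 0 := pow_ne_zero _ hq
  set b := a1 * a2 * a3 * q ^ 2 * Z with hb
  have hb0 : b ≠ 0 := by positivity
  have h1 : ∀ k : ℕ, 1 - a1 * a2 * q * q ^ k ≠ 0 := fun k =>
    h.A12.ne (k + 1 : ℕ) (by rw [zpow_natCast]; ring)
  have h2 : ∀ k : ℕ, 1 - q * a2 * q ^ k ≠ 0 := fun k =>
    h.A2.ne (k + 1 : ℕ) (by rw [zpow_natCast]; ring)
  have h3 : ∀ k : ℕ, 1 - b * q ^ k ≠ 0 := fun k =>
    h.A123.ne (k + K + 3 : ℕ) (by rw [zpow_natCast, hb, hZdef]; ring)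
  have a1' : 1 - a1 * a2 * q ≠ 0 := by simpa using h1 0
  have a1'' : 1 - a1 * a2 * q ^ 2 ≠ 0 := by convert h1 1 using 2; ring
  have he : 1 - q * a2 ≠ 0 := by simpa using h2 0
  have hb1 : 1 - b ≠ 0 := by simpa using h3 0
  have aX : ∀ x : ℕ, 1 - a1 * a2 * q * (q ^ x) ^ 2 ≠ 0 := fun x => by
    convert h1 (2 * x) using 2; ring
  have aX2 : ∀ x : ℕ, 1 - a1 * a2 * q ^ 2 * (q ^ x) ^ 2 ≠ 0 := fun x => by
    convert h1 (2 * x + 1) using 2; ring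
  have aX3 : ∀ x : ℕ, 1 - a1 * a2 * q ^ 3 * (q ^ x) ^ 2 ≠ 0 := fun x => by
    convert h1 (2 * x + 2) using 2; ring
  have hX : ∀ x : ℕ, q ^ x ≠ 0 := fun x => pow_ne_zero x hq
  have hZ : 1 - Z⁻¹ ≠ 0 := by
    simpa using one_sub_inv_pow hq hqn (show 0 < K + 1 by omega)
  have hZc : ∀ x : ℕ, 1 - a1 * a2 * q ^ 2 * Z * q ^ x ≠ 0 := fun x => by
    convert h1 (K + 2 + x) using 2; rw [hZdef]; ring
  have hβ : ∀ x : ℕ, 1 - a1 * a2 * q ^ 2 / b * q ^ x ≠ 0 := fun x =>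
    h.A3.inv hq 0 (b := a3⁻¹) (by simp) |>.ne ((x : ℤ) - (K + 1 : ℕ)) (by
      rw [zpow_sub₀ hq, zpow_natCast, zpow_natCast, ← hZdef, hb]; field_simp)
  have hγ : ∀ x : ℕ, 1 - a1 * a2 * q ^ 2 / (q * a2) * q ^ x ≠ 0 := fun x =>
    h.A1.ne (x + 1 : ℕ) (by rw [zpow_natCast]; field_simp; ring)
  rw [hZq]
  refine sum_shift
    (A := fun x => raiseU q (a1 * a2) (q * a2) b Z⁻¹ (q ^ x) * wo q a1 a2 a3 Z x * g x)
    (B := fun x => raiseV q (a1 * a2) (q * a2) b Z⁻¹ (q ^ x) * wo q a1 a2 a3 Z x * g x)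
    (fun x hx => ?_) ?_ ?_ fun x hx => ?_
  · rw [pR_raise x hq (by positivity) hZ0 (by rw [← neg_ne_zero]; simpa using aX x) (fun k _ => h2 k)
      (fun k _ => h3 k) (fun k hk => one_sub_inv_pow hq hqn (by omega)) (fun k _ => hqn k)]
    ring
  · simp [raiseV_one]
  · have : 1 - Z⁻¹ * q ^ (K + 1) = 0 := by rw [← hZdef, inv_mul_cancel₀ hZ0, sub_self]
    simp [raiseU, this]
  · have hC1 := aX x
    have g1 : a1 * (q * a2) = q * (a1 * a2) := by ring
    have g2 : q * (a1 * a2) * (q * a3) * q ^ 2 * (Z / q) = q * b := by rw [hb]; field_simp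
    have g3 : (q * (q * a2 * (q * a3)))⁻¹ = (q * (a2 * a3))⁻¹ / q ^ 2 := by field_simp
    have hz' : (Z / q)⁻¹ = q * Z⁻¹ := by rw [inv_div]; ring
    have hinv : a1 * a2 * q ^ 2 / Z⁻¹ = a1 * a2 * q ^ 2 * Z := by
      rw [div_inv_eq_mul]
    obtain ⟨key1, key2⟩ := wo_raise_aux (D := a2 * a3) hq (mul_ne_zero n1 n2) (hX x) hZ0 hb0
      (mul_ne_zero hq n2) hZ hb1 he hC1 (aX2 x) (aX3 x)
      (by rw [← pow_succ']; exact hqn x) (hZc x) (hβ x) (hγ x) a1'' (by rw [hb]; ring)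
      (mul_ne_zero n2 n3)
    simp only [wo, g1, g2, g3, hz', vwp_shift hC1 a1', pr_shift_both hq hZ,
      pr_shift_both hq hb1, pr_shift_both hq he, vwp_succ hC1, pr_succ, hinv, ← hb,
      div_pow _ (q ^ 2) x, pow_right_comm q 2 x]
    simp only [pow_succ _ x]
    linear_combination (vwp q (a1 * a2) x * pr q (a1 * a2) Z⁻¹ x * pr q (a1 * a2) (q * a2) x *
      pr q (a1 * a2) b x * ((q * (a2 * a3))⁻¹) ^ x) * (g x * key1 + g (x + 1) * key2)

theorem orthSum_symm (q a1 a2 a3 : ℂ) (K n m : ℕ) :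
    orthSum q a1 a2 a3 K n m = orthSum q a1 a2 a3 K m n :=
  Finset.sum_congr rfl fun _ _ => mul_right_comm ..

theorem orthSum_succ_zero {q a1 a2 a3 : ℂ} (h : Gen3 q a1 a2 a3) {K n : ℕ} (hn : n ≤ K) :
    orthSum q a1 a2 a3 (K + 1) (n + 1) 0 = 0 := by
  rw [orthSum, sum_wo_pR_succ h hn]
  simp [pR_zero_left]

theorem orthSum_succ_succ {q a1 a2 a3 : ℂ} (h : Gen3 q a1 a2 a3) {K n m : ℕ} (hn : n ≤ K)
    (hm : m ≤ K) :
    orthSum q a1 a2 a3 (K + 1) (n + 1) (m + 1) =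
      (1 - a1 * a2 * q ^ 2) * ((1 - (q ^ (m + 1))⁻¹) * (1 - a2 * a3 * q ^ (m + 2)) /
          ((1 - q * a2) * (1 - a1 * a2 * a3 * q ^ 2 * q ^ (K + 1)) * (1 - (q ^ (K + 1))⁻¹))) *
        orthSum q a1 (q * a2) (q * a3) K n m := by
  have hq := h.hq
  have h1 : ∀ k : ℕ, 1 - a1 * a2 * q * q ^ k ≠ 0 := fun k =>
    h.A12.ne (k + 1 : ℕ) (by rw [zpow_natCast]; ring)
  have h2 : ∀ k : ℕ, 1 - q * a2 * q ^ k ≠ 0 := fun k =>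
    h.A2.ne (k + 1 : ℕ) (by rw [zpow_natCast]; ring)
  have h3 : ∀ k : ℕ, 1 - a1 * a2 * a3 * q ^ 2 * q ^ (K + 1) * q ^ k ≠ 0 := fun k =>
    h.A123.ne (k + K + 3 : ℕ) (by rw [zpow_natCast]; ring)
  have aX2 : ∀ x : ℕ, 1 - a1 * a2 * q ^ 2 * (q ^ x) ^ 2 ≠ 0 := fun x => by
    convert h1 (2 * x + 1) using 2; ring
  rw [orthSum, sum_wo_pR_succ h hn, orthSum, Finset.mul_sum]
  refine Finset.sum_congr rfl fun x _ => ?_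
  rw [pR_forward x hq (fun k _ => h2 k) (fun k _ => h3 k)
    (fun k hk => one_sub_inv_pow hq h.hqn (by omega)) (fun k _ => h.hqn k)]
  have hZq : q ^ (K + 1) / q = q ^ K := by rw [pow_succ]; field_simp
  rw [hZq]
  have := aX2 x
  have hX := pow_ne_zero x hq
  generalize (1 - (q ^ (m + 1))⁻¹) * (1 - a2 * a3 * q ^ (m + 2)) /
          ((1 - q * a2) * (1 - a1 * a2 * a3 * q ^ 2 * q ^ (K + 1)) * (1 - (q ^ (K + 1))⁻¹)) = τ
  generalize 1 - a1 * a2 * q ^ 2 * (q ^ x) ^ 2 = W at *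
  field_simp

theorem pr_succ' {q D b : ℂ} (hq : q ≠ 0) (n : ℕ) :
    pr q D b (n + 1) = (1 - b) / (1 - D * q ^ 2 / b) * pr q (q ^ 2 * D) (q * b) n := by
  have : q ^ 2 * D * q ^ 2 / (q * b) = q * (D * q ^ 2 / b) := by field_simp
  rw [pr, pr, qPoch_succ', qPoch_succ', this, div_mul_div_comm]

theorem vwp_succ' {q D : ℂ} {n : ℕ} (h1 : 1 - D * q ≠ 0) (h2 : 1 - D * q ^ 2 * q ^ n ≠ 0)
    (h3 : 1 - D * q ^ 3 ≠ 0) (hqn : ∀ k : ℕ, 1 - q ^ (k + 1) ≠ 0) :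
    vwp q D (n + 1) = (1 - D * q ^ 3) * (1 - D * q ^ 2) / ((1 - D * q ^ (n + 2)) * (1 - q ^ (n + 1))) *
      vwp q (q ^ 2 * D) n := by
  have e1 : qPoch (D * q) q (n + 1) = (1 - D * q) * qPoch (D * q ^ 2) q n := by
    rw [qPoch_succ']; ring_nf
  have e2 := qPoch_shift (D * q ^ 2) q n
  have e3 : qPoch (D * q ^ 2) q n =
      (1 - D * q ^ 2) * qPoch (q * (D * q ^ 2)) q n / (1 - D * q ^ 2 * q ^ n) := by
    rw [e2]; field_simp
  rw [vwp, e1, e3, vwp, qPoch_succ q]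
  have e4 : q ^ 2 * D * q = q * (D * q ^ 2) := by ring
  have e5 : D * q ^ (n + 2) = D * q ^ 2 * q ^ n := by ring
  have e6 : q * (D * q ^ 2) = D * q ^ 3 := by ring
  have e7 : D * q * (q ^ (n + 1)) ^ 2 = D * q ^ 3 * (q ^ n) ^ 2 := by ring
  rw [e4, e5, e6, e7, ← pow_succ']
  have := hqn n
  generalize 1 - q ^ (n + 1) = W at *
  generalize 1 - D * q ^ 2 * q ^ n = W' at *
  generalize 1 - D * q ^ 3 * (q ^ n) ^ 2 = W'' at *
  generalize 1 - D * q ^ 3 = W3 at *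
  generalize 1 - D * q = W1 at *
  field_simp

theorem wo_ne_zero {q a1 a2 a3 : ℂ} (h : Gen3 q a1 a2 a3) {K n : ℕ} (hn : n ≤ K) :
    wo q a1 a2 a3 (q ^ K) n ≠ 0 := by
  have hq := h.hq
  have n1 := h.n1
  have n2 := h.n2
  have n3 := h.n3
  have hX : ∀ x : ℕ, q ^ x ≠ 0 := fun x => pow_ne_zero x hq
  have hK := hX K
  refine mul_ne_zero (mul_ne_zero (mul_ne_zero (mul_ne_zero (vwp_ne_zero h.hqn (fun k => ?_) n) ?_) ?_) ?_)
    (pow_ne_zero _ (by positivity))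
  · exact h.A12.ne (k + 1 : ℕ) (by rw [zpow_natCast]; ring)
  · refine pr_ne_zero (fun k hk => one_sub_inv_pow hq h.hqn (by omega)) fun k _ => ?_
    exact h.A12.ne (k + K + 2 : ℕ) (by rw [zpow_natCast]; field_simp; ring)
  · refine pr_ne_zero (fun k hk => ?_) fun k _ => ?_
    · exact h.A2.ne (k + 1 : ℕ) (by rw [zpow_natCast]; ring)
    · exact h.A1.ne (k + 1 : ℕ) (by rw [zpow_natCast]; field_simp; ring)
  · refine pr_ne_zero (fun k hk => ?_) fun k _ => ?_
    · exact h.A123.ne (k + K + 2 : ℕ) (by rw [zpow_natCast]; ring)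
    · exact h.A3.inv hq 0 (b := a3⁻¹) (by simp) |>.ne ((k : ℤ) - K) (by
        rw [zpow_sub₀ hq, zpow_natCast, zpow_natCast]; field_simp)

theorem woMass_succ {q a1 a2 a3 : ℂ} (h : Gen3 q a1 a2 a3) (K : ℕ) :
    woMass q a1 a2 a3 (K + 1) = (1 - a1 * a2 * q ^ 2) * ((1 - a2 * a3 * q ^ 2) *
      (1 - a2 * a3 * q ^ 3)) * (1 - q * a1 * q ^ K)⁻¹ / ((1 - q * a3) * (q * a2) *
      (1 - a2 * a3 * q ^ 2 * q ^ (K + 1))) * q ^ K * woMass q a1 (q * a2) (q * a3) K := by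
  have hq := h.hq
  have n1 := h.n1
  have n2 := h.n2
  have n3 := h.n3
  have hX : ∀ x : ℕ, q ^ x ≠ 0 := fun x => pow_ne_zero x hq
  obtain ⟨Z, hZdef⟩ : ∃ Z, Z = q ^ (K + 1) := ⟨_, rfl⟩
  rw [← hZdef]
  have hZq : q ^ K = Z / q := by rw [hZdef, pow_succ]; field_simp
  have hZ0 : Z ≠ 0 := hZdef ▸ pow_ne_zero _ hq
  have hZd : 1 - a2 * a3 * q ^ 2 * Z ≠ 0 := h.A23.ne (K + 3 : ℕ) (by rw [zpow_natCast, hZdef]; ring)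
  have e1 : qPoch (a1 * a2 * q ^ 2) q (K + 1) =
      (1 - a1 * a2 * q ^ 2) * qPoch (a1 * (q * a2) * q ^ 2) q K := by
    rw [qPoch_succ']; ring_nf
  have e2 := qPoch_shift (a2 * a3 * q ^ 3) q K
  have e3 : qPoch (a2 * a3 * q ^ 3) q K = (1 - a2 * a3 * q ^ 3) *
      qPoch (q * a2 * (q * a3) * q ^ 2) q K / (1 - a2 * a3 * q ^ 2 * Z) := by
    rw [eq_div_iff hZd, hZdef]
    rw [show a2 * a3 * q ^ 3 * q ^ K = a2 * a3 * q ^ 2 * q ^ (K + 1) by ring,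
      show q * (a2 * a3 * q ^ 3) = q * a2 * (q * a3) * q ^ 2 by ring] at e2
    exact e2.symm
  have e4 : qPoch (a2 * a3 * q ^ 2) q (K + 1) =
      (1 - a2 * a3 * q ^ 2) * qPoch (a2 * a3 * q ^ 3) q K := by
    rw [qPoch_succ']; ring_nf
  rw [woMass, woMass, e1, e4, e3, qPoch_succ, qPoch_succ', pow_succ (q * a2) K, mul_pow q (q * a2)]
  have := hX K
  generalize 1 - a2 * a3 * q ^ 2 * Z = W at *
  generalize qPoch (q * a2 * (q * a3) * q ^ 2) q K = P1
  generalize qPoch (a1 * (q * a2) * q ^ 2) q K = P2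
  generalize qPoch (q * a1) q K = P3
  generalize qPoch (q * (q * a3)) q K = P4
  have : (q * a2) ^ K ≠ 0 := by positivity
  generalize (q * a2) ^ K = P5 at *
  generalize 1 - q * a1 * q ^ K = P6
  generalize 1 - q * a3 = P7
  generalize 1 - a1 * a2 * q ^ 2 = P8
  generalize 1 - a2 * a3 * q ^ 2 = P9
  generalize 1 - a2 * a3 * q ^ 3 = P10
  generalize q ^ K = Q at *
  clear e1 e2 e3 e4
  field_simp


theorem wo_succ_eq {q a1 a2 a3 : ℂ} (h : Gen3 q a1 a2 a3) (K n : ℕ) :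
    wo q a3 a2 a1 (q ^ (K + 1)) (n + 1) = (1 - a3 * a2 * q ^ 3) * (1 - a3 * a2 * q ^ 2) /
      ((1 - a3 * a2 * q ^ (n + 2)) * (1 - q ^ (n + 1))) *
      ((1 - (q ^ (K + 1))⁻¹) / (1 - a3 * a2 * q ^ 2 * q ^ (K + 1))) * ((1 - q * a2) / (1 - q * a3)) *
      ((1 - a1 * a2 * a3 * q ^ 2 * q ^ (K + 1)) / (1 - (a1 * q ^ (K + 1))⁻¹)) * (q ^ n * (q * (a2 * a1))⁻¹) * wo q (q * a3) (q * a2) a1 (q ^ K) n := by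
  have hq := h.hq
  have n1 := h.n1
  have n2 := h.n2
  have n3 := h.n3
  have hX : ∀ x : ℕ, q ^ x ≠ 0 := fun x => pow_ne_zero x hq
  obtain ⟨Z, hZdef⟩ : ∃ Z, Z = q ^ (K + 1) := ⟨_, rfl⟩
  rw [← hZdef]
  have hZq : q ^ K = Z / q := by rw [hZdef, pow_succ]; field_simp
  have hZ0 : Z ≠ 0 := hZdef ▸ pow_ne_zero _ hq
  have hd : ∀ k : ℕ, 1 - a3 * a2 * q * q ^ k ≠ 0 := fun k =>
    h.A23.ne (k + 1 : ℕ) (by rw [zpow_natCast]; ring)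
  have g1 : q * a3 * (q * a2) = q ^ 2 * (a3 * a2) := by ring
  have g2 : (q ^ K)⁻¹ = q * Z⁻¹ := by rw [hZq, inv_div]; ring
  have g3 : q ^ 2 * (a3 * a2) * a1 * q ^ 2 * q ^ K = q * (a3 * a2 * a1 * q ^ 2 * Z) := by
    rw [hZq]; field_simp
  have g4 : a3 * a2 * q ^ 2 / Z⁻¹ = a3 * a2 * q ^ 2 * Z := by rw [div_inv_eq_mul]
  have g5 : a3 * a2 * q ^ 2 / (q * a2) = q * a3 := by field_simp
  have g6 : a3 * a2 * q ^ 2 / (a3 * a2 * a1 * q ^ 2 * Z) = (a1 * Z)⁻¹ := by field_simp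
  have g7 : (q * (q * a2 * a1))⁻¹ = (q * (a2 * a1))⁻¹ / q := by field_simp
  have g8 : a3 * a2 * a1 * q ^ 2 * Z = a1 * a2 * a3 * q ^ 2 * Z := by ring
  rw [wo, wo, g1, g2, g3, g7, vwp_succ' (by simpa using hd 0)
    (by convert hd (n + 1) using 2; ring) (by convert hd 2 using 2; ring) h.hqn, pr_succ' hq,
    pr_succ' hq, pr_succ' hq, g4, g5, g6, g8, div_pow, pow_succ (q * (a2 * a1))⁻¹ n]
  have := hX n
  generalize pr q (q ^ 2 * (a3 * a2)) (q * Z⁻¹) n = P1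
  generalize pr q (q ^ 2 * (a3 * a2)) (q * (q * a2)) n = P2
  generalize pr q (q ^ 2 * (a3 * a2)) (q * (a1 * a2 * a3 * q ^ 2 * Z)) n = P3
  generalize vwp q (q ^ 2 * (a3 * a2)) n = P4
  generalize (1 - a3 * a2 * q ^ 3) * (1 - a3 * a2 * q ^ 2) /
    ((1 - a3 * a2 * q ^ (n + 2)) * (1 - q ^ (n + 1))) = P5
  generalize (1 - Z⁻¹) / (1 - a3 * a2 * q ^ 2 * Z) = P6
  generalize (1 - q * a2) / (1 - q * a3) = P7
  generalize (1 - a1 * a2 * a3 * q ^ 2 * Z) / (1 - (a1 * Z)⁻¹) = P8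
  generalize ((q * (a2 * a1))⁻¹) ^ n = P9
  field_simp


theorem wo_succ {q a1 a2 a3 : ℂ} (h : Gen3 q a1 a2 a3) {K n : ℕ} (hn : n ≤ K) :
    woMass q a1 a2 a3 (K + 1) / wo q a3 a2 a1 (q ^ (K + 1)) (n + 1) =
      (1 - a1 * a2 * q ^ 2) * ((1 - (q ^ (n + 1))⁻¹) * (1 - a2 * a3 * q ^ (n + 2)) /
          ((1 - q * a2) * (1 - a1 * a2 * a3 * q ^ 2 * q ^ (K + 1)) * (1 - (q ^ (K + 1))⁻¹))) *
        (woMass q a1 (q * a2) (q * a3) K / wo q (q * a3) (q * a2) a1 (q ^ K) n) := by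
  have hq := h.hq
  have n1 := h.n1
  have n2 := h.n2
  have n3 := h.n3
  have hX : ∀ x : ℕ, q ^ x ≠ 0 := fun x => pow_ne_zero x hq
  set Z := q ^ (K + 1) with hZdef
  have hZq : q ^ K = Z / q := by rw [hZdef, pow_succ]; field_simp
  have hZ0 : Z ≠ 0 := pow_ne_zero _ hq
  have hd : ∀ k : ℕ, 1 - a3 * a2 * q * q ^ k ≠ 0 := fun k =>
    h.A23.ne (k + 1 : ℕ) (by rw [zpow_natCast]; ring)
  have hw := wo_ne_zero h.shift23.swap hn
  have hZd : 1 - a2 * a3 * q ^ 2 * Z ≠ 0 := h.A23.ne (K + 3 : ℕ) (by rw [zpow_natCast, hZdef]; ring)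
  set w := wo q (q * a3) (q * a2) a1 (q ^ K) n with hwdef
  rw [wo_succ_eq h K n, woMass_succ h K, ← hZdef, ← hwdef]
  generalize woMass q a1 (q * a2) (q * a3) K = m
  have x1 : 1 - (a1 * Z)⁻¹ = - (1 - q * a1 * q ^ K) / (a1 * Z) := by
    rw [hZdef]; have := hX K; field_simp; ring
  have x2 : 1 - (q ^ (n + 1))⁻¹ = - (1 - q ^ (n + 1)) / (q ^ n * q) := by
    have := hX n; field_simp; ring
  rw [x1, x2, mul_comm a3 a2, mul_comm a2 a1]
  have y1 : 1 - q * a1 * q ^ K ≠ 0 := h.A1.ne (K + 1 : ℕ) (by rw [zpow_natCast]; ring)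
  have y2 : 1 - q * a3 ≠ 0 := h.A3.ne (1 : ℕ) (by rw [zpow_natCast]; ring)
  have y3 : 1 - a2 * a3 * q ^ 3 ≠ 0 := h.A23.ne (3 : ℕ) (by rw [zpow_natCast]; ring)
  have y4 : 1 - a2 * a3 * q ^ 2 ≠ 0 := h.A23.ne (2 : ℕ) (by rw [zpow_natCast]; ring)
  have y5 := h.hqn n
  have y6 := hX n
  have y7 : q ^ K = Z / q := hZq
  clear_value w
  clear hwdef hd
  generalize 1 - q * a1 * q ^ K = W1 at *
  rw [y7]
  generalize 1 - q * a3 = W2 at *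
  generalize 1 - a2 * a3 * q ^ 3 = W3 at *
  generalize 1 - a2 * a3 * q ^ 2 = W4 at *
  generalize 1 - q ^ (n + 1) = W5 at *
  generalize 1 - a2 * a3 * q ^ 2 * Z = W6 at *
  generalize 1 - a2 * a3 * q ^ (n + 2) = W7 at *
  generalize 1 - Z⁻¹ = W8 at *
  generalize 1 - q * a2 = W9 at *
  generalize 1 - a1 * a2 * a3 * q ^ 2 * Z = V1 at *
  generalize 1 - a1 * a2 * q ^ 2 = V2 at *
  clear_value Z
  generalize q ^ n = Q at *
  field_simp

theorem orthSum_eq (n : ℕ) : ∀ {q a1 a2 a3 : ℂ} (_ : Gen3 q a1 a2 a3) {K m : ℕ} (_ : n ≤ K)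
    (_ : m ≤ K), orthSum q a1 a2 a3 K n m =
      if n = m then woMass q a1 a2 a3 K / wo q a3 a2 a1 (q ^ K) n else 0 := by
  induction n with
  | zero =>
    intro q a1 a2 a3 h K m _ hm
    cases m with
    | zero =>
      have := h.n1
      have hK := pow_ne_zero K h.hq
      simp only [orthSum, pR_zero_left, mul_one, if_true]
      rw [sum_wo h.hq h.hqn K h.n1 h.n2 h.n3]
      · rw [wo, vwp_zero]
        · simp [pr_zero]
        · exact h.A23.ne (1 : ℕ) (by rw [zpow_natCast]; ring)
      · exact fun k => h.A12.ne (k + 1 : ℕ) (by rw [zpow_natCast]; ring)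
      · exact fun k => h.A3.inv h.hq 0 (b := a3⁻¹) (by simp) |>.ne ((k : ℤ) - K) (by
          have := h.n3
          rw [zpow_sub₀ h.hq, zpow_natCast, zpow_natCast]; field_simp)
      · exact fun k => h.A1.ne (k + 1 : ℕ) (by rw [zpow_natCast]; ring)
    | succ m =>
      obtain ⟨K, rfl⟩ : ∃ K', K = K' + 1 := ⟨K - 1, by omega⟩
      rw [orthSum_symm, orthSum_succ_zero h (by omega), if_neg (by omega)]
  | succ n ih =>
    intro q a1 a2 a3 h K m hn hm
    obtain ⟨K, rfl⟩ : ∃ K', K = K' + 1 := ⟨K - 1, by omega⟩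
    cases m with
    | zero => rw [orthSum_succ_zero h (by omega), if_neg (by omega)]
    | succ m =>
      rw [orthSum_succ_succ h (by omega) (by omega), ih h.shift23 (by omega) (by omega)]
      by_cases hnm : n = m
      · subst hnm
        rw [if_pos rfl, if_pos rfl, wo_succ h (by omega)]
      · rw [if_neg hnm, if_neg (by omega), mul_zero]

theorem core_eq_sum_of_le_right {q : ℂ} (hq : q ≠ 0) (C D e1 e2 e3 : ℂ) (n : ℕ) {x L : ℕ}
    (h : x ≤ L) : core q C D e1 e2 e3 n (q ^ x) =
      ∑ k ∈ Finset.range (L + 1), coreTerm q C D e1 e2 e3 n (q ^ x) k := by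
  rw [core_eq_sum_of_le hq _ _ _ _ _ (le_max_left n L)]
  refine (Finset.sum_subset (Finset.range_mono (by omega)) fun k _ hk => ?_).symm
  have : x < k := by
    have : L + 1 ≤ k := by simpa using hk
    omega
  simp [coreTerm, qPoch_inv_pow_eq_zero hq this]

/-- A three-term relation in the variable, at the level of the basis. -/
theorem basis_three_term {q C e d Y : ℂ} (hq : q ≠ 0) (hY : Y ≠ 0) (k : ℕ) :
    (1 - e * Y) * (1 - C * q ^ 2 * d * Y) * (qPoch Y⁻¹ q (k + 1) * qPoch (C * q * Y) q (k + 1)) -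
      (C * q ^ 2 * Y - e) * (Y - d) *
        (qPoch (Y * q)⁻¹ q (k + 1) * qPoch (C * q * (Y * q)) q (k + 1)) =
    (1 - C * q ^ 2 * Y ^ 2) *
      ((1 - e * d / q ^ (k + 1)) * (qPoch Y⁻¹ q (k + 1) * qPoch (q * C * q * Y) q (k + 1)) -
        (C * q ^ (k + 2) - e) * (q ^ k - d) * (1 - (q ^ (k + 1))⁻¹) *
          (qPoch Y⁻¹ q k * qPoch (q * C * q * Y) q k)) := by
  have b1 : qPoch (Y * q)⁻¹ q (k + 1) = (1 - (Y * q)⁻¹) * qPoch Y⁻¹ q k := by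
    rw [qPoch_succ']; congr 2; field_simp
  have b2 : qPoch (C * q * (Y * q)) q (k + 1) =
      qPoch (q * C * q * Y) q k * (1 - C * q ^ 2 * Y * q ^ k) := by
    rw [qPoch_succ]; ring_nf
  have b3 : qPoch Y⁻¹ q (k + 1) = qPoch Y⁻¹ q k * (1 - Y⁻¹ * q ^ k) := qPoch_succ ..
  have b4 : qPoch (C * q * Y) q (k + 1) = (1 - C * q * Y) * qPoch (q * C * q * Y) q k := by
    rw [qPoch_succ']; ring_nf
  rw [b1, b2, b3, b4, qPoch_succ (q * C * q * Y)]
  generalize qPoch Y⁻¹ q k = E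
  generalize qPoch (q * C * q * Y) q k = F
  have hQ := pow_ne_zero k hq
  rw [pow_succ q k, show q ^ (k + 2) = q ^ k * q ^ 2 by ring]
  generalize q ^ k = Q at *
  field_simp
  ring

/-- A three-term relation in the variable for `q`-Racah polynomials. -/
theorem pR_three_term {q a1 a2 a3 Z : ℂ} {j y : ℕ} (hq : q ≠ 0) (n1 : a1 ≠ 0) (n2 : a2 ≠ 0)
    (n3 : a3 ≠ 0) (hZ : Z ≠ 0) (h1 : ∀ k ≤ y, 1 - q * a2 * q ^ k ≠ 0)
    (h2 : ∀ k ≤ y, 1 - a1 * a2 * a3 * q ^ 2 * Z * q ^ k ≠ 0) (h3 : ∀ k ≤ y, 1 - Z⁻¹ * q ^ k ≠ 0)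
    (hqn : ∀ k ≤ y, 1 - q ^ (k + 1) ≠ 0) :
    (1 - q * a1 * q ^ y) * (1 - (a3 * Z)⁻¹ * q ^ y) * pR q a1 a2 a3 Z j y -
      (a1 * a2 * q ^ 2 * q ^ y - q * a1) * (q ^ y - (a1 * a2 * a3 * q ^ 2 * Z)⁻¹) *
        pR q a1 a2 a3 Z j (y + 1) =
    (1 - a1 * a2 * q ^ 2 * (q ^ y) ^ 2) *
      ((1 - q ^ j / Z) * (1 - (a2 * a3 * q * Z * q ^ j)⁻¹) / (1 - Z⁻¹)) *
        pR q (q * a1) a2 a3 (Z / q) j y := by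
  have g1 : q * a1 * a2 = q * (a1 * a2) := by ring
  have g2 : q * (a1 * a2) * a3 * q ^ 2 * (Z / q) = a1 * a2 * a3 * q ^ 2 * Z := by field_simp
  have g3 : (Z / q)⁻¹ = q * Z⁻¹ := by rw [inv_div]; ring
  simp only [pR, g1, g2, g3]
  rw [core_eq_sum_of_le_right hq _ _ _ _ _ j (Nat.le_succ y),
    core_eq_sum_of_le_right hq _ _ _ _ _ j (le_refl (y + 1)),
    core_eq_sum_of_le_right hq _ _ _ _ _ j (le_refl y), Finset.mul_sum, Finset.mul_sum,
    Finset.mul_sum, ← Finset.sum_sub_distrib]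
  set d := (a1 * a2 * a3 * q ^ 2 * Z)⁻¹ with hd
  set C := a1 * a2 with hC
  set D := a2 * a3 with hD
  have hd' : (a3 * Z)⁻¹ = C * q ^ 2 * d := by rw [hd, hC]; field_simp
  have hdi : a1 * a2 * a3 * q ^ 2 * Z = d⁻¹ := by rw [hd, inv_inv]
  set G : ℕ → ℂ := fun k => qPoch ((q ^ j)⁻¹) q k * qPoch (D * q ^ (j + 1)) q k /
    (qPoch (q * a2) q k * qPoch d⁻¹ q k * qPoch Z⁻¹ q k) * (q ^ k / qPoch q q k) with hG
  set b : ℕ → ℂ := fun k => qPoch (q ^ y)⁻¹ q k * qPoch (q * C * q * q ^ y) q k with hb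
  have hY := pow_ne_zero y hq
  have hd0 : d ≠ 0 := by rw [hd]; positivity
  have key : ∀ k, (1 - q * a1 * q ^ y) * (1 - (a3 * Z)⁻¹ * q ^ y) *
        coreTerm q C D (q * a2) (C * a3 * q ^ 2 * Z) Z⁻¹ j (q ^ y) (k + 1) -
      (C * q ^ 2 * q ^ y - q * a1) * (q ^ y - d) *
        coreTerm q C D (q * a2) (C * a3 * q ^ 2 * Z) Z⁻¹ j (q ^ (y + 1)) (k + 1) =
      (1 - C * q ^ 2 * (q ^ y) ^ 2) * (G (k + 1) * (1 - q * a1 * d / q ^ (k + 1)) * b (k + 1) -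
        G (k + 1) * ((C * q ^ (k + 2) - q * a1) * (q ^ k - d) * (1 - (q ^ (k + 1))⁻¹)) * b k) := by
    intro k
    have := basis_three_term (C := C) (e := q * a1) (d := d) hq hY k
    simp only [coreTerm, hG, hb, hd', hC, hdi, pow_succ q y] at this ⊢
    generalize qPoch ((q ^ j)⁻¹) q (k + 1) * qPoch (D * q ^ (j + 1)) q (k + 1) = A
    generalize qPoch (q * a2) q (k + 1) * qPoch d⁻¹ q (k + 1) * qPoch Z⁻¹ q (k + 1) = B
    generalize q ^ (k + 1) / qPoch q q (k + 1) = E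
    linear_combination (A / B * E) * this
  rw [Finset.sum_range_succ', Finset.sum_congr rfl fun k _ => key k]
  have key0 : (1 - q * a1 * q ^ y) * (1 - (a3 * Z)⁻¹ * q ^ y) *
        coreTerm q C D (q * a2) (C * a3 * q ^ 2 * Z) Z⁻¹ j (q ^ y) 0 -
      (C * q ^ 2 * q ^ y - q * a1) * (q ^ y - d) *
        coreTerm q C D (q * a2) (C * a3 * q ^ 2 * Z) Z⁻¹ j (q ^ (y + 1)) 0 =
      (1 - C * q ^ 2 * (q ^ y) ^ 2) * (G 0 * (1 - q * a1 * d / q ^ 0) * b 0) := by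
    simp only [coreTerm, hG, hb, qPoch_zero, pow_zero, hd']
    ring
  rw [key0, ← Finset.mul_sum, ← mul_add, Finset.sum_sub_distrib, sub_add_eq_add_sub,
    ← Finset.sum_range_succ' (fun k => G k * (1 - q * a1 * d / q ^ k) * b k),
    Finset.sum_range_succ _ (y + 1)]
  have hbz : b (y + 1) = 0 := by simp [hb, qPoch_inv_pow_eq_zero hq (Nat.lt_succ_self y)]
  rw [hbz, mul_zero, add_zero, ← Finset.sum_sub_distrib, Finset.mul_sum]
  refine Finset.sum_congr rfl fun k hk => ?_
  have hk : k ≤ y := by simpa [Nat.lt_succ_iff] using hk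
  have hz0 : 1 - Z⁻¹ ≠ 0 := by simpa using h3 0 (Nat.zero_le _)
  have hzk := h3 k hk
  have h1k := h1 k hk
  have h2k : 1 - d⁻¹ * q ^ k ≠ 0 := by rw [← hdi]; exact h2 k hk
  have hqk := hqn k hk
  have y1 : qPoch (q * a2) q k ≠ 0 := qPoch_ne_zero fun l hl => h1 l (by omega)
  have y2 : qPoch d⁻¹ q k ≠ 0 := qPoch_ne_zero fun l hl => by rw [← hdi]; exact h2 l (by omega)
  have y3 : qPoch Z⁻¹ q k ≠ 0 := qPoch_ne_zero fun l hl => h3 l (by omega)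
  have yq : qPoch q q k ≠ 0 := qPoch_ne_zero fun l hl => by
    rw [← pow_succ']; exact hqn l (by omega)
  have s3 : qPoch (q * Z⁻¹) q k = qPoch Z⁻¹ q k * (1 - Z⁻¹ * q ^ k) / (1 - Z⁻¹) := by
    rw [eq_div_iff hz0, ← qPoch_shift]; ring
  have ct : coreTerm q (q * C) D (q * a2) (C * a3 * q ^ 2 * Z) (q * Z⁻¹) j (q ^ y) k =
      G k * ((1 - Z⁻¹) / (1 - Z⁻¹ * q ^ k)) * b k := by
    simp only [coreTerm, s3, hG, hb, hC, hdi]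
    generalize qPoch ((q ^ j)⁻¹) q k * qPoch (D * q ^ (j + 1)) q k = A
    generalize qPoch (q * a2) q k * qPoch d⁻¹ q k = B
    generalize q ^ k / qPoch q q k = E
    generalize qPoch (q ^ y)⁻¹ q k * qPoch (q * (a1 * a2) * q * q ^ y) q k = F
    generalize qPoch Z⁻¹ q k = P at *
    generalize 1 - Z⁻¹ * q ^ k = W at *
    generalize 1 - Z⁻¹ = W' at *
    field_simp
  have gs : G (k + 1) = G k * ((1 - (q ^ j)⁻¹ * q ^ k) * (1 - D * q ^ (j + 1) * q ^ k) * q /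
      ((1 - q * a2 * q ^ k) * (1 - d⁻¹ * q ^ k) * (1 - Z⁻¹ * q ^ k) * (1 - q ^ (k + 1)))) := by
    simp only [hG, qPoch_succ, ← pow_succ']
    rw [pow_succ]
    generalize qPoch ((q ^ j)⁻¹) q k = A
    generalize qPoch (D * q ^ (j + 1)) q k = A'
    generalize qPoch (q * a2) q k = B1
    generalize qPoch d⁻¹ q k = B2
    generalize qPoch Z⁻¹ q k = B3
    generalize qPoch q q k = B4
    simp only [div_eq_mul_inv, mul_inv]
    ring
  rw [gs, ct]
  have hJ := pow_ne_zero j hq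
  have hQ := pow_ne_zero k hq
  have x1 : C * q ^ (k + 2) - q * a1 = - (q * a1) * (1 - q * a2 * q ^ k) := by rw [hC]; ring
  have x2 : q ^ k - d = - d * (1 - d⁻¹ * q ^ k) := by field_simp; ring
  have x3 : 1 - (q ^ (k + 1))⁻¹ = - (1 - q ^ (k + 1)) / (q * q ^ k) := by
    field_simp; ring
  rw [x1, x2, x3]
  have main : (1 - q * a1 * d / q ^ k) * (1 - Z⁻¹ * q ^ k) +
      (1 - (q ^ j)⁻¹ * q ^ k) * (1 - D * q ^ (j + 1) * q ^ k) * (q * a1 * d) / q ^ k =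
      (1 - q ^ j / Z) * (1 - (D * q * Z * q ^ j)⁻¹) := by
    have e1 : q * a1 * d = (D * q * Z)⁻¹ := by rw [hd, hD, hC]; field_simp
    have hD0 : D ≠ 0 := mul_ne_zero n2 n3
    rw [e1, pow_succ]
    field_simp
    ring
  rw [← main]
  clear_value G b
  generalize 1 - q * a2 * q ^ k = W1 at *
  generalize 1 - d⁻¹ * q ^ k = W2 at *
  generalize 1 - q ^ (k + 1) = W3 at *
  obtain ⟨W4, hW4⟩ : ∃ W, W = 1 - Z⁻¹ * q ^ k := ⟨_, rfl⟩
  obtain ⟨W5, hW5⟩ : ∃ W, W = 1 - Z⁻¹ := ⟨_, rfl⟩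
  rw [← hW4] at hzk
  rw [← hW5] at hz0
  rw [← hW4, ← hW5]
  field_simp
  ring

theorem wt_swap {q C Z b b' : ℂ} (hb : b ≠ 0) (hb' : b' ≠ 0) (x : ℕ) :
    wt q C Z b b'⁻¹ x = wt q C Z b' b⁻¹ x := by
  rw [wt, wt, dpr_eq_pr (inv_ne_zero hb'), dpr_eq_pr (inv_ne_zero hb), inv_inv, inv_inv, div_pow,
    div_pow, inv_pow, inv_pow]
  ring

/-- The sum of a product of two `q`-Racah polynomials against a very-well-poised weight. -/
def linSum (q c0 c1 c3 c4 : ℂ) (N j b : ℕ) : ℂ :=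
  ∑ y ∈ Finset.range (N + 1),
    wt q (c0 * c3) (q ^ N) (c0 * c3 * c1 * q ^ 2 * q ^ N) (c3 * c0 * c4 * q ^ 2 * q ^ N)⁻¹ y *
      pR q c3 c0 c4 (q ^ N) j y * pR q c0 c3 c1 (q ^ N) b y

theorem linSum_zero {q c0 c1 c3 c4 : ℂ} (h1 : Gen3 q c0 c3 c1) (h4 : Gen3 q c3 c0 c4)
    {N j : ℕ} (hj : j ≤ N) :
    linSum q c0 c1 c3 c4 N j 0 =
      qPoch (c0 * c3 * q ^ 2) q N * qPoch (c1 * c3 * q * q ^ N)⁻¹ q j *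
        qPoch (c0 * c1 * c3 * c4 * q ^ 2 * q ^ N * q ^ N)⁻¹ q (N - j) /
      (qPoch (q * c0) q j * qPoch (c4 * q ^ N)⁻¹ q (N - j) * qPoch (c1 * q ^ N)⁻¹ q N) := by
  obtain ⟨m, rfl⟩ := Nat.exists_eq_add_of_le hj
  have hq := h1.hq
  have n0 := h1.n1
  have n3 := h1.n2
  have n1 := h1.n3
  have n4 := h4.n3
  have hM := pow_ne_zero (j + m) hq
  have e1 : c0 * c3 * c1 * q ^ 2 * q ^ (j + m) ≠ 0 := by positivity
  have e2 : c3 * c0 * c4 * q ^ 2 * q ^ (j + m) ≠ 0 := by positivity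
  have := sum_wt_pR hq h1.hqn m j (a1 := c3) (a2 := c0) (a3 := c4)
    (d := (c0 * c3 * c1 * q ^ 2 * q ^ (j + m))⁻¹) n3 n0 n4
    (fun k => h4.A12.ne (k + 1 : ℕ) (by rw [zpow_natCast]; ring))
    (fun k => h4.A2.ne (k + 1 : ℕ) (by rw [zpow_natCast]; ring))
    (fun k => h4.A123.ne (k + 2 + (j + m) : ℕ) (by rw [zpow_natCast]; ring))
    (fun k => h4.A3.inv hq 0 (b := c4⁻¹) (by simp) |>.ne ((k : ℤ) - (j + m : ℕ)) (by
          rw [zpow_sub₀ hq, zpow_natCast, zpow_natCast]; field_simp))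
    (fun k => h1.A3.inv hq 0 (b := c1⁻¹) (by simp) |>.ne ((k : ℤ) - (j + m : ℕ)) (by
          rw [zpow_sub₀ hq, zpow_natCast, zpow_natCast]; field_simp))
  rw [linSum]
  simp only [pR_zero_left, mul_one]
  rw [show c0 * c3 = c3 * c0 by ring] at e1 this ⊢
  rw [Finset.sum_congr rfl fun x _ => by rw [wt_swap e1 e2], this]
  have g1 : q * c0 * (c3 * c0 * c1 * q ^ 2 * q ^ (j + m))⁻¹ = (c1 * c3 * q * q ^ (j + m))⁻¹ := by
    field_simp
  have g2 : (c3 * c0 * c1 * q ^ 2 * q ^ (j + m))⁻¹ * (c4 * q ^ (j + m))⁻¹ =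
      (c0 * c1 * c3 * c4 * q ^ 2 * q ^ (j + m) * q ^ (j + m))⁻¹ := by
    field_simp
  have g3 : c3 * c0 * q ^ 2 * (c3 * c0 * c1 * q ^ 2 * q ^ (j + m))⁻¹ = (c1 * q ^ (j + m))⁻¹ := by
    field_simp
  rw [g1, g2, g3, Nat.add_sub_cancel_left]

set_option maxHeartbeats 600000 in
theorem wt_raise {q C Z d b e : ℂ} {x : ℕ} (hq : q ≠ 0) (hqn : ∀ k : ℕ, 1 - q ^ (k + 1) ≠ 0)
    (hC : C ≠ 0) (hZ : Z ≠ 0) (hb : b ≠ 0) (hZ1 : 1 - Z⁻¹ ≠ 0) (hb1 : 1 - b ≠ 0) (he : 1 - e ≠ 0)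
    (h1 : ∀ k : ℕ, 1 - C * q * q ^ k ≠ 0)
    (h4 : 1 - C * q ^ 2 * Z * q ^ x ≠ 0) (h5 : 1 - C * q ^ 2 / b * q ^ x ≠ 0)
    (h6 : 1 - C * q ^ 2 * d * q ^ x ≠ 0) (h9 : 1 - C * q ^ 2 * d ≠ 0) :
    raiseU q C e b Z⁻¹ (q ^ x) * wt q C Z b d x =
      (1 - C * q ^ 2) / ((1 - e) * (1 - C * q ^ 2 * d)) * wt q (q * C) (Z / q) (q * b) d x *
        ((1 - e * q ^ x) * (1 - C * q ^ 2 * d * q ^ x) / (1 - C * q ^ 2 * (q ^ x) ^ 2)) ∧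
    raiseV q C e b Z⁻¹ (q ^ (x + 1)) * wt q C Z b d (x + 1) =
      - ((1 - C * q ^ 2) / ((1 - e) * (1 - C * q ^ 2 * d)) * wt q (q * C) (Z / q) (q * b) d x *
        ((C * q ^ 2 * q ^ x - e) * (q ^ x - d) / (1 - C * q ^ 2 * (q ^ x) ^ 2))) := by
  have a1' : 1 - C * q ≠ 0 := by simpa using h1 0
  have a1'' : 1 - C * q ^ 2 ≠ 0 := by convert h1 1 using 2; ring
  have hC1 : 1 - C * q * (q ^ x) ^ 2 ≠ 0 := by convert h1 (2 * x) using 2; ring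
  have hC2 : 1 - C * q ^ 2 * (q ^ x) ^ 2 ≠ 0 := by convert h1 (2 * x + 1) using 2; ring
  have hC3 : 1 - C * q ^ 3 * (q ^ x) ^ 2 ≠ 0 := by convert h1 (2 * x + 2) using 2; ring
  have hX := pow_ne_zero x hq
  have hz' : (Z / q)⁻¹ = q * Z⁻¹ := by rw [inv_div]; ring
  have hz'' : q * C * q ^ 2 * (Z / q) / (q * b) = C * q ^ 2 * Z / b / q := by
    field_simp
  have hinv : C * q ^ 2 / Z⁻¹ = C * q ^ 2 * Z := by rw [div_inv_eq_mul]
  have hqx : 1 - q * q ^ x ≠ 0 := by rw [← pow_succ']; exact hqn x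
  have e1 : raiseU q C e b Z⁻¹ (q ^ x) = (1 - C * q * q ^ x) * ((1 - e * q ^ x) * (1 - b * q ^ x) *
      (1 - Z⁻¹ * q ^ x)) /
      (q ^ x * ((1 - e) * (1 - b) * (1 - Z⁻¹)) * (1 - C * q * (q ^ x) ^ 2)) := by
    rw [raiseU, ← neg_sub, ← neg_sub _ (C * q * (q ^ x) ^ 2), mul_neg, neg_mul, neg_div_neg_eq]
  have e5 : C * q ^ 2 * q ^ x - Z⁻¹ = - (1 - C * q ^ 2 * Z * q ^ x) / Z := by field_simp; ring
  have e6 : C * q ^ 2 * q ^ x - b = - (b * (1 - C * q ^ 2 / b * q ^ x)) := by field_simp; ring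
  have e2 : raiseV q C e b Z⁻¹ (q ^ (x + 1)) =
      (1 - q * q ^ x) * ((C * q ^ 2 * q ^ x - e) * -(b * (1 - C * q ^ 2 / b * q ^ x)) *
        (- (1 - C * q ^ 2 * Z * q ^ x) / Z)) /
      (C * q ^ 2 * q ^ x * ((1 - e) * (1 - b) * (1 - Z⁻¹)) * (1 - C * q ^ 3 * (q ^ x) ^ 2)) := by
    rw [raiseV, ← e5, ← e6, ← neg_sub, show C * q * (q ^ (x + 1)) ^ 2 - 1 =
      - (1 - C * q ^ 3 * (q ^ x) ^ 2) by ring, mul_neg, neg_mul, neg_div_neg_eq]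
    ring_nf
  rw [e1, e2]
  simp only [wt, hz', hz'', vwp_shift hC1 a1', pr_shift_both hq hZ1, pr_shift_both hq hb1,
    dpr_shift_base h9, vwp_succ hC1, pr_succ, dpr_succ, hinv, div_pow _ q x]
  simp only [pow_succ _ x]
  clear e1 e2 e5 e6 hz' hz'' hinv h1
  generalize vwp q C x = V
  generalize pr q C Z⁻¹ x = P1
  generalize pr q C b x = P2
  generalize dpr q C d x = P3
  generalize (C * q ^ 2 * Z / b) ^ x = P4
  generalize q ^ x = X at *
  obtain ⟨W1, hW1⟩ : ∃ W, W = 1 - C * q * X ^ 2 := ⟨_, rfl⟩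
  obtain ⟨W2, hW2⟩ : ∃ W, W = 1 - C * q ^ 3 * X ^ 2 := ⟨_, rfl⟩
  obtain ⟨W3, hW3⟩ : ∃ W, W = 1 - q * X := ⟨_, rfl⟩
  obtain ⟨W4, hW4⟩ : ∃ W, W = 1 - C * q ^ 2 * Z * X := ⟨_, rfl⟩
  obtain ⟨W5, hW5⟩ : ∃ W, W = 1 - C * q ^ 2 / b * X := ⟨_, rfl⟩
  obtain ⟨W6, hW6⟩ : ∃ W, W = 1 - C * q ^ 2 * d * X := ⟨_, rfl⟩
  obtain ⟨W7, hW7⟩ : ∃ W, W = 1 - C * q ^ 2 := ⟨_, rfl⟩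
  obtain ⟨W8, hW8⟩ : ∃ W, W = 1 - e := ⟨_, rfl⟩
  obtain ⟨W9, hW9⟩ : ∃ W, W = 1 - C * q ^ 2 * d := ⟨_, rfl⟩
  obtain ⟨W0, hW0⟩ : ∃ W, W = 1 - Z⁻¹ := ⟨_, rfl⟩
  obtain ⟨V0, hV0⟩ : ∃ W, W = 1 - Z⁻¹ * X := ⟨_, rfl⟩
  obtain ⟨V1, hV1⟩ : ∃ W, W = 1 - C * q * X := ⟨_, rfl⟩
  obtain ⟨V2, hV2⟩ : ∃ W, W = 1 - b := ⟨_, rfl⟩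
  obtain ⟨V3, hV3⟩ : ∃ W, W = 1 - b * X := ⟨_, rfl⟩
  obtain ⟨V4, hV4⟩ : ∃ W, W = 1 - C * q ^ 2 * X ^ 2 := ⟨_, rfl⟩
  simp only [← hW1, ← hW2, ← hW3, ← hW4, ← hW5, ← hW6, ← hW7, ← hW8, ← hW9, ← hW0, ← hV0, ← hV1,
    ← hV2, ← hV3, ← hV4] at hC1 hC2 hC3 hqx h4 h5 h6 a1'' h9 hZ1 hb1 he ⊢
  constructor
  · field_simp
  · field_simp
    ring

section

theorem linSum_succ {q c0 c1 c3 c4 : ℂ} (h1 : Gen3 q c0 c3 c1) (h4 : Gen3 q c3 c0 c4)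
    {N b : ℕ} (j : ℕ) (hb : b ≤ N) :
    linSum q c0 c1 c3 c4 (N + 1) j (b + 1) =
      (1 - c0 * c3 * q ^ 2) / ((1 - q * c3) * (1 - (c4 * q ^ (N + 1))⁻¹)) *
        ((1 - q ^ j / q ^ (N + 1)) * (1 - (c0 * c4 * q * q ^ (N + 1) * q ^ j)⁻¹) /
          (1 - (q ^ (N + 1))⁻¹)) * linSum q c0 (q * c1) (q * c3) c4 N j b := by
  have hq := h1.hq
  have n0 := h1.n1
  have n3 := h1.n2
  have n1 := h1.n3
  have n4 := h4.n3
  have hqn := h1.hqn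
  obtain ⟨Z, hZdef⟩ : ∃ Z, Z = q ^ (N + 1) := ⟨_, rfl⟩
  have hZq : q ^ N = Z / q := by rw [hZdef, pow_succ]; field_simp
  have hZ0 : Z ≠ 0 := hZdef ▸ pow_ne_zero _ hq
  have hZ1 : 1 - Z⁻¹ ≠ 0 := by
    simpa [hZdef] using one_sub_inv_pow hq hqn (show 0 < N + 1 by omega)
  rw [linSum, linSum, hZq, ← hZdef]
  set e2 := c0 * c3 * c1 * q ^ 2 * Z with he2
  set d := (c3 * c0 * c4 * q ^ 2 * Z)⁻¹ with hd
  have he20 : e2 ≠ 0 := by positivity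
  have k1 : ∀ k : ℕ, 1 - c0 * c3 * q * q ^ k ≠ 0 := fun k =>
    h1.A12.ne (k + 1 : ℕ) (by rw [zpow_natCast]; ring)
  have k2 : ∀ k : ℕ, 1 - q * c3 * q ^ k ≠ 0 := fun k =>
    h1.A2.ne (k + 1 : ℕ) (by rw [zpow_natCast]; ring)
  have k3 : ∀ k : ℕ, 1 - e2 * q ^ k ≠ 0 := fun k =>
    h1.A123.ne (k + N + 3 : ℕ) (by rw [zpow_natCast, he2, hZdef]; ring)
  have k4 : ∀ k : ℕ, 1 - c0 * c3 * q ^ 2 / e2 * q ^ k ≠ 0 := fun k =>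
    h1.A3.inv hq 0 (b := c1⁻¹) (by simp) |>.ne ((k : ℤ) - (N + 1 : ℕ)) (by
      rw [zpow_sub₀ hq, zpow_natCast, zpow_natCast, he2, hZdef]
      have := pow_ne_zero (N + 1) hq
      field_simp)
  have hdc : c0 * c3 * q ^ 2 * d = (c4 * Z)⁻¹ := by rw [hd]; field_simp
  have k5 : ∀ k : ℕ, 1 - c0 * c3 * q ^ 2 * d * q ^ k ≠ 0 := fun k =>
    h4.A3.inv hq 0 (b := c4⁻¹) (by simp) |>.ne ((k : ℤ) - (N + 1 : ℕ)) (by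
      rw [zpow_sub₀ hq, zpow_natCast, zpow_natCast, hdc, hZdef]
      have := pow_ne_zero (N + 1) hq
      field_simp)
  have k6 : ∀ k : ℕ, 1 - q * c0 * q ^ k ≠ 0 := fun k =>
    h1.A1.ne (k + 1 : ℕ) (by rw [zpow_natCast]; ring)
  have k7 : ∀ k : ℕ, 1 - c3 * c0 * c4 * q ^ 2 * Z * q ^ k ≠ 0 := fun k =>
    h4.A123.ne (k + N + 3 : ℕ) (by rw [zpow_natCast, hZdef]; ring)
  have hX : ∀ x : ℕ, q ^ x ≠ 0 := fun x => pow_ne_zero x hq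
  have w1 : 1 - e2 ≠ 0 := by simpa using k3 0
  have w2 : 1 - q * c3 ≠ 0 := by simpa using k2 0
  have w3 : 1 - c0 * c3 * q ^ 2 * d ≠ 0 := by simpa using k5 0
  have g1 : c0 * (q * c3) = q * (c0 * c3) := by ring
  have g2 : q * (c0 * c3) * (q * c1) * q ^ 2 * (Z / q) = q * e2 := by rw [he2]; field_simp
  have g3 : (q * c3 * c0 * c4 * q ^ 2 * (Z / q))⁻¹ = d := by rw [hd]; field_simp
  rw [g1, g2, g3, ← hdc, show c0 * c4 * q * Z = c0 * c4 * q * Z by rfl]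
  rw [Finset.mul_sum]
  have := sum_shift (K := N)
    (f := fun y => wt q (c0 * c3) Z e2 d y * pR q c3 c0 c4 Z j y * pR q c0 c3 c1 Z (b + 1) y)
    (g := fun y => pR q c0 (q * c3) (q * c1) (Z / q) b y)
    (A := fun y => raiseU q (c0 * c3) (q * c3) e2 Z⁻¹ (q ^ y) * wt q (c0 * c3) Z e2 d y *
      pR q c3 c0 c4 Z j y)
    (B := fun y => raiseV q (c0 * c3) (q * c3) e2 Z⁻¹ (q ^ y) * wt q (c0 * c3) Z e2 d y *
      pR q c3 c0 c4 Z j y)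
    (c := fun y => (1 - c0 * c3 * q ^ 2) / ((1 - q * c3) * (1 - c0 * c3 * q ^ 2 * d)) *
        ((1 - q ^ j / Z) * (1 - (c0 * c4 * q * Z * q ^ j)⁻¹) / (1 - Z⁻¹)) *
        (wt q (q * (c0 * c3)) (Z / q) (q * e2) d y * pR q (q * c3) c0 c4 (Z / q) j y)) ?_ ?_ ?_ ?_
  · rw [this]
    exact Finset.sum_congr rfl fun y _ => by ring
  · intro x hx
    rw [pR_raise x hq (by positivity) hZ0
      (by rw [← neg_ne_zero]; convert k1 (2 * x) using 1; ring) (fun k _ => k2 k)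
      (fun k _ => k3 k) (fun k hk => by rw [hZdef]; exact one_sub_inv_pow hq hqn (by omega))
      (fun k _ => hqn k)]
    ring
  · simp [raiseV_one]
  · have : 1 - Z⁻¹ * q ^ (N + 1) = 0 := by rw [← hZdef, inv_mul_cancel₀ hZ0, sub_self]
    simp [raiseU, this]
  · intro y hy
    obtain ⟨r1, r2⟩ := wt_raise (x := y) (d := d) hq hqn (mul_ne_zero n0 n3) hZ0 he20 hZ1 w1 w2 k1
      (by convert k1 (N + 2 + y) using 2; rw [hZdef]; ring) (k4 y) (k5 y) w3
    have r3 := pR_three_term (j := j) (y := y) hq n3 n0 n4 hZ0 (fun k _ => k6 k) (fun k _ => k7 k)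
      (fun k hk => by rw [hZdef]; exact one_sub_inv_pow hq hqn (by omega)) (fun k _ => hqn k)
    rw [← hdc, ← hd, mul_comm c3 c0] at r3
    have w4 : 1 - c0 * c3 * q ^ 2 * (q ^ y) ^ 2 ≠ 0 := by convert k1 (2 * y + 1) using 2; ring
    rw [r1, r2]
    generalize wt q (q * (c0 * c3)) (Z / q) (q * e2) d y = w
    generalize pR q c3 c0 c4 Z j y = f1 at *
    generalize pR q c3 c0 c4 Z j (y + 1) = f2 at *
    generalize pR q (q * c3) c0 c4 (Z / q) j y = f3 at *
    generalize (1 - q ^ j / Z) * (1 - (c0 * c4 * q * Z * q ^ j)⁻¹) / (1 - Z⁻¹) = κ at *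
    generalize (1 - c0 * c3 * q ^ 2) / ((1 - q * c3) * (1 - c0 * c3 * q ^ 2 * d)) = κ' at *
    generalize 1 - c0 * c3 * q ^ 2 * (q ^ y) ^ 2 = W at *
    have : κ' * κ * (w * f3) = κ' * w / W * (W * κ * f3) := by field_simp
    rw [this, ← r3]
    ring

/-- The factor of the pentagon relation that depends on the index `j` only. -/
def pentG (q c0 c1 c2 c3 c4 : ℂ) (N j : ℕ) : ℂ :=
  qPoch (c0 * c3 * q ^ 2) q N * qPoch (c1 * c3 * q * q ^ N)⁻¹ q j * qPoch (q * c2) q (N - j) /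
    (qPoch (q * c0) q j * qPoch (c4 * q ^ N)⁻¹ q (N - j) * qPoch (c1 * q ^ N)⁻¹ q N)

/-- The factor of the pentagon relation that depends on the indices `j` and `b`. -/
def pentK (q c1 c2 c3 M J : ℂ) (b : ℕ) : ℂ :=
  qPoch (q * c1) q b * qPoch (c1 * c3 * q ^ 2 * M) q b /
      (qPoch (q * c3) q b * qPoch M⁻¹ q b * (c1 * c2 * q * M) ^ b) *
    (qPoch (J / M) q b * qPoch (c1 * c2 * c3 * q ^ 2 * M / J) q b /
      (qPoch (c1 * c3 * q ^ 2 * M / J) q b * qPoch (J / (c2 * M)) q b))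

/-- The parameters `c₀, …, c₄` are generic and satisfy `q ^ (2 N + 3) c₀ c₁ c₂ c₃ c₄ = 1`. -/
structure Gen5 (q c0 c1 c2 c3 c4 : ℂ) (N : ℕ) : Prop where
  hq : q ≠ 0
  hqn : ∀ k : ℕ, 1 - q ^ (k + 1) ≠ 0
  constr : q ^ (2 * N + 3) * c0 * c1 * c2 * c3 * c4 = 1
  A0 : Av q c0
  A1 : Av q c1
  A2 : Av q c2
  A3 : Av q c3
  A4 : Av q c4
  A01 : Av q (c0 * c1)
  A02 : Av q (c0 * c2)
  A03 : Av q (c0 * c3)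
  A04 : Av q (c0 * c4)
  A12 : Av q (c1 * c2)
  A13 : Av q (c1 * c3)
  A14 : Av q (c1 * c4)
  A23 : Av q (c2 * c3)
  A24 : Av q (c2 * c4)
  A34 : Av q (c3 * c4)

namespace Gen5

variable {q c0 c1 c2 c3 c4 : ℂ} {N : ℕ}

theorem prod_ne (h : Gen5 q c0 c1 c2 c3 c4 N) : c0 ≠ 0 ∧ c1 ≠ 0 ∧ c2 ≠ 0 ∧ c3 ≠ 0 ∧ c4 ≠ 0 := by
  have := h.constr
  refine ⟨?_, ?_, ?_, ?_, ?_⟩ <;> rintro rfl <;> simp at this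

theorem swap (h : Gen5 q c0 c1 c2 c3 c4 N) : Gen5 q c3 c4 c2 c0 c1 N where
  hq := h.hq
  hqn := h.hqn
  constr := by rw [← h.constr]; ring
  A0 := h.A3
  A1 := h.A4
  A2 := h.A2
  A3 := h.A0
  A4 := h.A1
  A01 := h.A34
  A02 := by rw [mul_comm]; exact h.A23
  A03 := by rw [mul_comm]; exact h.A03
  A04 := by rw [mul_comm]; exact h.A13
  A12 := by rw [mul_comm]; exact h.A24
  A13 := by rw [mul_comm]; exact h.A04
  A14 := by rw [mul_comm]; exact h.A14
  A23 := by rw [mul_comm]; exact h.A02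
  A24 := by rw [mul_comm]; exact h.A12
  A34 := h.A01

theorem shift13 (h : Gen5 q c0 c1 c2 c3 c4 (N + 1)) : Gen5 q c0 (q * c1) c2 (q * c3) c4 N where
  hq := h.hq
  hqn := h.hqn
  constr := by rw [← h.constr]; ring
  A0 := h.A0
  A1 := h.A1.shift h.hq 1 (by simp)
  A2 := h.A2
  A3 := h.A3.shift h.hq 1 (by simp)
  A4 := h.A4
  A01 := h.A01.shift h.hq 1 (by simp; ring)
  A02 := h.A02
  A03 := h.A03.shift h.hq 1 (by simp; ring)
  A04 := h.A04
  A12 := h.A12.shift h.hq 1 (by simp; ring)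
  A13 := h.A13.shift h.hq (2 : ℕ) (by rw [zpow_natCast]; ring)
  A14 := h.A14.shift h.hq 1 (by simp; ring)
  A23 := h.A23.shift h.hq 1 (by simp; ring)
  A24 := h.A24
  A34 := h.A34.shift h.hq 1 (by simp; ring)

/-- Permuting the second and the third parameter. -/
theorem perm12 (h : Gen5 q c0 c1 c2 c3 c4 N) : Gen5 q c0 c2 c1 c3 c4 N where
  hq := h.hq
  hqn := h.hqn
  constr := by rw [← h.constr]; ring
  A0 := h.A0
  A1 := h.A2
  A2 := h.A1
  A3 := h.A3
  A4 := h.A4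
  A01 := h.A02
  A02 := h.A01
  A03 := h.A03
  A04 := h.A04
  A12 := by rw [mul_comm]; exact h.A12
  A13 := h.A23
  A14 := h.A24
  A23 := h.A13
  A24 := h.A14
  A34 := h.A34

theorem perm23 (h : Gen5 q c0 c1 c2 c3 c4 N) : Gen5 q c0 c1 c3 c2 c4 N where
  hq := h.hq
  hqn := h.hqn
  constr := by rw [← h.constr]; ring
  A0 := h.A0
  A1 := h.A1
  A2 := h.A3
  A3 := h.A2
  A4 := h.A4
  A01 := h.A01
  A02 := h.A03
  A03 := h.A02
  A04 := h.A04
  A12 := h.A13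
  A13 := h.A12
  A14 := h.A14
  A23 := by rw [mul_comm]; exact h.A23
  A24 := h.A34
  A34 := h.A24

theorem shift12 (h : Gen5 q c0 c1 c2 c3 c4 (N + 1)) : Gen5 q c0 (q * c1) (q * c2) c3 c4 N :=
  h.perm23.shift13.perm23

theorem gen3 (h : Gen5 q c0 c1 c2 c3 c4 N) : Gen3 q c1 c2 c3 where
  hq := h.hq
  hqn := h.hqn
  n1 := h.prod_ne.2.1
  n2 := h.prod_ne.2.2.1
  n3 := h.prod_ne.2.2.2.1
  A1 := h.A1
  A2 := h.A2
  A3 := h.A3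
  A12 := h.A12
  A13 := h.A13
  A23 := h.A23
  A123 := h.A04.inv h.hq (-(2 * N + 3 : ℕ)) (by
    obtain ⟨n0, n1, n2, n3, n4⟩ := h.prod_ne
    have := h.constr
    have hq := pow_ne_zero (2 * N + 3) h.hq
    rw [zpow_neg, zpow_natCast, ← mul_inv]
    refine eq_inv_of_mul_eq_one_left ?_
    linear_combination this)

/-- Exchanging the first and the fourth parameter. -/
theorem perm03 (h : Gen5 q c0 c1 c2 c3 c4 N) : Gen5 q c3 c1 c2 c0 c4 N where
  hq := h.hq
  hqn := h.hqn
  constr := by rw [← h.constr]; ring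
  A0 := h.A3
  A1 := h.A1
  A2 := h.A2
  A3 := h.A0
  A4 := h.A4
  A01 := by rw [mul_comm]; exact h.A13
  A02 := by rw [mul_comm]; exact h.A23
  A03 := by rw [mul_comm]; exact h.A03
  A04 := h.A34
  A12 := h.A12
  A13 := by rw [mul_comm]; exact h.A01
  A14 := h.A14
  A23 := by rw [mul_comm]; exact h.A02
  A24 := h.A24
  A34 := h.A04

theorem gen031 (h : Gen5 q c0 c1 c2 c3 c4 N) : Gen3 q c0 c3 c1 :=
  h.perm03.perm23.perm12.perm03.perm23.gen3

end Gen5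

end

theorem pentK_zero (q c1 c2 c3 M J : ℂ) : pentK q c1 c2 c3 M J 0 = 1 := by
  simp [pentK, qPoch_zero]

theorem pentK_eq_zero {q c1 c2 c3 : ℂ} (hq : q ≠ 0) {N j b : ℕ} (hj : j ≤ N) (h : N < j + b) :
    pentK q c1 c2 c3 (q ^ N) (q ^ j) b = 0 := by
  obtain ⟨m, rfl⟩ := Nat.exists_eq_add_of_le hj
  have : q ^ j / q ^ (j + m) = (q ^ m)⁻¹ := by
    have := pow_ne_zero j hq
    rw [pow_add]; field_simp
  rw [pentK, this, qPoch_inv_pow_eq_zero hq (show m < b by omega)]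
  simp

theorem pentK_succ13 {q c1 c2 c3 M J : ℂ} (hq : q ≠ 0) (b : ℕ) :
    pentK q c1 c2 c3 M J (b + 1) =
      (1 - q * c1) * (1 - c1 * c3 * q ^ 2 * M) / ((1 - q * c3) * (1 - M⁻¹) * (c1 * c2 * q * M)) *
      ((1 - J / M) * (1 - c1 * c2 * c3 * q ^ 2 * M / J) /
        ((1 - c1 * c3 * q ^ 2 * M / J) * (1 - J / (c2 * M)))) *
      pentK q (q * c1) c2 (q * c3) (M / q) J b := by
  have e1 : q * c1 * (q * c3) * q ^ 2 * (M / q) = q * (c1 * c3 * q ^ 2 * M) := by field_simp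
  have e2 : (M / q)⁻¹ = q * M⁻¹ := by rw [inv_div]; ring
  have e3 : q * c1 * c2 * q * (M / q) = c1 * c2 * q * M := by field_simp
  have e4 : J / (M / q) = q * (J / M) := by field_simp
  have e5 : q * c1 * c2 * (q * c3) * q ^ 2 * (M / q) / J = q * (c1 * c2 * c3 * q ^ 2 * M / J) := by
    field_simp
  have e6 : q * (c1 * c3 * q ^ 2 * M) / J = q * (c1 * c3 * q ^ 2 * M / J) := by ring
  have e7 : J / (c2 * (M / q)) = q * (J / (c2 * M)) := by field_simp
  rw [pentK, pentK, e1, e2, e3, e4, e5, e6, e7]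
  simp only [qPoch_succ', pow_succ, div_eq_mul_inv, mul_inv]
  ring

theorem pentG_succ13 {q c0 c1 c2 c3 c4 : ℂ} {N : ℕ} (h : Gen5 q c0 c1 c2 c3 c4 (N + 1)) {j : ℕ}
    (hj : j ≤ N) :
    pentG q c0 c1 c2 c3 c4 (N + 1) j =
      (1 - c0 * c3 * q ^ 2) * (1 - q ^ j * (c1 * c3 * q ^ 2 * q ^ (N + 1))⁻¹) *
        (1 - c2 * q ^ (N + 1) / q ^ j) /
        ((1 - (c1 * c3 * q ^ 2 * q ^ (N + 1))⁻¹) * (1 - (c4 * q ^ (N + 1))⁻¹) *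
          (1 - (q * c1)⁻¹)) *
        pentG q c0 (q * c1) c2 (q * c3) c4 N j := by
  obtain ⟨n0, n1, n2, n3, n4⟩ := h.prod_ne
  have hq := h.hq
  obtain ⟨m, rfl⟩ := Nat.exists_eq_add_of_le hj
  have hM := pow_ne_zero (j + m) hq
  have s1 : j + m + 1 - j = m + 1 := by omega
  have s2 : j + m - j = m := by omega
  have e1 : qPoch (c0 * c3 * q ^ 2) q (j + m + 1) =
      (1 - c0 * c3 * q ^ 2) * qPoch (c0 * (q * c3) * q ^ 2) q (j + m) := by
    rw [qPoch_succ']; ring_nf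
  have e2 : qPoch (c1 * c3 * q * q ^ (j + m + 1))⁻¹ q j =
      qPoch (q * c1 * (q * c3) * q * q ^ (j + m))⁻¹ q j *
      (1 - q ^ j * (c1 * c3 * q ^ 2 * q ^ (j + m + 1))⁻¹) /
        (1 - (c1 * c3 * q ^ 2 * q ^ (j + m + 1))⁻¹) := by
    have := qPoch_shift (c1 * c3 * q ^ 2 * q ^ (j + m + 1))⁻¹ q j
    have hne : 1 - (c1 * c3 * q ^ 2 * q ^ (j + m + 1))⁻¹ ≠ 0 :=
      h.A13.inv hq 0 (b := (c1 * c3)⁻¹) (by simp) |>.ne (-(2 + (j + m + 1) : ℕ)) (by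
        rw [zpow_neg, zpow_natCast, pow_add q 2]; field_simp)
    rw [eq_div_iff hne]
    have a1 : q * (c1 * c3 * q ^ 2 * q ^ (j + m + 1))⁻¹ = (c1 * c3 * q * q ^ (j + m + 1))⁻¹ := by
      field_simp
    have a2 : q * c1 * (q * c3) * q * q ^ (j + m) = c1 * c3 * q ^ 2 * q ^ (j + m + 1) := by ring
    rw [a1] at this
    rw [a2]
    linear_combination this
  have e3 : qPoch (q * c2) q (m + 1) = qPoch (q * c2) q m * (1 - c2 * q ^ (j + m + 1) / q ^ j) := by
    rw [qPoch_succ]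
    congr 2
    have := pow_ne_zero j hq
    rw [pow_succ, pow_add]; field_simp
  have e4 : qPoch (c4 * q ^ (j + m + 1))⁻¹ q (m + 1) =
      (1 - (c4 * q ^ (j + m + 1))⁻¹) * qPoch (c4 * q ^ (j + m))⁻¹ q m := by
    rw [qPoch_succ']
    congr 2
    rw [pow_succ]; field_simp
  have e5 : qPoch (c1 * q ^ (j + m + 1))⁻¹ q (j + m + 1) =
      qPoch (q * c1 * q ^ (j + m))⁻¹ q (j + m) * (1 - (q * c1)⁻¹) := by
    rw [qPoch_succ, pow_succ, show c1 * (q ^ (j + m) * q) = q * c1 * q ^ (j + m) by ring]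
    congr 2
    field_simp
  rw [pentG, pentG, s1, s2, e1, e2, e3, e4, e5]
  simp only [div_eq_mul_inv, mul_inv]
  ring

theorem linSum_eq (b : ℕ) : ∀ {q c0 c1 c2 c3 c4 : ℂ} {N : ℕ} (_ : Gen5 q c0 c1 c2 c3 c4 N) {j : ℕ}
    (_ : j ≤ N) (_ : b ≤ N), linSum q c0 c1 c3 c4 N j b =
      pentG q c0 c1 c2 c3 c4 N j * pentK q c1 c2 c3 (q ^ N) (q ^ j) b := by
  induction b with
  | zero =>
    intro q c0 c1 c2 c3 c4 N h j hj _
    have e : (c0 * c1 * c3 * c4 * q ^ 2 * q ^ N * q ^ N)⁻¹ = q * c2 := by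
      symm
      refine eq_inv_of_mul_eq_one_left ?_
      rw [← h.constr]; ring
    rw [linSum_zero h.gen031 h.swap.gen031 hj, pentK_zero, mul_one, pentG, e]
  | succ b ih =>
    intro q c0 c1 c2 c3 c4 N h j hj hb
    obtain ⟨N, rfl⟩ : ∃ N', N = N' + 1 := ⟨N - 1, by omega⟩
    rw [linSum_succ h.gen031 h.swap.gen031 j (by omega)]
    rcases Nat.lt_or_ge N j with hj' | hj'
    · obtain rfl : j = N + 1 := by omega
      rw [pentK_eq_zero h.hq le_rfl (by omega), div_self (pow_ne_zero _ h.hq)]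
      simp
    · rw [ih h.shift13 hj' (by omega), pentG_succ13 h hj', pentK_succ13 h.hq]
      obtain ⟨n0, n1, n2, n3, n4⟩ := h.prod_ne
      have hq := h.hq
      obtain ⟨M, hM⟩ : ∃ M, M = q ^ (N + 1) := ⟨_, rfl⟩
      have hM' : q ^ (N + 1) / q = q ^ N := by rw [pow_succ]; field_simp
      have hM0 : M ≠ 0 := hM ▸ pow_ne_zero _ hq
      have hJ := pow_ne_zero j hq
      have x0 : c1 * c2 * c3 * q ^ 2 * M / q ^ j = (c0 * c4 * q * M * q ^ j)⁻¹ := by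
        refine eq_inv_of_mul_eq_one_left ?_
        have := h.constr
        rw [hM]
        field_simp
        linear_combination this
      rw [hM', ← hM, x0]
      have y1 : 1 - q * c1 ≠ 0 := h.A1.ne 1 (by simp)
      have y2 : 1 - c1 * c3 * q ^ 2 * M ≠ 0 :=
        h.A13.ne (N + 3 : ℕ) (by rw [zpow_natCast, hM]; ring)
      have y3 : 1 - c1 * c3 * q ^ 2 * M / q ^ j ≠ 0 := h.A13.ne ((N + 3 : ℕ) - (j : ℤ)) (by
        rw [zpow_sub₀ hq, zpow_natCast, zpow_natCast, hM]; field_simp; ring)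
      have y4 : 1 - q ^ j / (c2 * M) ≠ 0 :=
        h.A2.inv hq 0 (b := c2⁻¹) (by simp) |>.ne ((j : ℤ) - (N + 1 : ℕ)) (by
          rw [zpow_sub₀ hq, zpow_natCast, zpow_natCast, ← hM]; field_simp)
      have x1 : 1 - q ^ j * (c1 * c3 * q ^ 2 * M)⁻¹ =
          - (1 - c1 * c3 * q ^ 2 * M / q ^ j) * (q ^ j / (c1 * c3 * q ^ 2 * M)) := by
        field_simp; ring
      have x2 : 1 - (c1 * c3 * q ^ 2 * M)⁻¹ =
          - (1 - c1 * c3 * q ^ 2 * M) / (c1 * c3 * q ^ 2 * M) := by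
        field_simp; ring
      have x3 : 1 - c2 * M / q ^ j = - (1 - q ^ j / (c2 * M)) * (c2 * M / q ^ j) := by
        field_simp; ring
      have x4 : 1 - (q * c1)⁻¹ = - (1 - q * c1) / (q * c1) := by field_simp; ring
      rw [x1, x2, x3, x4]
      generalize pentG q c0 (q * c1) c2 (q * c3) c4 N j = G
      generalize pentK q (q * c1) c2 (q * c3) (q ^ N) (q ^ j) b = K
      clear x0 x1 x2 x3 x4 ih h hM hM'
      generalize (c0 * c4 * q * M * q ^ j)⁻¹ = W0
      generalize 1 - q * c1 = W1 at *
      generalize 1 - c1 * c3 * q ^ 2 * M = W2 at *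
      generalize 1 - c1 * c3 * q ^ 2 * M / q ^ j = W3 at *
      generalize 1 - q ^ j / (c2 * M) = W4 at *
      generalize 1 - q ^ j / M = W5
      generalize 1 - M⁻¹ = W6
      generalize (1 - (c4 * M)⁻¹) = W7
      generalize 1 - c0 * c3 * q ^ 2 = W8
      generalize 1 - q * c3 = W9
      field_simp

section

/-- The weight in the pentagon relation. -/
def pentW (q c0 c1 c2 c3 c4 M A X : ℂ) (y : ℕ) : ℂ :=
  vwp q (c0 * c3) y * pr q (c0 * c3) (X / M) y * pr q (c0 * c3) (A / M) y *
    pr q (c0 * c3) (c0 * c3 * c1 * q ^ 2 * M / X) y *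
    pr q (c0 * c3) (c0 * c3 * c4 * q ^ 2 * M / A) y * pr q (c0 * c3) (c0 * c3 * q ^ 2 * M) y *
    (c2 * q * M) ^ y

/-- The sum in the pentagon relation. -/
def pentSum (q c0 c1 c2 c3 c4 : ℂ) (N a j x b : ℕ) : ℂ :=
  ∑ y ∈ Finset.range (N + 1), pentW q c0 c1 c2 c3 c4 (q ^ N) (q ^ a) (q ^ x) y *
    pR q c3 c0 c4 (q ^ N / q ^ a) j y * pR q c4 c2 c1 (q ^ N / q ^ y) a x *
    pR q c0 c3 c1 (q ^ N / q ^ x) b y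

theorem pr_mul_pr_inv {q C b : ℂ} {x : ℕ} (hC : C * q ^ 2 ≠ 0) (hb : b ≠ 0)
    (h1 : ∀ k < x, 1 - b * q ^ k ≠ 0) (h2 : ∀ k < x, 1 - C * q ^ 2 / b * q ^ k ≠ 0) :
    pr q C b x * pr q C (C * q ^ 2 / b) x = 1 := by
  have e1 := qPoch_ne_zero h1
  have e2 := qPoch_ne_zero h2
  have : C * q ^ 2 / (C * q ^ 2 / b) = b := div_div_cancel₀ hC
  rw [pr, pr, this]
  field_simp

variable {q c0 c1 c2 c3 c4 : ℂ} {N : ℕ}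

theorem pentSum_zero_zero (h : Gen5 q c0 c1 c2 c3 c4 N) (j b : ℕ) :
    pentSum q c0 c1 c2 c3 c4 N 0 j 0 b = linSum q c0 c1 c3 c4 N j b := by
  obtain ⟨n0, n1, n2, n3, n4⟩ := h.prod_ne
  have hq := h.hq
  have hM := pow_ne_zero N hq
  refine Finset.sum_congr rfl fun y hy => ?_
  have hy : y ≤ N := by simpa [Nat.lt_succ_iff] using hy
  simp only [pow_zero, div_one, pR_zero_left, mul_one]
  congr 2
  have e1 : pr q (c0 * c3) (1 / q ^ N) y * pr q (c0 * c3) (c0 * c3 * q ^ 2 * q ^ N) y = 1 := by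
    have := pr_mul_pr_inv (q := q) (C := c0 * c3) (b := (q ^ N)⁻¹) (x := y) (by positivity)
      (by positivity) (fun k hk => one_sub_inv_pow hq h.hqn (by omega))
      (fun k _ => h.A03.ne (k + N + 2 : ℕ) (by rw [zpow_natCast, div_inv_eq_mul]; ring))
    rwa [div_inv_eq_mul, ← one_div] at this
  have e2 : c0 * c3 * q ^ 2 * q ^ N / (c0 * c3 * c1 * q ^ 2 * q ^ N) *
      (c3 * c0 * c4 * q ^ 2 * q ^ N)⁻¹ = c2 * q * q ^ N := by
    have := h.constr
    have hM2 : q ^ (2 * N + 3) = q ^ 3 * (q ^ N) ^ 2 := by ring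
    rw [hM2] at this
    field_simp
    linear_combination -this
  rw [pentW, wt, dpr_eq_pr (inv_ne_zero (by positivity)), inv_inv, ← e2, mul_pow,
    show c3 * c0 * c4 = c0 * c3 * c4 by ring]
  simp only [div_one, one_div] at e1 ⊢
  linear_combination (vwp q (c0 * c3) y * pr q (c0 * c3) (q ^ N)⁻¹ y *
    pr q (c0 * c3) (c0 * c3 * c1 * q ^ 2 * q ^ N) y *
    pr q (c0 * c3) (c0 * c3 * c4 * q ^ 2 * q ^ N) y *
    (c0 * c3 * q ^ 2 * q ^ N / (c0 * c3 * c1 * q ^ 2 * q ^ N)) ^ y *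
    ((c0 * c3 * c4 * q ^ 2 * q ^ N)⁻¹) ^ y) * e1

theorem pentSum_swap (h : Gen5 q c0 c1 c2 c3 c4 N) (a j x b : ℕ) :
    pentSum q c0 c1 c2 c3 c4 N a j x b = pentSum q c3 c4 c2 c0 c1 N x b a j := by
  refine Finset.sum_congr rfl fun y _ => ?_
  rw [pR_symm h.hq c4 c2 c1, pentW, pentW, mul_comm c3 c0]
  ring

/-- The first coefficient in `pentSum_succ`. -/
def pentU (q C03 c2 c4 M X : ℂ) : ℂ :=
  (c4 * c2 * q * X - 1) * (1 - q * c2 * X) * (1 - X / M) * (1 - C03 * q * M / X) /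
    ((1 - q * c2) * (c4 * c2 * q * X ^ 2 - 1) * (1 - C03 * q * M) * (1 - M⁻¹))

/-- The second coefficient in `pentSum_succ`. -/
def pentV (q c0 c1 c2 c3 c4 M X : ℂ) : ℂ :=
  (X - 1) * (c4 * c2 * q * X - q * c2) * (1 - c0 * c3 * c1 * q ^ 2 * M / X) *
      (1 - X / (c1 * q * M)) /
    ((1 - q * c2) * (c4 * c2 * q * X ^ 2 - 1) * (1 - c0 * c3 * q * M) * (1 - M⁻¹))

set_option maxHeartbeats 1000000 in
theorem pentW_raiseU (h : Gen5 q c0 c1 c2 c3 c4 (N + 1)) (A : ℂ) {x y : ℕ} (hx : x ≤ N)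
    (hy : y ≤ N) :
    raiseU q (c4 * c2) (q * c2) (c4 * c2 * c1 * q ^ 2 * (q ^ (N + 1) / q ^ y))
        (q ^ (N + 1) / q ^ y)⁻¹ (q ^ x) *
      pentW q c0 c1 c2 c3 c4 (q ^ (N + 1)) (A * q) (q ^ x) y =
    pentU q (c0 * c3) c2 c4 (q ^ (N + 1)) (q ^ x) *
      pentW q c0 (q * c1) (q * c2) c3 c4 (q ^ N) A (q ^ x) y := by
  obtain ⟨n0, n1, n2, n3, n4⟩ := h.prod_ne
  have hq := h.hq
  obtain ⟨M, hM⟩ : ∃ M, M = q ^ (N + 1) := ⟨_, rfl⟩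
  have hM' : q ^ N = M / q := by rw [hM, pow_succ]; field_simp
  have hM0 : M ≠ 0 := hM ▸ pow_ne_zero _ hq
  have hX := pow_ne_zero x hq
  have hY := pow_ne_zero y hq
  have k1 : 1 - q ^ x / M ≠ 0 := by
    rw [div_eq_inv_mul, hM]; exact one_sub_inv_pow hq h.hqn (by omega)
  have k2 : ∀ l : ℕ, 1 - c0 * c3 * q / (q ^ x / M) * q ^ l ≠ 0 := fun l =>
    h.A03.ne ((N + 2 + l : ℕ) - (x : ℤ)) (by
      rw [zpow_sub₀ hq, zpow_natCast, zpow_natCast, hM]; field_simp; ring)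
  have k3 : ∀ l : ℕ, 1 - c0 * c3 * q * M * q ^ l ≠ 0 := fun l =>
    h.A03.ne (N + 2 + l : ℕ) (by rw [zpow_natCast, hM]; ring)
  have k3' : c0 * c3 * q / (c0 * c3 * q * M) = M⁻¹ := by field_simp
  have k4 : ∀ l ≤ y, 1 - c0 * c3 * q / (c0 * c3 * q * M) * q ^ l ≠ 0 := fun l hl => by
    rw [k3', hM]; exact one_sub_inv_pow hq h.hqn (by omega)
  have k5 : 1 - c0 * c3 * q * M ≠ 0 := by simpa using k3 0
  have g1 : q ^ x / (M / q) = q * (q ^ x / M) := by field_simp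
  have g2 : A / (M / q) = A * q / M := by field_simp
  have g3 : c0 * c3 * (q * c1) * q ^ 2 * (M / q) = c0 * c3 * c1 * q ^ 2 * M := by field_simp
  have g4 : c0 * c3 * c4 * q ^ 2 * (M / q) / A = c0 * c3 * c4 * q ^ 2 * M / (A * q) := by
    rw [mul_div_assoc', div_div, mul_comm q A]
  have g5 : c0 * c3 * q ^ 2 * (M / q) = c0 * c3 * q * M := by field_simp
  have g6 : q * c2 * q * (M / q) = c2 * q * M := by field_simp
  have g7 : c0 * c3 * q ^ 2 * M = q * (c0 * c3 * q * M) := by ring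
  rw [hM', ← hM, pentW, pentW, g1, g2, g3, g4, g5, g6, g7,
    pr_shift hq k1 (by simpa using k2 0) (fun l _ => k2 l),
    pr_shift (b := c0 * c3 * q * M) hq k5 (by simpa using k4 0 (Nat.zero_le _)) k4, k3']
  have e2 : c4 * c2 * c1 * q ^ 2 * (M / q ^ y) = (c0 * c3 * q * M * q ^ y)⁻¹ := by
    refine eq_inv_of_mul_eq_one_left ?_
    have := h.constr
    rw [hM]
    field_simp
    linear_combination this
  have e3 : (M / q ^ y)⁻¹ = M⁻¹ * q ^ y := by rw [inv_div, div_eq_inv_mul]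
  have k6 : 1 - M⁻¹ * q ^ y ≠ 0 := by rw [hM]; exact one_sub_inv_pow hq h.hqn (by omega)
  have e5 : 1 - (c0 * c3 * q * M * q ^ y)⁻¹ =
      - (1 - c0 * c3 * q * M * q ^ y) / (c0 * c3 * q * M * q ^ y) := by field_simp; ring
  have e6 : 1 - (c0 * c3 * q * M * q ^ y)⁻¹ * q ^ x =
      - (1 - c0 * c3 * q / (q ^ x / M) * q ^ y) * q ^ x / (c0 * c3 * q * M * q ^ y) := by
    field_simp; ring
  have e7 : c0 * c3 * q / (q ^ x / M) = c0 * c3 * q * M / q ^ x := by field_simp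
  have e8 : 1 - M⁻¹ * q ^ y * q ^ x = 1 - q ^ x / M * q ^ y := by ring
  have k0 : 1 - q * c2 ≠ 0 := h.A2.ne 1 (by simp)
  have k24 : c4 * c2 * q * (q ^ x) ^ 2 - 1 ≠ 0 := by
    rw [← neg_ne_zero, neg_sub]
    exact h.A24.ne (1 + 2 * x : ℕ) (by rw [zpow_natCast]; ring)
  rw [e2, e3, raiseU, pentU, e5, e6, e8]
  have k7 := k3 y
  have k8 := k2 y
  have k9 := k2 0
  rw [pow_zero, mul_one] at k9
  have k10 : 1 - M⁻¹ ≠ 0 := by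
    have := k4 0 (Nat.zero_le _)
    rwa [k3', pow_zero, mul_one] at this
  rw [e7] at k8 k9 ⊢
  clear e2 e3 e5 e6 e7 e8 k2 k3 k3' k4 g1 g2 g3 g4 g5 g6 g7 hM hM' h
  generalize vwp q (c0 * c3) y = V
  generalize pr q (c0 * c3) (q ^ x / M) y = P1
  generalize pr q (c0 * c3) (A * q / M) y = P2
  generalize pr q (c0 * c3) (c0 * c3 * c1 * q ^ 2 * M / q ^ x) y = P3
  generalize pr q (c0 * c3) (c0 * c3 * c4 * q ^ 2 * M / (A * q)) y = P4
  generalize pr q (c0 * c3) (c0 * c3 * q * M) y = P5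
  generalize (c2 * q * M) ^ y = P6
  generalize 1 - q ^ x / M * q ^ y = W1 at *
  generalize 1 - c0 * c3 * q * M / q ^ x * q ^ y = W2 at *
  generalize 1 - c0 * c3 * q * M / q ^ x = W3 at *
  generalize 1 - c0 * c3 * q * M * q ^ y = W4 at *
  generalize 1 - c0 * c3 * q * M = W5 at *
  generalize 1 - q ^ x / M = W6 at *
  generalize 1 - M⁻¹ * q ^ y = W7 at *
  generalize 1 - M⁻¹ = W8 at *
  generalize 1 - q * c2 = W9 at *
  generalize 1 - q * c2 * q ^ x = V1
  generalize c4 * c2 * q * (q ^ x) ^ 2 - 1 = V2 at *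
  generalize c4 * c2 * q * q ^ x - 1 = V3
  field_simp

set_option maxHeartbeats 1000000 in
theorem pentW_raiseV (h : Gen5 q c0 c1 c2 c3 c4 (N + 1)) (A : ℂ) (x : ℕ) {y : ℕ} (hy : y ≤ N) :
    raiseV q (c4 * c2) (q * c2) (c4 * c2 * c1 * q ^ 2 * (q ^ (N + 1) / q ^ y))
        (q ^ (N + 1) / q ^ y)⁻¹ (q ^ x) *
      pentW q c0 c1 c2 c3 c4 (q ^ (N + 1)) (A * q) (q ^ x) y =
    pentV q c0 c1 c2 c3 c4 (q ^ (N + 1)) (q ^ x) *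
      pentW q c0 (q * c1) (q * c2) c3 c4 (q ^ N) A (q ^ x / q) y := by
  obtain ⟨n0, n1, n2, n3, n4⟩ := h.prod_ne
  have hq := h.hq
  obtain ⟨M, hM⟩ : ∃ M, M = q ^ (N + 1) := ⟨_, rfl⟩
  have hM' : q ^ N = M / q := by rw [hM, pow_succ]; field_simp
  have hM0 : M ≠ 0 := hM ▸ pow_ne_zero _ hq
  have hX := pow_ne_zero x hq
  have hY := pow_ne_zero y hq
  have k1 : 1 - c0 * c3 * c1 * q ^ 2 * M / q ^ x ≠ 0 :=
    h.gen031.A123.ne ((N + 3 : ℕ) - (x : ℤ)) (by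
      rw [zpow_sub₀ hq, zpow_natCast, zpow_natCast, hM]; field_simp; ring)
  have g8 : c0 * c3 * q / (c0 * c3 * c1 * q ^ 2 * M / q ^ x) = q ^ x / (c1 * q * M) := by
    field_simp
  have k2 : ∀ l : ℕ, 1 - q ^ x / (c1 * q * M) * q ^ l ≠ 0 := fun l =>
    h.A1.inv hq 0 (b := c1⁻¹) (by simp) |>.ne ((l + x : ℕ) - ((N + 2 : ℕ) : ℤ)) (by
      rw [zpow_sub₀ hq, zpow_natCast, zpow_natCast, hM]; field_simp; ring)
  have k3 : ∀ l : ℕ, 1 - c0 * c3 * q * M * q ^ l ≠ 0 := fun l =>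
    h.A03.ne (N + 2 + l : ℕ) (by rw [zpow_natCast, hM]; ring)
  have k3' : c0 * c3 * q / (c0 * c3 * q * M) = M⁻¹ := by field_simp
  have k4 : ∀ l ≤ y, 1 - c0 * c3 * q / (c0 * c3 * q * M) * q ^ l ≠ 0 := fun l hl => by
    rw [k3', hM]; exact one_sub_inv_pow hq h.hqn (by omega)
  have k5 : 1 - c0 * c3 * q * M ≠ 0 := by simpa using k3 0
  have g1 : q ^ x / q / (M / q) = q ^ x / M := by field_simp
  have g2 : A / (M / q) = A * q / M := by field_simp
  have g3 : c0 * c3 * (q * c1) * q ^ 2 * (M / q) / (q ^ x / q) =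
      q * (c0 * c3 * c1 * q ^ 2 * M / q ^ x) := by field_simp
  have g4 : c0 * c3 * c4 * q ^ 2 * (M / q) / A = c0 * c3 * c4 * q ^ 2 * M / (A * q) := by
    rw [mul_div_assoc', div_div, mul_comm q A]
  have g5 : c0 * c3 * q ^ 2 * (M / q) = c0 * c3 * q * M := by field_simp
  have g6 : q * c2 * q * (M / q) = c2 * q * M := by field_simp
  have g7 : c0 * c3 * q ^ 2 * M = q * (c0 * c3 * q * M) := by ring
  rw [hM', ← hM, pentW, pentW, g1, g2, g3, g4, g5, g6, g7,
    pr_shift (b := c0 * c3 * c1 * q ^ 2 * M / q ^ x) hq k1 (by rw [g8]; simpa using k2 0)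
      (fun l _ => by rw [g8]; exact k2 l),
    pr_shift (b := c0 * c3 * q * M) hq k5 (by simpa using k4 0 (Nat.zero_le _)) k4, k3', g8]
  have hC := h.constr
  have hMM : q ^ (2 * (N + 1) + 3) = q ^ 3 * M ^ 2 := by rw [hM]; ring
  rw [hMM] at hC
  have e2 : c4 * c2 * c1 * q ^ 2 * (M / q ^ y) = (c0 * c3 * q * M * q ^ y)⁻¹ := by
    refine eq_inv_of_mul_eq_one_left ?_
    field_simp
    linear_combination hC
  have e3 : (M / q ^ y)⁻¹ = M⁻¹ * q ^ y := by rw [inv_div, div_eq_inv_mul]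
  have k6 : 1 - M⁻¹ * q ^ y ≠ 0 := by rw [hM]; exact one_sub_inv_pow hq h.hqn (by omega)
  have e5 : 1 - (c0 * c3 * q * M * q ^ y)⁻¹ =
      - (1 - c0 * c3 * q * M * q ^ y) / (c0 * c3 * q * M * q ^ y) := by field_simp; ring
  have e6 : c4 * c2 * q * q ^ x - (c0 * c3 * q * M * q ^ y)⁻¹ =
      - (1 - q ^ x / (c1 * q * M) * q ^ y) / (c0 * c3 * q * M * q ^ y) := by
    field_simp
    linear_combination q ^ x * q ^ y * hC
  have e7 : c4 * c2 * q * q ^ x - M⁻¹ * q ^ y =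
      c4 * c2 * q * q ^ x * (1 - c0 * c3 * c1 * q ^ 2 * M / q ^ x * q ^ y) := by
    field_simp
    linear_combination q ^ y * hC
  have k0 : 1 - q * c2 ≠ 0 := h.A2.ne 1 (by simp)
  have k24 : c4 * c2 * q * (q ^ x) ^ 2 - 1 ≠ 0 := by
    rw [← neg_ne_zero, neg_sub]
    exact h.A24.ne (1 + 2 * x : ℕ) (by rw [zpow_natCast]; ring)
  rw [e2, e3, raiseV, pentV, e5, e6, e7]
  have k7 := k3 y
  have k8 := k2 y
  have k9 := k2 0
  rw [pow_zero, mul_one] at k9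
  have k10 : 1 - M⁻¹ ≠ 0 := by
    have := k4 0 (Nat.zero_le _)
    rwa [k3', pow_zero, mul_one] at this
  clear e2 e3 e5 e6 e7 hMM hC k2 k3 k3' k4 g1 g2 g3 g4 g5 g6 g7 g8 hM hM' h
  generalize vwp q (c0 * c3) y = V
  generalize pr q (c0 * c3) (q ^ x / M) y = P1
  generalize pr q (c0 * c3) (A * q / M) y = P2
  generalize pr q (c0 * c3) (c0 * c3 * c1 * q ^ 2 * M / q ^ x) y = P3
  generalize pr q (c0 * c3) (c0 * c3 * c4 * q ^ 2 * M / (A * q)) y = P4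
  generalize pr q (c0 * c3) (c0 * c3 * q * M) y = P5
  generalize (c2 * q * M) ^ y = P6
  generalize 1 - q ^ x / (c1 * q * M) * q ^ y = W1 at *
  generalize 1 - q ^ x / (c1 * q * M) = W2 at *
  generalize 1 - c0 * c3 * c1 * q ^ 2 * M / q ^ x * q ^ y = W3 at *
  generalize 1 - c0 * c3 * c1 * q ^ 2 * M / q ^ x = W6 at *
  generalize 1 - c0 * c3 * q * M * q ^ y = W4 at *
  generalize 1 - c0 * c3 * q * M = W5 at *
  generalize 1 - M⁻¹ * q ^ y = W7 at *
  generalize 1 - M⁻¹ = W8 at *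
  generalize 1 - q * c2 = W9 at *
  generalize c4 * c2 * q * q ^ x - q * c2 = V1
  generalize c4 * c2 * q * (q ^ x) ^ 2 - 1 = V2 at *
  field_simp

end

section

variable {q c0 c1 c2 c3 c4 : ℂ} {N : ℕ}

theorem qPoch_pow_div_eq_zero (hq : q ≠ 0) {a y : ℕ} (ha : a ≤ N) (h : N < a + y) :
    qPoch (q ^ a / q ^ N) q y = 0 := by
  obtain ⟨m, rfl⟩ := Nat.exists_eq_add_of_le ha
  have : q ^ a / q ^ (a + m) = (q ^ m)⁻¹ := by
    have := pow_ne_zero a hq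
    rw [pow_add]; field_simp
  rw [this, qPoch_inv_pow_eq_zero hq (show m < y by omega)]

theorem pentW_eq_zero_left (hq : q ≠ 0) {a y : ℕ} (X : ℂ) (ha : a ≤ N) (h : N < a + y) :
    pentW q c0 c1 c2 c3 c4 (q ^ N) (q ^ a) X y = 0 := by
  rw [pentW, pr, pr, pr, pr, pr, qPoch_pow_div_eq_zero hq ha h]; simp

theorem pentW_eq_zero_right (hq : q ≠ 0) {x y : ℕ} (A : ℂ) (hx : x ≤ N) (h : N < x + y) :
    pentW q c0 c1 c2 c3 c4 (q ^ N) A (q ^ x) y = 0 := by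
  rw [pentW, pr, pr, pr, pr, pr, qPoch_pow_div_eq_zero hq hx h]; simp

theorem pentV_one (M : ℂ) : pentV q c0 c1 c2 c3 c4 M 1 = 0 := by simp [pentV]

theorem pentU_self {M : ℂ} (hM : M ≠ 0) (C03 : ℂ) : pentU q C03 c2 c4 M M = 0 := by
  simp [pentU, hM]

set_option maxHeartbeats 1000000 in
theorem pentSum_succ (h : Gen5 q c0 c1 c2 c3 c4 (N + 1)) {a x : ℕ} (j b : ℕ) (ha : a ≤ N)
    (hx : x ≤ N + 1) :
    pentSum q c0 c1 c2 c3 c4 (N + 1) (a + 1) j x b =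
      pentU q (c0 * c3) c2 c4 (q ^ (N + 1)) (q ^ x) *
        (relU q (c1 * c3) (q ^ (N + 1) / q ^ x)⁻¹ (q ^ b) *
            pentSum q c0 (q * c1) (q * c2) c3 c4 N a j x b +
          relV q (c1 * c3) (q ^ (N + 1) / q ^ x)⁻¹ (q ^ b) *
            pentSum q c0 (q * c1) (q * c2) c3 c4 N a j x (b - 1)) +
      pentV q c0 c1 c2 c3 c4 (q ^ (N + 1)) (q ^ x) *
        (relU q (c1 * c3) (c1 * c3 * c0 * q ^ 2 * (q ^ (N + 1) / q ^ x)) (q ^ b) *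
            pentSum q c0 (q * c1) (q * c2) c3 c4 N a j (x - 1) b +
          relV q (c1 * c3) (c1 * c3 * c0 * q ^ 2 * (q ^ (N + 1) / q ^ x)) (q ^ b) *
            pentSum q c0 (q * c1) (q * c2) c3 c4 N a j (x - 1) (b - 1)) := by
  obtain ⟨n0, n1, n2, n3, n4⟩ := h.prod_ne
  have hq := h.hq
  have hM : q ^ (N + 1) ≠ 0 := pow_ne_zero _ hq
  have hX : ∀ x : ℕ, q ^ x ≠ 0 := fun x => pow_ne_zero x hq
  have hb : c1 * c3 * q * (q ^ b) ^ 2 - 1 ≠ 0 := by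
    rw [← neg_ne_zero, neg_sub]
    exact h.A13.ne (1 + 2 * b : ℕ) (by rw [zpow_natCast]; ring)
  have hxx : c4 * c2 * q * (q ^ x) ^ 2 - 1 ≠ 0 := by
    rw [← neg_ne_zero, neg_sub]
    exact h.A24.ne (1 + 2 * x : ℕ) (by rw [zpow_natCast]; ring)
  rw [pentSum, Finset.sum_range_succ, pentW_eq_zero_left hq _ (by omega) (by omega)]
  simp only [pentSum, Finset.mul_sum, ← Finset.sum_add_distrib, zero_mul, add_zero]
  refine Finset.sum_congr rfl fun y hy => ?_
  have hy : y ≤ N := by simpa [Nat.lt_succ_iff] using hy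
  have d1 : q ^ (N + 1) / q ^ (a + 1) = q ^ N / q ^ a := by
    rw [pow_succ, pow_succ, mul_div_mul_right _ _ hq]
  have d2 : ∀ z : ℕ, q ^ (N + 1) / q ^ z / q = q ^ N / q ^ z := fun z => by
    rw [pow_succ, div_right_comm, mul_div_cancel_right₀ _ hq]
  rw [d1]
  rcases Nat.lt_or_ge N (a + y) with hay | hay
  · rw [pentW_eq_zero_left hq _ (by omega) (by omega), pentW_eq_zero_left hq _ (by omega) (by omega),
      pentW_eq_zero_left hq _ (by omega) (by omega)]
    simp
  have hr := pR_raise (q := q) (a1 := c4) (a2 := c2) (a3 := c1) (Z := q ^ (N + 1) / q ^ y) (n := a)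
    x hq (by positivity) (div_ne_zero hM (hX y)) hxx
    (fun k _ => h.A2.ne (k + 1 : ℕ) (by rw [zpow_natCast]; ring))
    (fun k _ => h.A03.inv hq (-(2 * (N + 1) + 3 : ℕ)) (b := c4 * c2 * c1) (by
        rw [zpow_neg, zpow_natCast, ← mul_inv]
        refine eq_inv_of_mul_eq_one_left ?_
        linear_combination h.constr) |>.ne ((k + 2 + (N + 1) : ℕ) - (y : ℤ)) (by
      rw [zpow_sub₀ hq, zpow_natCast, zpow_natCast, pow_add _ (k + 2)]
      have := hX y
      field_simp
      ring))
    (fun k hk => by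
      have := one_sub_inv_pow hq h.hqn (show y + k < N + 1 by omega)
      rwa [pow_add q y, ← mul_assoc, ← div_eq_inv_mul, ← inv_div] at this)
    (fun k _ => h.hqn k)
  rw [d2] at hr
  rw [hr]
  have t1 : raiseU q (c4 * c2) (q * c2) (c4 * c2 * c1 * q ^ 2 * (q ^ (N + 1) / q ^ y))
        (q ^ (N + 1) / q ^ y)⁻¹ (q ^ x) *
      pentW q c0 c1 c2 c3 c4 (q ^ (N + 1)) (q ^ (a + 1)) (q ^ x) y *
        pR q c0 c3 c1 (q ^ (N + 1) / q ^ x) b y =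
      pentU q (c0 * c3) c2 c4 (q ^ (N + 1)) (q ^ x) *
        pentW q c0 (q * c1) (q * c2) c3 c4 (q ^ N) (q ^ a) (q ^ x) y *
          (relU q (c1 * c3) (q ^ (N + 1) / q ^ x)⁻¹ (q ^ b) *
              pR q c0 c3 (q * c1) (q ^ N / q ^ x) b y +
            relV q (c1 * c3) (q ^ (N + 1) / q ^ x)⁻¹ (q ^ b) *
              pR q c0 c3 (q * c1) (q ^ N / q ^ x) (b - 1) y) := by
    rcases Nat.lt_or_ge N x with hx' | hx'
    · obtain rfl : x = N + 1 := by omega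
      rw [pentU_self hM]
      rcases Nat.eq_zero_or_pos y with rfl | hy0
      · have : raiseU q (c4 * c2) (q * c2) (c4 * c2 * c1 * q ^ 2 * (q ^ (N + 1) / q ^ 0))
          (q ^ (N + 1) / q ^ 0)⁻¹ (q ^ (N + 1)) = 0 := by
          simp [raiseU, hq]
        rw [this]; simp
      · rw [pentW_eq_zero_right hq _ le_rfl (by omega)]; simp
    · rw [pow_succ q a, pentW_raiseU h _ hx' hy]
      rcases Nat.lt_or_ge N (x + y) with hxy | hxy
      · rw [pentW_eq_zero_right hq _ hx' hxy]; simp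
      · congr 1
        rw [pR_symm hq c0 c3 c1, pR_rel b hq hb, d2, pR_symm hq c0 c3 (q * c1),
          pR_symm hq c0 c3 (q * c1)]
        intro k hk
        have := one_sub_inv_pow hq h.hqn (show x + k < N + 1 by omega)
        rwa [pow_add q x, ← mul_assoc, ← div_eq_inv_mul, ← inv_div] at this
  have t2 : raiseV q (c4 * c2) (q * c2) (c4 * c2 * c1 * q ^ 2 * (q ^ (N + 1) / q ^ y))
        (q ^ (N + 1) / q ^ y)⁻¹ (q ^ x) *
      pentW q c0 c1 c2 c3 c4 (q ^ (N + 1)) (q ^ (a + 1)) (q ^ x) y *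
        pR q c0 c3 c1 (q ^ (N + 1) / q ^ x) b y =
      pentV q c0 c1 c2 c3 c4 (q ^ (N + 1)) (q ^ x) *
        (pentW q c0 (q * c1) (q * c2) c3 c4 (q ^ N) (q ^ a) (q ^ (x - 1)) y *
          (relU q (c1 * c3) (c1 * c3 * c0 * q ^ 2 * (q ^ (N + 1) / q ^ x)) (q ^ b) *
              pR q c0 c3 (q * c1) (q ^ N / q ^ (x - 1)) b y +
            relV q (c1 * c3) (c1 * c3 * c0 * q ^ 2 * (q ^ (N + 1) / q ^ x)) (q ^ b) *
              pR q c0 c3 (q * c1) (q ^ N / q ^ (x - 1)) (b - 1) y)) := by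
    rw [pow_succ q a, pentW_raiseV h _ x hy]
    cases x with
    | zero => simp [pentV_one]
    | succ x =>
      rw [mul_assoc]
      congr 2
      · rw [pow_succ q x, mul_div_cancel_right₀ _ hq, Nat.add_sub_cancel]
      · have d3 : q ^ N / q ^ (x + 1 - 1) = q ^ (N + 1) / q ^ (x + 1) := by
          rw [pow_succ, pow_succ, mul_div_mul_right _ _ hq, Nat.add_sub_cancel]
        rw [d3, pR_symm hq c0 c3 c1, pR_rel' b hq hb, pR_symm hq c0 c3 (q * c1),
          pR_symm hq c0 c3 (q * c1)]
        intro k _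
        exact h.gen031.A123.ne ((k + 2 + (N + 1) : ℕ) - ((x + 1 : ℕ) : ℤ)) (by
          rw [zpow_sub₀ hq, zpow_natCast, zpow_natCast, pow_add _ (k + 2)]
          have := hX (x + 1)
          field_simp
          ring)
  linear_combination pR q c3 c0 c4 (q ^ N / q ^ a) j y *
    (pR q c4 (q * c2) (q * c1) (q ^ N / q ^ y) a x * t1 +
      pR q c4 (q * c2) (q * c1) (q ^ N / q ^ y) a (x - 1) * t2)

end

/-- The factor of the pentagon relation that depends on the index `a` only. -/
def pentF (q c0 c1 c2 c3 c4 M : ℂ) (a : ℕ) : ℂ :=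
  qPoch (q * c1) q a * qPoch (c4 * M)⁻¹ q a /
    (qPoch (q * c2) q a * qPoch (c0 * c3 * q * M)⁻¹ q a * (c0 * c1 * c3 * q ^ 2 * M) ^ a)

theorem pentF_zero (q c0 c1 c2 c3 c4 M : ℂ) : pentF q c0 c1 c2 c3 c4 M 0 = 1 := by
  simp [pentF, qPoch_zero]

theorem pentF_succ {q M : ℂ} (hq : q ≠ 0) (c0 c1 c2 c3 c4 : ℂ) (a : ℕ) :
    pentF q c0 c1 c2 c3 c4 M (a + 1) =
      (1 - q * c1) * (1 - (c4 * M)⁻¹) /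
        ((1 - q * c2) * (1 - (c0 * c3 * q * M)⁻¹) * (c0 * c1 * c3 * q ^ 2 * M)) *
      pentF q c0 (q * c1) (q * c2) c3 c4 (M / q) a := by
  have e1 : (c4 * (M / q))⁻¹ = q * (c4 * M)⁻¹ := by rw [mul_div_assoc', inv_div, div_eq_mul_inv]
  have e2 : (c0 * c3 * q * (M / q))⁻¹ = q * (c0 * c3 * q * M)⁻¹ := by
    rw [mul_div_assoc', inv_div, div_eq_mul_inv]
  have e3 : c0 * (q * c1) * c3 * q ^ 2 * (M / q) = c0 * c1 * c3 * q ^ 2 * M := by field_simp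
  rw [pentF, pentF, e1, e2, e3]
  simp only [qPoch_succ', pow_succ, div_eq_mul_inv, mul_inv]
  ring

theorem pentF_swap_shift {q c0 c1 c2 c3 c4 M : ℂ} {x : ℕ} (hq : q ≠ 0)
    (h2 : ∀ k : ℕ, 1 - q * c2 * q ^ k ≠ 0) (h3 : ∀ k : ℕ, 1 - (c0 * c3 * q * M)⁻¹ * q ^ k ≠ 0) :
    pentF q c3 c4 c2 c0 c1 M x =
      (1 - q * c2 * q ^ x) * (1 - (c0 * c3 * q * M)⁻¹ * q ^ x) /
        ((1 - q * c2) * (1 - (c0 * c3 * q * M)⁻¹) * q ^ x) *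
      pentF q c3 c4 (q * c2) c0 (q * c1) (M / q) x := by
  have e1 : q * c1 * (M / q) = c1 * M := by field_simp
  have e2 : (c3 * c0 * q * (M / q))⁻¹ = q * (c0 * c3 * q * M)⁻¹ := by
    rw [mul_div_assoc', inv_div, div_eq_mul_inv, mul_comm c3 c0]
  have e3 : c3 * c4 * c0 * q ^ 2 * (M / q) = c3 * c4 * c0 * q ^ 2 * M / q := by ring
  have f2 : qPoch (q * (q * c2)) q x = qPoch (q * c2) q x * (1 - q * c2 * q ^ x) / (1 - q * c2) := by
    rw [eq_div_iff (by simpa using h2 0), ← qPoch_shift]; ring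
  have f3 : qPoch (q * (c0 * c3 * q * M)⁻¹) q x = qPoch (c0 * c3 * q * M)⁻¹ q x *
      (1 - (c0 * c3 * q * M)⁻¹ * q ^ x) / (1 - (c0 * c3 * q * M)⁻¹) := by
    rw [eq_div_iff (by simpa using h3 0), ← qPoch_shift]; ring
  rw [pentF, pentF, e1, e2, e3, f2, f3, div_pow, mul_comm c3 c0]
  have g2 := h2 x
  have g3 := h3 x
  have g2' := h2 0
  have g3' := h3 0
  rw [pow_zero, mul_one] at g2' g3'
  have hX := pow_ne_zero x hq
  clear h2 h3 e1 e2 e3 f2 f3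
  generalize qPoch (q * c4) q x = P1
  generalize qPoch (c1 * M)⁻¹ q x = P2
  generalize qPoch (q * c2) q x = P3
  generalize qPoch (c0 * c3 * q * M)⁻¹ q x = P4
  generalize (c0 * c4 * c3 * q ^ 2 * M) ^ x = P5
  generalize (c0 * c3 * q * M)⁻¹ = Z at *
  generalize (c3 * c4 * c0 * q ^ 2 * M) ^ x = P6
  generalize 1 - q * c2 * q ^ x = W1 at *
  generalize 1 - q * c2 = W2 at *
  generalize 1 - Z * q ^ x = W3 at *
  generalize 1 - Z = W4 at *
  field_simp

theorem pentF_swap_succ {q c0 c1 c2 c3 c4 M : ℂ} (hq : q ≠ 0) (x : ℕ) :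
    pentF q c3 c4 c2 c0 c1 M (x + 1) =
      (1 - q * c4 * q ^ x) * (1 - (c1 * M)⁻¹ * q ^ x) /
        ((1 - q * c2) * (1 - (c0 * c3 * q * M)⁻¹) * (c3 * c4 * c0 * q ^ 2 * M) * q ^ x) *
      pentF q c3 c4 (q * c2) c0 (q * c1) (M / q) x := by
  have e1 : q * c1 * (M / q) = c1 * M := by field_simp
  have e2 : (c3 * c0 * q * (M / q))⁻¹ = q * (c0 * c3 * q * M)⁻¹ := by
    rw [mul_div_assoc', inv_div, div_eq_mul_inv, mul_comm c3 c0]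
  have e3 : c3 * c4 * c0 * q ^ 2 * (M / q) = c3 * c4 * c0 * q ^ 2 * M / q := by ring
  have hX := pow_ne_zero x hq
  rw [pentF, pentF, e1, e2, e3, div_pow, mul_comm c3 c0, qPoch_succ (q * c4),
    qPoch_succ (c1 * M)⁻¹, qPoch_succ' (q * c2), qPoch_succ' (c0 * c3 * q * M)⁻¹,
    pow_succ (c3 * c4 * c0 * q ^ 2 * M)]
  generalize (c0 * c3 * q * M)⁻¹ = Z
  generalize qPoch (q * (q * c2)) q x = P3
  generalize qPoch (q * Z) q x = P4
  generalize qPoch (q * c4) q x = P1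
  generalize qPoch (c1 * M)⁻¹ q x = P2
  generalize c3 * c4 * c0 * q ^ 2 * M = T
  generalize T ^ x = T'
  generalize 1 - q * c4 * q ^ x = W1
  generalize 1 - (c1 * M)⁻¹ * q ^ x = W2
  generalize 1 - q * c2 = W3
  generalize 1 - Z = W4
  field_simp

theorem pentG_succ12 {q c0 c1 c2 c3 c4 : ℂ} (hq : q ≠ 0) {N j : ℕ} (hj : j ≤ N) :
    pentG q c0 c1 c2 c3 c4 (N + 1) j =
      (1 - c0 * c3 * q * q ^ (N + 1)) * (1 - q * c2) /
        ((1 - (c4 * q ^ (N + 1))⁻¹) * (1 - (q * c1)⁻¹)) *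
      pentG q c0 (q * c1) (q * c2) c3 c4 N j := by
  have s1 : N + 1 - j = (N - j) + 1 := by omega
  have e1 : c1 * c3 * q * q ^ (N + 1) = q * c1 * c3 * q * q ^ N := by ring
  have e2 : q * (c4 * q ^ (N + 1))⁻¹ = (c4 * q ^ N)⁻¹ := by rw [pow_succ]; field_simp
  have e3 : c1 * q ^ (N + 1) = q * c1 * q ^ N := by ring
  have e4 : (q * c1 * q ^ N)⁻¹ * q ^ N = (q * c1)⁻¹ := by
    have := pow_ne_zero N hq
    field_simp
  have e5 : c0 * c3 * q ^ 2 * q ^ N = c0 * c3 * q * q ^ (N + 1) := by ring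
  rw [pentG, pentG, s1, qPoch_succ' (q * c2), qPoch_succ' (c4 * q ^ (N + 1))⁻¹, e2, qPoch_succ,
    qPoch_succ (c1 * q ^ (N + 1))⁻¹, e3, e4, e1, e5]
  simp only [div_eq_mul_inv, mul_inv]
  ring

theorem pentK_shift12 {q c1 c2 c3 M J : ℂ} {b : ℕ} (hq : q ≠ 0)
    (h1 : ∀ k ≤ b, 1 - q * c1 * q ^ k ≠ 0) (h2 : ∀ k ≤ b, 1 - M⁻¹ * q ^ k ≠ 0)
    (h3 : ∀ k ≤ b, 1 - J / M * q ^ k ≠ 0)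
    (h4 : ∀ k ≤ b, 1 - c1 * c2 * c3 * q ^ 2 * M / J * q ^ k ≠ 0) :
    pentK q c1 c2 c3 M J b =
      (1 - q * c1) * (1 - M⁻¹ * q ^ b) * q ^ b / ((1 - q * c1 * q ^ b) * (1 - M⁻¹)) *
      ((1 - J / M) * (1 - c1 * c2 * c3 * q ^ 2 * M / J) /
        ((1 - J / M * q ^ b) * (1 - c1 * c2 * c3 * q ^ 2 * M / J * q ^ b))) *
      pentK q (q * c1) (q * c2) c3 (M / q) J b := by
  have e1 : q * c1 * c3 * q ^ 2 * (M / q) = c1 * c3 * q ^ 2 * M := by field_simp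
  have e2 : (M / q)⁻¹ = q * M⁻¹ := by rw [inv_div]; ring
  have e3 : q * c1 * (q * c2) * q * (M / q) = c1 * c2 * q * M * q := by field_simp
  have e4 : J / (M / q) = q * (J / M) := by field_simp
  have e5 : q * c1 * (q * c2) * c3 * q ^ 2 * (M / q) / J = q * (c1 * c2 * c3 * q ^ 2 * M / J) := by
    field_simp
  have e7 : q * c2 * (M / q) = c2 * M := by field_simp
  have sh : ∀ z : ℂ, (∀ k ≤ b, 1 - z * q ^ k ≠ 0) →
      qPoch (q * z) q b = qPoch z q b * ((1 - z * q ^ b) / (1 - z)) := fun z hz => by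
    have : 1 - z ≠ 0 := by simpa using hz 0 (Nat.zero_le _)
    rw [mul_div_assoc', eq_div_iff this, ← qPoch_shift]; ring
  rw [pentK, pentK, e1, e2, e3, e4, e5, e7, sh _ h1, sh _ h2, sh _ h3, sh _ h4, mul_pow _ q b]
  have f1 := h1 b le_rfl
  have f2 := h2 b le_rfl
  have f3 := h3 b le_rfl
  have f4 := h4 b le_rfl
  have g1 := h1 0 (Nat.zero_le _)
  have g2 := h2 0 (Nat.zero_le _)
  have g3 := h3 0 (Nat.zero_le _)
  have g4 := h4 0 (Nat.zero_le _)
  rw [pow_zero, mul_one] at g1 g2 g3 g4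
  have hB := pow_ne_zero b hq
  clear h1 h2 h3 h4 sh e1 e2 e3 e4 e5 e7
  generalize c1 * c2 * c3 * q ^ 2 * M / J = z4 at *
  generalize c1 * c3 * q ^ 2 * M / J = z5
  generalize J / (c2 * M) = z6
  generalize J / M = z3 at *
  generalize M⁻¹ = z2 at *
  generalize (c1 * c2 * q * M) ^ b = z7
  generalize qPoch (c1 * c3 * q ^ 2 * M) q b = Q1
  generalize qPoch z4 q b = Q2
  generalize qPoch z3 q b = Q3
  generalize qPoch z2 q b = Q4
  generalize qPoch z5 q b = Q5
  generalize qPoch z6 q b = Q6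
  generalize qPoch (q * c1) q b = Q7
  generalize qPoch (q * c3) q b = Q8
  generalize 1 - z4 * q ^ b = W1 at *
  generalize 1 - z4 = W2 at *
  generalize 1 - z3 * q ^ b = W3 at *
  generalize 1 - z3 = W4 at *
  generalize 1 - z2 * q ^ b = W5 at *
  generalize 1 - z2 = W6 at *
  generalize 1 - q * c1 * q ^ b = W7 at *
  generalize 1 - q * c1 = W8 at *
  field_simp

theorem pentK_succ12 {q c1 c2 c3 M J : ℂ} (hq : q ≠ 0) (b : ℕ) :
    pentK q c1 c2 c3 M J (b + 1) =
      (1 - q * c1) * (1 - c1 * c3 * q ^ 2 * M * q ^ b) * q ^ b /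
        ((1 - q * c3 * q ^ b) * (1 - M⁻¹) * (c1 * c2 * q * M)) *
      ((1 - J / M) * (1 - c1 * c2 * c3 * q ^ 2 * M / J) /
        ((1 - c1 * c3 * q ^ 2 * M / J * q ^ b) * (1 - J / (c2 * M) * q ^ b))) *
      pentK q (q * c1) (q * c2) c3 (M / q) J b := by
  have e1 : q * c1 * c3 * q ^ 2 * (M / q) = c1 * c3 * q ^ 2 * M := by field_simp
  have e2 : (M / q)⁻¹ = q * M⁻¹ := by rw [inv_div]; ring
  have e3 : q * c1 * (q * c2) * q * (M / q) = c1 * c2 * q * M * q := by field_simp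
  have e4 : J / (M / q) = q * (J / M) := by field_simp
  have e5 : q * c1 * (q * c2) * c3 * q ^ 2 * (M / q) / J = q * (c1 * c2 * c3 * q ^ 2 * M / J) := by
    field_simp
  have e7 : q * c2 * (M / q) = c2 * M := by field_simp
  rw [pentK, pentK, e1, e2, e3, e4, e5, e7, qPoch_succ' (q * c1), qPoch_succ' M⁻¹,
    qPoch_succ' (J / M), qPoch_succ' (c1 * c2 * c3 * q ^ 2 * M / J), qPoch_succ, qPoch_succ,
    qPoch_succ, qPoch_succ, mul_pow _ q b, pow_succ (c1 * c2 * q * M)]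
  have hB := pow_ne_zero b hq
  clear e1 e2 e3 e4 e5 e7
  generalize c1 * c2 * c3 * q ^ 2 * M / J = z4
  generalize c1 * c3 * q ^ 2 * M / J = z5
  generalize J / (c2 * M) = z6
  generalize J / M = z3
  generalize M⁻¹ = z2
  generalize (c1 * c2 * q * M) ^ b = z7
  generalize qPoch (c1 * c3 * q ^ 2 * M) q b = Q1
  generalize qPoch (q * z4) q b = Q2
  generalize qPoch (q * z3) q b = Q3
  generalize qPoch (q * z2) q b = Q4
  generalize qPoch z5 q b = Q5
  generalize qPoch z6 q b = Q6
  generalize qPoch (q * (q * c1)) q b = Q7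
  generalize qPoch (q * c3) q b = Q8
  generalize 1 - z4 = W2
  generalize 1 - z3 = W4
  generalize 1 - z2 = W6
  generalize 1 - q * c1 = W8
  generalize 1 - q * c3 * q ^ b = W1
  generalize 1 - z5 * q ^ b = W3
  generalize 1 - z6 * q ^ b = W5
  generalize 1 - c1 * c3 * q ^ 2 * M * q ^ b = W7
  have (u : ℂ) : u = u * (q ^ b * (q ^ b)⁻¹) := by rw [mul_inv_cancel₀ hB, mul_one]
  rw [this (_ / _ * _)]
  ring

section

variable {q c0 c1 c2 c3 c4 : ℂ} {N : ℕ}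

theorem pentF_mul_pentG (h : Gen5 q c0 c1 c2 c3 c4 (N + 1)) (a : ℕ) {j : ℕ} (hj : j ≤ N) :
    pentF q c0 c1 c2 c3 c4 (q ^ (N + 1)) (a + 1) * pentG q c0 c1 c2 c3 c4 (N + 1) j =
      pentF q c0 (q * c1) (q * c2) c3 c4 (q ^ N) a * pentG q c0 (q * c1) (q * c2) c3 c4 N j := by
  obtain ⟨n0, n1, n2, n3, n4⟩ := h.prod_ne
  have hq := h.hq
  have hM' : q ^ (N + 1) / q = q ^ N := by rw [pow_succ]; field_simp
  have y1 : 1 - q * c1 ≠ 0 := h.A1.ne 1 (by simp)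
  have y2 : 1 - q * c2 ≠ 0 := h.A2.ne 1 (by simp)
  have y3 : 1 - c0 * c3 * q * q ^ (N + 1) ≠ 0 :=
    h.A03.ne (N + 2 : ℕ) (by rw [zpow_natCast]; ring)
  have y4 : 1 - (c4 * q ^ (N + 1))⁻¹ ≠ 0 :=
    h.A4.inv hq 0 (b := c4⁻¹) (by simp) |>.ne (-(N + 1 : ℕ)) (by
      rw [zpow_neg, zpow_natCast, mul_inv, mul_comm])
  rw [pentF_succ hq, pentG_succ12 hq hj, hM']
  have hM := pow_ne_zero (N + 1) hq
  have x1 : 1 - (c0 * c3 * q * q ^ (N + 1))⁻¹ =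
      - (1 - c0 * c3 * q * q ^ (N + 1)) / (c0 * c3 * q * q ^ (N + 1)) := by field_simp; ring
  have x2 : 1 - (q * c1)⁻¹ = - (1 - q * c1) / (q * c1) := by field_simp; ring
  rw [x1, x2]
  clear x1 x2
  generalize q ^ (N + 1) = M at *
  generalize pentF q c0 (q * c1) (q * c2) c3 c4 (q ^ N) a = F
  generalize pentG q c0 (q * c1) (q * c2) c3 c4 N j = G
  generalize 1 - c0 * c3 * q * M = W1 at *
  generalize 1 - q * c1 = W2 at *
  generalize 1 - q * c2 = W3 at *
  generalize 1 - (c4 * M)⁻¹ = W4 at *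
  field_simp

theorem pentK_mul_raiseU (h : Gen5 q c0 c1 c2 c3 c4 (N + 1)) {j b : ℕ} (hb : j + b ≤ N) :
    pentK q c1 c2 c3 (q ^ (N + 1)) (q ^ j) b *
      raiseU q (c3 * c1) (q * c1) (c3 * c1 * c2 * q ^ 2 * (q ^ (N + 1) / q ^ j))
        (q ^ (N + 1) / q ^ j)⁻¹ (q ^ b) =
      (1 - (q ^ (N + 1))⁻¹ * q ^ b) * (c1 * c3 * q * q ^ b - 1) /
        ((1 - (q ^ (N + 1))⁻¹) * (c1 * c3 * q * (q ^ b) ^ 2 - 1)) *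
      pentK q (q * c1) (q * c2) c3 (q ^ N) (q ^ j) b := by
  obtain ⟨n0, n1, n2, n3, n4⟩ := h.prod_ne
  have hq := h.hq
  have hM' : q ^ (N + 1) / q = q ^ N := by rw [pow_succ]; field_simp
  have hM := pow_ne_zero (N + 1) hq
  have hJ := pow_ne_zero j hq
  have hB := pow_ne_zero b hq
  have y1 : ∀ k : ℕ, 1 - q * c1 * q ^ k ≠ 0 := fun k =>
    h.A1.ne (k + 1 : ℕ) (by rw [zpow_natCast]; ring)
  have y2 : ∀ k ≤ b, 1 - (q ^ (N + 1))⁻¹ * q ^ k ≠ 0 := fun k hk =>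
    one_sub_inv_pow hq h.hqn (by omega)
  have y3 : ∀ k ≤ b, 1 - q ^ j / q ^ (N + 1) * q ^ k ≠ 0 := fun k hk => by
    have := one_sub_inv_pow hq h.hqn (show j + k < N + 1 by omega)
    rwa [pow_add q j, ← mul_assoc, ← div_eq_inv_mul] at this
  have y4 : ∀ k ≤ b, 1 - c1 * c2 * c3 * q ^ 2 * q ^ (N + 1) / q ^ j * q ^ k ≠ 0 := fun k _ =>
    h.gen3.A123.ne ((k + 2 + (N + 1) : ℕ) - (j : ℤ)) (by
      rw [zpow_sub₀ hq, zpow_natCast, zpow_natCast, pow_add _ (k + 2)]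
      field_simp
      ring)
  have z1 := y1 0
  have z2 := y2 0 (Nat.zero_le _)
  have z3 := y3 0 (Nat.zero_le _)
  have z4 := y4 0 (Nat.zero_le _)
  have w1 := y1 b
  have w3 := y3 b le_rfl
  have w4 := y4 b le_rfl
  rw [pow_zero, mul_one] at z1 z2 z3 z4
  have y5 : c1 * c3 * q * (q ^ b) ^ 2 - 1 ≠ 0 := by
    rw [← neg_ne_zero, neg_sub]
    exact h.A13.ne (1 + 2 * b : ℕ) (by rw [zpow_natCast]; ring)
  rw [pentK_shift12 hq (fun k _ => y1 k) y2 y3 y4, hM', raiseU, inv_div, mul_comm c3 c1,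
    show c1 * c3 * c2 * q ^ 2 * (q ^ (N + 1) / q ^ j) =
      c1 * c2 * c3 * q ^ 2 * q ^ (N + 1) / q ^ j by ring]
  clear y1 y2 y3 y4 hM'
  generalize pentK q (q * c1) (q * c2) c3 (q ^ N) (q ^ j) b = K
  generalize q ^ (N + 1) = M at *
  generalize c1 * c2 * c3 * q ^ 2 * M / q ^ j = e at *
  generalize q ^ j / M = f at *
  generalize 1 - q * c1 * q ^ b = W1 at *
  generalize 1 - q * c1 = W2 at *
  generalize 1 - e * q ^ b = W3 at *
  generalize 1 - e = W4 at *
  generalize 1 - f * q ^ b = W5 at *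
  generalize 1 - f = W6 at *
  generalize 1 - M⁻¹ * q ^ b = W7 at *
  generalize 1 - M⁻¹ = W8 at *
  generalize c1 * c3 * q * (q ^ b) ^ 2 - 1 = W9 at *
  field_simp

theorem pentK_mul_raiseV (h : Gen5 q c0 c1 c2 c3 c4 (N + 1)) {j b : ℕ} (hj : j ≤ N) :
    pentK q c1 c2 c3 (q ^ (N + 1)) (q ^ j) (b + 1) *
      raiseV q (c3 * c1) (q * c1) (c3 * c1 * c2 * q ^ 2 * (q ^ (N + 1) / q ^ j))
        (q ^ (N + 1) / q ^ j)⁻¹ (q * q ^ b) =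
      (1 - q * q ^ b) * (1 - c1 * c3 * q ^ 2 * q ^ (N + 1) * q ^ b) /
        (q ^ (N + 1) * (1 - (q ^ (N + 1))⁻¹) * (c1 * c3 * q * (q * q ^ b) ^ 2 - 1)) *
      pentK q (q * c1) (q * c2) c3 (q ^ N) (q ^ j) b := by
  obtain ⟨n0, n1, n2, n3, n4⟩ := h.prod_ne
  have hq := h.hq
  have hM' : q ^ (N + 1) / q = q ^ N := by rw [pow_succ]; field_simp
  have hM := pow_ne_zero (N + 1) hq
  have hJ := pow_ne_zero j hq
  have hB := pow_ne_zero b hq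
  have z1 : 1 - q * c1 ≠ 0 := h.A1.ne 1 (by simp)
  have z2 : 1 - (q ^ (N + 1))⁻¹ ≠ 0 := by
    simpa using one_sub_inv_pow hq h.hqn (show 0 < N + 1 by omega)
  have z3 : 1 - q ^ j / q ^ (N + 1) ≠ 0 := by
    have := one_sub_inv_pow hq h.hqn (show j < N + 1 by omega)
    rwa [← div_eq_inv_mul] at this
  have z4 : 1 - c1 * c2 * c3 * q ^ 2 * q ^ (N + 1) / q ^ j ≠ 0 :=
    h.gen3.A123.ne ((2 + (N + 1) : ℕ) - (j : ℤ)) (by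
      rw [zpow_sub₀ hq, zpow_natCast, zpow_natCast, pow_add _ 2]
      field_simp)
  have y5 : c1 * c3 * q * (q * q ^ b) ^ 2 - 1 ≠ 0 := by
    rw [← neg_ne_zero, neg_sub]
    exact h.A13.ne (3 + 2 * b : ℕ) (by rw [zpow_natCast]; ring)
  have w1 : 1 - q * c3 * q ^ b ≠ 0 := h.A3.ne (b + 1 : ℕ) (by rw [zpow_natCast]; ring)
  have w2 : 1 - c1 * c3 * q ^ 2 * q ^ (N + 1) / q ^ j * q ^ b ≠ 0 :=
    h.A13.ne ((b + 2 + (N + 1) : ℕ) - (j : ℤ)) (by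
      rw [zpow_sub₀ hq, zpow_natCast, zpow_natCast, pow_add _ (b + 2)]
      field_simp
      ring)
  have w3 : 1 - q ^ j / (c2 * q ^ (N + 1)) * q ^ b ≠ 0 :=
    h.A2.inv hq 0 (b := c2⁻¹) (by simp) |>.ne ((j + b : ℕ) - ((N + 1 : ℕ) : ℤ)) (by
      rw [zpow_sub₀ hq, zpow_natCast, zpow_natCast, pow_add q j]; field_simp)
  rw [pentK_succ12 hq, hM', raiseV, inv_div, mul_comm c3 c1,
    show c1 * c3 * c2 * q ^ 2 * (q ^ (N + 1) / q ^ j) =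
      c1 * c2 * c3 * q ^ 2 * q ^ (N + 1) / q ^ j by ring]
  have x1 : c1 * c3 * q * (q * q ^ b) - q * c1 = - (q * c1 * (1 - q * c3 * q ^ b)) := by ring
  have x2 : c1 * c3 * q * (q * q ^ b) - c1 * c2 * c3 * q ^ 2 * q ^ (N + 1) / q ^ j =
      - (c1 * c2 * c3 * q ^ 2 * q ^ (N + 1) / q ^ j * (1 - q ^ j / (c2 * q ^ (N + 1)) * q ^ b)) := by
    field_simp; ring
  have x3 : c1 * c3 * q * (q * q ^ b) - q ^ j / q ^ (N + 1) =
      - (q ^ j / q ^ (N + 1) * (1 - c1 * c3 * q ^ 2 * q ^ (N + 1) / q ^ j * q ^ b)) := by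
    field_simp; ring
  rw [x1, x2, x3]
  clear x1 x2 x3 hM'
  generalize pentK q (q * c1) (q * c2) c3 (q ^ N) (q ^ j) b = K
  generalize q ^ (N + 1) = M at *
  generalize 1 - c1 * c2 * c3 * q ^ 2 * M / q ^ j = W1 at *
  generalize 1 - q ^ j / M = W2 at *
  generalize 1 - q * c1 = W3 at *
  generalize 1 - M⁻¹ = W4 at *
  generalize 1 - q * c3 * q ^ b = W5 at *
  generalize 1 - q ^ j / (c2 * M) * q ^ b = W6 at *
  generalize 1 - c1 * c3 * q ^ 2 * M / q ^ j * q ^ b = W7 at *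
  generalize c1 * c3 * q * (q * q ^ b) ^ 2 - 1 = W9 at *
  generalize 1 - c1 * c3 * q ^ 2 * M * q ^ b = V1
  field_simp
  ring

end

section

variable {q c0 c1 c2 c3 c4 : ℂ} {N : ℕ}

theorem pentF_swap_shift' (h : Gen5 q c0 c1 c2 c3 c4 (N + 1)) (x : ℕ) :
    pentF q c3 c4 c2 c0 c1 (q ^ (N + 1)) x =
      (1 - q * c2 * q ^ x) * (1 - (c0 * c3 * q * q ^ (N + 1))⁻¹ * q ^ x) /
        ((1 - q * c2) * (1 - (c0 * c3 * q * q ^ (N + 1))⁻¹) * q ^ x) *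
      pentF q c3 c4 (q * c2) c0 (q * c1) (q ^ N) x := by
  have hq := h.hq
  have hM' : q ^ (N + 1) / q = q ^ N := by rw [pow_succ]; field_simp
  rw [pentF_swap_shift hq, hM']
  · exact fun k => h.A2.ne (k + 1 : ℕ) (by rw [zpow_natCast]; ring)
  · intro k
    obtain ⟨n0, n1, n2, n3, n4⟩ := h.prod_ne
    exact h.A03.inv hq 0 (b := (c0 * c3)⁻¹) (by simp) |>.ne ((k : ℤ) - (N + 2 : ℕ)) (by
      rw [zpow_sub₀ hq, zpow_natCast, zpow_natCast, show N + 2 = N + 1 + 1 by rfl, pow_succ _ (N + 1)]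
      have := pow_ne_zero (N + 1) hq
      field_simp)

theorem pent_coeff_UU (h : Gen5 q c0 c1 c2 c3 c4 (N + 1)) {j x b : ℕ} (hj : j + b ≤ N)
    (hx : x + b ≤ N + 1) :
    pentF q c3 c4 c2 c0 c1 (q ^ (N + 1)) x * pentK q c1 c2 c3 (q ^ (N + 1)) (q ^ j) b *
      raiseU q (c3 * c1) (q * c1) (c3 * c1 * c2 * q ^ 2 * (q ^ (N + 1) / q ^ j))
        (q ^ (N + 1) / q ^ j)⁻¹ (q ^ b) * relU q (c2 * c4) (q ^ (N + 1) / q ^ b)⁻¹ (q ^ x) =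
    pentU q (c0 * c3) c2 c4 (q ^ (N + 1)) (q ^ x) *
      relU q (c1 * c3) (q ^ (N + 1) / q ^ x)⁻¹ (q ^ b) *
      (pentF q c3 c4 (q * c2) c0 (q * c1) (q ^ N) x *
        pentK q (q * c1) (q * c2) c3 (q ^ N) (q ^ j) b) := by
  have hq := h.hq
  obtain ⟨n0, n1, n2, n3, n4⟩ := h.prod_ne
  have hM := pow_ne_zero (N + 1) hq
  have hB := pow_ne_zero b hq
  have hX := pow_ne_zero x hq
  rw [mul_assoc (pentF _ _ _ _ _ _ _ _), pentK_mul_raiseU h hj, pentF_swap_shift' h, inv_div, inv_div]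
  have y1 : 1 - (q ^ (N + 1))⁻¹ * q ^ b ≠ 0 := one_sub_inv_pow hq h.hqn (by omega)
  have y2 : 1 - (q ^ (N + 1))⁻¹ ≠ 0 := by
    simpa using one_sub_inv_pow hq h.hqn (show 0 < N + 1 by omega)
  rcases Nat.lt_or_ge N x with hx' | hx'
  · obtain rfl : x = N + 1 := by omega
    obtain rfl : b = 0 := by omega
    rw [pentU_self hM, relU, pow_zero, one_div, inv_mul_cancel₀ hM]
    simp
  have y3 : 1 - q ^ x / q ^ (N + 1) ≠ 0 := by
    rw [div_eq_inv_mul]; exact one_sub_inv_pow hq h.hqn (by omega)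
  have y4 : 1 - q * c2 ≠ 0 := h.A2.ne 1 (by simp)
  have y5 : 1 - c0 * c3 * q * q ^ (N + 1) ≠ 0 :=
    h.A03.ne (N + 2 : ℕ) (by rw [zpow_natCast]; ring)
  have y6 : c4 * c2 * q * (q ^ x) ^ 2 - 1 ≠ 0 := by
    rw [← neg_ne_zero, neg_sub]
    exact h.A24.ne (1 + 2 * x : ℕ) (by rw [zpow_natCast]; ring)
  have y7 : c1 * c3 * q * (q ^ b) ^ 2 - 1 ≠ 0 := by
    rw [← neg_ne_zero, neg_sub]
    exact h.A13.ne (1 + 2 * b : ℕ) (by rw [zpow_natCast]; ring)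
  have x1 : 1 - (c0 * c3 * q * q ^ (N + 1))⁻¹ =
      - (1 - c0 * c3 * q * q ^ (N + 1)) / (c0 * c3 * q * q ^ (N + 1)) := by field_simp; ring
  have x2 : 1 - (c0 * c3 * q * q ^ (N + 1))⁻¹ * q ^ x =
      - (1 - c0 * c3 * q * q ^ (N + 1) / q ^ x) * q ^ x / (c0 * c3 * q * q ^ (N + 1)) := by
    field_simp; ring
  rw [relU, relU, pentU, x1, x2, mul_comm c2 c4, ← div_eq_inv_mul] 
  rw [← div_eq_inv_mul] at y1
  clear x1 x2
  rw [show q ^ b / q ^ (N + 1) * q ^ x = q ^ x / q ^ (N + 1) * q ^ b by ring]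
  generalize pentK q (q * c1) (q * c2) c3 (q ^ N) (q ^ j) b = K
  generalize pentF q c3 c4 (q * c2) c0 (q * c1) (q ^ N) x = F
  generalize q ^ (N + 1) = M at *
  generalize 1 - c0 * c3 * q * M / q ^ x = V1
  generalize 1 - q ^ x / M * q ^ b = V2
  generalize c1 * c3 * q * q ^ b - 1 = V3
  generalize c4 * c2 * q * q ^ x - 1 = V4
  generalize 1 - q * c2 * q ^ x = V5
  generalize 1 - q ^ b / M = W1 at *
  generalize 1 - M⁻¹ = W2 at *
  generalize 1 - q ^ x / M = W3 at *
  generalize 1 - q * c2 = W4 at *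
  generalize 1 - c0 * c3 * q * M = W5 at *
  generalize c4 * c2 * q * (q ^ x) ^ 2 - 1 = W6 at *
  generalize c1 * c3 * q * (q ^ b) ^ 2 - 1 = W7 at *
  field_simp

theorem pent_coeff_VU (h : Gen5 q c0 c1 c2 c3 c4 (N + 1)) {j x b : ℕ} (hj : j ≤ N)
    (hx : x + b ≤ N) :
    pentF q c3 c4 c2 c0 c1 (q ^ (N + 1)) x * pentK q c1 c2 c3 (q ^ (N + 1)) (q ^ j) (b + 1) *
      raiseV q (c3 * c1) (q * c1) (c3 * c1 * c2 * q ^ 2 * (q ^ (N + 1) / q ^ j))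
        (q ^ (N + 1) / q ^ j)⁻¹ (q ^ (b + 1)) *
      relU q (c2 * c4) (c2 * c4 * c0 * q ^ 2 * (q ^ (N + 1) / q ^ (b + 1))) (q ^ x) =
    pentU q (c0 * c3) c2 c4 (q ^ (N + 1)) (q ^ x) *
      relV q (c1 * c3) (q ^ (N + 1) / q ^ x)⁻¹ (q ^ (b + 1)) *
      (pentF q c3 c4 (q * c2) c0 (q * c1) (q ^ N) x *
        pentK q (q * c1) (q * c2) c3 (q ^ N) (q ^ j) b) := by
  have hq := h.hq
  obtain ⟨n0, n1, n2, n3, n4⟩ := h.prod_ne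
  have hM := pow_ne_zero (N + 1) hq
  have hB := pow_ne_zero b hq
  have hX := pow_ne_zero x hq
  have x3 : c2 * c4 * c0 * q ^ 2 * (q ^ (N + 1) / (q * q ^ b)) =
      (c1 * c3 * q ^ 2 * q ^ (N + 1) * q ^ b)⁻¹ := by
    refine eq_inv_of_mul_eq_one_left ?_
    have := h.constr
    field_simp
    linear_combination this
  rw [mul_assoc (pentF _ _ _ _ _ _ _ _), pow_succ' q b, pentK_mul_raiseV h hj, pentF_swap_shift' h,
    inv_div, x3]
  have y2 : 1 - (q ^ (N + 1))⁻¹ ≠ 0 := by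
    simpa using one_sub_inv_pow hq h.hqn (show 0 < N + 1 by omega)
  have y3 : 1 - q ^ x / q ^ (N + 1) ≠ 0 := by
    rw [div_eq_inv_mul]; exact one_sub_inv_pow hq h.hqn (by omega)
  have y4 : 1 - q * c2 ≠ 0 := h.A2.ne 1 (by simp)
  have y5 : 1 - c0 * c3 * q * q ^ (N + 1) ≠ 0 :=
    h.A03.ne (N + 2 : ℕ) (by rw [zpow_natCast]; ring)
  have y6 : c4 * c2 * q * (q ^ x) ^ 2 - 1 ≠ 0 := by
    rw [← neg_ne_zero, neg_sub]
    exact h.A24.ne (1 + 2 * x : ℕ) (by rw [zpow_natCast]; ring)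
  have y7 : c1 * c3 * q * (q * q ^ b) ^ 2 - 1 ≠ 0 := by
    rw [← neg_ne_zero, neg_sub]
    exact h.A13.ne (3 + 2 * b : ℕ) (by rw [zpow_natCast]; ring)
  have y8 : 1 - c1 * c3 * q ^ 2 * q ^ (N + 1) * q ^ b ≠ 0 :=
    h.A13.ne (3 + N + b : ℕ) (by rw [zpow_natCast]; ring)
  have x1 : 1 - (c0 * c3 * q * q ^ (N + 1))⁻¹ =
      - (1 - c0 * c3 * q * q ^ (N + 1)) / (c0 * c3 * q * q ^ (N + 1)) := by field_simp; ring
  have x2 : 1 - (c0 * c3 * q * q ^ (N + 1))⁻¹ * q ^ x =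
      - (1 - c0 * c3 * q * q ^ (N + 1) / q ^ x) * q ^ x / (c0 * c3 * q * q ^ (N + 1)) := by
    field_simp; ring
  have x4 : 1 - (c1 * c3 * q ^ 2 * q ^ (N + 1) * q ^ b)⁻¹ =
      - (1 - c1 * c3 * q ^ 2 * q ^ (N + 1) * q ^ b) / (c1 * c3 * q ^ 2 * q ^ (N + 1) * q ^ b) := by
    field_simp; ring
  have x5 : 1 - (c1 * c3 * q ^ 2 * q ^ (N + 1) * q ^ b)⁻¹ * q ^ x =
      (c1 * c3 * q * (q * q ^ b) - q ^ x / q ^ (N + 1)) / (c1 * c3 * q ^ 2 * q ^ b) := by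
    field_simp
  rw [relU, relV, pentU, x1, x2, x4, x5, mul_comm c2 c4,
    show 1 - q * q ^ b = - (q * q ^ b - 1) by ring]
  clear x1 x2 x3 x4 x5
  generalize pentK q (q * c1) (q * c2) c3 (q ^ N) (q ^ j) b = K
  generalize pentF q c3 c4 (q * c2) c0 (q * c1) (q ^ N) x = F
  generalize q ^ (N + 1) = M at *
  generalize 1 - c0 * c3 * q * M / q ^ x = V1
  generalize c1 * c3 * q * (q * q ^ b) - q ^ x / M = V3
  generalize c4 * c2 * q * q ^ x - 1 = V4
  generalize 1 - q * c2 * q ^ x = V5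
  generalize q * q ^ b - 1 = V6
  generalize 1 - M⁻¹ = W2 at *
  generalize 1 - q ^ x / M = W3 at *
  generalize 1 - q * c2 = W4 at *
  generalize 1 - c0 * c3 * q * M = W5 at *
  generalize c4 * c2 * q * (q ^ x) ^ 2 - 1 = W6 at *
  generalize c1 * c3 * q * (q * q ^ b) ^ 2 - 1 = W7 at *
  generalize 1 - c1 * c3 * q ^ 2 * M * q ^ b = W8 at *
  field_simp

theorem pentF_swap_succ' (h : Gen5 q c0 c1 c2 c3 c4 (N + 1)) (x : ℕ) :
    pentF q c3 c4 c2 c0 c1 (q ^ (N + 1)) (x + 1) =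
      (1 - q * c4 * q ^ x) * (1 - q * q ^ x / (c1 * q * q ^ (N + 1))) /
        (- ((1 - q * c2) * (1 - c0 * c3 * q * q ^ (N + 1))) * (c4 * q) * q ^ x) *
      pentF q c3 c4 (q * c2) c0 (q * c1) (q ^ N) x := by
  have hq := h.hq
  obtain ⟨n0, n1, n2, n3, n4⟩ := h.prod_ne
  have hM' : q ^ (N + 1) / q = q ^ N := by rw [pow_succ]; field_simp
  have hM := pow_ne_zero (N + 1) hq
  have x1 : 1 - (c0 * c3 * q * q ^ (N + 1))⁻¹ =
      - (1 - c0 * c3 * q * q ^ (N + 1)) / (c0 * c3 * q * q ^ (N + 1)) := by field_simp; ring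
  have x2 : q * q ^ x / (c1 * q * q ^ (N + 1)) = (c1 * q ^ (N + 1))⁻¹ * q ^ x := by
    field_simp
  rw [pentF_swap_succ hq, hM', x1, x2]
  congr 2
  field_simp

theorem pent_coeff_UV (h : Gen5 q c0 c1 c2 c3 c4 (N + 1)) {j x b : ℕ} (hj : j + b ≤ N)
    (hx : x + b ≤ N) :
    pentF q c3 c4 c2 c0 c1 (q ^ (N + 1)) (x + 1) * pentK q c1 c2 c3 (q ^ (N + 1)) (q ^ j) b *
      raiseU q (c3 * c1) (q * c1) (c3 * c1 * c2 * q ^ 2 * (q ^ (N + 1) / q ^ j))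
        (q ^ (N + 1) / q ^ j)⁻¹ (q ^ b) * relV q (c2 * c4) (q ^ (N + 1) / q ^ b)⁻¹ (q ^ (x + 1)) =
    pentV q c0 c1 c2 c3 c4 (q ^ (N + 1)) (q ^ (x + 1)) *
      relU q (c1 * c3) (c1 * c3 * c0 * q ^ 2 * (q ^ (N + 1) / q ^ (x + 1))) (q ^ b) *
      (pentF q c3 c4 (q * c2) c0 (q * c1) (q ^ N) x *
        pentK q (q * c1) (q * c2) c3 (q ^ N) (q ^ j) b) := by
  have hq := h.hq
  obtain ⟨n0, n1, n2, n3, n4⟩ := h.prod_ne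
  have hM := pow_ne_zero (N + 1) hq
  have hB := pow_ne_zero b hq
  have hX := pow_ne_zero x hq
  rw [mul_assoc (pentF _ _ _ _ _ _ _ _), pow_succ' q x, pentK_mul_raiseU h hj, pentF_swap_succ' h,
    inv_div]
  have y1 : 1 - q ^ b / q ^ (N + 1) ≠ 0 := by
    rw [div_eq_inv_mul]; exact one_sub_inv_pow hq h.hqn (by omega)
  have y2 : 1 - (q ^ (N + 1))⁻¹ ≠ 0 := by
    simpa using one_sub_inv_pow hq h.hqn (show 0 < N + 1 by omega)
  have y4 : 1 - q * c2 ≠ 0 := h.A2.ne 1 (by simp)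
  have y5 : 1 - c0 * c3 * q * q ^ (N + 1) ≠ 0 :=
    h.A03.ne (N + 2 : ℕ) (by rw [zpow_natCast]; ring)
  have y6 : c4 * c2 * q * (q * q ^ x) ^ 2 - 1 ≠ 0 := by
    rw [← neg_ne_zero, neg_sub]
    exact h.A24.ne (3 + 2 * x : ℕ) (by rw [zpow_natCast]; ring)
  have y7 : c1 * c3 * q * (q ^ b) ^ 2 - 1 ≠ 0 := by
    rw [← neg_ne_zero, neg_sub]
    exact h.A13.ne (1 + 2 * b : ℕ) (by rw [zpow_natCast]; ring)
  have y8 : 1 - c0 * c3 * c1 * q ^ 2 * q ^ (N + 1) / (q * q ^ x) ≠ 0 :=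
    h.gen031.A123.ne ((N + 2 : ℕ) - (x : ℤ)) (by
      rw [zpow_sub₀ hq, zpow_natCast, zpow_natCast]; field_simp; ring)
  have x1 : 1 - c1 * c3 * c0 * q ^ 2 * (q ^ (N + 1) / (q * q ^ x)) =
      1 - c0 * c3 * c1 * q ^ 2 * q ^ (N + 1) / (q * q ^ x) := by ring
  have x2 : 1 - c1 * c3 * c0 * q ^ 2 * (q ^ (N + 1) / (q * q ^ x)) * q ^ b =
      (c4 * c2 * q * (q * q ^ x) - q ^ b / q ^ (N + 1)) / (c4 * c2 * q ^ 2 * q ^ x) := by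
    have := h.constr
    field_simp
    linear_combination - q ^ b * this
  have x3 : c4 * c2 * q * (q * q ^ x) - q * c2 = - (q * c2 * (1 - q * c4 * q ^ x)) := by ring
  rw [relU, relV, pentV, x1, x2, x3, mul_comm c2 c4, ← div_eq_inv_mul]
  clear x1 x2 x3
  generalize pentK q (q * c1) (q * c2) c3 (q ^ N) (q ^ j) b = K
  generalize pentF q c3 c4 (q * c2) c0 (q * c1) (q ^ N) x = F
  generalize q ^ (N + 1) = M at *
  generalize 1 - q * q ^ x / (c1 * q * M) = V1
  generalize c1 * c3 * q * q ^ b - 1 = V3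
  generalize c4 * c2 * q * (q * q ^ x) - q ^ b / M = V4
  generalize 1 - q * c4 * q ^ x = V5
  generalize q * q ^ x - 1 = V6
  generalize 1 - M⁻¹ = W2 at *
  generalize 1 - q ^ b / M = W1 at *
  generalize 1 - q * c2 = W4 at *
  generalize 1 - c0 * c3 * q * M = W5 at *
  generalize c4 * c2 * q * (q * q ^ x) ^ 2 - 1 = W6 at *
  generalize c1 * c3 * q * (q ^ b) ^ 2 - 1 = W7 at *
  generalize 1 - c0 * c3 * c1 * q ^ 2 * M / (q * q ^ x) = W8 at *
  field_simp

theorem pent_coeff_VV (h : Gen5 q c0 c1 c2 c3 c4 (N + 1)) {j x b : ℕ} (hj : j ≤ N) :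
    pentF q c3 c4 c2 c0 c1 (q ^ (N + 1)) (x + 1) * pentK q c1 c2 c3 (q ^ (N + 1)) (q ^ j) (b + 1) *
      raiseV q (c3 * c1) (q * c1) (c3 * c1 * c2 * q ^ 2 * (q ^ (N + 1) / q ^ j))
        (q ^ (N + 1) / q ^ j)⁻¹ (q ^ (b + 1)) *
      relV q (c2 * c4) (c2 * c4 * c0 * q ^ 2 * (q ^ (N + 1) / q ^ (b + 1))) (q ^ (x + 1)) =
    pentV q c0 c1 c2 c3 c4 (q ^ (N + 1)) (q ^ (x + 1)) *
      relV q (c1 * c3) (c1 * c3 * c0 * q ^ 2 * (q ^ (N + 1) / q ^ (x + 1))) (q ^ (b + 1)) *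
      (pentF q c3 c4 (q * c2) c0 (q * c1) (q ^ N) x *
        pentK q (q * c1) (q * c2) c3 (q ^ N) (q ^ j) b) := by
  have hq := h.hq
  obtain ⟨n0, n1, n2, n3, n4⟩ := h.prod_ne
  have hM := pow_ne_zero (N + 1) hq
  have hB := pow_ne_zero b hq
  have hX := pow_ne_zero x hq
  have x0 : c2 * c4 * c0 * q ^ 2 * (q ^ (N + 1) / (q * q ^ b)) =
      (c1 * c3 * q ^ 2 * q ^ (N + 1) * q ^ b)⁻¹ := by
    refine eq_inv_of_mul_eq_one_left ?_
    have := h.constr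
    field_simp
    linear_combination this
  rw [mul_assoc (pentF _ _ _ _ _ _ _ _), pow_succ' q b, pow_succ' q x, pentK_mul_raiseV h hj,
    pentF_swap_succ' h, x0]
  have y2 : 1 - (q ^ (N + 1))⁻¹ ≠ 0 := by
    simpa using one_sub_inv_pow hq h.hqn (show 0 < N + 1 by omega)
  have y4 : 1 - q * c2 ≠ 0 := h.A2.ne 1 (by simp)
  have y5 : 1 - c0 * c3 * q * q ^ (N + 1) ≠ 0 :=
    h.A03.ne (N + 2 : ℕ) (by rw [zpow_natCast]; ring)
  have y6 : c4 * c2 * q * (q * q ^ x) ^ 2 - 1 ≠ 0 := by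
    rw [← neg_ne_zero, neg_sub]
    exact h.A24.ne (3 + 2 * x : ℕ) (by rw [zpow_natCast]; ring)
  have y7 : c1 * c3 * q * (q * q ^ b) ^ 2 - 1 ≠ 0 := by
    rw [← neg_ne_zero, neg_sub]
    exact h.A13.ne (3 + 2 * b : ℕ) (by rw [zpow_natCast]; ring)
  have y8 : 1 - c0 * c3 * c1 * q ^ 2 * q ^ (N + 1) / (q * q ^ x) ≠ 0 :=
    h.gen031.A123.ne ((N + 2 : ℕ) - (x : ℤ)) (by
      rw [zpow_sub₀ hq, zpow_natCast, zpow_natCast]; field_simp; ring)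
  have y9 : 1 - c1 * c3 * q ^ 2 * q ^ (N + 1) * q ^ b ≠ 0 :=
    h.A13.ne (3 + N + b : ℕ) (by rw [zpow_natCast]; ring)
  have x1 : 1 - c1 * c3 * c0 * q ^ 2 * (q ^ (N + 1) / (q * q ^ x)) =
      1 - c0 * c3 * c1 * q ^ 2 * q ^ (N + 1) / (q * q ^ x) := by ring
  have x2 : c1 * c3 * q * (q * q ^ b) - c1 * c3 * c0 * q ^ 2 * (q ^ (N + 1) / (q * q ^ x)) =
      c1 * c3 * q ^ 2 * q ^ b / (c4 * c2 * q * (q * q ^ x)) *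
        (c4 * c2 * q * (q * q ^ x) - (c1 * c3 * q ^ 2 * q ^ (N + 1) * q ^ b)⁻¹) := by
    have := h.constr
    field_simp
    linear_combination - this
  have x3 : c4 * c2 * q * (q * q ^ x) - q * c2 = - (q * c2 * (1 - q * c4 * q ^ x)) := by ring
  have x4 : 1 - (c1 * c3 * q ^ 2 * q ^ (N + 1) * q ^ b)⁻¹ =
      - (1 - c1 * c3 * q ^ 2 * q ^ (N + 1) * q ^ b) / (c1 * c3 * q ^ 2 * q ^ (N + 1) * q ^ b) := by
    field_simp; ring
  rw [relV, relV, pentV, x1, x2, x3, x4, mul_comm c2 c4,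
    show 1 - q * q ^ b = - (q * q ^ b - 1) by ring]
  clear x0 x1 x2 x3 x4
  generalize pentK q (q * c1) (q * c2) c3 (q ^ N) (q ^ j) b = K
  generalize pentF q c3 c4 (q * c2) c0 (q * c1) (q ^ N) x = F
  generalize q ^ (N + 1) = M at *
  generalize 1 - q * q ^ x / (c1 * q * M) = V1
  generalize c4 * c2 * q * (q * q ^ x) - (c1 * c3 * q ^ 2 * M * q ^ b)⁻¹ = V4
  generalize 1 - q * c4 * q ^ x = V5
  generalize q * q ^ x - 1 = V6
  generalize q * q ^ b - 1 = V7
  generalize 1 - M⁻¹ = W2 at *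
  generalize 1 - q * c2 = W4 at *
  generalize 1 - c0 * c3 * q * M = W5 at *
  generalize c4 * c2 * q * (q * q ^ x) ^ 2 - 1 = W6 at *
  generalize c1 * c3 * q * (q * q ^ b) ^ 2 - 1 = W7 at *
  generalize 1 - c0 * c3 * c1 * q ^ 2 * M / (q * q ^ x) = W8 at *
  generalize 1 - c1 * c3 * q ^ 2 * M * q ^ b = W9 at *
  field_simp

end

section

variable {q c0 c1 c2 c3 c4 : ℂ} {N : ℕ}

/-- The right-hand side of the pentagon relation. -/
def pentR (q c0 c1 c2 c3 c4 : ℂ) (N a j x b : ℕ) : ℂ :=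
  pentF q c0 c1 c2 c3 c4 (q ^ N) a * pentF q c3 c4 c2 c0 c1 (q ^ N) x *
    pentG q c0 c1 c2 c3 c4 N j * pentK q c1 c2 c3 (q ^ N) (q ^ j) b *
    pR q c3 c1 c2 (q ^ N / q ^ j) a b * pR q c2 c4 c0 (q ^ N / q ^ b) j x

theorem pentR_eq_zero (hq : q ≠ 0) {j b : ℕ} (a x : ℕ) (hj : j ≤ N) (h : N < j + b) :
    pentR q c0 c1 c2 c3 c4 N a j x b = 0 := by
  rw [pentR, pentK_eq_zero hq hj h]; simp

theorem pentR_succ (h : Gen5 q c0 c1 c2 c3 c4 (N + 1)) {a x j b : ℕ} (ha : a + j ≤ N)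
    (hx : x + b ≤ N + 1) :
    pentR q c0 c1 c2 c3 c4 (N + 1) (a + 1) j x b =
      pentU q (c0 * c3) c2 c4 (q ^ (N + 1)) (q ^ x) *
        (relU q (c1 * c3) (q ^ (N + 1) / q ^ x)⁻¹ (q ^ b) *
            pentR q c0 (q * c1) (q * c2) c3 c4 N a j x b +
          relV q (c1 * c3) (q ^ (N + 1) / q ^ x)⁻¹ (q ^ b) *
            pentR q c0 (q * c1) (q * c2) c3 c4 N a j x (b - 1)) +
      pentV q c0 c1 c2 c3 c4 (q ^ (N + 1)) (q ^ x) *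
        (relU q (c1 * c3) (c1 * c3 * c0 * q ^ 2 * (q ^ (N + 1) / q ^ x)) (q ^ b) *
            pentR q c0 (q * c1) (q * c2) c3 c4 N a j (x - 1) b +
          relV q (c1 * c3) (c1 * c3 * c0 * q ^ 2 * (q ^ (N + 1) / q ^ x)) (q ^ b) *
            pentR q c0 (q * c1) (q * c2) c3 c4 N a j (x - 1) (b - 1)) := by
  obtain ⟨n0, n1, n2, n3, n4⟩ := h.prod_ne
  have hq := h.hq
  rcases Nat.lt_or_ge (N + 1) (j + b) with hjb | hjb
  · rw [pentR_eq_zero hq _ _ (by omega) hjb, pentR_eq_zero hq _ _ (by omega) (by omega),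
      pentR_eq_zero hq _ _ (by omega) (by omega), pentR_eq_zero hq _ _ (by omega) (by omega),
      pentR_eq_zero hq _ _ (by omega) (by omega)]
    simp
  have hX : ∀ x : ℕ, q ^ x ≠ 0 := fun x => pow_ne_zero x hq
  have hb : c3 * c1 * q * (q ^ b) ^ 2 - 1 ≠ 0 := by
    rw [← neg_ne_zero, neg_sub]
    exact h.A13.ne (1 + 2 * b : ℕ) (by rw [zpow_natCast]; ring)
  have hxx : c2 * c4 * q * (q ^ x) ^ 2 - 1 ≠ 0 := by
    rw [← neg_ne_zero, neg_sub]
    exact h.A24.ne (1 + 2 * x : ℕ) (by rw [zpow_natCast]; ring)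
  have d2 : ∀ z : ℕ, q ^ (N + 1) / q ^ z / q = q ^ N / q ^ z := fun z => by
    rw [pow_succ, div_right_comm, mul_div_cancel_right₀ _ hq]
  have d3 : ∀ z : ℕ, q ^ (N + 1) / q ^ (z + 1) = q ^ N / q ^ z := fun z => by
    rw [pow_succ, pow_succ, mul_div_mul_right _ _ hq]
  have hr := pR_raise (q := q) (a1 := c3) (a2 := c1) (a3 := c2) (Z := q ^ (N + 1) / q ^ j) (n := a)
    b hq (by positivity) (div_ne_zero (hX _) (hX j)) hb
    (fun k _ => h.A1.ne (k + 1 : ℕ) (by rw [zpow_natCast]; ring))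
    (fun k _ => h.gen3.A123.ne ((k + 2 + (N + 1) : ℕ) - (j : ℤ)) (by
      rw [zpow_sub₀ hq, zpow_natCast, zpow_natCast, pow_add _ (k + 2)]
      have := hX j
      field_simp
      ring))
    (fun k hk => by
      have := one_sub_inv_pow hq h.hqn (show j + k < N + 1 by omega)
      rwa [pow_add q j, ← mul_assoc, ← div_eq_inv_mul, ← inv_div] at this)
    (fun k _ => h.hqn k)
  rw [d2] at hr
  have hFG := pentF_mul_pentG h a (show j ≤ N by omega)
  set P1 := pR q c3 (q * c1) (q * c2) (q ^ N / q ^ j) a b with hP1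
  set P2 := pR q c3 (q * c1) (q * c2) (q ^ N / q ^ j) a (b - 1) with hP2
  set R := pR q c2 c4 c0 (q ^ (N + 1) / q ^ b) j x with hR
  set h0 := pentF q c3 c4 c2 c0 c1 (q ^ (N + 1)) x with hh0
  set K := pentK q c1 c2 c3 (q ^ (N + 1)) (q ^ j) b with hK
  set F' := pentF q c0 (q * c1) (q * c2) c3 c4 (q ^ N) a with hF'
  set G' := pentG q c0 (q * c1) (q * c2) c3 c4 N j with hG'
  have t1 : h0 * K * raiseU q (c3 * c1) (q * c1) (c3 * c1 * c2 * q ^ 2 * (q ^ (N + 1) / q ^ j))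
        (q ^ (N + 1) / q ^ j)⁻¹ (q ^ b) * (F' * G' * P1 * R) =
      pentU q (c0 * c3) c2 c4 (q ^ (N + 1)) (q ^ x) *
        (relU q (c1 * c3) (q ^ (N + 1) / q ^ x)⁻¹ (q ^ b) *
            pentR q c0 (q * c1) (q * c2) c3 c4 N a j x b) +
      pentV q c0 c1 c2 c3 c4 (q ^ (N + 1)) (q ^ x) *
        (relU q (c1 * c3) (c1 * c3 * c0 * q ^ 2 * (q ^ (N + 1) / q ^ x)) (q ^ b) *
            pentR q c0 (q * c1) (q * c2) c3 c4 N a j (x - 1) b) := by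
    rcases Nat.lt_or_ge N (j + b) with hjb' | hjb'
    · have : raiseU q (c3 * c1) (q * c1) (c3 * c1 * c2 * q ^ 2 * (q ^ (N + 1) / q ^ j))
          (q ^ (N + 1) / q ^ j)⁻¹ (q ^ b) = 0 := by
        have : q ^ (N + 1) = q ^ j * q ^ b := by rw [← pow_add]; congr 1; omega
        rw [this, mul_div_cancel_left₀ _ (hX j), raiseU, inv_mul_cancel₀ (hX b)]
        simp
      rw [this, pentR_eq_zero hq _ _ (by omega) hjb', pentR_eq_zero hq _ _ (by omega) hjb']
      simp
    · have e1 := pent_coeff_UU h hjb' hx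
      rw [hR, pR_rel x hq hxx (fun k hk => by
        have := one_sub_inv_pow hq h.hqn (show b + k < N + 1 by omega)
        rwa [pow_add q b, ← mul_assoc, ← div_eq_inv_mul, ← inv_div] at this), d2]
      rw [pentR, pentR]
      cases x with
      | zero =>
        rw [pow_zero, relV_one, pentV_one]
        rw [pow_zero] at e1
        linear_combination F' * G' * P1 * pR q (q * c2) c4 c0 (q ^ N / q ^ b) j 0 * e1
      | succ x =>
        have e2 := pent_coeff_UV h hjb' (show x + b ≤ N by omega)
        rw [Nat.add_sub_cancel]
        linear_combination F' * G' * P1 * pR q (q * c2) c4 c0 (q ^ N / q ^ b) j (x + 1) * e1 +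
          F' * G' * P1 * pR q (q * c2) c4 c0 (q ^ N / q ^ b) j x * e2
  have t2 : h0 * K * raiseV q (c3 * c1) (q * c1) (c3 * c1 * c2 * q ^ 2 * (q ^ (N + 1) / q ^ j))
        (q ^ (N + 1) / q ^ j)⁻¹ (q ^ b) * (F' * G' * P2 * R) =
      pentU q (c0 * c3) c2 c4 (q ^ (N + 1)) (q ^ x) *
        (relV q (c1 * c3) (q ^ (N + 1) / q ^ x)⁻¹ (q ^ b) *
            pentR q c0 (q * c1) (q * c2) c3 c4 N a j x (b - 1)) +
      pentV q c0 c1 c2 c3 c4 (q ^ (N + 1)) (q ^ x) *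
        (relV q (c1 * c3) (c1 * c3 * c0 * q ^ 2 * (q ^ (N + 1) / q ^ x)) (q ^ b) *
            pentR q c0 (q * c1) (q * c2) c3 c4 N a j (x - 1) (b - 1)) := by
    cases b with
    | zero => simp only [pow_zero, relV_one, raiseV_one]; ring
    | succ b =>
      have e1 := pent_coeff_VU h (show j ≤ N by omega) (show x + b ≤ N by omega)
      rw [hR, pR_rel' x hq hxx (fun k _ => h.A13.inv hq (-(2 * (N + 1) + 3 : ℕ)) (b := c2 * c4 * c0)
        (by
          rw [zpow_neg, zpow_natCast, ← mul_inv]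
          refine eq_inv_of_mul_eq_one_left ?_
          linear_combination h.constr) |>.ne ((k + 2 + (N + 1) : ℕ) - ((b + 1 : ℕ) : ℤ)) (by
        rw [zpow_sub₀ hq, zpow_natCast, zpow_natCast, pow_add _ (k + 2)]
        have := hX (b + 1)
        field_simp
        ring)), d3]
      have hP2' : P2 = pR q c3 (q * c1) (q * c2) (q ^ N / q ^ j) a b := hP2
      rw [← d3 b, pentR, pentR, Nat.add_sub_cancel, ← hP2', d3]
      rw [d3] at e1
      cases x with
      | zero =>
        simp only [pow_zero, relV_one, pentV_one] at e1 ⊢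
        linear_combination F' * G' * P2 * pR q (q * c2) c4 c0 (q ^ N / q ^ b) j 0 * e1
      | succ x =>
        have e2 := pent_coeff_VV h (x := x) (b := b) (show j ≤ N by omega)
        rw [d3 b] at e2
        rw [Nat.add_sub_cancel]
        linear_combination F' * G' * P2 * pR q (q * c2) c4 c0 (q ^ N / q ^ b) j (x + 1) * e1 +
          F' * G' * P2 * pR q (q * c2) c4 c0 (q ^ N / q ^ b) j x * e2
  rw [pentR, hr]
  linear_combination t1 + t2 + (h0 * K * (raiseU q (c3 * c1) (q * c1)
    (c3 * c1 * c2 * q ^ 2 * (q ^ (N + 1) / q ^ j)) (q ^ (N + 1) / q ^ j)⁻¹ (q ^ b) * P1 +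
    raiseV q (c3 * c1) (q * c1) (c3 * c1 * c2 * q ^ 2 * (q ^ (N + 1) / q ^ j))
      (q ^ (N + 1) / q ^ j)⁻¹ (q ^ b) * P2) * R) * hFG

end

/-- The pentagon relation holds for a given `a` and for all `x ≤ X`. -/
def PentagonHolds (a X : ℕ) : Prop :=
  ∀ (q c0 c1 c2 c3 c4 : ℂ) (N : ℕ), Gen5 q c0 c1 c2 c3 c4 N → ∀ j x b : ℕ, x ≤ X →
    a + j ≤ N → x + b ≤ N →
    pentSum q c0 c1 c2 c3 c4 N a j x b = pentR q c0 c1 c2 c3 c4 N a j x b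

theorem PentagonHolds.succ {a X : ℕ} (ih : PentagonHolds a X) : PentagonHolds (a + 1) X := by
  intro q c0 c1 c2 c3 c4 N h j x b hX ha hx
  obtain ⟨N, rfl⟩ : ∃ N', N = N' + 1 := ⟨N - 1, by omega⟩
  have hq := h.hq
  have h' := h.shift12
  rw [pentSum_succ h j b (by omega) (by omega), pentR_succ h (by omega) hx]
  congr 1
  · congr 2
    · rcases Nat.lt_or_ge N (x + b) with hxb | hxb
      · have : relU q (c1 * c3) (q ^ (N + 1) / q ^ x)⁻¹ (q ^ b) = 0 := by
          have : q ^ (N + 1) = q ^ x * q ^ b := by rw [← pow_add]; congr 1; omega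
          rw [this, mul_div_cancel_left₀ _ (pow_ne_zero x hq), relU,
            inv_mul_cancel₀ (pow_ne_zero b hq)]
          simp
        rw [this]; simp
      · rw [ih _ _ _ _ _ _ _ h' _ _ _ hX (by omega) hxb]
    · cases b with
      | zero => rw [pow_zero, relV_one]; simp
      | succ b => rw [ih _ _ _ _ _ _ _ h' _ _ _ hX (by omega) (by omega)]
  · cases x with
    | zero => rw [pow_zero, pentV_one]; simp
    | succ x =>
      rw [ih _ _ _ _ _ _ _ h' _ _ _ (by omega) (by omega) (by omega)]
      congr 2
      cases b with
      | zero => simp only [pow_zero, relV_one, zero_mul]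
      | succ b => rw [ih _ _ _ _ _ _ _ h' _ _ _ (by omega) (by omega) (by omega)]

theorem PentagonHolds.of_zero {X : ℕ} (h0 : PentagonHolds 0 X) (a : ℕ) : PentagonHolds a X := by
  induction a with
  | zero => exact h0
  | succ a ih => exact ih.succ

theorem pentR_zero_zero (q c0 c1 c2 c3 c4 : ℂ) (N j b : ℕ) :
    pentR q c0 c1 c2 c3 c4 N 0 j 0 b =
      pentG q c0 c1 c2 c3 c4 N j * pentK q c1 c2 c3 (q ^ N) (q ^ j) b := by
  rw [pentR, pentF_zero, pentF_zero, pR_zero_left, pR_zero_right]; ring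

theorem pentagonHolds_zero_zero : PentagonHolds 0 0 := by
  intro q c0 c1 c2 c3 c4 N h j x b hX hj hb
  obtain rfl : x = 0 := by omega
  rw [pentSum_zero_zero h, linSum_eq b h (by omega) (by omega), pentR_zero_zero]

/-- The pentagon relation for `q`-Racah polynomials. -/
theorem pentSum_eq {q c0 c1 c2 c3 c4 : ℂ} {N : ℕ} (h : Gen5 q c0 c1 c2 c3 c4 N) {a j x b : ℕ}
    (ha : a + j ≤ N) (hx : x + b ≤ N) :
    pentSum q c0 c1 c2 c3 c4 N a j x b = pentR q c0 c1 c2 c3 c4 N a j x b := by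
  refine PentagonHolds.of_zero (X := x) ?_ a _ _ _ _ _ _ _ h _ _ _ le_rfl ha hx
  intro q c0 c1 c2 c3 c4 N h j x b _ hj hb
  have e := pentagonHolds_zero_zero _ _ _ _ _ _ _ h j 0 b le_rfl hj (by omega)
  rw [pentSum_swap h, pentagonHolds_zero_zero _ _ _ _ _ _ _ h.swap b 0 j le_rfl (by omega)
    (by omega), pentR_zero_zero, pentR_zero_zero] at e
  rw [pentSum_swap h, pentagonHolds_zero_zero.of_zero x _ _ _ _ _ _ _ h.swap b 0 j le_rfl hb
    (by omega), pentR, pentR, pentF_zero, pR_zero_left, pR_zero_right,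
    pR_symm h.hq c2 c4]
  linear_combination pentF q c3 c4 c2 c0 c1 (q ^ N) x * pR q c0 c4 c2 (q ^ N / q ^ b) x j * e

/-- A relation between `q`-Racah polynomials of adjacent degrees and arguments. -/
theorem pR_four_term {q a b c Z : ℂ} {m y : ℕ} (hq : q ≠ 0) (n1 : a ≠ 0) (n2 : b ≠ 0)
    (n3 : c ≠ 0) (hZ : Z ≠ 0) (h1 : ∀ k ≤ y, 1 - q * b * q ^ k ≠ 0)
    (h2 : ∀ k ≤ y, 1 - a * b * c * q ^ 2 * Z * q ^ k ≠ 0) (h3 : ∀ k ≤ y, 1 - Z⁻¹ * q ^ k ≠ 0)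
    (hqn : ∀ k ≤ y, 1 - q ^ (k + 1) ≠ 0) (hD1 : 1 - b * c * q * q ^ m ≠ 0)
    (hD2 : 1 - b * c * q * (q ^ m) ^ 2 ≠ 0) :
    (1 - q * a * q ^ y) * pR q a b c Z m y +
      q * a * q ^ y * (1 - q * b * q ^ y) * pR q a b c Z m (y + 1) =
    (1 - a * b * q ^ 2 * (q ^ y) ^ 2) *
      ((1 - a * b * c * q ^ 2 * Z * q ^ m) * (1 - q ^ m / Z) * (1 - b * c * q * q ^ m) /
          ((1 - a * b * c * q ^ 2 * Z) * (1 - Z⁻¹) * (1 - b * c * q * (q ^ m) ^ 2)) *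
          pR q (q * a) b (q * c) (Z / q) m y +
        (1 - a * q * Z / q ^ m) * (1 - (Z * (b * c) * q * q ^ m)⁻¹) /
          ((1 - a * b * c * q ^ 2 * Z) * (1 - Z⁻¹) * (1 - (b * c * q * (q ^ m) ^ 2)⁻¹)) *
          (1 - (q ^ m)⁻¹) * pR q (q * a) b (q * c) (Z / q) (m - 1) y) := by
  have g1 : q * a * b = q * (a * b) := by ring
  have g2 : q * (a * b) * (q * c) * q ^ 2 * (Z / q) = q * (a * b * c * q ^ 2 * Z) := by
    field_simp
  have g3 : (Z / q)⁻¹ = q * Z⁻¹ := by rw [inv_div]; ring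
  have g4 : b * (q * c) = q * (b * c) := by ring
  simp only [pR, g1, g2, g3, g4]
  rw [core_eq_sum_of_le_right hq _ _ _ _ _ m (Nat.le_succ y),
    core_eq_sum_of_le_right hq _ _ _ _ _ m (le_refl (y + 1)),
    core_eq_sum_of_le_right hq _ _ _ _ _ m (le_refl y),
    core_eq_sum_of_le_right hq _ _ _ _ _ (m - 1) (le_refl y), Finset.mul_sum, Finset.mul_sum,
    ← Finset.sum_add_distrib]
  have hF : a * b * c * q ^ 2 * Z = (a * b) * c * q ^ 2 * Z := by ring
  set C := a * b with hC
  set D := b * c with hD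
  set F := C * c * q ^ 2 * Z with hFdef
  set G : ℕ → ℂ := fun k => qPoch ((q ^ m)⁻¹) q k * qPoch (D * q ^ (m + 1)) q k /
    (qPoch (q * b) q k * qPoch F q k * qPoch Z⁻¹ q k) * (q ^ k / qPoch q q k) with hG
  set B : ℕ → ℂ := fun k => qPoch (q ^ y)⁻¹ q k * qPoch (q * C * q * q ^ y) q k with hB
  have hY := pow_ne_zero y hq
  have hM := pow_ne_zero m hq
  have key : ∀ k, (1 - q * a * q ^ y) * coreTerm q C D (q * b) F Z⁻¹ m (q ^ y) (k + 1) +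
      q * a * q ^ y * (1 - q * b * q ^ y) *
        coreTerm q C D (q * b) F Z⁻¹ m (q ^ (y + 1)) (k + 1) =
      (1 - C * q ^ 2 * (q ^ y) ^ 2) * (G (k + 1) * B (k + 1) -
        G (k + 1) * (a * (1 - q * b * q ^ k) * (1 - q ^ (k + 1))) * B k) := by
    intro k
    have := basis_three_term (C := C) (e := q * a) (d := 0) hq hY k
    have e : (C * q ^ (k + 2) - q * a) * (q ^ k - 0) * (1 - (q ^ (k + 1))⁻¹) =
        a * (1 - q * b * q ^ k) * (1 - q ^ (k + 1)) := by
      have := pow_ne_zero k hq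
      rw [hC, pow_succ q k]
      field_simp
      ring
    have e' : C * q ^ 2 * q ^ y - q * a = - (q * a * (1 - q * b * q ^ y)) := by rw [hC]; ring
    rw [e, e'] at this
    simp only [coreTerm, hG, hB, pow_succ q y] at this ⊢
    generalize qPoch ((q ^ m)⁻¹) q (k + 1) * qPoch (D * q ^ (m + 1)) q (k + 1) = A
    generalize qPoch (q * b) q (k + 1) * qPoch F q (k + 1) * qPoch Z⁻¹ q (k + 1) = B
    generalize q ^ (k + 1) / qPoch q q (k + 1) = E
    linear_combination (A / B * E) * this
  rw [Finset.sum_range_succ', Finset.sum_congr rfl fun k _ => key k]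
  have key0 : (1 - q * a * q ^ y) * coreTerm q C D (q * b) F Z⁻¹ m (q ^ y) 0 +
      q * a * q ^ y * (1 - q * b * q ^ y) * coreTerm q C D (q * b) F Z⁻¹ m (q ^ (y + 1)) 0 =
      (1 - C * q ^ 2 * (q ^ y) ^ 2) * (G 0 * B 0) := by
    simp only [coreTerm, hG, hB, qPoch_zero, pow_zero, hC]
    ring
  rw [key0, ← Finset.mul_sum, ← mul_add, Finset.sum_sub_distrib, sub_add_eq_add_sub,
    ← Finset.sum_range_succ' (fun k => G k * B k), Finset.sum_range_succ _ (y + 1)]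
  have hbz : B (y + 1) = 0 := by simp [hB, qPoch_inv_pow_eq_zero hq (Nat.lt_succ_self y)]
  have hz0 : 1 - Z⁻¹ ≠ 0 := by simpa using h3 0 (Nat.zero_le _)
  have hF0 : 1 - F ≠ 0 := by simpa using h2 0 (Nat.zero_le _)
  have sh : ∀ z : ℂ, 1 - z ≠ 0 → ∀ k, qPoch (q * z) q k = qPoch z q k * (1 - z * q ^ k) / (1 - z) :=
    fun z hz k => by rw [eq_div_iff hz, ← qPoch_shift]; ring
  have hlast : (1 - (q ^ m)⁻¹) * ∑ k ∈ Finset.range (y + 1),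
      coreTerm q (q * C) (q * D) (q * b) (q * F) (q * Z⁻¹) (m - 1) (q ^ y) k =
      ∑ k ∈ Finset.range (y + 1), G k * (1 - (q ^ m)⁻¹ * q ^ k) *
        ((1 - F) * (1 - Z⁻¹) / ((1 - F * q ^ k) * (1 - Z⁻¹ * q ^ k))) * B k := by
    cases m with
    | zero =>
      symm
      simp only [pow_zero, inv_one, sub_self, zero_mul, one_mul]
      refine Finset.sum_eq_zero fun k _ => ?_
      cases k with
      | zero => simp
      | succ k => simp [hG, qPoch_succ']
    | succ m =>
      rw [Finset.mul_sum]
      refine Finset.sum_congr rfl fun k _ => ?_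
      have e1 : (q ^ m)⁻¹ = q * (q ^ (m + 1))⁻¹ := by
        have := pow_ne_zero m hq
        rw [pow_succ]; field_simp
      have e2 := qPoch_shift (q ^ (m + 1))⁻¹ q k
      have e3 : q * D * q ^ (m + 1) = D * q ^ (m + 1 + 1) := by ring
      simp only [coreTerm, Nat.add_sub_cancel, e1, e3, sh _ hz0, sh _ hF0, hG, hB]
      generalize qPoch (q * (q ^ (m + 1))⁻¹) q k = A1 at *
      generalize qPoch (q ^ (m + 1))⁻¹ q k = A2 at *
      simp only [div_eq_mul_inv, mul_inv, inv_inv]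
      linear_combination (qPoch (D * q ^ (m + 1 + 1)) q k *
        (qPoch (q ^ y)⁻¹ q k * qPoch (q * C * q * q ^ y) q k) * (qPoch (q * b) q k)⁻¹ *
        (qPoch F q k)⁻¹ * (1 - F * q ^ k)⁻¹ * (1 - F) * (qPoch Z⁻¹ q k)⁻¹ * (1 - Z⁻¹ * q ^ k)⁻¹ *
        (1 - Z⁻¹) * q ^ k * (qPoch q q k)⁻¹) * e2
  rw [hbz, mul_zero, add_zero, ← Finset.sum_sub_distrib, mul_assoc _ (1 - (q ^ m)⁻¹), hlast]
  congr 1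
  rw [Finset.mul_sum, Finset.mul_sum, ← Finset.sum_add_distrib]
  refine Finset.sum_congr rfl fun k hk => ?_
  have hk : k ≤ y := by simpa [Nat.lt_succ_iff] using hk
  have hzk := h3 k hk
  have h1k := h1 k hk
  have h2k := h2 k hk
  have hqk := hqn k hk
  have ct : coreTerm q (q * C) (q * D) (q * b) (q * F) (q * Z⁻¹) m (q ^ y) k =
      G k * ((1 - D * q * q ^ m * q ^ k) / (1 - D * q * q ^ m) * ((1 - F) * (1 - Z⁻¹) /
        ((1 - F * q ^ k) * (1 - Z⁻¹ * q ^ k)))) * B k := by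
    have e3 : q * D * q ^ (m + 1) = q * (D * q * q ^ m) := by ring
    have e4 : D * q ^ (m + 1) = D * q * q ^ m := by ring
    simp only [coreTerm, sh _ hz0, sh _ hF0, hG, hB, e3, e4, sh _ hD1]
    simp only [div_eq_mul_inv, mul_inv, inv_inv]
    ring
  have gs : G (k + 1) = G k * ((1 - (q ^ m)⁻¹ * q ^ k) * (1 - D * q * q ^ m * q ^ k) * q /
      ((1 - q * b * q ^ k) * (1 - F * q ^ k) * (1 - Z⁻¹ * q ^ k) * (1 - q ^ (k + 1)))) := by
    have e4 : D * q ^ (m + 1) = D * q * q ^ m := by ring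
    simp only [hG, qPoch_succ, ← pow_succ', e4]
    rw [pow_succ]
    generalize qPoch ((q ^ m)⁻¹) q k = A
    generalize qPoch (D * q * q ^ m) q k = A'
    generalize qPoch (q * b) q k = B1
    generalize qPoch F q k = B2
    generalize qPoch Z⁻¹ q k = B3
    generalize qPoch q q k = B4
    simp only [div_eq_mul_inv, mul_inv]
    ring
  rw [gs, ct]
  have hQ := pow_ne_zero k hq
  have hD0 : D ≠ 0 := mul_ne_zero n2 n3
  have main : (1 - F * q ^ k) * (1 - Z⁻¹ * q ^ k) -
      (1 - (q ^ m)⁻¹ * q ^ k) * (1 - D * q * q ^ m * q ^ k) * q * a =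
      (1 - F * q ^ m) * (1 - q ^ m / Z) / (1 - D * q * (q ^ m) ^ 2) *
        (1 - D * q * q ^ m * q ^ k) +
      (1 - a * q * Z / q ^ m) * (1 - (Z * D * q * q ^ m)⁻¹) / (1 - (D * q * (q ^ m) ^ 2)⁻¹) *
        (1 - (q ^ m)⁻¹ * q ^ k) := by
    have x1 : 1 - (D * q * (q ^ m) ^ 2)⁻¹ = - (1 - D * q * (q ^ m) ^ 2) / (D * q * (q ^ m) ^ 2) := by
      field_simp; ring
    have x2 : F = a * D * q ^ 2 * Z := by rw [hFdef, hC, hD]; ring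
    rw [x1, x2]
    clear_value D
    obtain ⟨W, hW⟩ : ∃ W, W = 1 - D * q * (q ^ m) ^ 2 := ⟨_, rfl⟩
    rw [← hW] at hD2 ⊢
    field_simp
    rw [hW]
    ring
  have hFk : 1 - F * q ^ k ≠ 0 := h2k
  clear_value G B F
  have lhs : G k * B k - G k * ((1 - (q ^ m)⁻¹ * q ^ k) * (1 - D * q * q ^ m * q ^ k) * q /
      ((1 - q * b * q ^ k) * (1 - F * q ^ k) * (1 - Z⁻¹ * q ^ k) * (1 - q ^ (k + 1)))) *
        (a * (1 - q * b * q ^ k) * (1 - q ^ (k + 1))) * B k =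
      G k * B k * (((1 - F * q ^ k) * (1 - Z⁻¹ * q ^ k) -
      (1 - (q ^ m)⁻¹ * q ^ k) * (1 - D * q * q ^ m * q ^ k) * q * a) /
        ((1 - F * q ^ k) * (1 - Z⁻¹ * q ^ k))) := by
    generalize 1 - q * b * q ^ k = W1 at *
    generalize 1 - F * q ^ k = W2 at *
    generalize 1 - Z⁻¹ * q ^ k = W3 at *
    generalize 1 - q ^ (k + 1) = W4 at *
    generalize 1 - (q ^ m)⁻¹ * q ^ k = W5 at *
    generalize 1 - D * q * q ^ m * q ^ k = W6 at *
    field_simp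
  rw [lhs, main]
  clear lhs main gs ct key key0 hlast
  generalize 1 - F * q ^ k = W2 at *
  generalize 1 - Z⁻¹ * q ^ k = W3 at *
  generalize 1 - (q ^ m)⁻¹ * q ^ k = W5 at *
  generalize 1 - D * q * q ^ m * q ^ k = W6 at *
  generalize 1 - D * q * q ^ m = W7 at *
  generalize 1 - F = W8 at *
  generalize 1 - Z⁻¹ = W9 at *
  generalize (1 - (D * q * (q ^ m) ^ 2)⁻¹) = V1
  generalize (1 - D * q * (q ^ m) ^ 2) = V2
  simp only [div_eq_mul_inv, mul_inv]
  have i7 := mul_inv_cancel₀ hD1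
  have i8 := mul_inv_cancel₀ hF0
  have i9 := mul_inv_cancel₀ hz0
  field_simp

/-- The sum in the Racah relation. -/
def racSum (q a1 a2 a3 : ℂ) (K n m : ℕ) : ℂ :=
  ∑ x ∈ Finset.range (K + 1),
    wt q (a1 * a2) (q ^ K) (a1 * a2 * a3 * q ^ 2 * q ^ K) 0 x * pR q a1 a2 a3 (q ^ K) n x *
      pR q a2 a1 a3 (q ^ K) m x

/-- The factor of the Racah relation that depends on `n`. -/
def racU (q a2 a3 : ℂ) (n : ℕ) : ℂ :=
  qPoch (q * a3) q n / (qPoch (q * a2) q n * (-a3) ^ n * q ^ ((n + 1).choose 2))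

/-- The factor of the Racah relation that depends on `m`. -/
def racV (q a1 a2 a3 : ℂ) (K m : ℕ) : ℂ :=
  qPoch (a1 * a2 * q ^ 2) q K / (qPoch (q * a1) q m * qPoch (a3 * q ^ K)⁻¹ q (K - m))

theorem racU_succ {q : ℂ} (a2 a3 : ℂ) (n : ℕ) :
    racU q a2 a3 (n + 1) = - (1 - q * a3) / ((1 - q * a2) * (q * a3)) *
      racU q (q * a2) (q * a3) n := by
  rw [racU, racU, qPoch_succ', qPoch_succ', Nat.choose_succ_succ (n + 1) 1, Nat.choose_one_right,
    pow_add q, pow_succ (-a3), show -(q * a3) = q * -a3 by ring, mul_pow, pow_succ q n]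
  generalize qPoch (q * (q * a3)) q n = A
  generalize qPoch (q * (q * a2)) q n = B
  generalize q ^ ((n + 1).choose 2) = E
  generalize (-a3) ^ n = T
  rw [show T * -a3 = -(T * a3) by ring]
  simp only [div_eq_mul_inv, mul_inv, inv_neg]
  ring

theorem racSum_zero {q a1 a2 a3 : ℂ} (h : Gen3 q a1 a2 a3) {K m : ℕ} (hm : m ≤ K) :
    racSum q a1 a2 a3 K 0 m = racV q a1 a2 a3 K m := by
  obtain ⟨l, rfl⟩ := Nat.exists_eq_add_of_le hm
  have hq := h.hq
  have n3 := h.n3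
  have := sum_wt_pR hq h.hqn l m (a1 := a2) (a2 := a1) (a3 := a3) (d := 0) h.n2 h.n1 h.n3
    (fun k => h.A12.ne (k + 1 : ℕ) (by rw [zpow_natCast]; ring))
    (fun k => h.A1.ne (k + 1 : ℕ) (by rw [zpow_natCast]; ring))
    (fun k => h.A123.ne (k + 2 + (m + l) : ℕ) (by rw [zpow_natCast]; ring))
    (fun k => h.A3.inv hq 0 (b := a3⁻¹) (by simp) |>.ne ((k : ℤ) - (m + l : ℕ)) (by
      rw [zpow_sub₀ hq, zpow_natCast, zpow_natCast]
      have := pow_ne_zero (m + l) hq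
      field_simp))
    (fun k => by simp)
  rw [racSum]
  simp only [pR_zero_left, mul_one, mul_comm a1 a2]
  rw [this, racV, Nat.add_sub_cancel_left]
  have z : ∀ k, qPoch 0 q k = 1 := fun k => by simp [qPoch]
  simp only [mul_zero, zero_mul, z, mul_one, mul_comm a1 a2]

theorem racSum_succ {q a1 a2 a3 : ℂ} (h : Gen3 q a1 a2 a3) {K n : ℕ} (m : ℕ) (hn : n ≤ K) :
    racSum q a1 a2 a3 (K + 1) (n + 1) m =
      (1 - a1 * a2 * q ^ 2) / (1 - q * a2) *
        ((1 - a1 * a2 * a3 * q ^ 2 * q ^ (K + 1) * q ^ m) * (1 - q ^ m / q ^ (K + 1)) *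
            (1 - a1 * a3 * q * q ^ m) /
            ((1 - a1 * a2 * a3 * q ^ 2 * q ^ (K + 1)) * (1 - (q ^ (K + 1))⁻¹) *
              (1 - a1 * a3 * q * (q ^ m) ^ 2)) * racSum q a1 (q * a2) (q * a3) K n m +
          (1 - a2 * q * q ^ (K + 1) / q ^ m) * (1 - (q ^ (K + 1) * (a1 * a3) * q * q ^ m)⁻¹) /
            ((1 - a1 * a2 * a3 * q ^ 2 * q ^ (K + 1)) * (1 - (q ^ (K + 1))⁻¹) *
              (1 - (a1 * a3 * q * (q ^ m) ^ 2)⁻¹)) * (1 - (q ^ m)⁻¹) *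
            racSum q a1 (q * a2) (q * a3) K n (m - 1)) := by
  have hq := h.hq
  have hqn := h.hqn
  have n1 := h.n1
  have n2 := h.n2
  have n3 := h.n3
  obtain ⟨Z, hZdef⟩ : ∃ Z, Z = q ^ (K + 1) := ⟨_, rfl⟩
  have hZq : q ^ K = Z / q := by rw [hZdef, pow_succ]; field_simp
  have hZ0 : Z ≠ 0 := hZdef ▸ pow_ne_zero _ hq
  have hZ1 : 1 - Z⁻¹ ≠ 0 := by
    simpa [hZdef] using one_sub_inv_pow hq hqn (show 0 < K + 1 by omega)
  obtain ⟨b, hb⟩ : ∃ b, b = a1 * a2 * a3 * q ^ 2 * Z := ⟨_, rfl⟩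
  have hb0 : b ≠ 0 := by rw [hb]; positivity
  have k1 : ∀ k : ℕ, 1 - a1 * a2 * q * q ^ k ≠ 0 := fun k =>
    h.A12.ne (k + 1 : ℕ) (by rw [zpow_natCast]; ring)
  have k2 : ∀ k : ℕ, 1 - q * a2 * q ^ k ≠ 0 := fun k =>
    h.A2.ne (k + 1 : ℕ) (by rw [zpow_natCast]; ring)
  have k2' : ∀ k : ℕ, 1 - q * a1 * q ^ k ≠ 0 := fun k =>
    h.A1.ne (k + 1 : ℕ) (by rw [zpow_natCast]; ring)
  have k3 : ∀ k : ℕ, 1 - b * q ^ k ≠ 0 := fun k =>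
    h.A123.ne (k + K + 3 : ℕ) (by rw [zpow_natCast, hb, hZdef]; ring)
  have k4 : ∀ k : ℕ, 1 - a1 * a2 * q ^ 2 / b * q ^ k ≠ 0 := fun k =>
    h.A3.inv hq 0 (b := a3⁻¹) (by simp) |>.ne ((k : ℤ) - (K + 1 : ℕ)) (by
      rw [zpow_sub₀ hq, zpow_natCast, zpow_natCast, hb, hZdef]
      have := pow_ne_zero (K + 1) hq
      field_simp)
  have k5 : 1 - a1 * a3 * q * q ^ m ≠ 0 := h.A13.ne (m + 1 : ℕ) (by rw [zpow_natCast]; ring)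
  have k6 : 1 - a1 * a3 * q * (q ^ m) ^ 2 ≠ 0 :=
    h.A13.ne (2 * m + 1 : ℕ) (by rw [zpow_natCast]; ring)
  have w2 : 1 - q * a2 ≠ 0 := by simpa using k2 0
  have w1 : 1 - b ≠ 0 := by simpa using k3 0
  have g1 : a1 * (q * a2) = q * (a1 * a2) := by ring
  have g2 : q * (a1 * a2) * (q * a3) * q ^ 2 * (Z / q) = q * b := by rw [hb]; field_simp
  rw [racSum, racSum, racSum, hZq, ← hZdef, g1, g2, ← hb]
  have := sum_shift (K := K)
    (f := fun x => wt q (a1 * a2) Z b 0 x * pR q a1 a2 a3 Z (n + 1) x * pR q a2 a1 a3 Z m x)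
    (g := fun x => pR q a1 (q * a2) (q * a3) (Z / q) n x)
    (A := fun x => raiseU q (a1 * a2) (q * a2) b Z⁻¹ (q ^ x) * wt q (a1 * a2) Z b 0 x *
      pR q a2 a1 a3 Z m x)
    (B := fun x => raiseV q (a1 * a2) (q * a2) b Z⁻¹ (q ^ x) * wt q (a1 * a2) Z b 0 x *
      pR q a2 a1 a3 Z m x)
    (c := fun x => (1 - a1 * a2 * q ^ 2) / (1 - q * a2) * wt q (q * (a1 * a2)) (Z / q) (q * b) 0 x *
      ((1 - b * q ^ m) * (1 - q ^ m / Z) * (1 - a1 * a3 * q * q ^ m) /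
          ((1 - b) * (1 - Z⁻¹) * (1 - a1 * a3 * q * (q ^ m) ^ 2)) *
          pR q (q * a2) a1 (q * a3) (Z / q) m x +
        (1 - a2 * q * Z / q ^ m) * (1 - (Z * (a1 * a3) * q * q ^ m)⁻¹) /
          ((1 - b) * (1 - Z⁻¹) * (1 - (a1 * a3 * q * (q ^ m) ^ 2)⁻¹)) *
          (1 - (q ^ m)⁻¹) * pR q (q * a2) a1 (q * a3) (Z / q) (m - 1) x)) ?_ ?_ ?_ ?_
  · rw [this]
    simp only [Finset.mul_sum, ← Finset.sum_add_distrib]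
    exact Finset.sum_congr rfl fun x _ => by ring
  · intro x hx
    rw [pR_raise x hq (mul_ne_zero n1 n2) hZ0
      (by rw [← neg_ne_zero]; convert k1 (2 * x) using 1; ring) (fun k _ => k2 k)
      (fun k _ => by rw [← hb]; exact k3 k)
      (fun k hk => by rw [hZdef]; exact one_sub_inv_pow hq hqn (by omega)) (fun k _ => hqn k), ← hb]
    ring
  · simp [raiseV_one]
  · have : 1 - Z⁻¹ * q ^ (K + 1) = 0 := by rw [← hZdef, inv_mul_cancel₀ hZ0, sub_self]
    simp [raiseU, this]
  · intro x hx
    obtain ⟨r1, r2⟩ := wt_raise (x := x) (d := 0) hq hqn (mul_ne_zero n1 n2) hZ0 hb0 hZ1 w1 w2 k1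
      (by convert k1 (K + 2 + x) using 2; rw [hZdef]; ring) (k4 x) (by simp) (by simp)
    have hb' : a2 * a1 * a3 * q ^ 2 * Z = b := by rw [hb]; ring
    have r3 := pR_four_term (m := m) (y := x) hq n2 n1 n3 hZ0 (fun k _ => k2' k)
      (fun k _ => by rw [hb']; exact k3 k)
      (fun k hk => by rw [hZdef]; exact one_sub_inv_pow hq hqn (by omega)) (fun k _ => hqn k) k5 k6
    rw [hb', mul_comm a2 a1] at r3
    have w4 : 1 - a1 * a2 * q ^ 2 * (q ^ x) ^ 2 ≠ 0 := by convert k1 (2 * x + 1) using 2; ring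
    rw [r1, r2]
    simp only [mul_zero, zero_mul, sub_zero, mul_one]
    generalize (1 - a1 * a2 * q ^ 2) / (1 - q * a2) * wt q (q * (a1 * a2)) (Z / q) (q * b) 0 x = w
    refine Eq.trans ?_ (congrArg (fun t => w * t) (eq_div_of_mul_eq w4 ((mul_comm _ _).trans r3.symm)).symm)
    ring

theorem racV_shift {q a1 a2 a3 : ℂ} (h : Gen3 q a1 a2 a3) {K m : ℕ} (hm : m ≤ K) :
    racV q a1 a2 a3 (K + 1) m = (1 - a1 * a2 * q ^ 2) / (1 - (a3 * q * q ^ m)⁻¹) *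
      racV q a1 (q * a2) (q * a3) K m := by
  obtain ⟨l, rfl⟩ := Nat.exists_eq_add_of_le hm
  have hq := h.hq
  have n3 := h.n3
  have e1 : (a3 * q ^ (m + l + 1))⁻¹ * q ^ l = (a3 * q * q ^ m)⁻¹ := by
    have := pow_ne_zero l hq
    have := pow_ne_zero m hq
    rw [pow_succ, pow_add]; field_simp
  have e2 : q * a3 * q ^ (m + l) = a3 * q ^ (m + l + 1) := by ring
  have e3 : a1 * (q * a2) * q ^ 2 = q * (a1 * a2 * q ^ 2) := by ring
  rw [racV, racV, show m + l + 1 - m = l + 1 by omega, Nat.add_sub_cancel_left, qPoch_succ', e2, e3,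
    qPoch_succ _ q l, e1]
  simp only [div_eq_mul_inv, mul_inv]
  ring

theorem racV_succ {q : ℂ} (a1 a2 a3 : ℂ) (K m : ℕ) :
    racV q a1 a2 a3 (K + 1) (m + 1) = (1 - a1 * a2 * q ^ 2) / (1 - a1 * q * q ^ m) *
      racV q a1 (q * a2) (q * a3) K m := by
  have e2 : q * a3 * q ^ K = a3 * q ^ (K + 1) := by ring
  have e3 : a1 * (q * a2) * q ^ 2 = q * (a1 * a2 * q ^ 2) := by ring
  rw [racV, racV, Nat.add_sub_add_right, qPoch_succ', e2, e3, qPoch_succ (q * a1), mul_comm a1 q]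
  simp only [div_eq_mul_inv, mul_inv]
  ring

theorem racSum_eq (n : ℕ) : ∀ {q a1 a2 a3 : ℂ} (_ : Gen3 q a1 a2 a3) {K m : ℕ} (_ : n ≤ K)
    (_ : m ≤ K), racSum q a1 a2 a3 K n m =
      racU q a2 a3 n * racV q a1 a2 a3 K m * pR q a1 a3 a2 (q ^ K) n m := by
  induction n with
  | zero =>
    intro q a1 a2 a3 h K m _ hm
    rw [racSum_zero h hm, pR_zero_left]
    simp [racU, qPoch_zero]
  | succ n ih =>
    intro q a1 a2 a3 h K m hn hm
    obtain ⟨K, rfl⟩ : ∃ K', K = K' + 1 := ⟨K - 1, by omega⟩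
    have hq := h.hq
    have hqn := h.hqn
    have n1 := h.n1
    have n2 := h.n2
    have n3 := h.n3
    have hM := pow_ne_zero m hq
    obtain ⟨Z, hZdef⟩ : ∃ Z, Z = q ^ (K + 1) := ⟨_, rfl⟩
    have hZq : q ^ (K + 1) / q = q ^ K := by rw [pow_succ]; field_simp
    have hZ0 : Z ≠ 0 := hZdef ▸ pow_ne_zero _ hq
    have hZ1 : 1 - Z⁻¹ ≠ 0 := by
      simpa [hZdef] using one_sub_inv_pow hq hqn (show 0 < K + 1 by omega)
    have k3 : ∀ k : ℕ, 1 - a1 * a2 * a3 * q ^ 2 * Z * q ^ k ≠ 0 := fun k =>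
      h.A123.ne (k + K + 3 : ℕ) (by rw [zpow_natCast, hZdef]; ring)
    have w1 : 1 - a1 * a2 * a3 * q ^ 2 * Z ≠ 0 := by simpa using k3 0
    have w2 : 1 - q * a2 ≠ 0 := h.A2.ne 1 (by simp)
    have w3 : 1 - q * a3 ≠ 0 := h.A3.ne 1 (by simp)
    have w4 : 1 - a1 * a3 * q * (q ^ m) ^ 2 ≠ 0 :=
      h.A13.ne (2 * m + 1 : ℕ) (by rw [zpow_natCast]; ring)
    have w5 : 1 - q * a3 * q ^ m ≠ 0 := h.A3.ne (m + 1 : ℕ) (by rw [zpow_natCast]; ring)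
    have w6 : 1 - a1 * a2 * q ^ 2 ≠ 0 := h.A12.ne (2 : ℕ) (by rw [zpow_natCast]; ring)
    have hF : a1 * a3 * a2 * q ^ 2 * Z = a1 * a2 * a3 * q ^ 2 * Z := by ring
    rw [racSum_succ h m (by omega), pR_raise m hq (mul_ne_zero n1 n3) (by rw [← hZdef]; exact hZ0)
      (by rw [← neg_ne_zero, neg_sub]; exact w4)
      (fun k _ => h.A3.ne (k + 1 : ℕ) (by rw [zpow_natCast]; ring))
      (fun k _ => by rw [← hZdef, hF]; exact k3 k)
      (fun k hk => one_sub_inv_pow hq hqn (by omega)) (fun k _ => hqn k), hZq, ← hZdef, hF,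
      racU_succ, mul_add, mul_add]
    congr 1
    · rcases Nat.lt_or_ge K m with hm' | hm'
      · obtain rfl : m = K + 1 := by omega
        rw [← hZdef, raiseU, div_self hZ0, inv_mul_cancel₀ hZ0]
        simp
      · rw [ih h.shift23 (by omega) hm', racV_shift h hm', raiseU]
        have x1 : 1 - (a3 * q * q ^ m)⁻¹ = - (1 - q * a3 * q ^ m) / (a3 * q * q ^ m) := by
          field_simp; ring
        have x2 : a1 * a3 * q * (q ^ m) ^ 2 - 1 = - (1 - a1 * a3 * q * (q ^ m) ^ 2) := by ring
        have x3 : a1 * a3 * q * q ^ m - 1 = - (1 - a1 * a3 * q * q ^ m) := by ring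
        rw [x1, x2, x3, ← div_eq_inv_mul]
        generalize racU q (q * a2) (q * a3) n = U
        generalize racV q a1 (q * a2) (q * a3) K m = V
        generalize pR q a1 (q * a3) (q * a2) (q ^ K) n m = R
        generalize a1 * a2 * a3 * q ^ 2 * Z = F at *
        generalize 1 - F * q ^ m = V1
        generalize 1 - a1 * a3 * q * q ^ m = V2
        generalize 1 - q ^ m / Z = V3
        generalize 1 - F = W1 at *
        generalize 1 - q * a2 = W2 at *
        generalize 1 - q * a3 = W3 at *
        generalize 1 - a1 * a3 * q * (q ^ m) ^ 2 = W4 at *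
        generalize 1 - q * a3 * q ^ m = W5 at *
        generalize 1 - a1 * a2 * q ^ 2 = W6 at *
        generalize 1 - Z⁻¹ = W7 at *
        field_simp
    · cases m with
      | zero => rw [pow_zero, raiseV_one]; simp
      | succ m =>
        rw [ih h.shift23 (by omega) (show m + 1 - 1 ≤ K by omega), Nat.add_sub_cancel, racV_succ,
          raiseV]
        have w7 : 1 - a1 * q * q ^ m ≠ 0 := h.A1.ne (m + 1 : ℕ) (by rw [zpow_natCast]; ring)
        have hm0 := pow_ne_zero m hq
        have x2 : a1 * a3 * q * (q ^ (m + 1)) ^ 2 - 1 = - (1 - a1 * a3 * q * (q ^ (m + 1)) ^ 2) := by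
          ring
        have x3 : a1 * a3 * q * q ^ (m + 1) - q * a3 = - (q * a3 * (1 - a1 * q * q ^ m)) := by ring
        have x4 : a1 * a3 * q * q ^ (m + 1) - a1 * a2 * a3 * q ^ 2 * Z =
            a1 * a3 * q * q ^ (m + 1) * (1 - a2 * q * Z / q ^ (m + 1)) := by field_simp
        have x5 : a1 * a3 * q * q ^ (m + 1) - Z⁻¹ =
            a1 * a3 * q * q ^ (m + 1) * (1 - (Z * (a1 * a3) * q * q ^ (m + 1))⁻¹) := by field_simp
        have x6 : 1 - (a1 * a3 * q * (q ^ (m + 1)) ^ 2)⁻¹ =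
            - (1 - a1 * a3 * q * (q ^ (m + 1)) ^ 2) / (a1 * a3 * q * (q ^ (m + 1)) ^ 2) := by
          field_simp; ring
        have x7 : 1 - (q ^ (m + 1))⁻¹ = (q ^ (m + 1) - 1) / q ^ (m + 1) := by field_simp
        rw [x2, x3, x4, x5, x6, x7]
        clear x2 x3 x4 x5 x6 x7 ih hF
        generalize racU q (q * a2) (q * a3) n = U
        generalize racV q a1 (q * a2) (q * a3) K m = V
        generalize pR q a1 (q * a3) (q * a2) (q ^ K) n m = R
        generalize a1 * a2 * a3 * q ^ 2 * Z = F at *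
        generalize 1 - a2 * q * Z / q ^ (m + 1) = V1
        generalize 1 - (Z * (a1 * a3) * q * q ^ (m + 1))⁻¹ = V2
        generalize q ^ (m + 1) - 1 = V3
        generalize 1 - F = W1 at *
        generalize 1 - q * a2 = W2 at *
        generalize 1 - q * a3 = W3 at *
        generalize 1 - a1 * a3 * q * (q ^ (m + 1)) ^ 2 = W4 at *
        generalize 1 - a1 * a2 * q ^ 2 = W6 at *
        generalize 1 - Z⁻¹ = W7 at *
        generalize 1 - a1 * q * q ^ m = W8 at *
        generalize q ^ (m + 1) = M at *
        field_simp

theorem inv_reducedPoch' {c q : ℂ} (hc : Av q c) {n K : ℕ} (hn : n ≤ K) :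
    (reducedPoch c q n K)⁻¹ = (1 - c * q ^ (2 * n + 1)) / qPoch (c * q ^ (n + 1)) q (K + 1) :=
  inv_reducedPoch c q hn (hc.ne (2 * n + 1 : ℕ) (by rw [zpow_natCast]; ring))

/-- `Ω` with the last product in its unreduced form. -/
theorem Omega_eq {r s1 s2 s3 : ℂ} (h : Gen3 (r ^ 2) (s1 ^ 2) (s2 ^ 2) (s3 ^ 2)) {n K : ℕ}
    (hn : n ≤ K) :
    Omega r n s1 s2 s3 K =
      qPoch (r ^ 2) (r ^ 2) K / (qPoch (r ^ 2) (r ^ 2) n * qPoch (r ^ 2) (r ^ 2) (K - n)) *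
        (qPoch (r ^ 2 * s2 ^ 2) (r ^ 2) n *
          qPoch (s1 ^ 2 * s2 ^ 2 * s3 ^ 2 * (r ^ 2) ^ (K + 2)) (r ^ 2) n *
          qPoch (r ^ 2 * s1 ^ 2) (r ^ 2) (K - n)) /
        (((r * s2) ^ n) ^ 2 * qPoch (r ^ 2 * s3 ^ 2) (r ^ 2) n) * (r * s2) ^ K *
        ((1 - s2 ^ 2 * s3 ^ 2 * (r ^ 2) ^ (2 * n + 1)) /
          qPoch (s2 ^ 2 * s3 ^ 2 * (r ^ 2) ^ (n + 1)) (r ^ 2) (K + 1)) := by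
  have hr : r * s2 ≠ 0 := by
    have h1 := h.hq
    have h2 := h.n2
    refine mul_ne_zero ?_ ?_ <;> rintro rfl <;> simp at h1 h2
  rw [Omega, qBinom, if_pos hn, ← inv_reducedPoch' h.A23 hn, zpow_sub₀ hr, zpow_mul, zpow_natCast,
    zpow_natCast]
  rw [show ((r * s2) ^ (2 : ℤ)) ^ n = ((r * s2) ^ n) ^ 2 by
    rw [← pow_mul, mul_comm n, pow_mul]; norm_cast]
  generalize reducedPoch (s2 ^ 2 * s3 ^ 2) (r ^ 2) n K = R
  generalize (r * s2) ^ n = T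
  generalize (r * s2) ^ K = T'
  simp only [div_eq_mul_inv, mul_inv, inv_inv]
  ring

theorem Omega_zero {r s1 s2 s3 : ℂ} (h : Gen3 (r ^ 2) (s1 ^ 2) (s2 ^ 2) (s3 ^ 2)) (K : ℕ) :
    Omega r 0 s1 s2 s3 K = qPoch (r ^ 2 * s1 ^ 2) (r ^ 2) K * (r * s2) ^ K /
      qPoch (s2 ^ 2 * s3 ^ 2 * (r ^ 2) ^ 2) (r ^ 2) K := by
  have e : 1 - s2 ^ 2 * s3 ^ 2 * r ^ 2 ≠ 0 := h.A23.ne 1 (by simp; ring)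
  have e2 : qPoch (r ^ 2) (r ^ 2) K ≠ 0 := qPoch_ne_zero fun l _ => by
    rw [← pow_succ']; exact h.hqn l
  rw [Omega_eq h (Nat.zero_le K)]
  simp only [qPoch_zero, pow_zero, mul_zero, zero_add, pow_one, Nat.sub_zero, one_pow, mul_one,
    one_mul]
  rw [qPoch_succ', show r ^ 2 * (s2 ^ 2 * s3 ^ 2 * r ^ 2) = s2 ^ 2 * s3 ^ 2 * (r ^ 2) ^ 2 by ring]
  generalize qPoch (s2 ^ 2 * s3 ^ 2 * (r ^ 2) ^ 2) (r ^ 2) K = Q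
  generalize 1 - s2 ^ 2 * s3 ^ 2 * r ^ 2 = W at *
  field_simp

theorem wo_zero {q a1 a2 a3 : ℂ} (h : Gen3 q a1 a2 a3) (Z : ℂ) : wo q a1 a2 a3 Z 0 = 1 := by
  rw [wo, vwp_zero (h.A12.ne 1 (by simp; ring))]
  simp [pr_zero]

theorem wo_step {q a1 a2 a3 Z : ℂ} (h : Gen3 q a1 a2 a3) (hZ : Z ≠ 0) (n : ℕ) :
    wo q a1 a2 a3 Z (n + 1) = wo q a1 a2 a3 Z n *
      ((1 - a1 * a2 * q ^ 3 * (q ^ n) ^ 2) * (1 - a1 * a2 * q * q ^ n) /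
          ((1 - a1 * a2 * q * (q ^ n) ^ 2) * (1 - q * q ^ n)) *
        ((1 - Z⁻¹ * q ^ n) / (1 - a1 * a2 * q ^ 2 * Z * q ^ n)) *
        ((1 - q * a2 * q ^ n) / (1 - q * a1 * q ^ n)) *
        ((1 - a1 * a2 * a3 * q ^ 2 * Z * q ^ n) / (1 - (a3 * Z)⁻¹ * q ^ n)) *
        (q * (a2 * a3))⁻¹) := by
  have n1 := h.n1
  have n2 := h.n2
  have n3 := h.n3
  have hq := h.hq
  have e1 : a1 * a2 * q ^ 2 / Z⁻¹ = a1 * a2 * q ^ 2 * Z := by rw [div_inv_eq_mul]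
  have e2 : a1 * a2 * q ^ 2 / (q * a2) = q * a1 := by field_simp
  have e3 : a1 * a2 * q ^ 2 / (a1 * a2 * a3 * q ^ 2 * Z) = (a3 * Z)⁻¹ := by field_simp
  rw [wo, wo, vwp_succ (h.A12.ne (2 * n + 1 : ℕ) (by rw [zpow_natCast]; ring)), pr_succ, pr_succ,
    pr_succ, e1, e2, e3, pow_succ _ n]
  ring

theorem Omega_succ {r s1 s2 s3 : ℂ} (h : Gen3 (r ^ 2) (s1 ^ 2) (s2 ^ 2) (s3 ^ 2)) {n K : ℕ}
    (hn : n + 1 ≤ K) :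
    Omega r (n + 1) s1 s2 s3 K = Omega r n s1 s2 s3 K *
      ((1 - s3 ^ 2 * s2 ^ 2 * (r ^ 2) ^ 3 * ((r ^ 2) ^ n) ^ 2) * (1 - s3 ^ 2 * s2 ^ 2 * r ^ 2 * (r ^ 2) ^ n) /
          ((1 - s3 ^ 2 * s2 ^ 2 * r ^ 2 * ((r ^ 2) ^ n) ^ 2) * (1 - r ^ 2 * (r ^ 2) ^ n)) *
        ((1 - ((r ^ 2) ^ K)⁻¹ * (r ^ 2) ^ n) / (1 - s3 ^ 2 * s2 ^ 2 * (r ^ 2) ^ 2 * (r ^ 2) ^ K * (r ^ 2) ^ n)) *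
        ((1 - r ^ 2 * s2 ^ 2 * (r ^ 2) ^ n) / (1 - r ^ 2 * s3 ^ 2 * (r ^ 2) ^ n)) *
        ((1 - s3 ^ 2 * s2 ^ 2 * s1 ^ 2 * (r ^ 2) ^ 2 * (r ^ 2) ^ K * (r ^ 2) ^ n) /
          (1 - (s1 ^ 2 * (r ^ 2) ^ K)⁻¹ * (r ^ 2) ^ n)) *
        (r ^ 2 * (s2 ^ 2 * s1 ^ 2))⁻¹) := by
  obtain ⟨m, rfl⟩ := Nat.exists_eq_add_of_le hn
  have hrs : (r * s2) ^ 2 = r ^ 2 * s2 ^ 2 := by ring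
  rw [Omega_eq h hn, Omega_eq h (Nat.le_of_succ_le hn), Nat.add_sub_cancel_left,
    show n + 1 + m - n = m + 1 by omega, pow_succ (r * s2) n, mul_pow _ (r * s2), hrs]
  have hq := h.hq
  have n1 := h.n1
  have n2 := h.n2
  have k1 : ∀ k : ℕ, 1 - s2 ^ 2 * s3 ^ 2 * (r ^ 2) ^ (k + 1) ≠ 0 := fun k =>
    h.A23.ne (k + 1 : ℕ) (by rw [zpow_natCast]; ring)
  have k2 : ∀ k : ℕ, 1 - r ^ 2 * s1 ^ 2 * (r ^ 2) ^ k ≠ 0 := fun k =>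
    h.A1.ne (k + 1 : ℕ) (by rw [zpow_natCast]; ring)
  have k3 := h.hqn
  generalize r ^ 2 = q at *
  generalize s1 ^ 2 = c1 at *
  generalize s2 ^ 2 = c2 at *
  generalize s3 ^ 2 = c3 at *
  have hN := pow_ne_zero n hq
  have hm := pow_ne_zero m hq
  have x1 : 1 - (q ^ (n + 1 + m))⁻¹ * q ^ n = - (1 - q ^ (m + 1)) / q ^ (m + 1) := by
    rw [show n + 1 + m = n + (m + 1) by ring, pow_add q n]
    have := pow_ne_zero (m + 1) hq
    field_simp; ring
  have x2 : 1 - (c1 * q ^ (n + 1 + m))⁻¹ * q ^ n =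
      - (1 - q * c1 * q ^ m) / (c1 * q ^ (m + 1)) := by
    rw [show n + 1 + m = n + (m + 1) by ring, pow_add q n]
    have := pow_ne_zero (m + 1) hq
    field_simp; ring
  have x3 : qPoch (c2 * c3 * q ^ (n + 1 + 1)) q (n + 1 + m + 1) =
      qPoch (c2 * c3 * q ^ (n + 1)) q (n + 1 + m + 1) *
        (1 - c2 * c3 * q ^ (n + n + m + 2 + 1)) / (1 - c2 * c3 * q ^ (n + 1)) := by
    rw [eq_div_iff (k1 n), show c2 * c3 * q ^ (n + n + m + 2 + 1) =
      c2 * c3 * q ^ (n + 1) * q ^ (n + 1 + m + 1) by ring, ← qPoch_shift]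
    ring_nf
  have y1 : c3 * c2 * c1 * q ^ 2 * q ^ (n + 1 + m) * q ^ n =
      c1 * c2 * c3 * q ^ (n + 1 + m + 2) * q ^ n := by ring
  have y2 : c3 * c2 * q ^ 3 * (q ^ n) ^ 2 = c2 * c3 * q ^ (2 * n + 2 + 1) := by ring
  have y3 : c3 * c2 * q * (q ^ n) ^ 2 = c2 * c3 * q ^ (2 * n + 1) := by ring
  have y4 : c3 * c2 * q * q ^ n = c2 * c3 * q ^ (n + 1) := by ring
  have y5 : c3 * c2 * q ^ 2 * q ^ (n + 1 + m) * q ^ n = c2 * c3 * q ^ (n + n + m + 2 + 1) := by ring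
  have y6 : 2 * (n + 1) + 1 = 2 * n + 2 + 1 := by ring
  rw [x1, x2, x3, y1, y2, y3, y4, y5, y6, qPoch_succ _ q n, qPoch_succ _ q n, qPoch_succ _ q n,
    qPoch_succ _ q n, qPoch_succ _ q m, qPoch_succ _ q m, ← pow_succ' q m]
  have z1 := k1 n
  have z2 := k1 (2 * n)
  have z4 := k1 (2 * n + 2)
  have z5 := k2 m
  have z6 := k3 m
  have z7 : qPoch (q * c1) q m ≠ 0 := qPoch_ne_zero fun l _ => k2 l
  have z8 : qPoch q q m ≠ 0 := qPoch_ne_zero fun l _ => by rw [← pow_succ']; exact k3 l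
  have hm1 := pow_ne_zero (m + 1) hq
  clear k1 k2 k3 x1 x2 x3 y1 y2 y3 y4 y5 h
  generalize (r * s2) ^ n = T
  generalize (r * s2) ^ (n + 1 + m) = T'
  generalize qPoch q q (n + 1 + m) = Q0
  generalize qPoch (c2 * c3 * q ^ (n + 1)) q (n + 1 + m + 1) = Q1
  generalize qPoch (c1 * c2 * c3 * q ^ (n + 1 + m + 2)) q n = Q2
  generalize qPoch (q * c2) q n = Q3
  generalize qPoch (q * c1) q m = Q4 at *
  generalize qPoch q q m = Q5 at *
  generalize qPoch q q n = Q6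
  generalize qPoch (q * c3) q n = Q7
  generalize 1 - c1 * c2 * c3 * q ^ (n + 1 + m + 2) * q ^ n = V1
  generalize 1 - c2 * c3 * q ^ (n + n + m + 2 + 1) = V2
  generalize 1 - q * c2 * q ^ n = V3
  generalize 1 - q * c3 * q ^ n = V4
  generalize 1 - q * q ^ n = V5
  generalize 1 - c2 * c3 * q ^ (2 * n + 2 + 1) = W1 at *
  generalize 1 - c2 * c3 * q ^ (2 * n + 1) = W2 at *
  generalize 1 - c2 * c3 * q ^ (n + 1) = W3 at *
  generalize 1 - q * c1 * q ^ m = W4 at *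
  generalize 1 - q ^ (m + 1) = W5 at *
  generalize q ^ (m + 1) = M1 at *
  have (u : ℂ) : u = u * (W5 * W5⁻¹ * (W4 * W4⁻¹) * (W2 * W2⁻¹) * (M1 * M1⁻¹) * (c1 * c1⁻¹)) := by
    simp only [mul_inv_cancel₀ z6, mul_inv_cancel₀ z5, mul_inv_cancel₀ z2, mul_inv_cancel₀ hm1,
      mul_inv_cancel₀ n1, mul_one]
  rw [this (_ * (W1 / _))]
  simp only [div_eq_mul_inv, mul_inv, inv_inv, inv_neg]
  ring

theorem Omega_eq_wo {r s1 s2 s3 : ℂ} (h : Gen3 (r ^ 2) (s1 ^ 2) (s2 ^ 2) (s3 ^ 2)) {K : ℕ} (n : ℕ)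
    (hn : n ≤ K) :
    Omega r n s1 s2 s3 K =
      Omega r 0 s1 s2 s3 K * wo (r ^ 2) (s3 ^ 2) (s2 ^ 2) (s1 ^ 2) ((r ^ 2) ^ K) n := by
  induction n with
  | zero => rw [wo_zero h.swap, mul_one]
  | succ n ih =>
    rw [Omega_succ h hn, ih (by omega), wo_step h.swap (pow_ne_zero _ h.hq), mul_assoc]

theorem Omega_succ_right {r s1 s2 s3 : ℂ} (h : Gen3 (r ^ 2) (s1 ^ 2) (s2 ^ 2) (s3 ^ 2)) {n K : ℕ}
    (hn : n ≤ K) :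
    Omega r n s1 s2 s3 (K + 1) = Omega r n s1 s2 s3 K *
      ((1 - r ^ 2 * (r ^ 2) ^ K) / (1 - r ^ 2 * (r ^ 2) ^ K / (r ^ 2) ^ n) *
        ((1 - s1 ^ 2 * s2 ^ 2 * s3 ^ 2 * (r ^ 2) ^ 2 * (r ^ 2) ^ K * (r ^ 2) ^ n) /
          (1 - s1 ^ 2 * s2 ^ 2 * s3 ^ 2 * (r ^ 2) ^ 2 * (r ^ 2) ^ K)) *
        ((1 - r ^ 2 * s1 ^ 2 * (r ^ 2) ^ K / (r ^ 2) ^ n) * (r * s2) /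
          (1 - s2 ^ 2 * s3 ^ 2 * (r ^ 2) ^ 2 * (r ^ 2) ^ K * (r ^ 2) ^ n))) := by
  obtain ⟨m, rfl⟩ := Nat.exists_eq_add_of_le hn
  rw [Omega_eq h hn, Omega_eq h (show n ≤ n + m + 1 by omega), Nat.add_sub_cancel_left,
    show n + m + 1 - n = m + 1 by omega, pow_succ (r * s2) (n + m)]
  have hq := h.hq
  have k1 : 1 - s1 ^ 2 * s2 ^ 2 * s3 ^ 2 * (r ^ 2) ^ (n + m + 2) ≠ 0 :=
    h.A123.ne (n + m + 2 : ℕ) (by rw [zpow_natCast]; ring)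
  generalize r ^ 2 = q at *
  generalize s1 ^ 2 = c1 at *
  generalize s2 ^ 2 = c2 at *
  generalize s3 ^ 2 = c3 at *
  have hN := pow_ne_zero n hq
  have x1 : qPoch (c1 * c2 * c3 * q ^ (n + m + 1 + 2)) q n =
      qPoch (c1 * c2 * c3 * q ^ (n + m + 2)) q n *
        (1 - c1 * c2 * c3 * q ^ 2 * q ^ (n + m) * q ^ n) / (1 - c1 * c2 * c3 * q ^ (n + m + 2)) := by
    rw [eq_div_iff k1, show c1 * c2 * c3 * q ^ 2 * q ^ (n + m) * q ^ n =
      c1 * c2 * c3 * q ^ (n + m + 2) * q ^ n by ring, ← qPoch_shift]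
    ring_nf
  have y1 : c2 * c3 * q ^ 2 * q ^ (n + m) * q ^ n = c2 * c3 * q ^ (n + 1) * q ^ (n + m + 1) := by ring
  have y2 : c1 * c2 * c3 * q ^ 2 * q ^ (n + m) = c1 * c2 * c3 * q ^ (n + m + 2) := by ring
  have y3 : q * q ^ (n + m) / q ^ n = q * q ^ m := by rw [pow_add]; field_simp
  have y4 : q * c1 * q ^ (n + m) / q ^ n = q * c1 * q ^ m := by rw [pow_add]; field_simp
  rw [x1, y1, y2, y3, y4, qPoch_succ _ q (n + m + 1), qPoch_succ _ q (n + m), qPoch_succ _ q m,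
    qPoch_succ _ q m]
  simp only [div_eq_mul_inv, mul_inv]
  ring

/-- The reciprocal of `Ω(0; c₃, c₂, c₁; K)`. -/
theorem Omega_zero_mul_woMass {r s1 s2 s3 : ℂ} (h : Gen3 (r ^ 2) (s1 ^ 2) (s2 ^ 2) (s3 ^ 2)) (K : ℕ) :
    Omega r 0 s1 s2 s3 K * woMass (r ^ 2) (s1 ^ 2) (s2 ^ 2) (s3 ^ 2) K =
      qPoch (s1 ^ 2 * s2 ^ 2 * (r ^ 2) ^ 2) (r ^ 2) K /
        (qPoch (r ^ 2 * s3 ^ 2) (r ^ 2) K * (r * s2) ^ K) := by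
  have hr : r * s2 ≠ 0 := by
    have h1 := h.hq
    have h2 := h.n2
    refine mul_ne_zero ?_ ?_ <;> rintro rfl <;> simp at h1 h2
  have z1 : qPoch (r ^ 2 * s1 ^ 2) (r ^ 2) K ≠ 0 := qPoch_ne_zero fun l _ =>
    h.A1.ne (l + 1 : ℕ) (by rw [zpow_natCast]; ring)
  have z2 : qPoch (s2 ^ 2 * s3 ^ 2 * (r ^ 2) ^ 2) (r ^ 2) K ≠ 0 := qPoch_ne_zero fun l _ =>
    h.A23.ne (l + 2 : ℕ) (by rw [zpow_natCast]; ring)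
  rw [Omega_zero h, woMass, show (r ^ 2 * s2 ^ 2) ^ K = (r * s2) ^ K * (r * s2) ^ K by ring]
  have z3 := pow_ne_zero K hr
  generalize qPoch (s1 ^ 2 * s2 ^ 2 * (r ^ 2) ^ 2) (r ^ 2) K = Q
  generalize qPoch (s2 ^ 2 * s3 ^ 2 * (r ^ 2) ^ 2) (r ^ 2) K = Q' at *
  generalize qPoch (r ^ 2 * s1 ^ 2) (r ^ 2) K = Q'' at *
  field_simp

theorem qRacah_eq {n x K : ℕ} (r s1 s2 s3 : ℂ) (hn : n ≤ K) (hx : x ≤ K) :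
    qRacah r n x s1 s2 s3 K = Omega r n s1 s2 s3 K *
      pR (r ^ 2) (s1 ^ 2) (s2 ^ 2) (s3 ^ 2) ((r ^ 2) ^ K) n x := by
  rw [qRacah, if_pos ⟨hn, hx⟩, phi43, pR, core]
  congr 1
  refine Finset.sum_congr rfl fun k _ => ?_
  rw [coreTerm]
  have e1 : s1 ^ 2 * s2 ^ 2 * s3 ^ 2 * (r ^ 2) ^ (K + 2) =
    s1 ^ 2 * s2 ^ 2 * s3 ^ 2 * (r ^ 2) ^ 2 * (r ^ 2) ^ K := by ring
  have e2 : s1 ^ 2 * s2 ^ 2 * (r ^ 2) ^ (x + 1) = s1 ^ 2 * s2 ^ 2 * r ^ 2 * (r ^ 2) ^ x := by ring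
  rw [e1, e2]
  ring

theorem Lambda_zero (r s1 s2 s3 s4 : ℂ) {N : ℕ} (hqn : ∀ k : ℕ, 1 - (r ^ 2) ^ (k + 1) ≠ 0) :
    Lambda r 0 s1 s2 s3 s4 N =
      (r * s2) ^ N * (reducedPoch (s1 ^ 2 * s2 ^ 2) (r ^ 2) 0 N)⁻¹ := by
  have e2 : qPoch (r ^ 2) (r ^ 2) N ≠ 0 := qPoch_ne_zero fun l _ => by
    rw [← pow_succ']; exact hqn l
  simp only [Lambda, qBinom, if_pos (Nat.zero_le N), qPoch_zero, pow_zero, Nat.sub_zero, one_mul,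
    mul_one]
  rw [div_self e2, one_mul, div_eq_mul_inv]

theorem inv_reducedPoch_eq_vwp {q c : ℂ} (hq : q ≠ 0) (hqn : ∀ k : ℕ, 1 - q ^ (k + 1) ≠ 0)
    (hc : Av q c) {N : ℕ} (x : ℕ) (hx : x ≤ N) :
    (-1) ^ x * qBinom q N x * (reducedPoch c q x N)⁻¹ * q ^ (x.choose 2) =
      (reducedPoch c q 0 N)⁻¹ * vwp q c x * pr q c (q ^ N)⁻¹ x * (q ^ N) ^ x := by
  have k1 : ∀ k : ℕ, 1 - c * q * q ^ k ≠ 0 := fun k =>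
    hc.ne (k + 1 : ℕ) (by rw [zpow_natCast]; ring)
  have hz : ∀ k, qPoch q q k ≠ 0 := fun k => qPoch_ne_zero fun l _ => by
    rw [← pow_succ']; exact hqn l
  induction x with
  | zero =>
    rw [vwp_zero (by simpa using k1 0), pr_zero, qBinom, if_pos (Nat.zero_le N)]
    simp [qPoch_zero, hz]
  | succ x ih =>
    obtain ⟨m, rfl⟩ := Nat.exists_eq_add_of_le hx
    have h := ih (by omega)
    rw [qBinom, if_pos hx, inv_reducedPoch' hc hx, Nat.add_sub_cancel_left, Nat.choose_succ_succ,
      Nat.choose_one_right, pow_add q x, pow_succ _ x, pow_succ _ x, pr_succ,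
      vwp_succ (by convert k1 (2 * x) using 2; ring)]
    rw [qBinom, if_pos (by omega), inv_reducedPoch' hc (by omega),
      show x + 1 + m - x = m + 1 by omega, qPoch_succ _ q m, ← pow_succ' q m] at h
    have hX := pow_ne_zero x hq
    have hm := pow_ne_zero (m + 1) hq
    have hN : q ^ (x + 1 + m) = q ^ x * q ^ (m + 1) := by ring
    have x1 : qPoch (c * q ^ (x + 1 + 1)) q (x + 1 + m + 1) =
      qPoch (c * q ^ (x + 1)) q (x + 1 + m + 1) * (1 - c * q ^ 2 * q ^ (x + 1 + m) * q ^ x) /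
        (1 - c * q ^ (x + 1)) := by
      rw [eq_div_iff (by convert k1 x using 2; ring), show c * q ^ 2 * q ^ (x + 1 + m) * q ^ x =
        c * q ^ (x + 1) * q ^ (x + 1 + m + 1) by ring, ← qPoch_shift]
      ring_nf
    have x2 : c * q ^ 2 / (q ^ (x + 1 + m))⁻¹ = c * q ^ 2 * q ^ (x + 1 + m) := by
      rw [div_inv_eq_mul]
    have x3 : 1 - (q ^ (x + 1 + m))⁻¹ * q ^ x = - (1 - q ^ (m + 1)) / q ^ (m + 1) := by
      rw [hN]; field_simp; ring
    have x4 : c * q ^ (x + 1) = c * q * q ^ x := by ring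
    have x5 : c * q ^ (2 * x + 1) = c * q * (q ^ x) ^ 2 := by ring
    have x6 : c * q ^ (2 * (x + 1) + 1) = c * q ^ 3 * (q ^ x) ^ 2 := by ring
    rw [x1, x2, x3, x4, x6, qPoch_succ _ q x]
    rw [x4, x5] at h
    have z1 := k1 x
    have z2 : 1 - c * q * (q ^ x) ^ 2 ≠ 0 := by convert k1 (2 * x) using 2; ring
    have z3 := hqn m
    have z4 := hqn x
    rw [pow_succ' q x] at z4
    rw [hN] at h ⊢
    clear x1 x2 x3 x4 x5 x6 ih hN k1 hz
    generalize (reducedPoch c q 0 (x + 1 + m))⁻¹ = R at *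
    generalize qPoch q q (x + 1 + m) = Q1 at *
    generalize qPoch q q x = Q2 at *
    generalize qPoch q q m = Q3 at *
    generalize vwp q c x = V at *
    generalize pr q c (q ^ x * q ^ (m + 1))⁻¹ x = P at *
    generalize (q ^ x * q ^ (m + 1)) ^ x = P' at *
    generalize qPoch (c * q * q ^ x) q (x + 1 + m + 1) = Q4 at *
    generalize q ^ (x.choose 2) = P'' at *
    generalize 1 - c * q ^ 2 * (q ^ x * q ^ (m + 1)) * q ^ x = V1 at *
    generalize 1 - c * q ^ 3 * (q ^ x) ^ 2 = V2 at *
    generalize 1 - c * q * (q ^ x) ^ 2 = W1 at *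
    generalize 1 - c * q * q ^ x = W2 at *
    generalize 1 - q * q ^ x = W3 at *
    generalize 1 - q ^ (m + 1) = W4 at *
    generalize q ^ (m + 1) = M1 at *
    generalize q ^ x = X at *
    have (u : ℂ) : u = u * (W4 * W4⁻¹ * (W1 * W1⁻¹)) := by
      simp only [mul_inv_cancel₀ z3, mul_inv_cancel₀ z2, mul_one]
    rw [this (_ * (X * P''))]
    have h' : M1 * M1⁻¹ = 1 := mul_inv_cancel₀ hm
    simp only [div_eq_mul_inv, mul_inv, inv_inv, inv_neg] at h ⊢
    linear_combination (-X * V2 * W4 * V1⁻¹ * W2 * W3⁻¹ * W1⁻¹) * h -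
      R * V * P * P' * V2 * W2 * W1⁻¹ * W3⁻¹ * W4 * V1⁻¹ * X * (-h')

theorem Lambda_eq {r s1 s2 s3 s4 : ℂ} (hr : r ≠ 0) (hs1 : s1 ≠ 0) (hs2 : s2 ≠ 0)
    (hqn : ∀ k : ℕ, 1 - (r ^ 2) ^ (k + 1) ≠ 0) (hc : Av (r ^ 2) (s1 ^ 2 * s2 ^ 2)) {N x : ℕ}
    (hx : x ≤ N) :
    Lambda r x s1 s2 s3 s4 N = Lambda r 0 s1 s2 s3 s4 N * xi r x s2 s1 * (s3 / s4) ^ x *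
      (vwp (r ^ 2) (s1 ^ 2 * s2 ^ 2) x * pr (r ^ 2) (s1 ^ 2 * s2 ^ 2) ((r ^ 2) ^ N)⁻¹ x *
        ((r ^ 2) ^ N) ^ x) := by
  have h := inv_reducedPoch_eq_vwp (pow_ne_zero 2 hr) hqn hc x hx
  have e : (s1 * s3 * r ^ ((x : ℤ) - 1) / (s2 * s4)) ^ x =
      (s1 / s2) ^ x * (s3 / s4) ^ x * (r ^ 2) ^ (x.choose 2) := by
    have : (r ^ ((x : ℤ) - 1)) ^ x = (r ^ 2) ^ (x.choose 2) := by
      rw [← zpow_natCast, ← zpow_mul, ← pow_mul, ← zpow_natCast]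
      congr 1
      have := Finset.sum_range_id_mul_two x
      rw [Finset.sum_range_id, ← Nat.choose_two_right] at this
      cases x with
      | zero => simp
      | succ x =>
        rw [Nat.add_sub_cancel] at this
        push_cast
        have : (((x + 1).choose 2 : ℕ) : ℤ) * 2 = (x + 1) * x := by exact_mod_cast this
        linear_combination -this
    rw [← this, ← mul_pow, ← mul_pow]
    congr 1
    simp only [div_eq_mul_inv, mul_inv]
    ring
  rw [Lambda_zero _ _ _ _ _ hqn, Lambda, e, xi]
  simp only [div_eq_mul_inv, mul_inv] at h ⊢
  linear_combination (qPoch (r ^ 2 * s2 ^ 2) (r ^ 2) x * (r * s2) ^ N *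
    (qPoch (r ^ 2 * s1 ^ 2) (r ^ 2) x)⁻¹ * (s1 * s2⁻¹) ^ x * (s3 * s4⁻¹) ^ x) * h

theorem pentW_zero {q c0 c1 c2 c3 c4 M A X : ℂ} (h : 1 - c0 * c3 * q ≠ 0) :
    pentW q c0 c1 c2 c3 c4 M A X 0 = 1 := by
  simp [pentW, vwp_zero h, pr_zero]

theorem pentW_scalar {q c0 c1 c2 c3 c4 M A X Y t : ℂ} (hq : q ≠ 0) (n0 : c0 ≠ 0) (n1 : c1 ≠ 0)
    (n2 : c2 ≠ 0) (n3 : c3 ≠ 0) (n4 : c4 ≠ 0) (hM : M ≠ 0) (hA : A ≠ 0) (hX : X ≠ 0) (hY : Y ≠ 0)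
    (hC : q ^ 3 * M ^ 2 * c0 * c1 * c2 * c3 * c4 = 1) (ht : t * t = q * c2)
    (z1 : 1 - X / M * Y ≠ 0) (z2 : 1 - A / M * Y ≠ 0) (z3 : 1 - M⁻¹ * Y ≠ 0)
    (z4 : 1 - c0 * c3 * q ^ 2 * M / X * Y ≠ 0) (z5 : 1 - c0 * c3 * q ^ 2 * M / A * Y ≠ 0)
    (z6 : 1 - c0 * c3 * q ^ 2 * M * Y ≠ 0) (z7 : 1 - c0 * c3 * c1 * q ^ 2 * M / X * Y ≠ 0)
    (z8 : 1 - c0 * c3 * c4 * q ^ 2 * M / A * Y ≠ 0) (z9 : 1 - X / (c1 * M) * Y ≠ 0)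
    (z0 : 1 - A / (c4 * M) * Y ≠ 0) :
    (1 - M / Y) / (1 - M / Y / X) *
        ((1 - c1 * c2 * c4 * q * (M / Y) * X) / (1 - c1 * c2 * c4 * q * (M / Y))) *
        ((1 - c1 * (M / Y) / X) * t / (1 - c2 * c4 * q * (M / Y) * X)) *
      ((1 - M / Y) / (1 - M / Y / A) *
        ((1 - c1 * c2 * c4 * q * (M / Y) * A) / (1 - c1 * c2 * c4 * q * (M / Y))) *
        ((1 - c4 * (M / Y) / A) * t / (1 - c2 * c1 * q * (M / Y) * A))) *
      ((1 - X / M * Y) / (1 - c0 * c3 * q ^ 2 * M / X * Y) *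
        ((1 - A / M * Y) / (1 - c0 * c3 * q ^ 2 * M / A * Y)) *
        ((1 - c0 * c3 * c1 * q ^ 2 * M / X * Y) / (1 - X / (c1 * M) * Y)) *
        ((1 - c0 * c3 * c4 * q ^ 2 * M / A * Y) / (1 - A / (c4 * M) * Y)) *
        ((1 - c0 * c3 * q ^ 2 * M * Y) / (1 - M⁻¹ * Y)) * (c2 * q * M)) =
    (1 - M⁻¹ * Y) / (1 - c0 * c3 * q ^ 2 * M * Y) * M := by
  have y1 : 1 - M / Y = - (1 - M⁻¹ * Y) * (M / Y) := by field_simp; ring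
  have y2 : 1 - M / Y / X = - (1 - X / M * Y) * (M / Y / X) := by field_simp; ring
  have y2' : 1 - M / Y / A = - (1 - A / M * Y) * (M / Y / A) := by field_simp; ring
  have y3 : ∀ T : ℂ, T ≠ 0 → 1 - c1 * c2 * c4 * q * (M / Y) * T =
      - (1 - c0 * c3 * q ^ 2 * M / T * Y) * (T / (c0 * c3 * q ^ 2 * M * Y)) := fun T hT => by
    field_simp; linear_combination - T * hC
  have y3' : 1 - c1 * c2 * c4 * q * (M / Y) =
      - (1 - c0 * c3 * q ^ 2 * M * Y) / (c0 * c3 * q ^ 2 * M * Y) := by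
    have := y3 1 one_ne_zero
    rw [mul_one, div_one] at this
    rw [this]; ring
  have y4 : 1 - c1 * (M / Y) / X = - (1 - X / (c1 * M) * Y) * (c1 * M / (X * Y)) := by
    field_simp; ring
  have y4' : 1 - c4 * (M / Y) / A = - (1 - A / (c4 * M) * Y) * (c4 * M / (A * Y)) := by
    field_simp; ring
  have y5 : 1 - c2 * c4 * q * (M / Y) * X =
      - (1 - c0 * c3 * c1 * q ^ 2 * M / X * Y) * (X / (c0 * c3 * c1 * q ^ 2 * M * Y)) := by
    field_simp; linear_combination - X * hC
  have y5' : 1 - c2 * c1 * q * (M / Y) * A =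
      - (1 - c0 * c3 * c4 * q ^ 2 * M / A * Y) * (A / (c0 * c3 * c4 * q ^ 2 * M * Y)) := by
    field_simp; linear_combination - A * hC
  rw [y1, y2, y2', y3 X hX, y3 A hA, y3', y4, y4', y5, y5']
  clear y1 y2 y2' y3 y3' y4 y4' y5 y5'
  generalize 1 - X / M * Y = W1 at *
  generalize 1 - A / M * Y = W2 at *
  generalize 1 - M⁻¹ * Y = W3 at *
  generalize 1 - c0 * c3 * q ^ 2 * M / X * Y = W4 at *
  generalize 1 - c0 * c3 * q ^ 2 * M / A * Y = W5 at *
  generalize 1 - c0 * c3 * q ^ 2 * M * Y = W6 at *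
  generalize 1 - c0 * c3 * c1 * q ^ 2 * M / X * Y = W7 at *
  generalize 1 - c0 * c3 * c4 * q ^ 2 * M / A * Y = W8 at *
  generalize 1 - X / (c1 * M) * Y = W9 at *
  generalize 1 - A / (c4 * M) * Y = W0 at *
  have e1 : - W3 * (M / Y) / (- W1 * (M / Y / X)) * (- W4 * (X / (c0 * c3 * q ^ 2 * M * Y)) /
      (- W6 / (c0 * c3 * q ^ 2 * M * Y))) * (- W9 * (c1 * M / (X * Y)) * t /
      (- W7 * (X / (c0 * c3 * c1 * q ^ 2 * M * Y)))) =
      W3 * W4 * W9 / (W1 * W6 * W7) * (t * c1 * M * (c0 * c3 * c1 * q ^ 2 * M)) := by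
    field_simp
  have e2 : - W3 * (M / Y) / (- W2 * (M / Y / A)) * (- W5 * (A / (c0 * c3 * q ^ 2 * M * Y)) /
      (- W6 / (c0 * c3 * q ^ 2 * M * Y))) * (- W0 * (c4 * M / (A * Y)) * t /
      (- W8 * (A / (c0 * c3 * c4 * q ^ 2 * M * Y)))) =
      W3 * W5 * W0 / (W2 * W6 * W8) * (t * c4 * M * (c0 * c3 * c4 * q ^ 2 * M)) := by
    field_simp
  rw [e1, e2]
  have e3 : W3 * W4 * W9 / (W1 * W6 * W7) * (W3 * W5 * W0 / (W2 * W6 * W8)) *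
      (W1 / W4 * (W2 / W5) * (W7 / W9) * (W8 / W0) * (W6 / W3)) = W3 / W6 := by
    field_simp
  have e4 : t * c1 * M * (c0 * c3 * c1 * q ^ 2 * M) * (t * c4 * M * (c0 * c3 * c4 * q ^ 2 * M)) *
      (c2 * q * M) = M := by
    have : (t * t) * (c1 * M * (c0 * c3 * c1 * q ^ 2 * M) * (c4 * M * (c0 * c3 * c4 * q ^ 2 * M)) *
      (c2 * q * M)) = M := by
      rw [ht]
      linear_combination M * (q ^ 3 * M ^ 2 * c0 * c1 * c2 * c3 * c4 + 1) * hC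
    linear_combination this
  linear_combination (t * c1 * M * (c0 * c3 * c1 * q ^ 2 * M) *
    (t * c4 * M * (c0 * c3 * c4 * q ^ 2 * M)) * (c2 * q * M)) * e3 + W3 / W6 * e4

section

namespace Gen5

variable {q c0 c1 c2 c3 c4 : ℂ} {N : ℕ}

theorem perm14 (h : Gen5 q c0 c1 c2 c3 c4 N) : Gen5 q c0 c4 c2 c3 c1 N := h.swap.perm03

theorem perm13 (h : Gen5 q c0 c1 c2 c3 c4 N) : Gen5 q c0 c3 c2 c1 c4 N := h.perm12.perm23.perm12

theorem perm34 (h : Gen5 q c0 c1 c2 c3 c4 N) : Gen5 q c0 c1 c2 c4 c3 N := h.perm13.perm14.perm13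

theorem perm01 (h : Gen5 q c0 c1 c2 c3 c4 N) : Gen5 q c1 c0 c2 c3 c4 N := h.perm13.perm03.perm13

theorem gen132 (h : Gen5 q c0 c1 c2 c3 c4 N) : Gen3 q c1 c3 c2 := h.perm23.gen3

theorem gen231 (h : Gen5 q c0 c1 c2 c3 c4 N) : Gen3 q c2 c3 c1 := h.gen132.swap

theorem gen124 (h : Gen5 q c0 c1 c2 c3 c4 N) : Gen3 q c1 c2 c4 := h.perm34.gen3

theorem gen304 (h : Gen5 q c0 c1 c2 c3 c4 N) : Gen3 q c3 c0 c4 :=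
  h.perm01.perm23.perm34.perm12.gen3

theorem gen042 (h : Gen5 q c0 c1 c2 c3 c4 N) : Gen3 q c0 c4 c2 := h.perm01.perm34.perm23.gen3

end Gen5

set_option maxHeartbeats 400000 in
theorem pentW_eq_Omega {r s0 s1 s2 s3 s4 : ℂ} {N : ℕ}
    (h : Gen5 (r ^ 2) (s0 ^ 2) (s1 ^ 2) (s2 ^ 2) (s3 ^ 2) (s4 ^ 2) N) {a x : ℕ} (y : ℕ)
    (hx : x + y ≤ N) (ha : a + y ≤ N) :
    Omega r x s1 s2 s4 (N - y) * Omega r a s4 s2 s1 (N - y) *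
        (vwp (r ^ 2) (s0 ^ 2 * s3 ^ 2) y * pr (r ^ 2) (s0 ^ 2 * s3 ^ 2) ((r ^ 2) ^ N)⁻¹ y *
          ((r ^ 2) ^ N) ^ y) =
      Omega r x s1 s2 s4 N * Omega r a s4 s2 s1 N *
        pentW (r ^ 2) (s0 ^ 2) (s1 ^ 2) (s2 ^ 2) (s3 ^ 2) (s4 ^ 2) ((r ^ 2) ^ N) ((r ^ 2) ^ a)
          ((r ^ 2) ^ x) y := by
  have k03 : ∀ k : ℕ, 1 - s0 ^ 2 * s3 ^ 2 * r ^ 2 * (r ^ 2) ^ k ≠ 0 := fun k =>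
    h.A03.ne (k + 1 : ℕ) (by rw [zpow_natCast]; ring)
  induction y with
  | zero =>
    rw [vwp_zero (by simpa using k03 0), pentW_zero (by simpa using k03 0)]
    simp [pr_zero]
  | succ y ih =>
    obtain ⟨K, rfl⟩ : ∃ K, N = K + 1 + y := ⟨N - 1 - y, by omega⟩
    have ih := ih (by omega) (by omega)
    rw [Nat.add_sub_cancel, Omega_succ_right h.gen124 (by omega),
      Omega_succ_right h.gen124.swap (by omega)] at ih
    rw [show K + 1 + y - (y + 1) = K by omega]
    have hq := h.hq
    obtain ⟨n0, n1, n2, n3, n4⟩ := h.prod_ne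
    have ht : (r * s2) * (r * s2) = r ^ 2 * s2 ^ 2 := by ring
    have hC := h.constr
    have hqn := h.hqn
    have A03 := h.A03
    have A1 := h.A1
    have A4 := h.A4
    have A031 := h.gen031.A123
    have A034 := h.gen304.A123
    generalize Omega r x s1 s2 s4 K = O1 at *
    generalize Omega r a s4 s2 s1 K = O2 at *
    generalize Omega r x s1 s2 s4 (K + 1 + y) * Omega r a s4 s2 s1 (K + 1 + y) = O3 at *
    generalize r * s2 = t at *
    generalize r ^ 2 = q at *
    generalize s0 ^ 2 = c0 at *
    generalize s1 ^ 2 = c1 at *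
    generalize s2 ^ 2 = c2 at *
    generalize s3 ^ 2 = c3 at *
    generalize s4 ^ 2 = c4 at *
    have hX : ∀ x : ℕ, q ^ x ≠ 0 := fun x => pow_ne_zero x hq
    have e1 : q * q ^ K = q ^ (K + 1 + y) / q ^ y := by
      rw [eq_div_iff (hX y)]; ring
    have sub : ∀ u : ℕ, u + (y + 1) ≤ K + 1 + y → 1 - q ^ u / q ^ (K + 1 + y) * q ^ y ≠ 0 :=
      fun u hu => by
        have := one_sub_inv_pow hq hqn (show u + y < K + 1 + y by omega)
        rwa [pow_add q u, ← mul_assoc, ← div_eq_inv_mul] at this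
    have cm : ∀ u : ℕ, 1 - c0 * c3 * q ^ 2 * q ^ (K + 1 + y) / q ^ u * q ^ y ≠ 0 := fun u =>
      A03.ne ((K + 1 + y + y + 2 : ℕ) - (u : ℤ)) (by
        rw [zpow_sub₀ hq, zpow_natCast, zpow_natCast]
        have := hX u
        field_simp
        ring)
    have z3 : 1 - (q ^ (K + 1 + y))⁻¹ * q ^ y ≠ 0 := one_sub_inv_pow hq hqn (by omega)
    have z6 : 1 - c0 * c3 * q ^ 2 * q ^ (K + 1 + y) * q ^ y ≠ 0 := by simpa using cm 0
    have z7 : 1 - c0 * c3 * c1 * q ^ 2 * q ^ (K + 1 + y) / q ^ x * q ^ y ≠ 0 :=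
      A031.ne ((K + 1 + y + y + 2 : ℕ) - (x : ℤ)) (by
        rw [zpow_sub₀ hq, zpow_natCast, zpow_natCast]
        have := hX x
        field_simp
        ring)
    have z8 : 1 - c0 * c3 * c4 * q ^ 2 * q ^ (K + 1 + y) / q ^ a * q ^ y ≠ 0 :=
      A034.ne ((K + 1 + y + y + 2 : ℕ) - (a : ℤ)) (by
        rw [zpow_sub₀ hq, zpow_natCast, zpow_natCast]
        have := hX a
        field_simp
        ring)
    have iv : ∀ c : ℂ, c ≠ 0 → Av q c → ∀ u : ℕ, 1 - q ^ u / (c * q ^ (K + 1 + y)) * q ^ y ≠ 0 :=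
      fun c hc hA u => hA.inv hq 0 (b := c⁻¹) (by simp) |>.ne ((u + y : ℕ) - ((K + 1 + y : ℕ) : ℤ))
        (by
          rw [zpow_sub₀ hq, zpow_natCast, zpow_natCast, pow_add q u]
          have := hX (K + 1 + y)
          field_simp)
    have main := pentW_scalar (Y := q ^ y) (X := q ^ x) (A := q ^ a) (M := q ^ (K + 1 + y)) (t := t)
      hq n0 n1 n2 n3 n4 (hX _) (hX a) (hX x) (hX y)
      (by rw [← hC]; ring) ht (sub x (by omega)) (sub a (by omega)) z3 (cm x) (cm a) z6 z7 z8
      (iv c1 n1 A1 x) (iv c4 n4 A4 a)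
    have f1 : c1 * c2 * c4 * q ^ 2 * q ^ K = c1 * c2 * c4 * q * (q ^ (K + 1 + y) / q ^ y) := by
      rw [← e1]; ring
    have f2 : c4 * c2 * c1 * q ^ 2 * q ^ K = c1 * c2 * c4 * q * (q ^ (K + 1 + y) / q ^ y) := by
      rw [← e1]; ring
    have f3 : q * c1 * q ^ K = c1 * (q ^ (K + 1 + y) / q ^ y) := by rw [← e1]; ring
    have f4 : q * c4 * q ^ K = c4 * (q ^ (K + 1 + y) / q ^ y) := by rw [← e1]; ring
    have f5 : c2 * c4 * q ^ 2 * q ^ K = c2 * c4 * q * (q ^ (K + 1 + y) / q ^ y) := by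
      rw [← e1]; ring
    have f6 : c2 * c1 * q ^ 2 * q ^ K = c2 * c1 * q * (q ^ (K + 1 + y) / q ^ y) := by
      rw [← e1]; ring
    rw [f1, f2, f3, f4, f5, f6, e1] at ih
    have hM := hX (K + 1 + y)
    have hXx := hX x
    have hXa := hX a
    have g1 : c0 * c3 * q ^ 2 / (q ^ x / q ^ (K + 1 + y)) =
      c0 * c3 * q ^ 2 * q ^ (K + 1 + y) / q ^ x := by field_simp
    have g2 : c0 * c3 * q ^ 2 / (q ^ a / q ^ (K + 1 + y)) =
      c0 * c3 * q ^ 2 * q ^ (K + 1 + y) / q ^ a := by field_simp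
    have g3 : c0 * c3 * q ^ 2 / (c0 * c3 * c1 * q ^ 2 * q ^ (K + 1 + y) / q ^ x) =
      q ^ x / (c1 * q ^ (K + 1 + y)) := by field_simp
    have g4 : c0 * c3 * q ^ 2 / (c0 * c3 * c4 * q ^ 2 * q ^ (K + 1 + y) / q ^ a) =
      q ^ a / (c4 * q ^ (K + 1 + y)) := by field_simp
    have g5 : c0 * c3 * q ^ 2 / (c0 * c3 * q ^ 2 * q ^ (K + 1 + y)) = (q ^ (K + 1 + y))⁻¹ := by
      field_simp
    have g6 : c0 * c3 * q ^ 2 / (q ^ (K + 1 + y))⁻¹ = c0 * c3 * q ^ 2 * q ^ (K + 1 + y) := by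
      rw [div_inv_eq_mul]
    rw [pentW] at ih ⊢
    simp only [pr_succ, g1, g2, g3, g4, g5, g6, pow_succ _ y,
      vwp_succ (show 1 - c0 * c3 * q * (q ^ y) ^ 2 ≠ 0 by convert k03 (2 * y) using 2; ring)]
    clear g1 g2 g3 g4 g5 g6 f1 f2 f3 f4 f5 f6 e1 sub cm z3 z6 z7 z8 iv k03
    generalize (1 - c0 * c3 * q ^ 3 * (q ^ y) ^ 2) * (1 - c0 * c3 * q * q ^ y) /
      ((1 - c0 * c3 * q * (q ^ y) ^ 2) * (1 - q * q ^ y)) = v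
    generalize vwp q (c0 * c3) y = V at *
    generalize pr q (c0 * c3) (q ^ (K + 1 + y))⁻¹ y = P at *
    generalize pr q (c0 * c3) (q ^ x / q ^ (K + 1 + y)) y = P1 at *
    generalize pr q (c0 * c3) (q ^ a / q ^ (K + 1 + y)) y = P2 at *
    generalize pr q (c0 * c3) (c0 * c3 * c1 * q ^ 2 * q ^ (K + 1 + y) / q ^ x) y = P3 at *
    generalize pr q (c0 * c3) (c0 * c3 * c4 * q ^ 2 * q ^ (K + 1 + y) / q ^ a) y = P4 at *
    generalize pr q (c0 * c3) (c0 * c3 * q ^ 2 * q ^ (K + 1 + y)) y = P5 at *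
    generalize (c2 * q * q ^ (K + 1 + y)) ^ y = P6 at *
    generalize (q ^ (K + 1 + y)) ^ y = P7 at *
    linear_combination (-(O1 * O2 * V * P * P7 * v)) * main + ((1 - q ^ x / q ^ (K + 1 + y) * q ^ y) /
      (1 - c0 * c3 * q ^ 2 * q ^ (K + 1 + y) / q ^ x * q ^ y) *
        ((1 - q ^ a / q ^ (K + 1 + y) * q ^ y) /
          (1 - c0 * c3 * q ^ 2 * q ^ (K + 1 + y) / q ^ a * q ^ y)) *
        ((1 - c0 * c3 * c1 * q ^ 2 * q ^ (K + 1 + y) / q ^ x * q ^ y) /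
          (1 - q ^ x / (c1 * q ^ (K + 1 + y)) * q ^ y)) *
        ((1 - c0 * c3 * c4 * q ^ 2 * q ^ (K + 1 + y) / q ^ a * q ^ y) /
          (1 - q ^ a / (c4 * q ^ (K + 1 + y)) * q ^ y)) *
        ((1 - c0 * c3 * q ^ 2 * q ^ (K + 1 + y) * q ^ y) / (1 - (q ^ (K + 1 + y))⁻¹ * q ^ y)) *
        (c2 * q * q ^ (K + 1 + y)) * v) * ih

end

theorem pentF_step (q c0 c1 c2 c3 c4 M : ℂ) (a : ℕ) :
    pentF q c0 c1 c2 c3 c4 M (a + 1) = pentF q c0 c1 c2 c3 c4 M a *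
      ((1 - q * c1 * q ^ a) * (1 - (c4 * M)⁻¹ * q ^ a) /
        ((1 - q * c2 * q ^ a) * (1 - (c0 * c3 * q * M)⁻¹ * q ^ a) * (c0 * c1 * c3 * q ^ 2 * M))) := by
  simp only [pentF, qPoch_succ, pow_succ _ a, div_eq_mul_inv, mul_inv]
  ring

theorem xi_succ (r : ℂ) (n : ℕ) (s1 s2 : ℂ) :
    xi r (n + 1) s1 s2 = xi r n s1 s2 *
      ((1 - r ^ 2 * s1 ^ 2 * (r ^ 2) ^ n) / (1 - r ^ 2 * s2 ^ 2 * (r ^ 2) ^ n) * (s2 / s1)) := by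
  simp only [xi, qPoch_succ, pow_succ _ n, div_eq_mul_inv, mul_inv]
  ring

theorem pentF_scalar {q c0 c1 c2 c3 c4 M A J V u w : ℂ} (hq : q ≠ 0) (n0 : c0 ≠ 0) (n1 : c1 ≠ 0)
    (n2 : c2 ≠ 0) (n3 : c3 ≠ 0) (n4 : c4 ≠ 0) (hM : M ≠ 0) (hA : A ≠ 0) (hJ : J ≠ 0)
    (hC : q ^ 3 * M ^ 2 * c0 * c1 * c2 * c3 * c4 = 1) (hu : u * w * (q * M * c2 * c3) = 1)
    (z2 : 1 - (M / J)⁻¹ * A ≠ 0)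
    (z3 : 1 - c2 * c1 * q ^ 2 * (M / J) * A ≠ 0) (z4 : 1 - c1 * c2 * q ^ 2 * M * A ≠ 0)
    (z5 : 1 - (c3 * (M / J))⁻¹ * A ≠ 0) (z6 : 1 - c2 * c1 * c3 * q ^ 2 * (M / J) * A ≠ 0)
    (z7 : 1 - c1 * c2 * c4 * q ^ 2 * M * A ≠ 0) (z8 : 1 - q * c1 * A ≠ 0) (z9 : 1 - q * c2 * A ≠ 0)
    (z0 : 1 - (c4 * M)⁻¹ * A ≠ 0) :
    V * ((1 - M⁻¹ * A) / (1 - c1 * c2 * q ^ 2 * M * A)) * ((1 - q * c2 * A) / (1 - q * c1 * A)) *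
        ((1 - c1 * c2 * c4 * q ^ 2 * M * A) / (1 - (c4 * M)⁻¹ * A)) * (q * (c2 * c4))⁻¹ *
      ((1 - q * c1 * A) * (1 - (c4 * M)⁻¹ * A) /
        ((1 - q * c2 * A) * (1 - (c0 * c3 * q * M)⁻¹ * A) * (c0 * c1 * c3 * q ^ 2 * M))) =
    ((1 - q * c2 * A) / (1 - q * c1 * A) * u) *
      (V * ((1 - (M / J)⁻¹ * A) / (1 - c2 * c1 * q ^ 2 * (M / J) * A)) *
        ((1 - q * c1 * A) / (1 - q * c2 * A)) *
        ((1 - c2 * c1 * c3 * q ^ 2 * (M / J) * A) / (1 - (c3 * (M / J))⁻¹ * A)) *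
        (q * (c1 * c3))⁻¹) *
      ((1 - M / A) / (1 - M / A / J) *
        ((1 - c3 * c0 * c4 * q * (M / A) * J) / (1 - c3 * c0 * c4 * q * (M / A))) *
        ((1 - c3 * (M / A) / J) * w / (1 - c0 * c4 * q * (M / A) * J))) := by
  have y1 : 1 - M / A = - (1 - M⁻¹ * A) * (M / A) := by field_simp; ring
  have y2 : 1 - M / A / J = - (1 - (M / J)⁻¹ * A) * (M / A / J) := by field_simp; ring
  have y3 : 1 - c3 * c0 * c4 * q * (M / A) * J =
      - (1 - c2 * c1 * q ^ 2 * (M / J) * A) * (J / (c1 * c2 * q ^ 2 * M * A)) := by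
    field_simp; linear_combination - J * hC
  have y4 : 1 - c3 * c0 * c4 * q * (M / A) =
      - (1 - c1 * c2 * q ^ 2 * M * A) / (c1 * c2 * q ^ 2 * M * A) := by
    field_simp; linear_combination - hC
  have y5 : 1 - c3 * (M / A) / J = - (1 - (c3 * (M / J))⁻¹ * A) * (c3 * M / (J * A)) := by
    field_simp; ring
  have y6 : 1 - c0 * c4 * q * (M / A) * J =
      - (1 - c2 * c1 * c3 * q ^ 2 * (M / J) * A) * (J / (c1 * c2 * c3 * q ^ 2 * M * A)) := by
    field_simp; linear_combination - J * hC
  have y7 : 1 - (c0 * c3 * q * M)⁻¹ * A = 1 - c1 * c2 * c4 * q ^ 2 * M * A := by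
    field_simp; linear_combination A * hC
  have y8 : u * w = (q * M * c2 * c3)⁻¹ := eq_inv_of_mul_eq_one_left hu
  rw [y1, y2, y3, y4, y5, y6, y7]
  clear y1 y2 y3 y4 y5 y6 y7
  generalize 1 - M⁻¹ * A = W1 at *
  generalize 1 - (M / J)⁻¹ * A = W2 at *
  generalize 1 - c2 * c1 * q ^ 2 * (M / J) * A = W3 at *
  generalize 1 - c1 * c2 * q ^ 2 * M * A = W4 at *
  generalize 1 - (c3 * (M / J))⁻¹ * A = W5 at *
  generalize 1 - c2 * c1 * c3 * q ^ 2 * (M / J) * A = W6 at *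
  generalize 1 - c1 * c2 * c4 * q ^ 2 * M * A = W7 at *
  generalize 1 - q * c1 * A = W8 at *
  generalize 1 - q * c2 * A = W9 at *
  generalize 1 - (c4 * M)⁻¹ * A = W0 at *
  have e1 : V * (W1 / W4) * (W9 / W8) * (W7 / W0) * (q * (c2 * c4))⁻¹ *
      (W8 * W0 / (W9 * W7 * (c0 * c1 * c3 * q ^ 2 * M))) =
      V * W1 / W4 * (c3 * M * c2 / (q ^ 3 * M ^ 2 * c0 * c1 * c2 * c3 * c4 * c2 * c3)) := by
    field_simp
  have e2 : (W9 / W8 * u) * (V * (W2 / W3) * (W8 / W9) * (W6 / W5) * (q * (c1 * c3))⁻¹) *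
      (-W1 * (M / A) / (-W2 * (M / A / J)) * (-W3 * (J / (c1 * c2 * q ^ 2 * M * A)) /
      (-W4 / (c1 * c2 * q ^ 2 * M * A))) * (-W5 * (c3 * M / (J * A)) * w /
      (-W6 * (J / (c1 * c2 * c3 * q ^ 2 * M * A))))) =
      V * W1 / W4 * (u * w * (c2 * c3 * M ^ 2 * q)) := by
    field_simp
  rw [e1, e2, hC, y8]
  field_simp

/-- The scalar identity behind the pentagon relation, for the dependence on the index `a`. -/
theorem Omega_mul_pentF {r s0 s1 s2 s3 s4 : ℂ} {N : ℕ}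
    (hroot : r ^ (2 * N + 3) * s0 * s1 * s2 * s3 * s4 = 1)
    (h : Gen5 (r ^ 2) (s0 ^ 2) (s1 ^ 2) (s2 ^ 2) (s3 ^ 2) (s4 ^ 2) N) {a j : ℕ} (ha : a + j ≤ N) :
    Omega r a s4 s2 s1 N * Omega r j s3 s0 s4 (N - a) *
        pentF (r ^ 2) (s0 ^ 2) (s1 ^ 2) (s2 ^ 2) (s3 ^ 2) (s4 ^ 2) ((r ^ 2) ^ N) a *
        Omega r 0 s3 s1 s2 (N - j) =
      xi r a s2 s1 * (s4 / s3) ^ a * Omega r 0 s4 s2 s1 N * Omega r j s3 s0 s4 N *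
        Omega r a s3 s1 s2 (N - j) := by
  induction a with
  | zero => simp [pentF_zero, xi, qPoch_zero]
  | succ a ih =>
    have key : ∀ {F O1 O2 O3 O4 O5 O6 O7 O8 P R S x u v T : ℂ},
        O1 * (O2 * R) * F * O3 = O7 * O8 * O4 * O5 * O6 → S * P = x * (u * v) * T * R →
        O1 * S * O2 * (F * P) * O3 = O7 * (x * u) * (O8 * v) * O4 * O5 * (O6 * T) := by
      intro F O1 O2 O3 O4 O5 O6 O7 O8 P R S x u v T ih main
      linear_combination (x * u * v * T) * ih + O1 * O2 * F * O3 * main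
    obtain ⟨K, rfl⟩ : ∃ K, N = K + 1 + a := ⟨N - 1 - a, by omega⟩
    have ih := ih (by omega)
    rw [Nat.add_sub_cancel, Omega_succ_right h.gen304 (by omega)] at ih
    rw [show K + 1 + a - (a + 1) = K by omega, pentF_step, xi_succ, pow_succ (s4 / s3),
      Omega_succ h.gen124.swap (by omega), Omega_succ h.perm12.gen3.swap (show a + 1 ≤ _ by omega)]
    have hw : (s1 / s2 * (s4 / s3)) * (r * s0) *
        (r ^ 2 * (r ^ 2) ^ (K + 1 + a) * s2 ^ 2 * s3 ^ 2) = 1 := by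
      have h2 : s2 ≠ 0 := by rintro rfl; simp at hroot
      have h3 : s3 ≠ 0 := by rintro rfl; simp at hroot
      rw [← pow_mul]
      field_simp
      linear_combination hroot
    have hq := h.hq
    obtain ⟨n0, n1, n2, n3, n4⟩ := h.prod_ne
    have hqn := h.hqn
    have hC : (r ^ 2) ^ 3 * ((r ^ 2) ^ (K + 1 + a)) ^ 2 * s0 ^ 2 * s1 ^ 2 * s2 ^ 2 * s3 ^ 2 *
        s4 ^ 2 = 1 := by rw [← h.constr]; ring
    have A12 := h.A12
    have A1 := h.A1
    have A2 := h.A2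
    have A3 := h.A3
    have A4 := h.A4
    have A123 := h.gen3.A123
    have A124 := h.gen124.A123
    have hX : ∀ x : ℕ, (r ^ 2) ^ x ≠ 0 := fun x => pow_ne_zero x hq
    have eJ : (r ^ 2) ^ (K + 1 + a - j) = (r ^ 2) ^ (K + 1 + a) / (r ^ 2) ^ j := by
      rw [eq_div_iff (hX j), ← pow_add]; congr 1; omega
    have e1 : r ^ 2 * (r ^ 2) ^ K = (r ^ 2) ^ (K + 1 + a) / (r ^ 2) ^ a := by
      rw [eq_div_iff (hX a)]; ring
    rw [eJ]
    generalize Omega r a s4 s2 s1 (K + 1 + a) = O1 at *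
    generalize Omega r j s3 s0 s4 K = O2 at *
    generalize Omega r 0 s3 s1 s2 (K + 1 + a - j) = O3 at *
    generalize Omega r 0 s4 s2 s1 (K + 1 + a) = O4 at *
    generalize Omega r j s3 s0 s4 (K + 1 + a) = O5 at *
    generalize Omega r a s3 s1 s2 (K + 1 + a - j) = O6 at *
    generalize xi r a s2 s1 = O7 at *
    generalize (s4 / s3) ^ a = O8 at *
    generalize s1 / s2 = u at *
    generalize s4 / s3 = v at *
    generalize r * s0 = w at *
    generalize pentF (r ^ 2) (s0 ^ 2) (s1 ^ 2) (s2 ^ 2) (s3 ^ 2) (s4 ^ 2) ((r ^ 2) ^ (K + 1 + a)) a = F at *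
    generalize r ^ 2 = q at *
    generalize s0 ^ 2 = c0 at *
    generalize s1 ^ 2 = c1 at *
    generalize s2 ^ 2 = c2 at *
    generalize s3 ^ 2 = c3 at *
    generalize s4 ^ 2 = c4 at *
    have inv1 : ∀ c : ℂ, c ≠ 0 → Av q c →
        1 - (c * (q ^ (K + 1 + a) / q ^ j))⁻¹ * q ^ a ≠ 0 := fun c hc hA =>
      hA.inv hq 0 (b := c⁻¹) (by simp) |>.ne ((a + j : ℕ) - ((K + 1 + a : ℕ) : ℤ)) (by
        rw [zpow_sub₀ hq, zpow_natCast, zpow_natCast, pow_add q a]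
        have := hX (K + 1 + a)
        have := hX j
        field_simp)
    have k12 : ∀ c : ℂ, Av q c → ∀ z : ℂ, z = c → ∀ u : ℕ,
        1 - z * q ^ 2 * (q ^ (K + 1 + a) / q ^ u) * q ^ a ≠ 0 := fun c hA z hz u =>
      hA.ne ((2 + (K + 1 + a) + a : ℕ) - (u : ℤ)) (by
        rw [hz, zpow_sub₀ hq, zpow_natCast, zpow_natCast]
        ring)
    have main := pentF_scalar (A := q ^ a) (J := q ^ j) (M := q ^ (K + 1 + a)) (u := u * v) (w := w)
      (V := (1 - c1 * c2 * q ^ 3 * (q ^ a) ^ 2) * (1 - c1 * c2 * q * q ^ a) /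
        ((1 - c1 * c2 * q * (q ^ a) ^ 2) * (1 - q * q ^ a)))
      hq n0 n1 n2 n3 n4 (hX _) (hX a) (hX j) hC hw
      (by
        have := one_sub_inv_pow hq hqn (show j + a < K + 1 + a by omega)
        rwa [pow_add q j, ← mul_assoc, ← div_eq_inv_mul, ← inv_div] at this)
      (k12 _ A12 _ (mul_comm _ _) j) (by simpa using k12 _ A12 _ rfl 0) (inv1 c3 n3 A3)
      (k12 _ A123 _ (by ring) j)
      (by simpa using k12 _ A124 _ rfl 0) (A1.ne (a + 1 : ℕ) (by rw [zpow_natCast]; ring))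
      (A2.ne (a + 1 : ℕ) (by rw [zpow_natCast]; ring))
      (A4.inv hq 0 (b := c4⁻¹) (by simp) |>.ne (a - ((K + 1 + a : ℕ) : ℤ)) (by
        rw [zpow_sub₀ hq, zpow_natCast, zpow_natCast, mul_inv]
        ring))
    have f1 : c3 * c0 * c4 * q ^ 2 * q ^ K = c3 * c0 * c4 * q * (q ^ (K + 1 + a) / q ^ a) := by
      rw [← e1]; ring
    have f2 : q * c3 * q ^ K = c3 * (q ^ (K + 1 + a) / q ^ a) := by rw [← e1]; ring
    have f3 : c0 * c4 * q ^ 2 * q ^ K = c0 * c4 * q * (q ^ (K + 1 + a) / q ^ a) := by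
      rw [← e1]; ring
    rw [f1, f2, f3, e1] at ih
    clear f1 f2 f3 e1 k12 inv1
    rw [mul_comm c2 c1] at main ⊢
    exact key ih main

theorem pentK_step (q c1 c2 c3 M J : ℂ) (b : ℕ) :
    pentK q c1 c2 c3 M J (b + 1) = pentK q c1 c2 c3 M J b *
      ((1 - q * c1 * q ^ b) * (1 - c1 * c3 * q ^ 2 * M * q ^ b) /
        ((1 - q * c3 * q ^ b) * (1 - M⁻¹ * q ^ b) * (c1 * c2 * q * M)) *
        ((1 - J / M * q ^ b) * (1 - c1 * c2 * c3 * q ^ 2 * M / J * q ^ b) /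
          ((1 - c1 * c3 * q ^ 2 * M / J * q ^ b) * (1 - J / (c2 * M) * q ^ b)))) := by
  simp only [pentK, qPoch_succ, pow_succ _ b, div_eq_mul_inv, mul_inv]
  ring

theorem pentK_scalar {q c0 c1 c2 c3 c4 M B J V u w : ℂ} (hq : q ≠ 0) (n0 : c0 ≠ 0) (n1 : c1 ≠ 0)
    (n2 : c2 ≠ 0) (n3 : c3 ≠ 0) (hM : M ≠ 0) (hB : B ≠ 0)
    (hC : q ^ 3 * M ^ 2 * c0 * c1 * c2 * c3 * c4 = 1) (hu : u = w * (q * M * c0 * c3))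
    (z1 : 1 - M⁻¹ * B ≠ 0) (z2 : 1 - c1 * c3 * q ^ 2 * M * B ≠ 0) (z3 : 1 - (c0 * M)⁻¹ * B ≠ 0)
    (z4 : 1 - c1 * c3 * c0 * q ^ 2 * M * B ≠ 0) (z5 : 1 - q * c1 * B ≠ 0)
    (z6 : 1 - q * c3 * B ≠ 0) (z7 : 1 - c1 * c3 * q ^ 2 * (M / J) * B ≠ 0)
    (z8 : 1 - (c2 * (M / J))⁻¹ * B ≠ 0) :
    V * ((1 - M⁻¹ * B) / (1 - c1 * c3 * q ^ 2 * M * B)) * ((1 - q * c3 * B) / (1 - q * c1 * B)) *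
        ((1 - c1 * c3 * c0 * q ^ 2 * M * B) / (1 - (c0 * M)⁻¹ * B)) * (q * (c3 * c0))⁻¹ *
      ((1 - q * c1 * B) * (1 - c1 * c3 * q ^ 2 * M * B) /
        ((1 - q * c3 * B) * (1 - M⁻¹ * B) * (c1 * c2 * q * M)) *
        ((1 - J / M * B) * (1 - c1 * c2 * c3 * q ^ 2 * M / J * B) /
          ((1 - c1 * c3 * q ^ 2 * M / J * B) * (1 - J / (c2 * M) * B)))) *
      ((1 - c0 * (M / B)) * w / (1 - c4 * c2 * q * (M / B))) =
    ((1 - q * c1 * B) / (1 - q * c3 * B) * u) *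
      (V * ((1 - (M / J)⁻¹ * B) / (1 - c1 * c3 * q ^ 2 * (M / J) * B)) *
        ((1 - q * c3 * B) / (1 - q * c1 * B)) *
        ((1 - c1 * c3 * c2 * q ^ 2 * (M / J) * B) / (1 - (c2 * (M / J))⁻¹ * B)) *
        (q * (c3 * c2))⁻¹) := by
  have y1 : 1 - c0 * (M / B) = - (1 - (c0 * M)⁻¹ * B) * (c0 * M / B) := by field_simp; ring
  have y2 : 1 - c4 * c2 * q * (M / B) =
      - (1 - c1 * c3 * c0 * q ^ 2 * M * B) / (c1 * c3 * c0 * q ^ 2 * M * B) := by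
    field_simp; linear_combination - hC
  have y3 : J / M = (M / J)⁻¹ := by rw [inv_div]
  have y4 : c1 * c2 * c3 * q ^ 2 * M / J = c1 * c3 * c2 * q ^ 2 * (M / J) := by ring
  have y5 : c1 * c3 * q ^ 2 * M / J = c1 * c3 * q ^ 2 * (M / J) := by ring
  have y6 : J / (c2 * M) = (c2 * (M / J))⁻¹ := by rw [mul_div_assoc', inv_div]
  rw [y1, y2, y3, y4, y5, y6, hu]
  clear y1 y2 y3 y4 y5 y6
  generalize 1 - M⁻¹ * B = W1 at *
  generalize 1 - c1 * c3 * q ^ 2 * M * B = W2 at *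
  generalize 1 - (c0 * M)⁻¹ * B = W3 at *
  generalize 1 - c1 * c3 * c0 * q ^ 2 * M * B = W4 at *
  generalize 1 - q * c1 * B = W5 at *
  generalize 1 - q * c3 * B = W6 at *
  generalize 1 - c1 * c3 * q ^ 2 * (M / J) * B = W7 at *
  generalize 1 - (c2 * (M / J))⁻¹ * B = W8 at *
  field_simp

/-- The scalar identity behind the pentagon relation, for the dependence on the index `b`. -/
theorem Omega_mul_pentK {r s0 s1 s2 s3 s4 : ℂ} {N : ℕ}
    (hroot : r ^ (2 * N + 3) * s0 * s1 * s2 * s3 * s4 = 1)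
    (h : Gen5 (r ^ 2) (s0 ^ 2) (s1 ^ 2) (s2 ^ 2) (s3 ^ 2) (s4 ^ 2) N) {b j : ℕ} (hb : b + j ≤ N) :
    pentK (r ^ 2) (s1 ^ 2) (s2 ^ 2) (s3 ^ 2) ((r ^ 2) ^ N) ((r ^ 2) ^ j) b *
        Omega r b s0 s3 s1 N * Omega r 0 s0 s4 s2 N * Omega r 0 s2 s3 s1 (N - j) =
      xi r b s1 s3 * (s0 / s2) ^ b * Omega r b s2 s3 s1 (N - j) * Omega r 0 s0 s3 s1 N *
        Omega r 0 s0 s4 s2 (N - b) := by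
  induction b with
  | zero => simp [pentK_zero, xi, qPoch_zero]; ring
  | succ b ih =>
    have key : ∀ {F O1 O2 O3 O4 O5 O6 O7 O8 P R S x u v T : ℂ},
        F * O1 * O3 * O4 = O7 * O8 * O6 * O5 * (O2 * R) → S * P * R = x * (u * v) * T →
        F * P * (O1 * S) * O3 * O4 = O7 * (x * u) * (O8 * v) * (O6 * T) * O5 * O2 := by
      intro F O1 O2 O3 O4 O5 O6 O7 O8 P R S x u v T ih main
      linear_combination (S * P) * ih + O7 * O8 * O6 * O5 * O2 * main
    obtain ⟨K, rfl⟩ : ∃ K, N = K + 1 + b := ⟨N - 1 - b, by omega⟩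
    have ih := ih (by omega)
    rw [Nat.add_sub_cancel, Omega_succ_right h.gen042 (Nat.zero_le K) (n := 0)] at ih
    rw [show K + 1 + b - (b + 1) = K by omega, pentK_step, xi_succ, pow_succ (s0 / s2),
      Omega_succ h.gen031 (by omega), Omega_succ h.gen231 (show b + 1 ≤ _ by omega)]
    have hw : s3 / s1 * (s0 / s2) =
        r * s4 * (r ^ 2 * (r ^ 2) ^ (K + 1 + b) * s0 ^ 2 * s3 ^ 2) := by
      have h2 : s2 ≠ 0 := by rintro rfl; simp at hroot
      have h1 : s1 ≠ 0 := by rintro rfl; simp at hroot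
      rw [← pow_mul]
      field_simp
      linear_combination (-(s3 * s0)) * hroot
    have hq := h.hq
    obtain ⟨n0, n1, n2, n3, n4⟩ := h.prod_ne
    have hqn := h.hqn
    have hC : (r ^ 2) ^ 3 * ((r ^ 2) ^ (K + 1 + b)) ^ 2 * s0 ^ 2 * s1 ^ 2 * s2 ^ 2 * s3 ^ 2 *
        s4 ^ 2 = 1 := by rw [← h.constr]; ring
    have A13 := h.A13
    have A0 := h.A0
    have A1 := h.A1
    have A2 := h.A2
    have A3 := h.A3
    have A031 := h.gen031.A123
    have A042 := h.gen042.A123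
    have hX : ∀ x : ℕ, (r ^ 2) ^ x ≠ 0 := fun x => pow_ne_zero x hq
    have eJ : (r ^ 2) ^ (K + 1 + b - j) = (r ^ 2) ^ (K + 1 + b) / (r ^ 2) ^ j := by
      rw [eq_div_iff (hX j), ← pow_add]; congr 1; omega
    have e1 : r ^ 2 * (r ^ 2) ^ K = (r ^ 2) ^ (K + 1 + b) / (r ^ 2) ^ b := by
      rw [eq_div_iff (hX b)]; ring
    rw [eJ]
    generalize Omega r b s0 s3 s1 (K + 1 + b) = O1 at *
    generalize Omega r 0 s0 s4 s2 K = O2 at *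
    generalize Omega r 0 s0 s4 s2 (K + 1 + b) = O3 at *
    generalize Omega r 0 s2 s3 s1 (K + 1 + b - j) = O4 at *
    generalize Omega r 0 s0 s3 s1 (K + 1 + b) = O5 at *
    generalize Omega r b s2 s3 s1 (K + 1 + b - j) = O6 at *
    generalize xi r b s1 s3 = O7 at *
    generalize (s0 / s2) ^ b = O8 at *
    generalize s3 / s1 = u at *
    generalize s0 / s2 = v at *
    generalize r * s4 = w at *
    generalize pentK (r ^ 2) (s1 ^ 2) (s2 ^ 2) (s3 ^ 2) ((r ^ 2) ^ (K + 1 + b)) ((r ^ 2) ^ j) b = F at *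
    generalize r ^ 2 = q at *
    generalize s0 ^ 2 = c0 at *
    generalize s1 ^ 2 = c1 at *
    generalize s2 ^ 2 = c2 at *
    generalize s3 ^ 2 = c3 at *
    generalize s4 ^ 2 = c4 at *
    have k13 : ∀ c : ℂ, Av q c → ∀ z : ℂ, z = c → ∀ u : ℕ,
        1 - z * q ^ 2 * (q ^ (K + 1 + b) / q ^ u) * q ^ b ≠ 0 := fun c hA z hz u =>
      hA.ne ((2 + (K + 1 + b) + b : ℕ) - (u : ℤ)) (by
        rw [hz, zpow_sub₀ hq, zpow_natCast, zpow_natCast]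
        ring)
    have main := pentK_scalar (B := q ^ b) (J := q ^ j) (M := q ^ (K + 1 + b)) (u := u * v) (w := w)
      (V := (1 - c1 * c3 * q ^ 3 * (q ^ b) ^ 2) * (1 - c1 * c3 * q * q ^ b) /
        ((1 - c1 * c3 * q * (q ^ b) ^ 2) * (1 - q * q ^ b)))
      hq n0 n1 n2 n3 (hX _) (hX b) hC hw
      (one_sub_inv_pow hq hqn (by omega)) (by simpa using k13 _ A13 _ rfl 0)
      (A0.inv hq 0 (b := c0⁻¹) (by simp) |>.ne (b - ((K + 1 + b : ℕ) : ℤ)) (by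
        rw [zpow_sub₀ hq, zpow_natCast, zpow_natCast, mul_inv]
        ring))
      (by simpa using k13 _ A031 _ (show c1 * c3 * c0 = _ by ring) 0)
      (A1.ne (b + 1 : ℕ) (by rw [zpow_natCast]; ring))
      (A3.ne (b + 1 : ℕ) (by rw [zpow_natCast]; ring)) (k13 _ A13 _ rfl j)
      (A2.inv hq 0 (b := c2⁻¹) (by simp) |>.ne ((b + j : ℕ) - ((K + 1 + b : ℕ) : ℤ)) (by
        rw [zpow_sub₀ hq, zpow_natCast, zpow_natCast, pow_add q b]
        have := hX (K + 1 + b)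
        have := hX j
        field_simp))
    have hR : (1 - q * q ^ K) / (1 - q * q ^ K / q ^ 0) *
        ((1 - c0 * c4 * c2 * q ^ 2 * q ^ K * q ^ 0) / (1 - c0 * c4 * c2 * q ^ 2 * q ^ K)) *
        ((1 - q * c0 * q ^ K / q ^ 0) * w / (1 - c4 * c2 * q ^ 2 * q ^ K * q ^ 0)) =
        (1 - c0 * (q ^ (K + 1 + b) / q ^ b)) * w / (1 - c4 * c2 * q * (q ^ (K + 1 + b) / q ^ b)) := by
      have z1 : 1 - q * q ^ K ≠ 0 := by rw [← pow_succ']; exact hqn K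
      have z2 : 1 - c0 * c4 * c2 * q ^ 2 * q ^ K ≠ 0 :=
        A042.ne (2 + K : ℕ) (by rw [zpow_natCast]; ring)
      rw [pow_zero, div_one, div_one, mul_one, mul_one, div_self z1, div_self z2, one_mul, one_mul,
        ← e1]
      ring
    rw [hR] at ih
    exact key ih main

theorem qPoch_ne_of_Av {q a : ℂ} (ha : Av q a) (m : ℕ) {z : ℂ} (hz : z = q ^ m * a) (k : ℕ) :
    qPoch z q k ≠ 0 :=
  qPoch_ne_zero fun l _ => ha.ne (l + m : ℕ) (by rw [zpow_natCast, hz]; ring)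

theorem Omega_zero_ne_zero {r s1 s2 s3 : ℂ} (h : Gen3 (r ^ 2) (s1 ^ 2) (s2 ^ 2) (s3 ^ 2)) (K : ℕ) :
    Omega r 0 s1 s2 s3 K ≠ 0 := by
  have hr : r * s2 ≠ 0 := by
    have h1 := h.hq
    have h2 := h.n2
    refine mul_ne_zero ?_ ?_ <;> rintro rfl <;> simp at h1 h2
  rw [Omega_zero h]
  exact div_ne_zero (mul_ne_zero (qPoch_ne_of_Av h.A1 1 (by ring) K) (pow_ne_zero _ hr))
    (qPoch_ne_of_Av h.A23 2 (by ring) K)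

theorem Omega_zero_mul_mass {r s1 s2 s3 : ℂ} (h : Gen3 (r ^ 2) (s1 ^ 2) (s2 ^ 2) (s3 ^ 2)) (K : ℕ) :
    Omega r 0 s1 s2 s3 K * Omega r 0 s3 s2 s1 K * woMass (r ^ 2) (s1 ^ 2) (s2 ^ 2) (s3 ^ 2) K =
      1 := by
  have hr : r * s2 ≠ 0 := by
    have h1 := h.hq
    have h2 := h.n2
    refine mul_ne_zero ?_ ?_ <;> rintro rfl <;> simp at h1 h2
  have z1 := qPoch_ne_of_Av h.A3 1 (show r ^ 2 * s3 ^ 2 = _ by ring) K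
  have z2 := qPoch_ne_of_Av h.A12 2 (show s1 ^ 2 * s2 ^ 2 * (r ^ 2) ^ 2 = _ by ring) K
  have z3 := pow_ne_zero K hr
  rw [mul_right_comm, Omega_zero_mul_woMass h, Omega_zero h.swap, mul_comm (s2 ^ 2) (s1 ^ 2)]
  generalize qPoch (s1 ^ 2 * s2 ^ 2 * (r ^ 2) ^ 2) (r ^ 2) K = Q at *
  generalize qPoch (r ^ 2 * s3 ^ 2) (r ^ 2) K = Q' at *
  field_simp

/-- Orthogonality of the normalized `q`-Racah polynomials. -/
theorem sum_qRacah_mul_qRacah {r s1 s2 s3 : ℂ} (h : Gen3 (r ^ 2) (s1 ^ 2) (s2 ^ 2) (s3 ^ 2))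
    {K l j : ℕ} (hl : l ≤ K) (hj : j ≤ K) :
    ∑ x ∈ Finset.range (K + 1), qRacah r l x s1 s2 s3 K * qRacah r x j s3 s2 s1 K =
      if l = j then 1 else 0 := by
  have e : ∑ x ∈ Finset.range (K + 1), qRacah r l x s1 s2 s3 K * qRacah r x j s3 s2 s1 K =
      Omega r l s1 s2 s3 K * Omega r 0 s3 s2 s1 K *
        orthSum (r ^ 2) (s1 ^ 2) (s2 ^ 2) (s3 ^ 2) K l j := by
    rw [orthSum, Finset.mul_sum]
    refine Finset.sum_congr rfl fun x hx => ?_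
    have hx : x ≤ K := by simpa [Nat.lt_succ_iff] using hx
    rw [qRacah_eq _ _ _ _ hl hx, qRacah_eq _ _ _ _ hx hj, Omega_eq_wo h.swap x hx,
      pR_symm h.hq (s3 ^ 2)]
    ring
  rw [e, orthSum_eq l h hl hj, Omega_eq_wo h l hl]
  split_ifs with hlj
  · have := wo_ne_zero h.swap hl
    have hm := Omega_zero_mul_mass h K
    field_simp
    exact hm
  · ring

theorem xi_ne_zero {r s1 s2 : ℂ} (hs1 : s1 ≠ 0) (hs2 : s2 ≠ 0) (h1 : Av (r ^ 2) (s1 ^ 2))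
    (h2 : Av (r ^ 2) (s2 ^ 2)) (n : ℕ) : xi r n s1 s2 ≠ 0 :=
  mul_ne_zero (div_ne_zero (qPoch_ne_of_Av h1 1 (by ring) n) (qPoch_ne_of_Av h2 1 (by ring) n))
    (pow_ne_zero _ (div_ne_zero hs2 hs1))

theorem omega_ne_zero {r s : ℂ} (hr : r ≠ 0) (hs : s ≠ 0) (n : ℕ) : omega r n s ≠ 0 :=
  mul_ne_zero (mul_ne_zero (pow_ne_zero _ (by norm_num)) (pow_ne_zero _ hs))
    (pow_ne_zero _ (pow_ne_zero _ hr))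

theorem xi_mul_xi {r s1 s2 : ℂ} (hs1 : s1 ≠ 0) (hs2 : s2 ≠ 0) (h1 : Av (r ^ 2) (s1 ^ 2))
    (h2 : Av (r ^ 2) (s2 ^ 2)) (n : ℕ) : xi r n s1 s2 * xi r n s2 s1 = 1 := by
  have z1 := qPoch_ne_of_Av h1 1 (show r ^ 2 * s1 ^ 2 = _ by ring) n
  have z2 := qPoch_ne_of_Av h2 1 (show r ^ 2 * s2 ^ 2 = _ by ring) n
  rw [xi, xi, mul_mul_mul_comm, ← mul_pow (s2 / s1), show s2 / s1 * (s1 / s2) = 1 by field_simp, one_pow,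
    mul_one, div_mul_div_cancel₀ z2, div_self z1]

theorem Omega_swap23 {r s1 s2 s3 : ℂ} (h : Gen3 (r ^ 2) (s1 ^ 2) (s2 ^ 2) (s3 ^ 2))
    (h' : Gen3 (r ^ 2) (s1 ^ 2) (s3 ^ 2) (s2 ^ 2)) {n K : ℕ} (hn : n ≤ K) :
    Omega r n s1 s3 s2 K * xi r n s2 s3 ^ 2 * Omega r 0 s1 s2 s3 K =
      Omega r 0 s1 s3 s2 K * Omega r n s1 s2 s3 K := by
  have n2 := h.n2
  have n3 := h.n3
  have hq := h.hq
  have n1 := h.n1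
  have hs2 : s2 ≠ 0 := by rintro rfl; exact n2 (by simp)
  have hs3 : s3 ≠ 0 := by rintro rfl; exact n3 (by simp)
  rw [Omega_eq_wo h' n hn, Omega_eq_wo h n hn, wo, wo, mul_comm (s2 ^ 2) (s3 ^ 2), xi]
  have e1 : s3 ^ 2 * s2 ^ 2 * (r ^ 2) ^ 2 / (r ^ 2 * s2 ^ 2) = r ^ 2 * s3 ^ 2 := by field_simp
  have e2 : s3 ^ 2 * s2 ^ 2 * (r ^ 2) ^ 2 / (r ^ 2 * s3 ^ 2) = r ^ 2 * s2 ^ 2 := by field_simp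
  have z1 := qPoch_ne_of_Av h.A2 1 (show r ^ 2 * s2 ^ 2 = _ by ring) n
  have z2 := qPoch_ne_of_Av h.A3 1 (show r ^ 2 * s3 ^ 2 = _ by ring) n
  have e3 : pr (r ^ 2) (s3 ^ 2 * s2 ^ 2) (r ^ 2 * s3 ^ 2) n *
      (qPoch (r ^ 2 * s2 ^ 2) (r ^ 2) n / qPoch (r ^ 2 * s3 ^ 2) (r ^ 2) n) ^ 2 =
      pr (r ^ 2) (s3 ^ 2 * s2 ^ 2) (r ^ 2 * s2 ^ 2) n := by
    rw [pr, pr, e1, e2]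
    field_simp
  have e4 : ((r ^ 2 * (s3 ^ 2 * s1 ^ 2))⁻¹) ^ n * ((s3 / s2) ^ n) ^ 2 =
      ((r ^ 2 * (s2 ^ 2 * s1 ^ 2))⁻¹) ^ n := by
    rw [← pow_mul, mul_comm n 2, pow_mul, ← mul_pow]
    congr 1
    field_simp
  rw [mul_pow]
  rw [← e3, ← e4]
  ring

theorem racU_eq {r s2 s3 : ℂ} (hs2 : s2 ≠ 0) (n : ℕ) :
    racU (r ^ 2) (s2 ^ 2) (s3 ^ 2) n = (omega r n (s2 * s3) * xi r n s2 s3)⁻¹ := by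
  have : (-s3 ^ 2) ^ n = (-1) ^ n * (s2 * s3) ^ n * (s3 / s2) ^ n := by
    rw [← mul_pow, ← mul_pow]; congr 1; field_simp
  rw [racU, this, omega, xi]
  simp only [div_eq_mul_inv, mul_inv, inv_inv]
  ring

theorem choose_add_succ_two (m l : ℕ) :
    (m + l + 1).choose 2 = (m + 1).choose 2 + (l + 1).choose 2 + m * l := by
  induction l with
  | zero => simp
  | succ l ih =>
    rw [← add_assoc, Nat.choose_succ_succ, Nat.choose_one_right, ih, Nat.choose_succ_succ (l + 1),
      Nat.choose_one_right]
    ring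

theorem racV_eq {r s1 s2 s3 : ℂ} (h : Gen3 (r ^ 2) (s1 ^ 2) (s2 ^ 2) (s3 ^ 2))
    (h12 : Gen3 (r ^ 2) (s3 ^ 2) (s1 ^ 2) (s2 ^ 2)) (h23 : Gen3 (r ^ 2) (s1 ^ 2) (s3 ^ 2) (s2 ^ 2))
    {m K : ℕ} (hm : m ≤ K) :
    Omega r 0 s3 s1 s2 K * Omega r 0 s1 s2 s3 K * racV (r ^ 2) (s1 ^ 2) (s2 ^ 2) (s3 ^ 2) K m *
        omega r m (s1 * s3) =
      omega r K (r * s1 * s2 * s3) * Omega r 0 s1 s3 s2 K * xi r m s3 s1 := by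
  obtain ⟨l, rfl⟩ := Nat.exists_eq_add_of_le hm
  have hs3 : s3 ≠ 0 := by
    rintro rfl; exact h.n3 (by simp)
  have e1 := qPoch_reverse h.hq (mul_ne_zero h.n3 (pow_ne_zero m h.hq)) l
  rw [mul_assoc (s3 ^ 2), ← pow_add] at e1
  have z1 := qPoch_ne_of_Av h.A3 (m + 1)
    (show r ^ 2 * (s3 ^ 2 * (r ^ 2) ^ m) = _ by ring) l
  have z2 := qPoch_ne_of_Av h.A1 1 (show r ^ 2 * s1 ^ 2 = _ by ring) m
  have z3 := qPoch_ne_of_Av h.A12 2 (show s1 ^ 2 * s2 ^ 2 * (r ^ 2) ^ 2 = _ by ring) (m + l)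
  have z4 := qPoch_ne_of_Av h.A23 2 (show s2 ^ 2 * s3 ^ 2 * (r ^ 2) ^ 2 = _ by ring) (m + l)
  have e2 : qPoch (r ^ 2 * s3 ^ 2) (r ^ 2) (m + l) = qPoch (r ^ 2 * s3 ^ 2) (r ^ 2) m *
      qPoch (r ^ 2 * (s3 ^ 2 * (r ^ 2) ^ m)) (r ^ 2) l := by
    rw [qPoch_add]; ring_nf
  rw [Omega_zero h12, Omega_zero h, Omega_zero h23, racV, Nat.add_sub_cancel_left, e1, e2, xi,
    omega, omega, choose_add_succ_two, mul_comm (s3 ^ 2) (s2 ^ 2)]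
  generalize qPoch (r ^ 2 * (s3 ^ 2 * (r ^ 2) ^ m)) (r ^ 2) l = Q1 at *
  generalize qPoch (r ^ 2 * s1 ^ 2) (r ^ 2) m = Q2 at *
  generalize qPoch (s1 ^ 2 * s2 ^ 2 * (r ^ 2) ^ 2) (r ^ 2) (m + l) = Q3 at *
  generalize qPoch (s2 ^ 2 * s3 ^ 2 * (r ^ 2) ^ 2) (r ^ 2) (m + l) = Q4 at *
  generalize qPoch (r ^ 2 * s3 ^ 2) (r ^ 2) m = Q5 at *
  generalize qPoch (r ^ 2 * s1 ^ 2) (r ^ 2) (m + l) = Q6 at *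
  have hr : r ≠ 0 := by rintro rfl; exact h.hq (by simp)
  rw [pow_add (r ^ 2), pow_add (r ^ 2)]
  have z5 : (r ^ 2) ^ ((l + 1).choose 2) ≠ 0 := pow_ne_zero _ h.hq
  generalize (r ^ 2) ^ ((l + 1).choose 2) = E1 at *
  generalize (r ^ 2) ^ ((m + 1).choose 2) = E2 at *
  clear h h12 h23 e1 e2
  have i1 : Q5 * Q1 * (r * s1) ^ (m + l) / Q3 * (Q6 * (r * s2) ^ (m + l) / Q4) *
      (Q3 / (Q2 * (Q1 * ((-1) ^ l * ((s3 ^ 2 * (r ^ 2) ^ m)⁻¹) ^ l * E1⁻¹)))) *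
      ((-1) ^ m * (s1 * s3) ^ m * E2) = Q5 * Q6 / (Q4 * Q2) * (E1 * E2 * ((r * s1) ^ (m + l) *
      (r * s2) ^ (m + l) * ((-1) ^ m * (-1) ^ l * (s1 * s3) ^ m * (s3 ^ 2 * (r ^ 2) ^ m) ^ l))) := by
    have hT : ((-1 : ℂ) ^ l) * (-1) ^ l = 1 := by rw [← mul_pow]; norm_num
    have := pow_ne_zero l (neg_ne_zero.2 (one_ne_zero (α := ℂ)))
    have := pow_ne_zero l (mul_ne_zero (pow_ne_zero 2 hs3) (pow_ne_zero m (pow_ne_zero 2 hr)))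
    rw [inv_pow]
    generalize (s3 ^ 2 * (r ^ 2) ^ m) ^ l = T at *
    generalize (-1 : ℂ) ^ l = T' at *
    field_simp
    linear_combination (-(Q5 * (r * s1) ^ (m + l) * Q6 * (r * s2) ^ (m + l) * (s1 * s3) ^ m * E2)) * hT
  have i2 : (r * s1) ^ (m + l) *
      (r * s2) ^ (m + l) * ((-1) ^ m * (-1) ^ l * (s1 * s3) ^ m * (s3 ^ 2 * (r ^ 2) ^ m) ^ l) =
      (-1) ^ (m + l) * (r * s1 * s2 * s3) ^ (m + l) * (r ^ 2) ^ (m * l) *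
        ((r * s3) ^ (m + l) * (s1 / s3) ^ m) := by
    rw [div_pow, pow_add (r * s3)]
    field_simp
    ring
  rw [i1, i2]
  simp only [div_eq_mul_inv, mul_inv]
  ring

/-- The Racah relation for the normalized `q`-Racah polynomials. -/
theorem sum_omega_mul_qRacah {r s1 s2 s3 : ℂ} (h : Gen3 (r ^ 2) (s1 ^ 2) (s2 ^ 2) (s3 ^ 2))
    (h12 : Gen3 (r ^ 2) (s3 ^ 2) (s1 ^ 2) (s2 ^ 2)) (h23 : Gen3 (r ^ 2) (s1 ^ 2) (s3 ^ 2) (s2 ^ 2))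
    {K n m : ℕ} (hn : n ≤ K) (hm : m ≤ K) :
    ∑ x ∈ Finset.range (K + 1), omega r x (s1 * s2) * xi r x s2 s1 * qRacah r n x s1 s2 s3 K *
        qRacah r x m s3 s1 s2 K =
      omega r K (r * s1 * s2 * s3) * xi r n s2 s3 * xi r m s3 s1 * qRacah r n m s1 s3 s2 K /
        (omega r n (s2 * s3) * omega r m (s1 * s3)) := by
  have hs1 : s1 ≠ 0 := by rintro rfl; exact h.n1 (by simp)
  have hs2 : s2 ≠ 0 := by rintro rfl; exact h.n2 (by simp)
  have hs3 : s3 ≠ 0 := by rintro rfl; exact h.n3 (by simp)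
  have hr : r ≠ 0 := by rintro rfl; exact h.hq (by simp)
  have e : ∑ x ∈ Finset.range (K + 1), omega r x (s1 * s2) * xi r x s2 s1 *
        qRacah r n x s1 s2 s3 K * qRacah r x m s3 s1 s2 K =
      Omega r n s1 s2 s3 K * Omega r 0 s3 s1 s2 K *
        racSum (r ^ 2) (s1 ^ 2) (s2 ^ 2) (s3 ^ 2) K n m := by
    rw [racSum, Finset.mul_sum]
    refine Finset.sum_congr rfl fun x hx => ?_
    have hx : x ≤ K := by simpa [Nat.lt_succ_iff] using hx
    have e1 : s1 ^ 2 * s2 ^ 2 * (r ^ 2) ^ 2 / (r ^ 2 * s1 ^ 2) = r ^ 2 * s2 ^ 2 := by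
      have := h.n1
      field_simp
    have z1 := qPoch_ne_of_Av h.A1 1 (show r ^ 2 * s1 ^ 2 = _ by ring) x
    have z2 := qPoch_ne_of_Av h.A2 1 (show r ^ 2 * s2 ^ 2 = _ by ring) x
    have e3 : pr (r ^ 2) (s1 ^ 2 * s2 ^ 2) (r ^ 2 * s1 ^ 2) x *
        (qPoch (r ^ 2 * s2 ^ 2) (r ^ 2) x / qPoch (r ^ 2 * s1 ^ 2) (r ^ 2) x) = 1 := by
      rw [pr, e1]
      field_simp
    have e4 : ((r ^ 2 * (s1 ^ 2 * s3 ^ 2))⁻¹) ^ x * ((s1 / s2) ^ x * ((-1) ^ x * (s1 * s2) ^ x)) *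
        (r ^ 2) ^ x = ((s3 ^ 2)⁻¹) ^ x * (-1) ^ x := by
      simp only [← mul_pow]
      congr 1
      field_simp
    have e5 : s1 ^ 2 * s2 ^ 2 * (r ^ 2) ^ 2 * (r ^ 2) ^ K /
        (s1 ^ 2 * s2 ^ 2 * s3 ^ 2 * (r ^ 2) ^ 2 * (r ^ 2) ^ K) = (s3 ^ 2)⁻¹ := by
      field_simp
    have e6 : dpr (r ^ 2) (s1 ^ 2 * s2 ^ 2) 0 x = (-1) ^ x * (r ^ 2) ^ (x.choose 2) := by
      have : ∀ y : ℕ, ∏ l ∈ Finset.range y, (0 - (r ^ 2) ^ l) = (-1) ^ y * (r ^ 2) ^ (y.choose 2) := by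
        intro y
        induction y with
        | zero => simp
        | succ y ih =>
          rw [Finset.prod_range_succ, ih, Nat.choose_succ_succ, Nat.choose_one_right]
          ring
      rw [dpr, this]
      simp [qPoch]
    rw [qRacah_eq _ _ _ _ hn hx, qRacah_eq _ _ _ _ hx hm, Omega_eq_wo h12 x hx,
      pR_symm h.hq (s3 ^ 2), wo, wt, e5, e6, omega, xi, mul_comm (s2 ^ 2) (s1 ^ 2),
      Nat.choose_succ_succ, Nat.choose_one_right, pow_add (r ^ 2)]
    generalize pr (r ^ 2) (s1 ^ 2 * s2 ^ 2) (r ^ 2 * s1 ^ 2) x = P at *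
    generalize qPoch (r ^ 2 * s2 ^ 2) (r ^ 2) x / qPoch (r ^ 2 * s1 ^ 2) (r ^ 2) x = P' at *
    generalize ((r ^ 2 * (s1 ^ 2 * s3 ^ 2))⁻¹) ^ x = T1 at *
    generalize (s1 / s2) ^ x = T2 at *
    generalize ((s3 ^ 2)⁻¹) ^ x = T3 at *
    generalize pR (r ^ 2) (s1 ^ 2) (s2 ^ 2) (s3 ^ 2) ((r ^ 2) ^ K) n x = R1
    generalize pR (r ^ 2) (s2 ^ 2) (s1 ^ 2) (s3 ^ 2) ((r ^ 2) ^ K) m x = R2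
    generalize vwp (r ^ 2) (s1 ^ 2 * s2 ^ 2) x = V
    generalize pr (r ^ 2) (s1 ^ 2 * s2 ^ 2) ((r ^ 2) ^ K)⁻¹ x = P1
    generalize pr (r ^ 2) (s1 ^ 2 * s2 ^ 2)
      (s1 ^ 2 * s2 ^ 2 * s3 ^ 2 * (r ^ 2) ^ 2 * (r ^ 2) ^ K) x = P2
    generalize (r ^ 2) ^ x.choose 2 = E
    generalize (r ^ 2) ^ x = X at *
    linear_combination (P' * E * Omega r n s1 s2 s3 K * R1 * Omega r 0 s3 s1 s2 K * V * P1 * P2 *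
      P * R2) * e4 + (E * Omega r n s1 s2 s3 K * R1 * Omega r 0 s3 s1 s2 K * V * P1 * P2 * R2 * T3 *
      (-1) ^ x) * e3
  rw [e, racSum_eq n h hn hm, qRacah_eq _ _ _ _ hn hm, racU_eq hs2]
  have v := racV_eq h h12 h23 hm
  have w := Omega_swap23 h h23 hn
  have x1 := xi_ne_zero hs2 hs3 h.A2 h.A3 n
  have x2 := omega_ne_zero hr (mul_ne_zero hs2 hs3) n
  have x3 := omega_ne_zero hr (mul_ne_zero hs1 hs3) m
  have x4 := Omega_zero_ne_zero h K
  generalize pR (r ^ 2) (s1 ^ 2) (s3 ^ 2) (s2 ^ 2) ((r ^ 2) ^ K) n m = R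
  generalize omega r n (s2 * s3) = a at *
  generalize omega r m (s1 * s3) = b at *
  generalize omega r K (r * s1 * s2 * s3) = d at *
  apply mul_left_cancel₀ x4
  generalize Omega r 0 s1 s2 s3 K = O at *
  clear x4 e
  rw [eq_comm, mul_div_assoc', div_eq_iff (mul_ne_zero x2 x3)]
  field_simp
  linear_combination (- R * Omega r n s1 s2 s3 K) * v + R * d * xi r m s3 s1 * w

section

variable {r s0 s1 s2 s3 s4 : ℂ} {N : ℕ}

/-- The weight of the biorthogonality relation of the Griffiths polynomials. -/
def griffithsW (r s0 s1 s2 s3 s4 : ℂ) (N x y : ℕ) : ℂ :=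
  Omega r x s1 s2 s4 (N - y) * Lambda r y s3 s0 s4 s1 N /
    (xi r x s2 s4 * xi r y s0 s3 * (s1 / s0) ^ x * (s4 / s1) ^ y)

/-- The constant of the pentagon relation for the normalized `q`-Racah polynomials. -/
def pentConst (r s0 s1 s2 s3 s4 : ℂ) (N j : ℕ) : ℂ :=
  Omega r 0 s1 s2 s4 N * Lambda r 0 s3 s0 s4 s1 N * Omega r 0 s4 s2 s1 N * Omega r 0 s0 s3 s1 N *
      Omega r j s3 s0 s4 N *
      pentG (r ^ 2) (s0 ^ 2) (s1 ^ 2) (s2 ^ 2) (s3 ^ 2) (s4 ^ 2) N j /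
    (Omega r 0 s0 s4 s2 N * Omega r 0 s2 s3 s1 (N - j) * Omega r 0 s3 s1 s2 (N - j))

theorem root_ne (hroot : r ^ (2 * N + 3) * s0 * s1 * s2 * s3 * s4 = 1) :
    r ≠ 0 ∧ s0 ≠ 0 ∧ s1 ≠ 0 ∧ s2 ≠ 0 ∧ s3 ≠ 0 ∧ s4 ≠ 0 := by
  refine ⟨?_, ?_, ?_, ?_, ?_, ?_⟩ <;> rintro rfl <;> simp at hroot

/-- The pentagon relation for the normalized `q`-Racah polynomials. -/
theorem sum_griffithsW_mul_qRacah
    (hroot : r ^ (2 * N + 3) * s0 * s1 * s2 * s3 * s4 = 1)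
    (h : Gen5 (r ^ 2) (s0 ^ 2) (s1 ^ 2) (s2 ^ 2) (s3 ^ 2) (s4 ^ 2) N) {a j x b : ℕ}
    (ha : a + j ≤ N) (hx : x + b ≤ N) :
    ∑ y ∈ Finset.range (N - x + 1), griffithsW r s0 s1 s2 s3 s4 N x y *
        qRacah r j y s3 s0 s4 (N - a) * qRacah r a x s4 s2 s1 (N - y) *
        qRacah r b y s0 s3 s1 (N - x) =
      if j + b ≤ N then
        pentConst r s0 s1 s2 s3 s4 N j * (xi r a s2 s1 * (s4 / s3) ^ a) *
          (xi r b s1 s3 * (s0 / s2) ^ b) * Omega r b s2 s3 s1 (N - j) *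
          qRacah r a b s3 s1 s2 (N - j) * qRacah r x j s0 s4 s2 (N - b)
      else 0 := by
  obtain ⟨hr, hs0, hs1, hs2, hs3, hs4⟩ := root_ne hroot
  have hq := h.hq
  have hX : ∀ x : ℕ, (r ^ 2) ^ x ≠ 0 := fun x => pow_ne_zero x hq
  have eP : ∀ {u v : ℕ}, v ≤ u → (r ^ 2) ^ (u - v) = (r ^ 2) ^ u / (r ^ 2) ^ v := fun {u v} huv => by
    rw [eq_div_iff (hX v), ← pow_add, Nat.sub_add_cancel huv]
  have x24 := xi_ne_zero hs2 hs4 h.A2 h.A4 x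
  have e : ∑ y ∈ Finset.range (N - x + 1), griffithsW r s0 s1 s2 s3 s4 N x y *
        qRacah r j y s3 s0 s4 (N - a) * qRacah r a x s4 s2 s1 (N - y) *
        qRacah r b y s0 s3 s1 (N - x) =
      Lambda r 0 s3 s0 s4 s1 N / (xi r x s2 s4 * (s1 / s0) ^ x) *
        (Omega r x s1 s2 s4 N * Omega r a s4 s2 s1 N * Omega r j s3 s0 s4 (N - a) *
          Omega r b s0 s3 s1 (N - x)) *
        pentSum (r ^ 2) (s0 ^ 2) (s1 ^ 2) (s2 ^ 2) (s3 ^ 2) (s4 ^ 2) N a j x b := by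
    have hsub : Finset.range (N - x + 1) ⊆ Finset.range (N + 1) := by
      intro y; simp only [Finset.mem_range]; omega
    rw [pentSum, ← Finset.sum_subset hsub, Finset.mul_sum]
    · refine Finset.sum_congr rfl fun y hy => ?_
      have hy : y ≤ N - x := by simpa [Nat.lt_succ_iff] using hy
      by_cases hay : a + y ≤ N
      · have w := pentW_eq_Omega h y (show x + y ≤ N by omega) hay
        have x03 := xi_ne_zero hs0 hs3 h.A0 h.A3 y
        have hz : (s4 / s1) ^ y ≠ 0 := pow_ne_zero _ (div_ne_zero hs4 hs1)
        have hz' : (s1 / s0) ^ x ≠ 0 := pow_ne_zero _ (div_ne_zero hs1 hs0)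
        rw [qRacah_eq _ _ _ _ (by omega) (by omega), qRacah_eq _ _ _ _ (by omega) (by omega),
          qRacah_eq _ _ _ _ (by omega) (by omega), griffithsW,
          Lambda_eq hr hs3 hs0 h.hqn (by rw [mul_comm]; exact h.A03) (by omega),
          eP (show a ≤ N by omega), eP (show y ≤ N by omega), eP (show x ≤ N by omega),
          mul_comm (s3 ^ 2) (s0 ^ 2)]
        generalize xi r x s2 s4 = X1 at *
        generalize xi r y s0 s3 = X2 at *
        generalize (s4 / s1) ^ y = T1 at *
        generalize (s1 / s0) ^ x = T2 at *
        generalize vwp (r ^ 2) (s0 ^ 2 * s3 ^ 2) y * pr (r ^ 2) (s0 ^ 2 * s3 ^ 2) ((r ^ 2) ^ N)⁻¹ y *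
          ((r ^ 2) ^ N) ^ y = V at *
        field_simp
        linear_combination (Lambda r 0 s3 s0 s4 s1 N * Omega r j s3 s0 s4 (N - a) *
          Omega r b s0 s3 s1 (N - x) *
          pR (r ^ 2) (s3 ^ 2) (s0 ^ 2) (s4 ^ 2) ((r ^ 2) ^ N / (r ^ 2) ^ a) j y *
          pR (r ^ 2) (s4 ^ 2) (s2 ^ 2) (s1 ^ 2) ((r ^ 2) ^ N / (r ^ 2) ^ y) a x *
          pR (r ^ 2) (s0 ^ 2) (s3 ^ 2) (s1 ^ 2) ((r ^ 2) ^ N / (r ^ 2) ^ x) b y) * w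
      · rw [pentW_eq_zero_left hq _ (by omega) (by omega), qRacah, if_neg (by omega)]
        simp
    · intro y hy hy'
      simp only [Finset.mem_range] at hy hy'
      rw [pentW_eq_zero_right hq _ (by omega) (by omega)]
      simp
  rw [e, pentSum_eq h ha hx]
  split_ifs with hjb
  · rw [pentR, qRacah_eq _ _ _ _ (by omega) (by omega), qRacah_eq _ _ _ _ (by omega) (by omega),
      eP (show j ≤ N by omega), eP (show b ≤ N by omega), pentConst]
    have fa := Omega_mul_pentF hroot h ha
    have fx := Omega_mul_pentF (by rw [← hroot]; ring) h.swap hx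
    have fb := Omega_mul_pentK hroot h (show b + j ≤ N by omega)
    have pp : pR (r ^ 2) (s2 ^ 2) (s4 ^ 2) (s0 ^ 2) ((r ^ 2) ^ N / (r ^ 2) ^ b) j x =
        pR (r ^ 2) (s0 ^ 2) (s4 ^ 2) (s2 ^ 2) ((r ^ 2) ^ N / (r ^ 2) ^ b) x j := pR_symm hq ..
    rw [pp]
    have z1 := Omega_zero_ne_zero h.perm12.gen3.swap (N - j)
    have z2 := Omega_zero_ne_zero h.gen231 (N - j)
    have z3 := Omega_zero_ne_zero h.gen042 N
    have z4 := Omega_zero_ne_zero h.gen042 (N - b)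
    have hz' : (s1 / s0) ^ x ≠ 0 := pow_ne_zero _ (div_ne_zero hs1 hs0)
    apply mul_left_cancel₀ z4
    generalize (s1 / s0) ^ x = T1 at *
    generalize (s4 / s3) ^ a = T2 at *
    generalize (s0 / s2) ^ b = T3 at *
    generalize pR (r ^ 2) (s0 ^ 2) (s4 ^ 2) (s2 ^ 2) ((r ^ 2) ^ N / (r ^ 2) ^ b) x j = R1
    generalize pR (r ^ 2) (s3 ^ 2) (s1 ^ 2) (s2 ^ 2) ((r ^ 2) ^ N / (r ^ 2) ^ j) a b = R2
    generalize pentF (r ^ 2) (s0 ^ 2) (s1 ^ 2) (s2 ^ 2) (s3 ^ 2) (s4 ^ 2) ((r ^ 2) ^ N) a = F1 at *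
    generalize pentF (r ^ 2) (s3 ^ 2) (s4 ^ 2) (s2 ^ 2) (s0 ^ 2) (s1 ^ 2) ((r ^ 2) ^ N) x = F2 at *
    generalize pentG (r ^ 2) (s0 ^ 2) (s1 ^ 2) (s2 ^ 2) (s3 ^ 2) (s4 ^ 2) N j = G
    generalize pentK (r ^ 2) (s1 ^ 2) (s2 ^ 2) (s3 ^ 2) ((r ^ 2) ^ N) ((r ^ 2) ^ j) b = F3 at *
    generalize Lambda r 0 s3 s0 s4 s1 N = L
    generalize Omega r x s1 s2 s4 N = O1 at *
    generalize Omega r b s0 s3 s1 (N - x) = O2 at *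
    generalize Omega r 0 s0 s4 s2 (N - b) = O3 at *
    generalize Omega r 0 s1 s2 s4 N = O4 at *
    generalize Omega r b s0 s3 s1 N = O5 at *
    generalize Omega r x s0 s4 s2 (N - b) = O6 at *
    generalize Omega r a s4 s2 s1 N = O7 at *
    generalize Omega r j s3 s0 s4 (N - a) = O8 at *
    generalize Omega r 0 s3 s1 s2 (N - j) = O9 at *
    generalize Omega r 0 s4 s2 s1 N = P1 at *
    generalize Omega r j s3 s0 s4 N = P2 at *
    generalize Omega r a s3 s1 s2 (N - j) = P3 at *
    generalize Omega r 0 s0 s4 s2 N = P4 at *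
    generalize Omega r 0 s2 s3 s1 (N - j) = P5 at *
    generalize Omega r b s2 s3 s1 (N - j) = P6 at *
    generalize Omega r 0 s0 s3 s1 N = P7 at *
    generalize xi r x s2 s4 = X1 at *
    generalize xi r a s2 s1 = X2 at *
    generalize xi r b s1 s3 = X3 at *
    clear e z4
    field_simp
    linear_combination L * G * R1 * R2 * (O7 * O8 * F1 * F3 * O9 * P5 * P4 * fx +
      X1 * T1 * O4 * O5 * O6 * F3 * P5 * P4 * fa + X1 * T1 * O4 * O6 * X2 * T2 * P1 * P2 * P3 * fb)
  · rw [pentR_eq_zero hq _ _ (by omega) (by omega), mul_zero]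

end

/-- Partial reversal of a `q`-Pochhammer symbol. -/
theorem qPoch_reverse_mul {q α : ℂ} (hq : q ≠ 0) (hα : α ≠ 0) (x l : ℕ) :
    qPoch (α * q ^ (x + l))⁻¹ q x * qPoch (q * α) q l = qPoch (q * α) q (x + l) *
      ((-1) ^ x * (α⁻¹) ^ x * (q ^ ((x + 1).choose 2))⁻¹ * ((q ^ (x * l))⁻¹)) := by
  have e := qPoch_reverse hq (mul_ne_zero hα (pow_ne_zero l hq)) x
  rw [show α * q ^ l * q ^ x = α * q ^ (x + l) by ring] at e
  have e2 : qPoch (q * α) q (x + l) = qPoch (q * α) q l * qPoch (q * (α * q ^ l)) q x := by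
    rw [add_comm, qPoch_add]; ring_nf
  rw [e, e2, mul_inv, mul_pow, show ((q ^ l)⁻¹) ^ x = (q ^ (x * l))⁻¹ by
    rw [inv_pow, ← pow_mul, mul_comm l]]
  ring

theorem Lambda_zero' (r s1 s2 s3 s4 : ℂ) {N : ℕ} (hqn : ∀ k : ℕ, 1 - (r ^ 2) ^ (k + 1) ≠ 0)
    (hc : Av (r ^ 2) (s1 ^ 2 * s2 ^ 2)) :
    Lambda r 0 s1 s2 s3 s4 N =
      (r * s2) ^ N / qPoch (s1 ^ 2 * s2 ^ 2 * (r ^ 2) ^ 2) (r ^ 2) N := by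
  have e : 1 - s1 ^ 2 * s2 ^ 2 * r ^ 2 ≠ 0 := hc.ne 1 (by simp; ring)
  rw [Lambda_zero _ _ _ _ _ hqn, inv_reducedPoch' hc (Nat.zero_le N), qPoch_succ']
  simp only [mul_zero, zero_add, pow_one]
  rw [show r ^ 2 * (s1 ^ 2 * s2 ^ 2 * r ^ 2) = s1 ^ 2 * s2 ^ 2 * (r ^ 2) ^ 2 by ring,
    div_mul_cancel_left₀ e, div_eq_mul_inv]

theorem pentConst_monomial {r s0 s1 s2 s3 s4 E1 E2 : ℂ} {j l : ℕ}
    (hroot : r ^ (2 * (j + l) + 3) * s0 * s1 * s2 * s3 * s4 = 1) (hE1 : E1 ^ 2 = (r ^ 2) ^ (j * (j + 1))) (hE2 : E2 ^ 2 = (r ^ 2) ^ (l * (l + 1))) :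
    (r * s2) ^ (j + l) * (r * s2) ^ (j + l) * (r * s3) ^ (j + l) * (r * s0) ^ (j + l) /
        (r * s4) ^ (j + l) * ((r ^ 2 * (s0 ^ 2 * s3 ^ 2))⁻¹) ^ j *
        (((-1) ^ j * ((r ^ 2 * (s1 ^ 2 * s3 ^ 2))⁻¹) ^ j * E1⁻¹ * ((r ^ 2) ^ (j * l))⁻¹) *
          ((-1) ^ j * ((r ^ 2 * (s1 ^ 2 * s2 ^ 2))⁻¹) ^ j * E1⁻¹ * ((r ^ 2) ^ (j * l))⁻¹) /
          (((-1) ^ j * ((s3 ^ 2)⁻¹) ^ j * E1⁻¹ * ((r ^ 2) ^ (j * l))⁻¹) *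
            ((-1) ^ l * ((s4 ^ 2)⁻¹) ^ l * E2⁻¹ * ((r ^ 2) ^ (l * j))⁻¹) *
            ((-1) ^ (j + l) * ((s1 ^ 2)⁻¹) ^ (j + l) * (E1 * E2 * (r ^ 2) ^ (j * l))⁻¹))) /
        (r ^ 2 * s1 * s2) ^ l * ((-1) ^ l * (r * s1 * s2 * s3) ^ l * E2) =
      (-1) ^ j * (s2 * s0 * s4 / s3) ^ j * E1 *
        ((-1) ^ (j + l) * (r * s1 * s2 * s3) ^ (j + l) * (E1 * E2 * (r ^ 2) ^ (j * l))) *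
        (s3 / s1) ^ j * ((r ^ 2) ^ (j + l)) ^ j := by
  obtain ⟨hr, hs0, hs1, hs2, hs3, hs4⟩ := root_ne hroot
  have z1 : E1 ≠ 0 := by
    rintro rfl; exact pow_ne_zero _ (pow_ne_zero 2 hr) (hE1.symm.trans (by simp))
  have z2 : E2 ≠ 0 := by
    rintro rfl; exact pow_ne_zero _ (pow_ne_zero 2 hr) (hE2.symm.trans (by simp))
  field_simp
  rw [hE1, hE2]
  have hH : ∀ k : ℕ, (r ^ (2 * (j + l) + 3) * s0 * s1 * s2 * s3 * s4) ^ k = 1 := fun k => by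
    rw [hroot, one_pow]
  have h1 : ((-1 : ℂ) ^ (j + l)) ^ 2 = 1 := by rw [← pow_mul, mul_comm, pow_mul]; simp
  have fin : ∀ L R : ℂ, (r ^ (2 * (j + l) + 3) * s0 * s1 * s2 * s3 * s4) ^ (2 * j) * L =
      (r ^ (2 * (j + l) + 3) * s0 * s1 * s2 * s3 * s4) ^ l * R → L = R := fun L R h => by
    rwa [hH, hH, one_mul, one_mul] at h
  rw [h1]
  apply fin
  clear fin hH h1 hE1 hE2
  simp only [mul_pow, div_pow, one_pow, pow_add, pow_one, pow_mul]
  field_simp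
  ring

theorem pentConst_eq {r s0 s1 s2 s3 s4 : ℂ} {N : ℕ}
    (hroot : r ^ (2 * N + 3) * s0 * s1 * s2 * s3 * s4 = 1)
    (h : Gen5 (r ^ 2) (s0 ^ 2) (s1 ^ 2) (s2 ^ 2) (s3 ^ 2) (s4 ^ 2) N) {j : ℕ} (hj : j ≤ N) :
    pentConst r s0 s1 s2 s3 s4 N j * omega r (N - j) (r * s1 * s2 * s3) *
        Omega r 0 s1 s3 s2 (N - j) * xi r j s0 s4 =
      omega r j (s2 * s0 * s4 / s3) * omega r N (r * s1 * s2 * s3) *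
        Lambda r j s4 s0 s3 s1 N * Omega r 0 s1 s2 s3 (N - j) := by
  obtain ⟨hr, hs0, hs1, hs2, hs3, hs4⟩ := root_ne hroot
  obtain ⟨l, rfl⟩ := Nat.exists_eq_add_of_le hj
  have hq := h.hq
  obtain ⟨n0, n1, n2, n3, n4⟩ := h.prod_ne
  have mono := pentConst_monomial hroot (E1 := (r ^ 2) ^ ((j + 1).choose 2))
    (E2 := (r ^ 2) ^ ((l + 1).choose 2))
    (by
      rw [← pow_mul, Nat.choose_two_right, Nat.add_sub_cancel, Nat.div_mul_cancel
        (even_iff_two_dvd.1 (by simpa [mul_comm] using Nat.even_mul_succ_self j)), mul_comm])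
    (by
      rw [← pow_mul, Nat.choose_two_right, Nat.add_sub_cancel, Nat.div_mul_cancel
        (even_iff_two_dvd.1 (by simpa [mul_comm] using Nat.even_mul_succ_self l)), mul_comm])
  have m1 := qPoch_reverse_mul hq (mul_ne_zero hq (mul_ne_zero n1 n3)) j l
  have m2 := qPoch_reverse_mul hq (mul_ne_zero hq (mul_ne_zero n1 n2)) j l
  have m3 := qPoch_reverse_mul hq n3 j l
  have m4 := qPoch_reverse_mul hq n4 l j
  have m5 := qPoch_reverse_mul hq n1 (j + l) 0
  rw [qPoch_zero, mul_one, mul_zero, pow_zero, inv_one, mul_one, add_zero, choose_add_succ_two,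
    pow_add (r ^ 2) _ (j * l),
    pow_add (r ^ 2) ((j + 1).choose 2)] at m5
  rw [add_comm l j] at m4
  have e1 : s4 ^ 2 * s0 ^ 2 * (r ^ 2) ^ 2 / (r ^ 2 * s0 ^ 2) = r ^ 2 * s4 ^ 2 := by
    field_simp
  have e2 : s4 ^ 2 * s0 ^ 2 * s3 ^ 2 * (r ^ 2) ^ 2 * (r ^ 2) ^ (j + l) =
      (r ^ 2 * (s1 ^ 2 * s2 ^ 2) * (r ^ 2) ^ (j + l))⁻¹ := by
    refine eq_inv_of_mul_eq_one_left ?_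
    rw [← h.constr]
    ring
  have e3 : s4 ^ 2 * s0 ^ 2 * (r ^ 2) ^ 2 / (r ^ 2 * (s1 ^ 2 * s2 ^ 2) * (r ^ 2) ^ (j + l))⁻¹ =
      (s3 ^ 2 * (r ^ 2) ^ (j + l))⁻¹ := by
    rw [← e2]
    field_simp
  have e4 : (s1 ^ 2 * s3 ^ 2 * r ^ 2 * (r ^ 2) ^ (j + l))⁻¹ =
      (r ^ 2 * (s1 ^ 2 * s3 ^ 2) * (r ^ 2) ^ (j + l))⁻¹ := by ring
  rw [pentConst, Omega_zero h.gen124, Omega_zero h.gen124.swap, Omega_zero h.gen031,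
    Omega_zero h.gen042, Omega_zero h.gen231, Omega_zero h.perm12.gen3.swap,
    Omega_eq_wo h.gen304 j (by omega), Omega_zero h.gen304, Omega_zero h.gen132,
    Omega_zero h.gen3, Lambda_eq hr hs4 hs0 h.hqn (by rw [mul_comm]; exact h.A04) (by omega),
    Lambda_zero' _ _ _ _ _ h.hqn (by rw [mul_comm]; exact h.A03),
    Lambda_zero' _ _ _ _ _ h.hqn (by rw [mul_comm]; exact h.A04), wo, pr, pr, pr, e1, e2, e3,
    pentG, e4, Nat.add_sub_cancel_left, omega, omega, omega, choose_add_succ_two,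
    pow_add (r ^ 2) _ (j * l),
    pow_add (r ^ 2) ((j + 1).choose 2)]
  have q2 : ∀ c : ℂ, r ^ 2 * (r ^ 2 * c) = c * (r ^ 2) ^ 2 := fun c => by ring
  rw [q2] at m1 m2
  rw [mul_comm (s2 ^ 2) (s1 ^ 2), mul_comm (s3 ^ 2) (s1 ^ 2), mul_comm (s3 ^ 2) (s0 ^ 2),
    mul_comm (s4 ^ 2) (s0 ^ 2), mul_comm (s4 ^ 2) (s2 ^ 2), mul_comm (s3 ^ 2) (s2 ^ 2)]
  have z1 := qPoch_ne_of_Av h.A1 1 (show r ^ 2 * s1 ^ 2 = _ by ring) (j + l)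
  have z1' := qPoch_ne_of_Av h.A1 1 (show r ^ 2 * s1 ^ 2 = _ by ring) l
  have z2' := qPoch_ne_of_Av h.A2 1 (show r ^ 2 * s2 ^ 2 = _ by ring) l
  have z3 := qPoch_ne_of_Av h.A3 1 (show r ^ 2 * s3 ^ 2 = _ by ring) (j + l)
  have z3' := qPoch_ne_of_Av h.A3 1 (show r ^ 2 * s3 ^ 2 = _ by ring) l
  have z4 := qPoch_ne_of_Av h.A4 1 (show r ^ 2 * s4 ^ 2 = _ by ring) (j + l)
  have z4' := qPoch_ne_of_Av h.A4 1 (show r ^ 2 * s4 ^ 2 = _ by ring) j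
  have z0 := qPoch_ne_of_Av h.A0 1 (show r ^ 2 * s0 ^ 2 = _ by ring) (j + l)
  have z0' := qPoch_ne_of_Av h.A0 1 (show r ^ 2 * s0 ^ 2 = _ by ring) j
  have y03 := qPoch_ne_of_Av h.A03 2 (show s0 ^ 2 * s3 ^ 2 * (r ^ 2) ^ 2 = _ by ring) (j + l)
  have y04 := qPoch_ne_of_Av h.A04 2 (show s0 ^ 2 * s4 ^ 2 * (r ^ 2) ^ 2 = _ by ring) (j + l)
  have y13 := qPoch_ne_of_Av h.A13 2 (show s1 ^ 2 * s3 ^ 2 * (r ^ 2) ^ 2 = _ by ring) (j + l)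
  have y13' := qPoch_ne_of_Av h.A13 2 (show s1 ^ 2 * s3 ^ 2 * (r ^ 2) ^ 2 = _ by ring) l
  have y12 := qPoch_ne_of_Av h.A12 2 (show s1 ^ 2 * s2 ^ 2 * (r ^ 2) ^ 2 = _ by ring) (j + l)
  have y12' := qPoch_ne_of_Av h.A12 2 (show s1 ^ 2 * s2 ^ 2 * (r ^ 2) ^ 2 = _ by ring) l
  have y24 := qPoch_ne_of_Av h.A24 2 (show s2 ^ 2 * s4 ^ 2 * (r ^ 2) ^ 2 = _ by ring) (j + l)
  have y23' := qPoch_ne_of_Av h.A23 2 (show s2 ^ 2 * s3 ^ 2 * (r ^ 2) ^ 2 = _ by ring) l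
  have hu : (r ^ 2 * s1 * s2) ^ l = (r * s1) ^ l * (r * s2) ^ l := by rw [← mul_pow]; ring
  rw [hu] at mono
  have hp : ∀ {z : ℂ}, z ≠ 0 → ∀ k : ℕ, z ^ k ≠ 0 := fun hz k => pow_ne_zero k hz
  have x0 := hp (mul_ne_zero hr hs0) (j + l)
  have x1 := hp (mul_ne_zero hr hs1) l
  have x2 := hp (mul_ne_zero hr hs2) (j + l)
  have x2' := hp (mul_ne_zero hr hs2) l
  have x3' := hp (mul_ne_zero hr hs3) l
  have x4 := hp (mul_ne_zero hr hs4) (j + l)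
  have w3 : (-1) ^ j * ((s3 ^ 2)⁻¹) ^ j * ((r ^ 2) ^ ((j + 1).choose 2))⁻¹ * ((r ^ 2) ^ (j * l))⁻¹ ≠ 0 :=
    mul_ne_zero (mul_ne_zero (mul_ne_zero (hp (by norm_num) _) (hp (inv_ne_zero n3) _))
      (inv_ne_zero (hp hq _))) (inv_ne_zero (hp hq _))
  have w4 : (-1) ^ l * ((s4 ^ 2)⁻¹) ^ l * ((r ^ 2) ^ ((l + 1).choose 2))⁻¹ * ((r ^ 2) ^ (l * j))⁻¹ ≠ 0 :=
    mul_ne_zero (mul_ne_zero (mul_ne_zero (hp (by norm_num) _) (hp (inv_ne_zero n4) _))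
      (inv_ne_zero (hp hq _))) (inv_ne_zero (hp hq _))
  have w5 : (-1) ^ (j + l) * ((s1 ^ 2)⁻¹) ^ (j + l) * ((r ^ 2) ^ ((j + 1).choose 2) *
      (r ^ 2) ^ ((l + 1).choose 2) * (r ^ 2) ^ (j * l))⁻¹ ≠ 0 :=
    mul_ne_zero (mul_ne_zero (hp (by norm_num) _) (hp (inv_ne_zero n1) _))
      (inv_ne_zero (mul_ne_zero (mul_ne_zero (hp hq _) (hp hq _)) (hp hq _)))
  rw [← eq_div_iff y13'] at m1
  rw [← eq_div_iff y12'] at m2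
  rw [← eq_div_iff z3'] at m3
  rw [← eq_div_iff z4'] at m4
  rw [m1, m2, m3, m4, m5]
  generalize (-1) ^ j * ((r ^ 2 * (s1 ^ 2 * s3 ^ 2))⁻¹) ^ j * ((r ^ 2) ^ ((j + 1).choose 2))⁻¹ *
    ((r ^ 2) ^ (j * l))⁻¹ = M1 at *
  generalize (-1) ^ j * ((r ^ 2 * (s1 ^ 2 * s2 ^ 2))⁻¹) ^ j * ((r ^ 2) ^ ((j + 1).choose 2))⁻¹ *
    ((r ^ 2) ^ (j * l))⁻¹ = M2 at *
  generalize (-1) ^ j * ((s3 ^ 2)⁻¹) ^ j * ((r ^ 2) ^ ((j + 1).choose 2))⁻¹ *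
    ((r ^ 2) ^ (j * l))⁻¹ = M3 at *
  generalize (-1) ^ l * ((s4 ^ 2)⁻¹) ^ l * ((r ^ 2) ^ ((l + 1).choose 2))⁻¹ *
    ((r ^ 2) ^ (l * j))⁻¹ = M4 at *
  generalize (-1) ^ (j + l) * ((s1 ^ 2)⁻¹) ^ (j + l) * ((r ^ 2) ^ ((j + 1).choose 2) *
      (r ^ 2) ^ ((l + 1).choose 2) * (r ^ 2) ^ (j * l))⁻¹ = M5 at *
  generalize (-1) ^ l * (r * s1 * s2 * s3) ^ l * (r ^ 2) ^ (l + 1).choose 2 = E1 at *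
  generalize (-1) ^ (j + l) * (r * s1 * s2 * s3) ^ (j + l) * ((r ^ 2) ^ (j + 1).choose 2 *
    (r ^ 2) ^ (l + 1).choose 2 * (r ^ 2) ^ (j * l)) = E2 at *
  generalize (-1) ^ j * (s2 * s0 * s4 / s3) ^ j * (r ^ 2) ^ (j + 1).choose 2 = E3 at *
  generalize ((r ^ 2) ^ (j + l)) ^ j = E4 at *
  generalize (s3 / s1) ^ j = E5 at *
  generalize ((r ^ 2 * (s0 ^ 2 * s3 ^ 2))⁻¹) ^ j = E6 at *
  generalize vwp (r ^ 2) (s0 ^ 2 * s4 ^ 2) j * (qPoch ((r ^ 2) ^ (j + l))⁻¹ (r ^ 2) j /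
    qPoch (s0 ^ 2 * s4 ^ 2 * (r ^ 2) ^ 2 / ((r ^ 2) ^ (j + l))⁻¹) (r ^ 2) j) = V at *
  generalize xi r j s0 s4 = X at *
  clear m1 m2 m3 m4 m5 e1 e2 e3 e4 q2 hu hp h n0 n1 n2 n3 n4 hq
  generalize qPoch (r ^ 2 * s1 ^ 2) (r ^ 2) (j + l) = Z1 at *
  generalize qPoch (r ^ 2 * s1 ^ 2) (r ^ 2) l = Z1' at *
  generalize qPoch (r ^ 2 * s2 ^ 2) (r ^ 2) l = Z2' at *
  generalize qPoch (r ^ 2 * s3 ^ 2) (r ^ 2) (j + l) = Z3 at *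
  generalize qPoch (r ^ 2 * s3 ^ 2) (r ^ 2) l = Z3' at *
  generalize qPoch (r ^ 2 * s4 ^ 2) (r ^ 2) (j + l) = Z4 at *
  generalize qPoch (r ^ 2 * s4 ^ 2) (r ^ 2) j = Z4' at *
  generalize qPoch (r ^ 2 * s0 ^ 2) (r ^ 2) (j + l) = Z0 at *
  generalize qPoch (r ^ 2 * s0 ^ 2) (r ^ 2) j = Z0' at *
  generalize qPoch (s0 ^ 2 * s3 ^ 2 * (r ^ 2) ^ 2) (r ^ 2) (j + l) = Y03 at *
  generalize qPoch (s0 ^ 2 * s4 ^ 2 * (r ^ 2) ^ 2) (r ^ 2) (j + l) = Y04 at *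
  generalize qPoch (s1 ^ 2 * s3 ^ 2 * (r ^ 2) ^ 2) (r ^ 2) (j + l) = Y13 at *
  generalize qPoch (s1 ^ 2 * s3 ^ 2 * (r ^ 2) ^ 2) (r ^ 2) l = Y13' at *
  generalize qPoch (s1 ^ 2 * s2 ^ 2 * (r ^ 2) ^ 2) (r ^ 2) (j + l) = Y12 at *
  generalize qPoch (s1 ^ 2 * s2 ^ 2 * (r ^ 2) ^ 2) (r ^ 2) l = Y12' at *
  generalize qPoch (s2 ^ 2 * s4 ^ 2 * (r ^ 2) ^ 2) (r ^ 2) (j + l) = Y24 at *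
  generalize qPoch (s2 ^ 2 * s3 ^ 2 * (r ^ 2) ^ 2) (r ^ 2) l = Y23' at *
  generalize (r * s0) ^ (j + l) = T0 at *
  generalize (r * s1) ^ l = T1 at *
  generalize (r * s2) ^ (j + l) = T2 at *
  generalize (r * s2) ^ l = T2' at *
  generalize (r * s3) ^ (j + l) = T3 at *
  generalize (r * s3) ^ l = T3' at *
  generalize (r * s4) ^ (j + l) = T4 at *
  clear hs0 hs1 hs2 hs3 hs4 hr hroot
  have rest : ∀ L R A B C : ℂ, A = B → L = A * C → R = B * C → L = R := fun L R A B C h h1 h2 => by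
    rw [h1, h2, h]
  refine rest _ _ _ _ (T0 * X * V * Z1' * T2' / (Y04 * Y23')) mono ?_ ?_
  · field_simp
  · ring

section

variable {r s0 s1 s2 s3 s4 : ℂ} {N : ℕ}

theorem rootC0_eq (hroot : r ^ (2 * N + 3) * s0 * s1 * s2 * s3 * s4 = 1) :
    rootC0 r s1 s2 s3 s4 N = s0 := by
  rw [rootC0, eq_comm]
  refine eq_inv_of_mul_eq_one_left ?_
  linear_combination hroot

theorem simplexSum_sum {ι : Type*} (s : Finset ι) (f : ι → ℕ → ℕ → ℂ) :
    simplexSum N (fun x y => ∑ b ∈ s, f b x y) = ∑ b ∈ s, simplexSum N (f b) := by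
  simp only [simplexSum]
  rw [Finset.sum_comm]
  exact Finset.sum_congr rfl fun x _ => Finset.sum_comm

theorem simplexSum_mul_left (c : ℂ) (f : ℕ → ℕ → ℂ) :
    simplexSum N (fun x y => c * f x y) = c * simplexSum N f := by
  simp only [simplexSum, Finset.mul_sum]

/-- The Griffiths polynomials with the condition `a ≤ N - y` removed from the range of summation. -/
theorem griffiths_eq (hroot : r ^ (2 * N + 3) * s0 * s1 * s2 * s3 * s4 = 1) (i j x y : ℕ) :
    griffiths r i j x y s1 s2 s3 s4 N = ∑ a ∈ Finset.range (N - j + 1),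
      omega r a (s1 * s2 * s3 / s4) * qRacah r i a s1 s2 s3 (N - j) *
        qRacah r j y s3 s0 s4 (N - a) * qRacah r a x s4 s2 s1 (N - y) := by
  rw [griffiths, rootC0_eq hroot]
  refine Finset.sum_subset (fun a => ?_) fun a ha ha' => ?_
  · simp only [Finset.mem_range]; omega
  · simp only [Finset.mem_range] at ha ha'
    rw [qRacah.eq_1 r a x, if_neg (show ¬(a ≤ N - y ∧ x ≤ N - y) by omega), mul_zero]

theorem omega_mul_pow (r : ℂ) (n : ℕ) (s t : ℂ) : omega r n s * t ^ n = omega r n (s * t) := by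
  rw [omega, omega, mul_pow]; ring

theorem qRacah_dual {n x K : ℕ} (hn : n ≤ K) (hx : x ≤ K) (hr : r ≠ 0) :
    Omega r x s3 s2 s1 K * qRacah r n x s1 s2 s3 K =
      Omega r n s1 s2 s3 K * qRacah r x n s3 s2 s1 K := by
  rw [qRacah_eq _ _ _ _ hn hx, qRacah_eq _ _ _ _ hx hn, pR_symm (pow_ne_zero 2 hr) (s1 ^ 2)]
  ring

/-- The sum over the grid in the biorthogonality relation. -/
theorem simplexSum_griffithsW
    (hroot : r ^ (2 * N + 3) * s0 * s1 * s2 * s3 * s4 = 1)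
    (h : Gen5 (r ^ 2) (s0 ^ 2) (s1 ^ 2) (s2 ^ 2) (s3 ^ 2) (s4 ^ 2) N) {a j l b : ℕ}
    (ha : a + j ≤ N) (hb : b + l ≤ N) :
    simplexSum N (fun x y => griffithsW r s0 s1 s2 s3 s4 N x y *
        qRacah r j y s3 s0 s4 (N - a) * qRacah r a x s4 s2 s1 (N - y) *
        qRacah r b y s0 s3 s1 (N - x) * qRacah r l x s2 s4 s0 (N - b)) =
      if l = j then
        pentConst r s0 s1 s2 s3 s4 N j * (xi r a s2 s1 * (s4 / s3) ^ a) *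
          (xi r b s1 s3 * (s0 / s2) ^ b) * Omega r b s2 s3 s1 (N - j) *
          qRacah r a b s3 s1 s2 (N - j)
      else 0 := by
  have e : ∀ x ∈ Finset.range (N + 1), ∑ y ∈ Finset.range (N - x + 1),
      griffithsW r s0 s1 s2 s3 s4 N x y *
        qRacah r j y s3 s0 s4 (N - a) * qRacah r a x s4 s2 s1 (N - y) *
        qRacah r b y s0 s3 s1 (N - x) * qRacah r l x s2 s4 s0 (N - b) =
      if x + b ≤ N ∧ j + b ≤ N then
        pentConst r s0 s1 s2 s3 s4 N j * (xi r a s2 s1 * (s4 / s3) ^ a) *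
          (xi r b s1 s3 * (s0 / s2) ^ b) * Omega r b s2 s3 s1 (N - j) *
          qRacah r a b s3 s1 s2 (N - j) *
          (qRacah r l x s2 s4 s0 (N - b) * qRacah r x j s0 s4 s2 (N - b))
      else 0 := by
    intro x hx
    have hx : x ≤ N := by simpa [Nat.lt_succ_iff] using hx
    rw [← Finset.sum_mul]
    by_cases hxb : x + b ≤ N
    · rw [sum_griffithsW_mul_qRacah hroot h ha hxb]
      by_cases hjb : j + b ≤ N
      · rw [if_pos hjb, if_pos ⟨hxb, hjb⟩]; ring
      · rw [if_neg hjb, if_neg (by tauto), zero_mul]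
    · rw [if_neg (by tauto), qRacah.eq_1 r l x, if_neg (by omega), mul_zero]
  rw [simplexSum, Finset.sum_congr rfl e]
  by_cases hjb : j + b ≤ N
  · have hsub : Finset.range (N - b + 1) ⊆ Finset.range (N + 1) := by
      intro y; simp only [Finset.mem_range]; omega
    have e2 : ∑ x ∈ Finset.range (N - b + 1),
        qRacah r l x s2 s4 s0 (N - b) * qRacah r x j s0 s4 s2 (N - b) = if l = j then 1 else 0 :=
      sum_qRacah_mul_qRacah h.gen042.swap (by omega) (by omega)
    rw [← Finset.sum_subset hsub]
    · rw [Finset.sum_congr rfl (g := fun x => pentConst r s0 s1 s2 s3 s4 N j *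
          (xi r a s2 s1 * (s4 / s3) ^ a) *
          (xi r b s1 s3 * (s0 / s2) ^ b) * Omega r b s2 s3 s1 (N - j) *
          qRacah r a b s3 s1 s2 (N - j) *
          (qRacah r l x s2 s4 s0 (N - b) * qRacah r x j s0 s4 s2 (N - b))), ← Finset.mul_sum, e2]
      · split_ifs <;> simp
      · intro x hx
        simp only [Finset.mem_range] at hx
        rw [if_pos (by omega)]
    · intro x hx hx'
      simp only [Finset.mem_range] at hx hx'
      rw [if_neg (by omega)]
  · rw [if_neg (show l ≠ j by omega)]
    exact Finset.sum_eq_zero fun x _ => if_neg (by tauto)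

/-- The right-hand side of the biorthogonality relation for `i = k` and `j = l`. -/
def griffithsNorm (r s0 s1 s2 s3 s4 : ℂ) (N i j : ℕ) : ℂ :=
  omega r j (s2 * s0 * s4 / s3) * omega r N (r * s1 * s2 * s3) / omega r i (s2 * s3) *
    (Omega r i s1 s2 s3 (N - j) * Lambda r j s4 s0 s3 s1 N / (xi r i s2 s3 * xi r j s0 s4))

theorem griffiths_biorthogonal_of_gen5
    (hroot : r ^ (2 * N + 3) * s0 * s1 * s2 * s3 * s4 = 1)
    (h : Gen5 (r ^ 2) (s0 ^ 2) (s1 ^ 2) (s2 ^ 2) (s3 ^ 2) (s4 ^ 2) N) {i j k l : ℕ}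
    (hij : i + j ≤ N) (hkl : k + l ≤ N) :
    simplexSum N (fun x y => griffithsW r s0 s1 s2 s3 s4 N x y *
        griffiths r i j x y s1 s2 s3 s4 N * griffiths r k l y x s1 s3 s2 s0 N) =
      if i = k ∧ j = l then griffithsNorm r s0 s1 s2 s3 s4 N i j else 0 := by
  have hroot' : r ^ (2 * N + 3) * s4 * s1 * s3 * s2 * s0 = 1 := by rw [← hroot]; ring
  obtain ⟨hr, hs0, hs1, hs2, hs3, hs4⟩ := root_ne hroot
  have e1 : simplexSum N (fun x y => griffithsW r s0 s1 s2 s3 s4 N x y *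
        griffiths r i j x y s1 s2 s3 s4 N * griffiths r k l y x s1 s3 s2 s0 N) =
      ∑ b ∈ Finset.range (N - l + 1), ∑ a ∈ Finset.range (N - j + 1),
        omega r a (s1 * s2 * s3 / s4) * qRacah r i a s1 s2 s3 (N - j) *
        (omega r b (s1 * s3 * s2 / s0) * qRacah r k b s1 s3 s2 (N - l)) *
        simplexSum N (fun x y => griffithsW r s0 s1 s2 s3 s4 N x y *
          qRacah r j y s3 s0 s4 (N - a) * qRacah r a x s4 s2 s1 (N - y) *
          qRacah r b y s0 s3 s1 (N - x) * qRacah r l x s2 s4 s0 (N - b)) := by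
    simp only [← simplexSum_sum, ← simplexSum_mul_left]
    congr 1
    funext x y
    rw [griffiths_eq hroot, griffiths_eq hroot', mul_assoc, Finset.sum_mul_sum, Finset.mul_sum,
      Finset.sum_comm]
    simp only [Finset.mul_sum]
    refine Finset.sum_congr rfl fun b _ => Finset.sum_congr rfl fun a _ => ?_
    ring
  rw [e1]
  by_cases hlj : l = j
  swap
  · rw [if_neg (fun hh => hlj hh.2.symm)]
    refine Finset.sum_eq_zero fun b hb => Finset.sum_eq_zero fun a ha => ?_
    simp only [Finset.mem_range] at ha hb
    rw [simplexSum_griffithsW hroot h (by omega) (by omega), if_neg hlj, mul_zero]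
  subst hlj
  have e2 : ∀ b ∈ Finset.range (N - l + 1), ∑ a ∈ Finset.range (N - l + 1),
        omega r a (s1 * s2 * s3 / s4) * qRacah r i a s1 s2 s3 (N - l) *
        (omega r b (s1 * s3 * s2 / s0) * qRacah r k b s1 s3 s2 (N - l)) *
        simplexSum N (fun x y => griffithsW r s0 s1 s2 s3 s4 N x y *
          qRacah r l y s3 s0 s4 (N - a) * qRacah r a x s4 s2 s1 (N - y) *
          qRacah r b y s0 s3 s1 (N - x) * qRacah r l x s2 s4 s0 (N - b)) =
      pentConst r s0 s1 s2 s3 s4 N l * (omega r (N - l) (r * s1 * s2 * s3) * xi r i s2 s3 *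
        Omega r i s1 s3 s2 (N - l) / omega r i (s2 * s3)) *
        (qRacah r k b s1 s3 s2 (N - l) * qRacah r b i s2 s3 s1 (N - l)) := by
    intro b hb
    have hb : b ≤ N - l := by simpa [Nat.lt_succ_iff] using hb
    have rac := sum_omega_mul_qRacah h.gen3 h.perm12.gen3.swap h.gen132 (K := N - l) (n := i) (m := b)
      (by omega) hb
    have x1 := xi_mul_xi hs1 hs3 h.A1 h.A3 b
    have du := qRacah_dual (r := r) (s1 := s1) (s2 := s3) (s3 := s2) (n := i) (x := b) (K := N - l)
      (by omega) hb hr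
    have w1 := omega_ne_zero hr (mul_ne_zero hs2 hs3) i
    have w2 := omega_ne_zero hr (mul_ne_zero hs1 hs3) b
    have w3 : omega r b (s1 * s3 * s2 / s0) * (s0 / s2) ^ b = omega r b (s1 * s3) := by
      rw [omega_mul_pow]; congr 1; field_simp
    have e3 : ∑ a ∈ Finset.range (N - l + 1),
        omega r a (s1 * s2 * s3 / s4) * qRacah r i a s1 s2 s3 (N - l) *
        (omega r b (s1 * s3 * s2 / s0) * qRacah r k b s1 s3 s2 (N - l)) *
        simplexSum N (fun x y => griffithsW r s0 s1 s2 s3 s4 N x y *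
          qRacah r l y s3 s0 s4 (N - a) * qRacah r a x s4 s2 s1 (N - y) *
          qRacah r b y s0 s3 s1 (N - x) * qRacah r l x s2 s4 s0 (N - b)) =
        pentConst r s0 s1 s2 s3 s4 N l * omega r b (s1 * s3) * xi r b s1 s3 *
          Omega r b s2 s3 s1 (N - l) * qRacah r k b s1 s3 s2 (N - l) *
        ∑ a ∈ Finset.range (N - l + 1), omega r a (s1 * s2) * xi r a s2 s1 *
          qRacah r i a s1 s2 s3 (N - l) * qRacah r a b s3 s1 s2 (N - l) := by
      rw [Finset.mul_sum]
      refine Finset.sum_congr rfl fun a ha => ?_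
      simp only [Finset.mem_range] at ha
      have w4 : omega r a (s1 * s2 * s3 / s4) * (s4 / s3) ^ a = omega r a (s1 * s2) := by
        rw [omega_mul_pow]; congr 1; field_simp
      rw [simplexSum_griffithsW hroot h (by omega) (by omega), if_pos rfl, ← w3, ← w4]
      ring
    rw [e3, rac]
    generalize omega r b (s1 * s3) = W at *
    generalize omega r i (s2 * s3) = W' at *
    field_simp
    linear_combination pentConst r s0 s1 s2 s3 s4 N l * qRacah r k b s1 s3 s2 (N - l) *
      omega r (N - l) (r * s1 * s2 * s3) * xi r i s2 s3 * (xi r b s1 s3 * xi r b s3 s1 * du +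
        Omega r i s1 s3 s2 (N - l) * qRacah r b i s2 s3 s1 (N - l) * x1)
  rw [Finset.sum_congr rfl e2, ← Finset.mul_sum,
    sum_qRacah_mul_qRacah h.gen132 (by omega) (by omega)]
  by_cases hik : k = i
  · subst hik
    rw [if_pos rfl, if_pos ⟨rfl, rfl⟩, mul_one, griffithsNorm]
    have c1 := pentConst_eq hroot h (show l ≤ N by omega)
    have c2 := Omega_swap23 h.gen3 h.gen132 (show k ≤ N - l by omega)
    have x1 := xi_ne_zero hs2 hs3 h.A2 h.A3 k
    have x2 := xi_ne_zero hs0 hs4 h.A0 h.A4 l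
    have w1 := omega_ne_zero hr (mul_ne_zero hs2 hs3) k
    have z := Omega_zero_ne_zero h.gen3 (N - l)
    apply mul_left_cancel₀ z
    generalize Omega r 0 s1 s2 s3 (N - l) = O at *
    generalize omega r k (s2 * s3) = W' at *
    generalize omega r l (s2 * s0 * s4 / s3) = W at *
    clear z e1 e2
    field_simp
    linear_combination pentConst r s0 s1 s2 s3 s4 N l * omega r (N - l) (r * s1 * s2 * s3) *
      xi r l s0 s4 * c2 + Omega r k s1 s2 s3 (N - l) * c1
  · rw [if_neg hik, if_neg (fun hh => hik hh.1.symm), mul_zero]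

end

section

open Filter Topology

theorem Avoids1.ne {q c : ℂ} {N : ℕ} (h : Avoids1 q c N) {m : ℕ} (h1 : 1 ≤ m)
    (hm : m ≤ N) {z : ℂ} (hz : z = c * q ^ m) : 1 - z ≠ 0 := fun h0 =>
  h m h1 hm (eq_inv_of_mul_eq_one_left (by rw [← hz]; exact (sub_eq_zero.1 h0).symm))

theorem Avoids2.ne {q c : ℂ} {N : ℕ} (h : Avoids2 q c N) {m : ℕ} (h1 : 2 ≤ m)
    (hm : m ≤ 2 * N) {z : ℂ} (hz : z = c * q ^ m) : 1 - z ≠ 0 := fun h0 =>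
  h m h1 hm (eq_inv_of_mul_eq_one_left (by rw [← hz]; exact (sub_eq_zero.1 h0).symm))

theorem Avoids1.qPoch_ne {q c z : ℂ} {N k : ℕ} (h : Avoids1 q c N) (hk : k ≤ N)
    (hz : z = q * c) : qPoch z q k ≠ 0 :=
  qPoch_ne_zero fun l hl => h.ne (show 1 ≤ l + 1 by omega) (by omega) (by rw [hz]; ring)

theorem qPoch_self_ne {q : ℂ} {N k : ℕ} (h : ∀ m : ℕ, 1 ≤ m → m ≤ N → q ^ m ≠ 1) (hk : k ≤ N) :
    qPoch q q k ≠ 0 :=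
  qPoch_ne_zero fun l hl => by
    rw [← pow_succ']; exact sub_ne_zero.2 (h (l + 1) (by omega) (by omega)).symm

theorem reducedPoch_ne {q c : ℂ} {N n K : ℕ} (h : Avoids2 q c N) (hn : n ≤ K)
    (hK : K ≤ N) : reducedPoch c q n K ≠ 0 := by
  refine Finset.prod_ne_zero_iff.2 fun l hl => ?_
  simp only [Finset.mem_erase, Finset.mem_range] at hl
  exact h.ne (show 2 ≤ n + 1 + l by omega) (by omega) (by rw [pow_add]; ring)

section Continuity

variable {X : Type*} [TopologicalSpace X] {t : X} {f g : X → ℂ}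

theorem continuousAt_qPoch (hf : ContinuousAt f t) (hg : ContinuousAt g t) (k : ℕ) :
    ContinuousAt (fun u => qPoch (f u) (g u) k) t := by
  unfold qPoch
  exact tendsto_finsetProd _ fun l _ => continuousAt_const.sub (hf.mul (hg.pow l))

theorem continuousAt_reducedPoch (hf : ContinuousAt f t) (hg : ContinuousAt g t) (n K : ℕ) :
    ContinuousAt (fun u => reducedPoch (f u) (g u) n K) t := by
  unfold reducedPoch
  exact tendsto_finsetProd _ fun l _ =>
    continuousAt_const.sub ((hf.mul (hg.pow _)).mul (hg.pow l))

variable {N : ℕ}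

theorem continuousAt_qBinom (hg : ContinuousAt g t) (h : ∀ m : ℕ, 1 ≤ m → m ≤ N → g t ^ m ≠ 1)
    {K : ℕ} (hK : K ≤ N) (n : ℕ) : ContinuousAt (fun u => qBinom (g u) K n) t := by
  unfold qBinom
  split_ifs with hn
  · exact (continuousAt_qPoch hg hg K).div ((continuousAt_qPoch hg hg n).mul
      (continuousAt_qPoch hg hg (K - n)))
      (mul_ne_zero (qPoch_self_ne h (by omega)) (qPoch_self_ne h (by omega)))
  · exact continuousAt_const

variable {r s1 s2 s3 s4 : X → ℂ}

theorem continuousAt_Omega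
    (hr : ContinuousAt r t) (h1 : ContinuousAt s1 t) (h2 : ContinuousAt s2 t)
    (h3 : ContinuousAt s3 t) (hr0 : r t ≠ 0) (h20 : s2 t ≠ 0)
    (hq : ∀ m : ℕ, 1 ≤ m → m ≤ N → (r t ^ 2) ^ m ≠ 1) (a3 : Avoids1 (r t ^ 2) (s3 t ^ 2) N)
    (a23 : Avoids2 (r t ^ 2) (s2 t ^ 2 * s3 t ^ 2) N) {n K : ℕ} (hn : n ≤ K) (hK : K ≤ N) :
    ContinuousAt (fun u => Omega (r u) n (s1 u) (s2 u) (s3 u) K) t := by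
  have hr2 := hr.pow 2
  unfold Omega
  refine ((continuousAt_qBinom hr2 hq hK n).mul (((continuousAt_qPoch (hr2.mul (h2.pow 2)) hr2 n).mul
    (continuousAt_qPoch ((((h1.pow 2).mul (h2.pow 2)).mul (h3.pow 2)).mul (hr2.pow _)) hr2 n)).mul
    (continuousAt_qPoch (hr2.mul (h1.pow 2)) hr2 (K - n)))).div
    ((((hr.mul h2).zpow₀ _ (Or.inl (mul_ne_zero hr0 h20))).mul
      (continuousAt_reducedPoch ((h2.pow 2).mul (h3.pow 2)) hr2 n K)).mul
      (continuousAt_qPoch (hr2.mul (h3.pow 2)) hr2 n)) ?_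
  have hq0 : r t ^ 2 ≠ 0 := pow_ne_zero 2 hr0
  exact mul_ne_zero (mul_ne_zero (zpow_ne_zero _ (mul_ne_zero hr0 h20))
    (reducedPoch_ne a23 hn hK)) (a3.qPoch_ne (by omega) rfl)

theorem continuousAt_Lambda
    (hr : ContinuousAt r t) (h1 : ContinuousAt s1 t) (h2 : ContinuousAt s2 t)
    (h3 : ContinuousAt s3 t) (h4 : ContinuousAt s4 t) (hr0 : r t ≠ 0) (h20 : s2 t ≠ 0)
    (h40 : s4 t ≠ 0) (hq : ∀ m : ℕ, 1 ≤ m → m ≤ N → (r t ^ 2) ^ m ≠ 1)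
    (a1 : Avoids1 (r t ^ 2) (s1 t ^ 2) N) (a12 : Avoids2 (r t ^ 2) (s1 t ^ 2 * s2 t ^ 2) N) {x : ℕ} (hx : x ≤ N) :
    ContinuousAt (fun u => Lambda (r u) x (s1 u) (s2 u) (s3 u) (s4 u) N) t := by
  have hr2 := hr.pow 2
  have hq0 : r t ^ 2 ≠ 0 := pow_ne_zero 2 hr0
  unfold Lambda
  refine (((continuousAt_const.mul (continuousAt_qBinom hr2 hq le_rfl x)).mul
    ((continuousAt_qPoch (hr2.mul (h2.pow 2)) hr2 x).mul ((hr.mul h2).pow N))).div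
    ((continuousAt_qPoch (hr2.mul (h1.pow 2)) hr2 x).mul
      (continuousAt_reducedPoch ((h1.pow 2).mul (h2.pow 2)) hr2 x N)) ?_).mul
    ((((h1.mul h3).mul (hr.zpow₀ _ (Or.inl hr0))).div (h2.mul h4) (mul_ne_zero h20 h40)).pow x)
  exact mul_ne_zero (a1.qPoch_ne hx rfl) (reducedPoch_ne a12 hx le_rfl)

theorem continuousAt_xi
    (hr : ContinuousAt r t) (h1 : ContinuousAt s1 t) (h2 : ContinuousAt s2 t)
    (h10 : s1 t ≠ 0) (a2 : Avoids1 (r t ^ 2) (s2 t ^ 2) N) {n : ℕ} (hn : n ≤ N) :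
    ContinuousAt (fun u => xi (r u) n (s1 u) (s2 u)) t := by
  have hr2 := hr.pow 2
  unfold xi
  exact ((continuousAt_qPoch (hr2.mul (h1.pow 2)) hr2 n).div
    (continuousAt_qPoch (hr2.mul (h2.pow 2)) hr2 n) (a2.qPoch_ne hn rfl)).mul
    ((h2.div h1 h10).pow n)

theorem continuousAt_omega
    (hr : ContinuousAt r t) (h1 : ContinuousAt s1 t) (n : ℕ) : ContinuousAt (fun u => omega (r u) n (s1 u)) t := by
  unfold omega
  exact (continuousAt_const.mul (h1.pow n)).mul ((hr.pow 2).pow _)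

theorem continuousAt_qRacah
    (hr : ContinuousAt r t) (h1 : ContinuousAt s1 t) (h2 : ContinuousAt s2 t)
    (h3 : ContinuousAt s3 t) (hr0 : r t ≠ 0) (h20 : s2 t ≠ 0)
    (hq : ∀ m : ℕ, 1 ≤ m → m ≤ N → (r t ^ 2) ^ m ≠ 1) (a2 : Avoids1 (r t ^ 2) (s2 t ^ 2) N)
    (a3 : Avoids1 (r t ^ 2) (s3 t ^ 2) N) (a23 : Avoids2 (r t ^ 2) (s2 t ^ 2 * s3 t ^ 2) N)
    (a123 : Avoids2 (r t ^ 2) (r t ^ 2 * s1 t ^ 2 * s2 t ^ 2 * s3 t ^ 2) N) (n x : ℕ) {K : ℕ} (hK : K ≤ N) :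
    ContinuousAt (fun u => qRacah (r u) n x (s1 u) (s2 u) (s3 u) K) t := by
  have hr2 := hr.pow 2
  have hq0 : r t ^ 2 ≠ 0 := pow_ne_zero 2 hr0
  unfold qRacah
  split_ifs with hnx
  · refine (continuousAt_Omega hr h1 h2 h3 hr0 h20 hq a3 a23 hnx.1 hK).mul ?_
    unfold phi43
    refine tendsto_finsetSum _ fun k hk => ?_
    have hk : k ≤ n := by simpa [Nat.lt_succ_iff] using hk
    have hi : ∀ m : ℕ, ContinuousAt (fun u => ((r u ^ 2) ^ m)⁻¹) t := fun m =>
      (hr2.pow m).inv₀ (pow_ne_zero m hq0)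
    refine ((((((continuousAt_qPoch (hi n) hr2 k).mul (continuousAt_qPoch
      (((h2.pow 2).mul (h3.pow 2)).mul (hr2.pow _)) hr2 k)).mul (continuousAt_qPoch (hi x) hr2 k)).mul
      (continuousAt_qPoch (((h1.pow 2).mul (h2.pow 2)).mul (hr2.pow _)) hr2 k))).div
      (((continuousAt_qPoch (hr2.mul (h2.pow 2)) hr2 k).mul (continuousAt_qPoch
        ((((h1.pow 2).mul (h2.pow 2)).mul (h3.pow 2)).mul (hr2.pow _)) hr2 k)).mul
        (continuousAt_qPoch (hi K) hr2 k)) ?_).mul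
      ((hr2.pow k).div (continuousAt_qPoch hr2 hr2 k) (qPoch_self_ne hq (by omega)))
    refine mul_ne_zero (mul_ne_zero (a2.qPoch_ne (by omega) rfl) (qPoch_ne_zero fun l hl => ?_))
      (qPoch_ne_zero fun l hl => ?_)
    · exact a123.ne (show 2 ≤ K + 1 + l by omega) (by omega) (by simp only [Pi.mul_apply, Pi.pow_apply]; ring)
    · have hKl : (r t ^ 2) ^ K = (r t ^ 2) ^ (K - l) * (r t ^ 2) ^ l := by
        rw [← pow_add]; congr 1; omega
      rw [hKl, mul_inv, Pi.pow_apply, inv_mul_cancel_right₀ (pow_ne_zero l hq0)]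
      intro h0
      exact hq (K - l) (by omega) (by omega) (inv_eq_one.1 (sub_eq_zero.1 h0).symm)
  · exact continuousAt_const

end Continuity

end

open Filter Topology MeasureTheory

theorem subsingleton_zpow_eq_one (a : ℂ) {n : ℤ} (hn : n ≠ 0) :
    {u : ℝ | 0 < u ∧ a * (u : ℂ) ^ n = 1}.Subsingleton := by
  rintro u ⟨hu, hu'⟩ v ⟨hv, hv'⟩
  have e : ∀ w : ℝ, 0 < w → a * (w : ℂ) ^ n = 1 → w ^ n = ‖a‖⁻¹ := fun w hw h => by
    have := congrArg norm h
    rw [norm_mul, norm_zpow, Complex.norm_real, Real.norm_of_nonneg hw.le, norm_one] at this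
    exact eq_inv_of_mul_eq_one_right this
  have := (e u hu hu').trans (e v hv hv').symm
  exact zpow_left_injOn₀ hn hu.le hv.le this

theorem ae_av {r : ℂ} (a : ℂ) {e : ℤ} (he : ¬ (16 ∣ e)) :
    ∀ᵐ u : ℝ, 0 < u → Av ((r * (u : ℂ) ^ (16 : ℤ)) ^ 2) (a * (u : ℂ) ^ (2 * e)) := by
  have : ∀ m : ℤ, ∀ᵐ u : ℝ, ¬ (0 < u ∧ (r ^ 2) ^ m * a * (u : ℂ) ^ (32 * m + 2 * e) = 1) := fun m =>
    (subsingleton_zpow_eq_one ((r ^ 2) ^ m * a) (by omega)).countable.ae_notMem volume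
  filter_upwards [ae_all_iff.2 this] with u hu h0 m hm
  refine hu m ⟨h0, ?_⟩
  have hz : (u : ℂ) ≠ 0 := by exact_mod_cast h0.ne'
  rw [← hm, mul_pow, mul_zpow, zpow_add₀ hz, zpow_mul (u : ℂ) 32,
    show ((u : ℂ) ^ (16 : ℤ)) ^ 2 = (u : ℂ) ^ (32 : ℤ) by rw [← zpow_natCast, ← zpow_mul]; norm_num]
  ring

theorem ae_pow_ne {r : ℂ} :
    ∀ᵐ u : ℝ, 0 < u → ∀ k : ℕ, 1 - ((r * (u : ℂ) ^ (16 : ℤ)) ^ 2) ^ (k + 1) ≠ 0 := by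
  have : ∀ m : ℕ, ∀ᵐ u : ℝ, ¬ (0 < u ∧ (r ^ 2) ^ (m + 1) * (u : ℂ) ^ (32 * (m + 1) : ℤ) = 1) :=
    fun m => (subsingleton_zpow_eq_one ((r ^ 2) ^ (m + 1)) (by omega)).countable.ae_notMem volume
  filter_upwards [ae_all_iff.2 this] with u hu h0 m hm
  refine hu m ⟨h0, ?_⟩
  refine Eq.trans ?_ (sub_eq_zero.1 hm).symm
  rw [mul_pow, mul_pow, zpow_mul (u : ℂ) 32,
    show ((u : ℂ) ^ (16 : ℤ)) ^ 2 = (u : ℂ) ^ (32 : ℤ) by rw [← zpow_natCast, ← zpow_mul]; norm_num]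
  norm_cast

/-- A path of parameters through `s`. -/
def scalePath (s : ℂ) (e : ℤ) (u : ℝ) : ℂ := s * (u : ℂ) ^ e

theorem scalePath_one (s : ℂ) (e : ℤ) : scalePath s e 1 = s := by simp [scalePath]

theorem scalePath_sq (s : ℂ) (e : ℤ) (u : ℝ) :
    scalePath s e u ^ 2 = s ^ 2 * (u : ℂ) ^ (2 * e) := by
  rw [scalePath, mul_pow, mul_comm 2 e, zpow_mul]
  norm_cast

theorem continuousAt_scalePath (s : ℂ) (e : ℤ) : ContinuousAt (scalePath s e) 1 :=
  continuousAt_const.mul (Complex.continuous_ofReal.continuousAt.zpow₀ e (Or.inl (by simp)))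

theorem ae_av_sq (r s : ℂ) {e : ℤ} (he : ¬ (16 ∣ e)) :
    ∀ᵐ u : ℝ, 0 < u → Av (scalePath r 16 u ^ 2) (scalePath s e u ^ 2) := by
  filter_upwards [ae_av (r := r) (s ^ 2) he] with u hu h0
  rw [scalePath_sq s]
  exact hu h0

theorem ae_av_sq_mul_sq (r s s' : ℂ) {e e' : ℤ} (he : ¬ (16 ∣ e + e')) :
    ∀ᵐ u : ℝ, 0 < u →
      Av (scalePath r 16 u ^ 2) (scalePath s e u ^ 2 * scalePath s' e' u ^ 2) := by
  filter_upwards [ae_av (r := r) (s ^ 2 * s' ^ 2) he] with u hu h0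
  have hz : (u : ℂ) ≠ 0 := by exact_mod_cast h0.ne'
  rw [scalePath_sq s, scalePath_sq s', show s ^ 2 * (u : ℂ) ^ (2 * e) * (s' ^ 2 * (u : ℂ) ^ (2 * e')) =
    s ^ 2 * s' ^ 2 * (u : ℂ) ^ (2 * (e + e')) by rw [mul_add, zpow_add₀ hz]; ring]
  exact hu h0

theorem scalePath_constr {r s0 s1 s2 s3 s4 : ℂ} {N : ℕ} {e : ℤ}
    (hroot : r ^ (2 * N + 3) * s0 * s1 * s2 * s3 * s4 = 1) (he : e = -(16 * (2 * N + 3) + 15))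
    {u : ℝ} (hu : u ≠ 0) :
    scalePath r 16 u ^ (2 * N + 3) * scalePath s0 e u * scalePath s1 1 u * scalePath s2 2 u *
      scalePath s3 4 u * scalePath s4 8 u = 1 := by
  have hz : (u : ℂ) ≠ 0 := by exact_mod_cast hu
  have h0 : (u : ℂ) ^ e = (((u : ℂ) ^ 16) ^ (2 * N + 3) * (u : ℂ) ^ 15)⁻¹ := by
    rw [he, zpow_neg, zpow_add₀ hz, zpow_mul]
    norm_cast
  have z16 : (u : ℂ) ^ (16 : ℤ) = (u : ℂ) ^ 16 := by norm_cast
  have z8 : (u : ℂ) ^ (8 : ℤ) = (u : ℂ) ^ 8 := by norm_cast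
  have z4 : (u : ℂ) ^ (4 : ℤ) = (u : ℂ) ^ 4 := by norm_cast
  have z2 : (u : ℂ) ^ (2 : ℤ) = (u : ℂ) ^ 2 := by norm_cast
  simp only [scalePath]
  rw [h0, z16, z8, z4, z2, zpow_one, mul_pow]
  have hw := pow_ne_zero (2 * N + 3) (pow_ne_zero 16 hz)
  generalize ((u : ℂ) ^ 16) ^ (2 * N + 3) = w at *
  rw [mul_inv]
  calc _ = (r ^ (2 * N + 3) * s0 * s1 * s2 * s3 * s4) * (w * w⁻¹) * ((u : ℂ) ^ 15 * ((u : ℂ) ^ 15)⁻¹) := by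
        ring
    _ = 1 := by rw [hroot, mul_inv_cancel₀ hw, mul_inv_cancel₀ (pow_ne_zero _ hz)]; ring

theorem ae_gen5 {r s0 s1 s2 s3 s4 : ℂ} {N : ℕ} {e : ℤ}
    (hroot : r ^ (2 * N + 3) * s0 * s1 * s2 * s3 * s4 = 1) (he : e = -(16 * (2 * N + 3) + 15)) :
    ∀ᵐ u : ℝ, 0 < u → Gen5 (scalePath r 16 u ^ 2) (scalePath s0 e u ^ 2) (scalePath s1 1 u ^ 2)
      (scalePath s2 2 u ^ 2) (scalePath s3 4 u ^ 2) (scalePath s4 8 u ^ 2) N := by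
  obtain ⟨hr, hs0, hs1, hs2, hs3, hs4⟩ := root_ne hroot
  filter_upwards [ae_pow_ne (r := r), ae_av_sq r s0 (e := e) (by omega), ae_av_sq r s1 (e := 1) (by omega),
    ae_av_sq r s2 (e := 2) (by omega), ae_av_sq r s3 (e := 4) (by omega),
    ae_av_sq r s4 (e := 8) (by omega),
    ae_av_sq_mul_sq r s0 s1 (e := e) (e' := 1) (by omega),
    ae_av_sq_mul_sq r s0 s2 (e := e) (e' := 2) (by omega),
    ae_av_sq_mul_sq r s0 s3 (e := e) (e' := 4) (by omega),
    ae_av_sq_mul_sq r s0 s4 (e := e) (e' := 8) (by omega),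
    ae_av_sq_mul_sq r s1 s2 (e := 1) (e' := 2) (by omega),
    ae_av_sq_mul_sq r s1 s3 (e := 1) (e' := 4) (by omega),
    ae_av_sq_mul_sq r s1 s4 (e := 1) (e' := 8) (by omega),
    ae_av_sq_mul_sq r s2 s3 (e := 2) (e' := 4) (by omega),
    ae_av_sq_mul_sq r s2 s4 (e := 2) (e' := 8) (by omega),
    ae_av_sq_mul_sq r s3 s4 (e := 4) (e' := 8) (by omega)]
    with u g0 a0 a1 a2 a3 a4 a01 a02 a03 a04 a12 a13 a14 a23 a24 a34 hu
  have hz : (u : ℂ) ≠ 0 := by exact_mod_cast hu.ne'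
  refine ⟨pow_ne_zero 2 (mul_ne_zero hr (zpow_ne_zero _ hz)), g0 hu, ?_, a0 hu, a1 hu, a2 hu,
    a3 hu, a4 hu, a01 hu, a02 hu, a03 hu, a04 hu, a12 hu, a13 hu, a14 hu, a23 hu, a24 hu, a34 hu⟩
  have := scalePath_constr hroot he hu.ne'
  rw [show (scalePath r 16 u ^ 2) ^ (2 * N + 3) * scalePath s0 e u ^ 2 * scalePath s1 1 u ^ 2 *
    scalePath s2 2 u ^ 2 * scalePath s3 4 u ^ 2 * scalePath s4 8 u ^ 2 =
    (scalePath r 16 u ^ (2 * N + 3) * scalePath s0 e u * scalePath s1 1 u * scalePath s2 2 u *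
      scalePath s3 4 u * scalePath s4 8 u) ^ 2 by ring, this, one_pow]

theorem eq_of_continuousAt_of_ae {F G : ℝ → ℂ} (hF : ContinuousAt F 1) (hG : ContinuousAt G 1)
    (h : ∀ᵐ u : ℝ, 0 < u → F u = G u) : F 1 = G 1 := by
  by_contra hne
  have h1 : ∀ᶠ u in 𝓝 (1 : ℝ), F u ≠ G u := (hF.ne_iff_eventually_ne hG).1 hne
  have h2 : ∀ᶠ u in 𝓝 (1 : ℝ), 0 < u := lt_mem_nhds one_pos
  obtain ⟨v, hv, hv'⟩ := (Measure.dense_of_ae h).inter_nhds_nonempty (h1.and h2)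
  exact hv'.1 (hv hv'.2)

section

open Filter Topology MeasureTheory

theorem Avoids2.congr {q c c' : ℂ} {N : ℕ} (h : Avoids2 q c N) (hc : c' = c) : Avoids2 q c' N :=
  hc ▸ h

theorem continuousAt_griffiths {X : Type*} [TopologicalSpace X] {t : X} {N : ℕ}
    {r s0 s1 s2 s3 s4 : X → ℂ} (hr : ContinuousAt r t) (h0 : ContinuousAt s0 t)
    (h1 : ContinuousAt s1 t) (h2 : ContinuousAt s2 t) (h3 : ContinuousAt s3 t)
    (h4 : ContinuousAt s4 t) (hroot : r t ^ (2 * N + 3) * s0 t * s1 t * s2 t * s3 t * s4 t = 1)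
    (hG : Admissible (r t ^ 2) (s0 t ^ 2) (s1 t ^ 2) (s2 t ^ 2) (s3 t ^ 2) (s4 t ^ 2) N)
    (i j x y : ℕ) :
    ContinuousAt (fun u => griffiths (r u) i j x y (s1 u) (s2 u) (s3 u) (s4 u) N) t := by
  obtain ⟨hr0, hs0, hs1, hs2, hs3, hs4⟩ := root_ne hroot
  have e := rootC0_eq hroot
  have hc : ContinuousAt (fun u => rootC0 (r u) (s1 u) (s2 u) (s3 u) (s4 u) N) t := by
    unfold rootC0
    refine (((((hr.pow _).mul h1).mul h2).mul h3).mul h4).inv₀ ?_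
    simpa using ⟨⟨⟨⟨hr0, hs1⟩, hs2⟩, hs3⟩, hs4⟩
  obtain ⟨b0, b1, b2, b3, b4⟩ := hG.single
  have hq := hG.q_pow
  unfold griffiths
  refine tendsto_finsetSum _ fun a _ => ?_
  refine (((continuousAt_omega hr (((h1.mul h2).mul h3).div h4 hs4) a).mul
    (continuousAt_qRacah hr h1 h2 h3 hr0 hs2 hq b2 b3 hG.c23 hG.c123 i a (Nat.sub_le N j))).mul
    (continuousAt_qRacah hr h3 hc h4 hr0 ?_ hq ?_ b4 ?_ ?_ j y (Nat.sub_le N a))).mul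
    (continuousAt_qRacah hr h4 h2 h1 hr0 hs2 hq b2 b1 (hG.c12.congr (by ring))
      (hG.c124.congr (by ring)) a x (Nat.sub_le N y))
  · rwa [e]
  · rwa [e]
  · rw [e]; exact hG.c04
  · rw [e]; exact hG.c034.congr (by ring)

theorem xi_ne_zero' {r s1 s2 : ℂ} {n N : ℕ} (hs1 : s1 ≠ 0) (hs2 : s2 ≠ 0)
    (h1 : Avoids1 (r ^ 2) (s1 ^ 2) N) (h2 : Avoids1 (r ^ 2) (s2 ^ 2) N) (hn : n ≤ N) :
    xi r n s1 s2 ≠ 0 :=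
  mul_ne_zero (div_ne_zero (h1.qPoch_ne hn rfl) (h2.qPoch_ne hn rfl))
    (pow_ne_zero _ (div_ne_zero hs2 hs1))

variable {r s0 s1 s2 s3 s4 : ℂ} {N : ℕ}

/-- Biorthogonality of the Griffiths polynomials. -/
theorem griffiths_biorthogonal
    (hroot : r ^ (2 * N + 3) * s0 * s1 * s2 * s3 * s4 = 1)
    (hG : Admissible (r ^ 2) (s0 ^ 2) (s1 ^ 2) (s2 ^ 2) (s3 ^ 2) (s4 ^ 2) N)
    (hG' : Admissible (r ^ 2) (s4 ^ 2) (s1 ^ 2) (s3 ^ 2) (s2 ^ 2) (s0 ^ 2) N) {i j k l : ℕ}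
    (hij : i + j ≤ N) (hkl : k + l ≤ N) :
    simplexSum N (fun x y => griffithsW r s0 s1 s2 s3 s4 N x y *
        griffiths r i j x y s1 s2 s3 s4 N * griffiths r k l y x s1 s3 s2 s0 N) =
      if i = k ∧ j = l then griffithsNorm r s0 s1 s2 s3 s4 N i j else 0 := by
  obtain ⟨e, he⟩ : ∃ e : ℤ, e = -(16 * (2 * N + 3) + 15) := ⟨_, rfl⟩
  obtain ⟨hr0, hs0, hs1, hs2, hs3, hs4⟩ := root_ne hroot
  obtain ⟨b0, b1, b2, b3, b4⟩ := hG.single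
  have hq := hG.q_pow
  have hr := continuousAt_scalePath r 16
  have h0 := continuousAt_scalePath s0 e
  have h1 := continuousAt_scalePath s1 1
  have h2 := continuousAt_scalePath s2 2
  have h3 := continuousAt_scalePath s3 4
  have h4 := continuousAt_scalePath s4 8
  have er := scalePath_one r 16
  have e0 := scalePath_one s0 e
  have e1 := scalePath_one s1 1
  have e2 := scalePath_one s2 2
  have e3 := scalePath_one s3 4
  have e4 := scalePath_one s4 8
  have main := eq_of_continuousAt_of_ae
    (F := fun u => simplexSum N (fun x y =>
      griffithsW (scalePath r 16 u) (scalePath s0 e u) (scalePath s1 1 u) (scalePath s2 2 u)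
          (scalePath s3 4 u) (scalePath s4 8 u) N x y *
        griffiths (scalePath r 16 u) i j x y (scalePath s1 1 u) (scalePath s2 2 u)
          (scalePath s3 4 u) (scalePath s4 8 u) N *
        griffiths (scalePath r 16 u) k l y x (scalePath s1 1 u) (scalePath s3 4 u)
          (scalePath s2 2 u) (scalePath s0 e u) N))
    (G := fun u => if i = k ∧ j = l then griffithsNorm (scalePath r 16 u) (scalePath s0 e u)
      (scalePath s1 1 u) (scalePath s2 2 u) (scalePath s3 4 u) (scalePath s4 8 u) N i j else 0)
    ?_ ?_ ?_
  · simpa only [er, e0, e1, e2, e3, e4] using main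
  · simp only [simplexSum]
    refine tendsto_finsetSum _ fun x hx => tendsto_finsetSum _ fun y hy => ?_
    simp only [Finset.mem_range] at hx hy
    refine (ContinuousAt.mul ?_ (continuousAt_griffiths hr h0 h1 h2 h3 h4 ?_ ?_ i j x y)).mul
      (continuousAt_griffiths hr h4 h1 h3 h2 h0 ?_ ?_ k l y x)
    · unfold griffithsW
      refine ((continuousAt_Omega (N := N) hr h1 h2 h4 ?_ ?_ ?_ ?_ ?_ ?_ ?_).mul
        (continuousAt_Lambda hr h3 h0 h4 h1 ?_ ?_ ?_ ?_ ?_ ?_ ?_)).div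
        ((((continuousAt_xi (N := N) hr h2 h4 ?_ ?_ ?_).mul
          (continuousAt_xi (N := N) hr h0 h3 ?_ ?_ ?_)).mul ((h1.div h0 ?_).pow x)).mul
          ((h4.div h1 ?_).pow y)) ?_
      all_goals try simp only [er, e0, e1, e2, e3, e4]
      all_goals first | assumption | omega | skip
      · exact hG.c24
      · exact hG.c03.congr (by ring)
      · exact mul_ne_zero (mul_ne_zero (mul_ne_zero (xi_ne_zero' hs2 hs4 b2 b4 (by omega))
          (xi_ne_zero' hs0 hs3 b0 b3 (by omega))) (pow_ne_zero _ (div_ne_zero hs1 hs0)))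
          (pow_ne_zero _ (div_ne_zero hs4 hs1))
    all_goals simp only [er, e0, e1, e2, e3, e4]
    all_goals first | assumption | skip
    rw [← hroot]; ring
  · by_cases hc : i = k ∧ j = l
    · simp only [if_pos hc, griffithsNorm]
      refine (((continuousAt_omega hr (((h2.mul h0).mul h4).div h3 ?_) j).mul
        (continuousAt_omega hr (((hr.mul h1).mul h2).mul h3) N)).div
        (continuousAt_omega hr (h2.mul h3) i) ?_).mul
        (((continuousAt_Omega (N := N) hr h1 h2 h3 ?_ ?_ ?_ ?_ ?_ ?_ ?_).mul
          (continuousAt_Lambda hr h4 h0 h3 h1 ?_ ?_ ?_ ?_ ?_ ?_ ?_)).div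
          ((continuousAt_xi (N := N) hr h2 h3 ?_ ?_ ?_).mul
            (continuousAt_xi (N := N) hr h0 h4 ?_ ?_ ?_)) ?_)
      all_goals try simp only [er, e0, e1, e2, e3, e4, Pi.mul_apply]
      all_goals first | assumption | omega | skip
      · exact omega_ne_zero hr0 (mul_ne_zero hs2 hs3) i
      · exact hG.c23
      · exact hG.c04.congr (by ring)
      · exact mul_ne_zero (xi_ne_zero' hs2 hs3 b2 b3 (by omega)) (xi_ne_zero' hs0 hs4 b0 b4 (by omega))
    · simp only [if_neg hc]
      exact continuousAt_const
  · filter_upwards [ae_gen5 hroot he] with u hu hpos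
    exact griffiths_biorthogonal_of_gen5 (scalePath_constr hroot he hpos.ne') (hu hpos) hij hkl

end

/-- The value of a `q`-Racah polynomial at the right end of the grid. -/
theorem pR_right (n : ℕ) : ∀ {q a1 a2 a3 : ℂ} (_ : Gen3 q a1 a2 a3) {K : ℕ} (_ : n ≤ K),
    pR q a1 a2 a3 (q ^ K) n K = (-a2) ^ n * q ^ (n + 1).choose 2 *
      (qPoch (q * a3) q n * qPoch (a1 * q ^ (K - n + 1)) q n) /
        (qPoch (q * a2) q n * qPoch (a1 * a2 * a3 * q ^ 2 * q ^ K) q n) := by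
  induction n with
  | zero =>
    intro q a1 a2 a3 _ K _
    simp [pR_zero_left, qPoch_zero]
  | succ n ih =>
    intro q a1 a2 a3 h K hK
    obtain ⟨K, rfl⟩ : ∃ M, K = M + 1 := ⟨K - 1, by omega⟩
    have hq := h.hq
    have hn : n ≤ K := by omega
    have n1 := h.n1
    have n2 := h.n2
    have hX : q ^ (K + 1) ≠ 0 := pow_ne_zero _ hq
    have d1 : ∀ k : ℕ, 1 - q * a2 * q ^ k ≠ 0 := fun k =>
      h.A2.ne (k + 1 : ℕ) (by rw [zpow_natCast]; ring)
    have d2 : ∀ k : ℕ, 1 - a1 * a2 * a3 * q ^ 2 * q ^ (K + 1) * q ^ k ≠ 0 := fun k =>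
      h.A123.ne (k + K + 3 : ℕ) (by rw [zpow_natCast]; ring)
    have d3 : a1 * a2 * q * (q ^ (K + 1)) ^ 2 - 1 ≠ 0 := by
      rw [← neg_ne_zero, neg_sub]
      exact h.A12.ne (2 * K + 3 : ℕ) (by rw [zpow_natCast]; ring)
    have d4 : 1 - (q ^ (K + 1))⁻¹ ≠ 0 := by simpa using one_sub_inv_pow hq h.hqn K.succ_pos
    have hu : raiseU q (a1 * a2) (q * a2) (a1 * a2 * a3 * q ^ 2 * q ^ (K + 1)) (q ^ (K + 1))⁻¹
        (q ^ (K + 1)) = 0 := by simp [raiseU, hX]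
    have hv : raiseV q (a1 * a2) (q * a2) (a1 * a2 * a3 * q ^ 2 * q ^ (K + 1)) (q ^ (K + 1))⁻¹
        (q ^ (K + 1)) = -(q * a2) * ((1 - a1 * q ^ (K + 1)) * (1 - q * a3)) /
          ((1 - q * a2) * (1 - a1 * a2 * a3 * q ^ 2 * q ^ (K + 1))) := by
      have e1 := d1 0
      have e2 := d2 0
      rw [pow_zero, mul_one] at e1 e2
      rw [raiseV, div_eq_div_iff (by positivity) (by positivity)]
      generalize 1 - a1 * a2 * a3 * q ^ 2 * q ^ (K + 1) = D2
      generalize 1 - q * a2 = D1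
      field_simp
      ring
    have hZq : q ^ (K + 1) / q = q ^ K := by rw [pow_succ]; field_simp
    have e1 : qPoch (a1 * q ^ (K + 1 - (n + 1) + 1)) q (n + 1) =
        qPoch (a1 * q ^ (K - n + 1)) q n * (1 - a1 * q ^ (K + 1)) := by
      rw [Nat.add_sub_add_right, qPoch_succ, mul_assoc a1, ← pow_add,
        show K - n + 1 + n = K + 1 by omega]
    have e2 : (n + 1 + 1).choose 2 = (n + 1).choose 2 + (n + 1) := by
      rw [Nat.choose_succ_succ' (n + 1) 1, Nat.choose_one_right, add_comm]
    have e3 : a1 * (q * a2) * (q * a3) * q ^ 2 * q ^ K =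
        q * (a1 * a2 * a3 * q ^ 2 * q ^ (K + 1)) := by ring
    rw [pR_raise _ hq (mul_ne_zero n1 n2) hX d3 (fun k _ => d1 k) (fun k _ => d2 k)
      (fun k hk => one_sub_inv_pow hq h.hqn (by omega)) (fun k _ => h.hqn k), hu, zero_mul, zero_add,
      hv, hZq, Nat.add_sub_cancel, ih h.shift23 hn, e1, e2, e3, qPoch_succ' (q * a3),
      qPoch_succ' (q * a2), qPoch_succ' (a1 * a2 * a3 * q ^ 2 * q ^ (K + 1)), div_mul_div_comm]
    congr 1
    · ring
    · ring

theorem pR_right_succ {q a1 a2 a3 : ℂ} (h : Gen3 q a1 a2 a3) (K : ℕ) :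
    pR q a1 a2 a3 (q ^ (K + 1)) (K + 1) (K + 1) = pR q a1 a2 a3 (q ^ (K + 1)) K (K + 1) *
      (-(a2 * q ^ (K + 1)) * ((1 - a3 * q ^ (K + 1)) * (1 - q * a1)) /
        ((1 - a2 * q ^ (K + 1)) * (1 - a1 * a2 * a3 * q ^ (2 * K + 3)))) := by
  have e2 : (K + 1 + 1).choose 2 = (K + 1).choose 2 + (K + 1) := by
    rw [Nat.choose_succ_succ' (K + 1) 1, Nat.choose_one_right, add_comm]
  have e3 : a1 * q ^ (K + 1 - (K + 1) + 1) = q * a1 := by rw [Nat.sub_self]; ring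
  have e4 : q * (q * a1) = a1 * q ^ (K + 1 - K + 1) := by
    rw [show K + 1 - K + 1 = 2 by omega]; ring
  rw [pR_right _ h le_rfl, pR_right _ h K.le_succ, e2, e3, qPoch_succ' (q * a1), e4, qPoch_succ,
    qPoch_succ, qPoch_succ, div_mul_div_comm]
  congr 1
  · ring
  · ring

theorem pR_one_right {q a1 a2 a3 : ℂ} (h : Gen3 q a1 a2 a3) (K : ℕ) :
    pR q a1 a2 a3 (q ^ (K + 1)) 1 (K + 1) = -(q * a2) * ((1 - q * a3) * (1 - a1 * q ^ (K + 1))) /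
      ((1 - q * a2) * (1 - a1 * a2 * a3 * q ^ 2 * q ^ (K + 1))) := by
  rw [pR_right 1 h (by omega)]
  simp [qPoch, mul_comm]

section

variable {r s0 s1 s2 s3 s4 : ℂ} {M : ℕ}

theorem qRacah_zero_left {n x K : ℕ} (hn : n = 0) (hx : x ≤ K) (r s1 s2 s3 : ℂ) :
    qRacah r n x s1 s2 s3 K = Omega r 0 s1 s2 s3 K := by
  subst hn
  rw [qRacah_eq _ _ _ _ K.zero_le hx, pR_zero_left, mul_one]

theorem qRacah_zero_right {n K : ℕ} (hn : n ≤ K) (r s1 s2 s3 : ℂ) :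
    qRacah r n 0 s1 s2 s3 K = Omega r n s1 s2 s3 K := by
  rw [qRacah_eq _ _ _ _ hn K.zero_le, pR_zero_right, mul_one]

theorem griffiths_zero_pred_right_corner
    (hroot : r ^ (2 * (M + 1) + 3) * s0 * s1 * s2 * s3 * s4 = 1)
    (h : Gen5 (r ^ 2) (s0 ^ 2) (s1 ^ 2) (s2 ^ 2) (s3 ^ 2) (s4 ^ 2) (M + 1)) :
    griffiths r 0 M (M + 1) 0 s1 s2 s3 s4 (M + 1) =
      Omega r 0 s1 s2 s3 1 * Omega r M s3 s0 s4 (M + 1) * Omega r 0 s4 s2 s1 (M + 1) *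
        (-(r ^ 2 * s3 ^ 2) * (1 - (r ^ 2) ^ 2 * s1 ^ 2 * s2 ^ 2) / (1 - r ^ 2 * s3 ^ 2)) := by
  have g421 : Gen3 (r ^ 2) (s4 ^ 2) (s2 ^ 2) (s1 ^ 2) := h.gen124.swap
  have g304 : Gen3 (r ^ 2) (s3 ^ 2) (s0 ^ 2) (s4 ^ 2) := h.gen304
  rw [griffiths_eq hroot, show M + 1 - M = 1 by omega, Finset.sum_range_succ, Finset.sum_range_one]
  simp only [Nat.add_sub_cancel, Nat.sub_zero]
  rw [qRacah_zero_left rfl (Nat.zero_le _), qRacah_zero_left rfl le_rfl,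
    qRacah_zero_left rfl le_rfl, qRacah_zero_right M.le_succ, qRacah_zero_right le_rfl,
    qRacah_eq _ _ _ _ (by omega) le_rfl, pR_one_right g421, Omega_succ_right g304 le_rfl,
    Omega_succ g421 (by omega)]
  obtain ⟨r0, n0, n1, n2, n3, n4⟩ := root_ne hroot
  have hq := h.hq
  have hQ : (r ^ 2) ^ M ≠ 0 := pow_ne_zero _ hq
  have d1 : 1 - r ^ 2 ≠ 0 := by simpa using h.hqn 0
  have d2 : 1 - s1 ^ 2 * s2 ^ 2 * (r ^ 2) ^ 3 * (r ^ 2) ^ M ≠ 0 :=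
    h.A12.ne (M + 3 : ℕ) (by rw [zpow_natCast]; ring)
  have d3 : 1 - s1 ^ 2 * s2 ^ 2 * r ^ 2 ≠ 0 := h.A12.ne (1 : ℕ) (by rw [zpow_natCast]; ring)
  have d4 : 1 - r ^ 2 * s2 ^ 2 ≠ 0 := h.A2.ne (1 : ℕ) (by rw [zpow_natCast]; ring)
  have d5 : 1 - r ^ 2 * s1 ^ 2 ≠ 0 := h.A1.ne (1 : ℕ) (by rw [zpow_natCast]; ring)
  have d6 : 1 - r ^ 2 * s3 ^ 2 ≠ 0 := h.A3.ne (1 : ℕ) (by rw [zpow_natCast]; ring)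
  have d7 : 1 - s4 ^ 2 * ((r ^ 2) ^ M * r ^ 2) ≠ 0 :=
    h.A4.ne (M + 1 : ℕ) (by rw [zpow_natCast]; ring)
  have d8 : 1 - s4 ^ 2 * s2 ^ 2 * s1 ^ 2 * (r ^ 2) ^ 2 * ((r ^ 2) ^ M * r ^ 2) ≠ 0 :=
    g421.A123.ne (M + 3 : ℕ) (by rw [zpow_natCast]; ring)
  have d9 : 1 - s1 ^ 2 * s2 ^ 2 * s3 ^ 2 * (r ^ 2) ^ 3 ≠ 0 :=
    h.gen3.A123.ne (3 : ℕ) (by rw [zpow_natCast]; ring)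
  have hrt : r ^ 5 * (r ^ 2) ^ M * s0 * s1 * s2 * s3 * s4 = 1 := by rw [← hroot]; ring
  simp only [pow_zero, mul_one, omega, Nat.choose_self, zero_add, pow_one, one_pow, one_mul]
  rw [pow_succ (r ^ 2) M]
  generalize Omega r 0 s1 s2 s3 1 = OA
  generalize Omega r M s3 s0 s4 M = OB
  generalize Omega r 0 s4 s2 s1 (M + 1) = OC
  generalize (r ^ 2) ^ M = Q at *
  have c1 : (1 - s1 ^ 2 * s2 ^ 2 * (r ^ 2) ^ 3) * (1 - s1 ^ 2 * s2 ^ 2 * r ^ 2) /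
        ((1 - s1 ^ 2 * s2 ^ 2 * r ^ 2) * (1 - r ^ 2)) *
        ((1 - (Q * r ^ 2)⁻¹) / (1 - s1 ^ 2 * s2 ^ 2 * (r ^ 2) ^ 2 * (Q * r ^ 2))) *
        ((1 - r ^ 2 * s2 ^ 2) / (1 - r ^ 2 * s1 ^ 2)) *
        ((1 - s1 ^ 2 * s2 ^ 2 * s4 ^ 2 * (r ^ 2) ^ 2 * (Q * r ^ 2)) /
          (1 - (s4 ^ 2 * (Q * r ^ 2))⁻¹)) * (r ^ 2 * (s2 ^ 2 * s4 ^ 2))⁻¹ *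
        (-(r ^ 2 * s2 ^ 2) * ((1 - r ^ 2 * s1 ^ 2) * (1 - s4 ^ 2 * (Q * r ^ 2))) /
          ((1 - r ^ 2 * s2 ^ 2) * (1 - s4 ^ 2 * s2 ^ 2 * s1 ^ 2 * (r ^ 2) ^ 2 * (Q * r ^ 2)))) =
      (1 - s1 ^ 2 * s2 ^ 2 * (r ^ 2) ^ 3) * (Q * r ^ 2 - 1) /
        ((1 - r ^ 2) * (1 - s1 ^ 2 * s2 ^ 2 * (r ^ 2) ^ 3 * Q)) := by
    rw [show s1 ^ 2 * s2 ^ 2 * (r ^ 2) ^ 2 * (Q * r ^ 2) = s1 ^ 2 * s2 ^ 2 * (r ^ 2) ^ 3 * Q by ring,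
      show s1 ^ 2 * s2 ^ 2 * s4 ^ 2 * (r ^ 2) ^ 2 * (Q * r ^ 2) =
        s4 ^ 2 * s2 ^ 2 * s1 ^ 2 * (r ^ 2) ^ 2 * (Q * r ^ 2) by ring,
      show 1 - (s4 ^ 2 * (Q * r ^ 2))⁻¹ =
        -(1 - s4 ^ 2 * (Q * r ^ 2)) / (s4 ^ 2 * (Q * r ^ 2)) by field_simp; ring,
      show 1 - (Q * r ^ 2)⁻¹ = (Q * r ^ 2 - 1) / (Q * r ^ 2) by field_simp]
    generalize 1 - s4 ^ 2 * s2 ^ 2 * s1 ^ 2 * (r ^ 2) ^ 2 * (Q * r ^ 2) = D8 at *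
    generalize 1 - s4 ^ 2 * (Q * r ^ 2) = D7 at *
    generalize 1 - s1 ^ 2 * s2 ^ 2 * (r ^ 2) ^ 3 * Q = D2 at *
    generalize 1 - s1 ^ 2 * s2 ^ 2 * (r ^ 2) ^ 3 = D9 at *
    generalize 1 - r ^ 2 * s1 ^ 2 = D5 at *
    generalize 1 - r ^ 2 * s2 ^ 2 = D4 at *
    generalize 1 - s1 ^ 2 * s2 ^ 2 * r ^ 2 = D3 at *
    generalize 1 - r ^ 2 = D1 at *
    generalize Q * r ^ 2 - 1 = E at *
    field_simp
  have e1 : 1 - s3 ^ 2 * s0 ^ 2 * s4 ^ 2 * (r ^ 2) ^ 2 * Q * Q =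
      -(1 - s1 ^ 2 * s2 ^ 2 * (r ^ 2) ^ 3) / (s1 ^ 2 * s2 ^ 2 * (r ^ 2) ^ 3) := by
    rw [eq_div_iff (by positivity)]
    linear_combination (-(r ^ 5 * Q * s0 * s1 * s2 * s3 * s4) - 1) * hrt
  have e2 : 1 - s3 ^ 2 * s0 ^ 2 * s4 ^ 2 * (r ^ 2) ^ 2 * Q =
      -(1 - s1 ^ 2 * s2 ^ 2 * (r ^ 2) ^ 3 * Q) / (s1 ^ 2 * s2 ^ 2 * (r ^ 2) ^ 3 * Q) := by
    rw [eq_div_iff (by positivity)]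
    linear_combination (-(r ^ 5 * Q * s0 * s1 * s2 * s3 * s4) - 1) * hrt
  have e3 : 1 - s0 ^ 2 * s4 ^ 2 * (r ^ 2) ^ 2 * Q * Q =
      -(1 - s1 ^ 2 * s2 ^ 2 * s3 ^ 2 * (r ^ 2) ^ 3) / (s1 ^ 2 * s2 ^ 2 * s3 ^ 2 * (r ^ 2) ^ 3) := by
    rw [eq_div_iff (by positivity)]
    linear_combination (-(r ^ 5 * Q * s0 * s1 * s2 * s3 * s4) - 1) * hrt
  have e4 : s1 * s2 * s3 / s4 = r * s0 * (s1 ^ 2 * s2 ^ 2 * s3 ^ 2 * (r ^ 2) ^ 2 * Q) := by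
    rw [div_eq_iff n4]
    linear_combination -(s1 * s2 * s3) * hrt
  rw [e1, e2, e3, e4, mul_div_assoc (r ^ 2 * s3 ^ 2), mul_div_assoc (r ^ 2), div_self hQ, mul_one,
    mul_one]
  have key : (1 - r ^ 2 * Q) / (1 - r ^ 2) * (-(1 - s1 ^ 2 * s2 ^ 2 * (r ^ 2) ^ 3) /
          (s1 ^ 2 * s2 ^ 2 * (r ^ 2) ^ 3) / (-(1 - s1 ^ 2 * s2 ^ 2 * (r ^ 2) ^ 3 * Q) /
          (s1 ^ 2 * s2 ^ 2 * (r ^ 2) ^ 3 * Q))) * ((1 - r ^ 2 * s3 ^ 2) * (r * s0) /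
          (-(1 - s1 ^ 2 * s2 ^ 2 * s3 ^ 2 * (r ^ 2) ^ 3) /
            (s1 ^ 2 * s2 ^ 2 * s3 ^ 2 * (r ^ 2) ^ 3))) * (1 - s1 ^ 2 * s2 ^ 2 * s3 ^ 2 * (r ^ 2) ^ 3) =
      (1 - r ^ 2 * s3 ^ 2) * (r * s0 * (s1 ^ 2 * s2 ^ 2 * s3 ^ 2 * (r ^ 2) ^ 2 * Q) * r ^ 2) *
      ((1 - s1 ^ 2 * s2 ^ 2 * (r ^ 2) ^ 3) * (Q * r ^ 2 - 1) /
        ((1 - r ^ 2) * (1 - s1 ^ 2 * s2 ^ 2 * (r ^ 2) ^ 3 * Q))) := by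
    generalize 1 - s1 ^ 2 * s2 ^ 2 * s3 ^ 2 * (r ^ 2) ^ 3 = D9 at *
    generalize 1 - s1 ^ 2 * s2 ^ 2 * (r ^ 2) ^ 3 * Q = D2 at *
    generalize 1 - r ^ 2 = D1 at *
    field_simp
    ring
  generalize (1 - r ^ 2 * Q) / (1 - r ^ 2) * (-(1 - s1 ^ 2 * s2 ^ 2 * (r ^ 2) ^ 3) /
          (s1 ^ 2 * s2 ^ 2 * (r ^ 2) ^ 3) / (-(1 - s1 ^ 2 * s2 ^ 2 * (r ^ 2) ^ 3 * Q) /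
          (s1 ^ 2 * s2 ^ 2 * (r ^ 2) ^ 3 * Q))) * ((1 - r ^ 2 * s3 ^ 2) * (r * s0) /
          (-(1 - s1 ^ 2 * s2 ^ 2 * s3 ^ 2 * (r ^ 2) ^ 3) /
            (s1 ^ 2 * s2 ^ 2 * s3 ^ 2 * (r ^ 2) ^ 3))) = F at *
  rw [show Nat.choose 1 2 = 0 from rfl, pow_zero, one_mul, mul_assoc OC, c1,
    mul_div_assoc' (OA * (OB * F) * OC), eq_div_iff d6]
  linear_combination OA * OB * OC * key

end

section

theorem Omega_ne_zero {r s1 s2 s3 : ℂ} {n K N : ℕ} (hr : r ≠ 0) (hs2 : s2 ≠ 0)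
    (hq : ∀ m : ℕ, 1 ≤ m → m ≤ N → (r ^ 2) ^ m ≠ 1) (h1 : Avoids1 (r ^ 2) (s1 ^ 2) N)
    (h2 : Avoids1 (r ^ 2) (s2 ^ 2) N) (h3 : Avoids1 (r ^ 2) (s3 ^ 2) N)
    (h23 : Avoids2 (r ^ 2) (s2 ^ 2 * s3 ^ 2) N)
    (h123 : Avoids2 (r ^ 2) (r ^ 2 * s1 ^ 2 * s2 ^ 2 * s3 ^ 2) N) (hn : n ≤ K) (hK : K ≤ N) :
    Omega r n s1 s2 s3 K ≠ 0 := by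
  have e1 : qPoch (r ^ 2) (r ^ 2) n ≠ 0 := qPoch_self_ne hq (hn.trans hK)
  have e2 : qPoch (r ^ 2) (r ^ 2) (K - n) ≠ 0 := qPoch_self_ne hq (by omega)
  have e3 : qPoch (r ^ 2) (r ^ 2) K ≠ 0 := qPoch_self_ne hq hK
  have e4 : qPoch (s1 ^ 2 * s2 ^ 2 * s3 ^ 2 * (r ^ 2) ^ (K + 2)) (r ^ 2) n ≠ 0 :=
    qPoch_ne_zero fun l hl => h123.ne (m := K + 1 + l) (by omega) (by omega) (by ring)
  rw [Omega, qBinom, if_pos hn]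
  exact div_ne_zero (mul_ne_zero (div_ne_zero e3 (mul_ne_zero e1 e2))
    (mul_ne_zero (mul_ne_zero (h2.qPoch_ne (hn.trans hK) rfl) e4)
      (h1.qPoch_ne (by omega) rfl)))
    (mul_ne_zero (mul_ne_zero (zpow_ne_zero _ (mul_ne_zero hr hs2)) (reducedPoch_ne h23 hn hK))
      (h3.qPoch_ne (hn.trans hK) rfl))

theorem Lambda_ne_zero {r s1 s2 s3 s4 : ℂ} {x N : ℕ} (hr : r ≠ 0) (hs1 : s1 ≠ 0) (hs2 : s2 ≠ 0)
    (hs3 : s3 ≠ 0) (hs4 : s4 ≠ 0) (hq : ∀ m : ℕ, 1 ≤ m → m ≤ N → (r ^ 2) ^ m ≠ 1)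
    (h1 : Avoids1 (r ^ 2) (s1 ^ 2) N) (h2 : Avoids1 (r ^ 2) (s2 ^ 2) N)
    (h12 : Avoids2 (r ^ 2) (s1 ^ 2 * s2 ^ 2) N) (hx : x ≤ N) :
    Lambda r x s1 s2 s3 s4 N ≠ 0 := by
  have e1 : qPoch (r ^ 2) (r ^ 2) x ≠ 0 := qPoch_self_ne hq hx
  have e2 : qPoch (r ^ 2) (r ^ 2) (N - x) ≠ 0 := qPoch_self_ne hq (by omega)
  have e3 : qPoch (r ^ 2) (r ^ 2) N ≠ 0 := qPoch_self_ne hq le_rfl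
  rw [Lambda, qBinom, if_pos hx]
  exact mul_ne_zero (div_ne_zero (mul_ne_zero (mul_ne_zero (pow_ne_zero _ (by norm_num))
    (div_ne_zero e3 (mul_ne_zero e1 e2))) (mul_ne_zero (h2.qPoch_ne hx rfl)
      (pow_ne_zero _ (mul_ne_zero hr hs2)))) (mul_ne_zero (h1.qPoch_ne hx rfl)
      (reducedPoch_ne h12 hx le_rfl)))
    (pow_ne_zero _ (div_ne_zero (mul_ne_zero (mul_ne_zero hs1 hs3) (zpow_ne_zero _ hr))
      (mul_ne_zero hs2 hs4)))

variable {r s0 s1 s2 s3 s4 : ℂ} {N M : ℕ}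

theorem griffiths_zero_top (hroot : r ^ (2 * N + 3) * s0 * s1 * s2 * s3 * s4 = 1) {x y : ℕ}
    (hxy : x + y ≤ N) :
    griffiths r 0 N x y s1 s2 s3 s4 N =
      Omega r 0 s1 s2 s3 0 * qRacah r N y s3 s0 s4 N * Omega r 0 s4 s2 s1 (N - y) := by
  rw [griffiths_eq hroot, Nat.sub_self, Finset.sum_range_one, qRacah_zero_left rfl le_rfl,
    qRacah_zero_left rfl (by omega), Nat.sub_zero]
  simp [omega]

theorem griffiths_zero_pred_left_corner
    (hroot : r ^ (2 * (M + 1) + 3) * s0 * s1 * s2 * s3 * s4 = 1) :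
    griffiths r 0 M 0 (M + 1) s1 s2 s3 s4 (M + 1) =
      Omega r 0 s1 s2 s3 1 * qRacah r M (M + 1) s3 s0 s4 (M + 1) * Omega r 0 s4 s2 s1 0 := by
  have h0 : qRacah r 1 0 s4 s2 s1 (M + 1 - (M + 1)) = 0 := if_neg (by omega)
  rw [griffiths_eq hroot, show M + 1 - M = 1 by omega, Finset.sum_range_succ, Finset.sum_range_one,
    h0, qRacah_zero_left rfl (Nat.zero_le _), qRacah_zero_left rfl (Nat.zero_le _), Nat.sub_zero,
    Nat.sub_self]
  simp [omega]

/-- Comparison of the polynomials of indices `(0, N)` and `(0, N - 1)` at the points `(0, N)` and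
`(N, 0)`, for generic parameters. -/
theorem griffiths_corner_of_gen5
    (hroot : r ^ (2 * (M + 1) + 3) * s0 * s1 * s2 * s3 * s4 = 1)
    (h : Gen5 (r ^ 2) (s0 ^ 2) (s1 ^ 2) (s2 ^ 2) (s3 ^ 2) (s4 ^ 2) (M + 1)) :
    s4 ^ 2 * (r ^ 2) ^ (M + 1) * (1 - s0 ^ 2 * (r ^ 2) ^ (M + 1)) *
        (griffiths r 0 (M + 1) 0 (M + 1) s1 s2 s3 s4 (M + 1) *
          griffiths r 0 M (M + 1) 0 s1 s2 s3 s4 (M + 1)) =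
      -(1 - s4 ^ 2 * (r ^ 2) ^ (M + 1)) *
        (griffiths r 0 (M + 1) (M + 1) 0 s1 s2 s3 s4 (M + 1) *
          griffiths r 0 M 0 (M + 1) s1 s2 s3 s4 (M + 1)) := by
  have d1 : 1 - s0 ^ 2 * (r ^ 2) ^ (M + 1) ≠ 0 := h.A0.ne (M + 1 : ℕ) (by rw [zpow_natCast]; ring)
  have d2 : 1 - r ^ 2 * s3 ^ 2 ≠ 0 := h.A3.ne (1 : ℕ) (by rw [zpow_natCast]; ring)
  have d3 : 1 - (r ^ 2) ^ 2 * s1 ^ 2 * s2 ^ 2 ≠ 0 := h.A12.ne (2 : ℕ) (by rw [zpow_natCast]; ring)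
  obtain ⟨r0, n0, n1, n2, n3, n4⟩ := root_ne hroot
  have hc := h.constr
  have e1 : 1 - s3 ^ 2 * s0 ^ 2 * s4 ^ 2 * (r ^ 2) ^ (2 * M + 3) =
      -(1 - (r ^ 2) ^ 2 * s1 ^ 2 * s2 ^ 2) / ((r ^ 2) ^ 2 * s1 ^ 2 * s2 ^ 2) := by
    rw [eq_div_iff (by positivity)]
    linear_combination -hc
  rw [griffiths_zero_top hroot (by omega), griffiths_zero_top hroot (by omega),
    griffiths_zero_pred_left_corner hroot, griffiths_zero_pred_right_corner hroot h,
    qRacah_zero_right le_rfl, qRacah_eq _ _ _ _ le_rfl le_rfl, qRacah_eq _ _ _ _ M.le_succ le_rfl,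
    pR_right_succ h.gen304, e1]
  simp only [Nat.sub_zero, Nat.sub_self]
  have key : s4 ^ 2 * (r ^ 2) ^ (M + 1) * (1 - s0 ^ 2 * (r ^ 2) ^ (M + 1)) *
      ((-(s0 ^ 2 * (r ^ 2) ^ (M + 1)) * ((1 - s4 ^ 2 * (r ^ 2) ^ (M + 1)) * (1 - r ^ 2 * s3 ^ 2)) /
        ((1 - s0 ^ 2 * (r ^ 2) ^ (M + 1)) *
          (-(1 - (r ^ 2) ^ 2 * s1 ^ 2 * s2 ^ 2) / ((r ^ 2) ^ 2 * s1 ^ 2 * s2 ^ 2)))) *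
        (-(r ^ 2 * s3 ^ 2) * (1 - (r ^ 2) ^ 2 * s1 ^ 2 * s2 ^ 2) / (1 - r ^ 2 * s3 ^ 2))) =
      -(1 - s4 ^ 2 * (r ^ 2) ^ (M + 1)) := by
    have hc' : (r ^ 2) ^ (M + 1) * (r ^ 2) ^ (M + 1) * (r ^ 2) ^ 3 * s0 ^ 2 * s1 ^ 2 * s2 ^ 2 *
      s3 ^ 2 * s4 ^ 2 = 1 := by rw [← hc]; ring
    generalize (r ^ 2) ^ (M + 1) = Q at *
    generalize 1 - s4 ^ 2 * Q = D4
    generalize 1 - r ^ 2 * s3 ^ 2 = D2 at *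
    generalize 1 - (r ^ 2) ^ 2 * s1 ^ 2 * s2 ^ 2 = D3 at *
    generalize 1 - s0 ^ 2 * Q = D1 at *
    field_simp
    linear_combination -D4 * hc'
  linear_combination Omega r 0 s1 s2 s3 0 * Omega r (M + 1) s3 s0 s4 (M + 1) *
    pR (r ^ 2) (s3 ^ 2) (s0 ^ 2) (s4 ^ 2) ((r ^ 2) ^ (M + 1)) M (M + 1) *
    Omega r 0 s4 s2 s1 0 * Omega r 0 s1 s2 s3 1 * Omega r M s3 s0 s4 (M + 1) *
    Omega r 0 s4 s2 s1 (M + 1) * key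

end

section

variable {r s0 s1 s2 s3 s4 : ℂ} {N M : ℕ}

/-- An identity between functions continuous in the parameters that holds for generic parameters
holds for all of them. -/
theorem eq_of_continuousAt_of_gen5 {N : ℕ} {F G : ℂ → ℂ → ℂ → ℂ → ℂ → ℂ → ℂ}
    (hroot : r ^ (2 * N + 3) * s0 * s1 * s2 * s3 * s4 = 1)
    (hF : ∀ {r' t0 t1 t2 t3 t4 : ℝ → ℂ}, ContinuousAt r' 1 → ContinuousAt t0 1 → ContinuousAt t1 1 →
      ContinuousAt t2 1 → ContinuousAt t3 1 → ContinuousAt t4 1 → r' 1 = r → t0 1 = s0 →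
      t1 1 = s1 → t2 1 = s2 → t3 1 = s3 → t4 1 = s4 →
      ContinuousAt (fun u => F (r' u) (t0 u) (t1 u) (t2 u) (t3 u) (t4 u)) 1 ∧
        ContinuousAt (fun u => G (r' u) (t0 u) (t1 u) (t2 u) (t3 u) (t4 u)) 1)
    (h : ∀ {r s0 s1 s2 s3 s4 : ℂ}, r ^ (2 * N + 3) * s0 * s1 * s2 * s3 * s4 = 1 →
      Gen5 (r ^ 2) (s0 ^ 2) (s1 ^ 2) (s2 ^ 2) (s3 ^ 2) (s4 ^ 2) N →
      F r s0 s1 s2 s3 s4 = G r s0 s1 s2 s3 s4) :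
    F r s0 s1 s2 s3 s4 = G r s0 s1 s2 s3 s4 := by
  obtain ⟨e, he⟩ : ∃ e : ℤ, e = -(16 * (2 * N + 3) + 15) := ⟨_, rfl⟩
  obtain ⟨h1, h2⟩ := hF (continuousAt_scalePath r 16) (continuousAt_scalePath s0 e)
    (continuousAt_scalePath s1 1) (continuousAt_scalePath s2 2) (continuousAt_scalePath s3 4)
    (continuousAt_scalePath s4 8) (scalePath_one ..) (scalePath_one ..) (scalePath_one ..)
    (scalePath_one ..) (scalePath_one ..) (scalePath_one ..)
  have := eq_of_continuousAt_of_ae h1 h2 (by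
    filter_upwards [ae_gen5 hroot he] with u hu hpos
    exact h (scalePath_constr hroot he hpos.ne') (hu hpos))
  simpa only [scalePath_one] using this

theorem griffiths_corner
    (hroot : r ^ (2 * (M + 1) + 3) * s0 * s1 * s2 * s3 * s4 = 1)
    (hG : Admissible (r ^ 2) (s0 ^ 2) (s1 ^ 2) (s2 ^ 2) (s3 ^ 2) (s4 ^ 2) (M + 1)) :
    s4 ^ 2 * (r ^ 2) ^ (M + 1) * (1 - s0 ^ 2 * (r ^ 2) ^ (M + 1)) *
        (griffiths r 0 (M + 1) 0 (M + 1) s1 s2 s3 s4 (M + 1) *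
          griffiths r 0 M (M + 1) 0 s1 s2 s3 s4 (M + 1)) =
      -(1 - s4 ^ 2 * (r ^ 2) ^ (M + 1)) *
        (griffiths r 0 (M + 1) (M + 1) 0 s1 s2 s3 s4 (M + 1) *
          griffiths r 0 M 0 (M + 1) s1 s2 s3 s4 (M + 1)) := by
  refine eq_of_continuousAt_of_gen5
    (F := fun r s0 s1 s2 s3 s4 => s4 ^ 2 * (r ^ 2) ^ (M + 1) * (1 - s0 ^ 2 * (r ^ 2) ^ (M + 1)) *
        (griffiths r 0 (M + 1) 0 (M + 1) s1 s2 s3 s4 (M + 1) *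
          griffiths r 0 M (M + 1) 0 s1 s2 s3 s4 (M + 1)))
    (G := fun r s0 s1 s2 s3 s4 => -(1 - s4 ^ 2 * (r ^ 2) ^ (M + 1)) *
        (griffiths r 0 (M + 1) (M + 1) 0 s1 s2 s3 s4 (M + 1) *
          griffiths r 0 M 0 (M + 1) s1 s2 s3 s4 (M + 1))) hroot ?_ griffiths_corner_of_gen5
  intro r' t0 t1 t2 t3 t4 hr h0 h1 h2 h3 h4 er e0 e1 e2 e3 e4
  subst er e0 e1 e2 e3 e4
  have hc := continuousAt_griffiths hr h0 h1 h2 h3 h4 hroot hG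
  exact ⟨(((h4.pow 2).mul ((hr.pow 2).pow _)).mul (continuousAt_const.sub
    ((h0.pow 2).mul ((hr.pow 2).pow _)))).mul ((hc ..).mul (hc ..)),
    (continuousAt_const.sub ((h4.pow 2).mul ((hr.pow 2).pow _))).neg.mul ((hc ..).mul (hc ..))⟩

theorem qRacah_pred_right_ne_zero
    (hroot : r ^ (2 * (M + 1) + 3) * s0 * s1 * s2 * s3 * s4 = 1)
    (hG : Admissible (r ^ 2) (s0 ^ 2) (s1 ^ 2) (s2 ^ 2) (s3 ^ 2) (s4 ^ 2) (M + 1)) :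
    qRacah r M (M + 1) s3 s0 s4 (M + 1) ≠ 0 := by
  obtain ⟨hr0, hs0, hs1, hs2, hs3, hs4⟩ := root_ne hroot
  obtain ⟨b0, b1, b2, b3, b4⟩ := hG.single
  have hO : Omega r M s3 s0 s4 (M + 1) ≠ 0 := Omega_ne_zero hr0 hs0 hG.q_pow b3 b0 b4 hG.c04
    (hG.c034.congr (by ring)) M.le_succ le_rfl
  have main := eq_of_continuousAt_of_gen5 (N := M + 1)
    (F := fun r s0 s1 s2 s3 s4 => qRacah r M (M + 1) s3 s0 s4 (M + 1) *
      (qPoch (r ^ 2 * s0 ^ 2) (r ^ 2) M *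
        qPoch (s3 ^ 2 * s0 ^ 2 * s4 ^ 2 * (r ^ 2) ^ 2 * (r ^ 2) ^ (M + 1)) (r ^ 2) M))
    (G := fun r s0 s1 s2 s3 s4 => Omega r M s3 s0 s4 (M + 1) *
      ((-s0 ^ 2) ^ M * (r ^ 2) ^ (M + 1).choose 2 * (qPoch (r ^ 2 * s4 ^ 2) (r ^ 2) M *
        qPoch (s3 ^ 2 * (r ^ 2) ^ 2) (r ^ 2) M))) hroot ?_ ?_
  · intro h0
    simp only [h0, zero_mul] at main
    refine mul_ne_zero hO (mul_ne_zero (mul_ne_zero (pow_ne_zero _ (neg_ne_zero.2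
      (pow_ne_zero _ hs0))) (pow_ne_zero _ (pow_ne_zero _ hr0)))
      (mul_ne_zero (b4.qPoch_ne M.le_succ rfl) (qPoch_ne_zero fun l hl => ?_))) main.symm
    exact b3.ne (m := l + 2) (by omega) (by omega) (by ring)
  · intro r' t0 t1 t2 t3 t4 hr h0 h1 h2 h3 h4 er e0 e1 e2 e3 e4
    subst er e0 e1 e2 e3 e4
    exact ⟨(continuousAt_qRacah hr h3 h0 h4 hr0 hs0 hG.q_pow b0 b4 hG.c04
        (hG.c034.congr (by ring)) M (M + 1) le_rfl).mul
        ((continuousAt_qPoch ((hr.pow 2).mul (h0.pow 2)) (hr.pow 2) M).mul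
          (continuousAt_qPoch (((((h3.pow 2).mul (h0.pow 2)).mul (h4.pow 2)).mul
            ((hr.pow 2).pow 2)).mul ((hr.pow 2).pow _)) (hr.pow 2) M)),
      (continuousAt_Omega hr h3 h0 h4 hr0 hs0 hG.q_pow b4 hG.c04 M.le_succ le_rfl).mul
        ((((h0.pow 2).neg.pow M).mul ((hr.pow 2).pow _)).mul
          ((continuousAt_qPoch ((hr.pow 2).mul (h4.pow 2)) (hr.pow 2) M).mul
          (continuousAt_qPoch ((h3.pow 2).mul ((hr.pow 2).pow 2)) (hr.pow 2) M)))⟩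
  · intro r s0 s1 s2 s3 s4 _ h
    have h' := h.gen304
    have e1 : qPoch (r ^ 2 * s0 ^ 2) (r ^ 2) M ≠ 0 :=
      qPoch_ne_of_Av h.A0 1 (by ring) M
    have e2 : qPoch (s3 ^ 2 * s0 ^ 2 * s4 ^ 2 * (r ^ 2) ^ 2 * (r ^ 2) ^ (M + 1)) (r ^ 2) M ≠ 0 :=
      qPoch_ne_of_Av h'.A123 (M + 3) (by ring) M
    simp only [qRacah_eq _ _ _ _ M.le_succ le_rfl, pR_right M h' M.le_succ,
      show M + 1 - M + 1 = 2 by omega]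
    rw [mul_assoc, div_mul_cancel₀ _ (mul_ne_zero e1 e2)]

theorem griffiths_corner_ne_zero
    (hroot : r ^ (2 * (M + 1) + 3) * s0 * s1 * s2 * s3 * s4 = 1)
    (hG : Admissible (r ^ 2) (s0 ^ 2) (s1 ^ 2) (s2 ^ 2) (s3 ^ 2) (s4 ^ 2) (M + 1)) :
    griffiths r 0 (M + 1) (M + 1) 0 s1 s2 s3 s4 (M + 1) *
      griffiths r 0 M 0 (M + 1) s1 s2 s3 s4 (M + 1) ≠ 0 := by
  obtain ⟨hr0, hs0, hs1, hs2, hs3, hs4⟩ := root_ne hroot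
  obtain ⟨b0, b1, b2, b3, b4⟩ := hG.single
  have h123 {K : ℕ} (hK : K ≤ M + 1) : Omega r 0 s1 s2 s3 K ≠ 0 :=
    Omega_ne_zero hr0 hs2 hG.q_pow b1 b2 b3 hG.c23 hG.c123 K.zero_le hK
  have h421 {K : ℕ} (hK : K ≤ M + 1) : Omega r 0 s4 s2 s1 K ≠ 0 :=
    Omega_ne_zero hr0 hs2 hG.q_pow b4 b2 b1 (hG.c12.congr (by ring)) (hG.c124.congr (by ring))
      K.zero_le hK
  rw [griffiths_zero_top hroot (by omega), griffiths_zero_pred_left_corner hroot,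
    qRacah_zero_right le_rfl]
  exact mul_ne_zero (mul_ne_zero (mul_ne_zero (h123 (by omega)) (Omega_ne_zero hr0 hs0 hG.q_pow
    b3 b0 b4 hG.c04 (hG.c034.congr (by ring)) le_rfl le_rfl)) (h421 (by omega)))
    (mul_ne_zero (mul_ne_zero (h123 (by omega)) (qRacah_pred_right_ne_zero hroot hG))
      (h421 (by omega)))

theorem griffithsW_ne_zero
    (hroot : r ^ (2 * N + 3) * s0 * s1 * s2 * s3 * s4 = 1)
    (hG : Admissible (r ^ 2) (s0 ^ 2) (s1 ^ 2) (s2 ^ 2) (s3 ^ 2) (s4 ^ 2) N) {x y : ℕ}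
    (hxy : x + y ≤ N) : griffithsW r s0 s1 s2 s3 s4 N x y ≠ 0 := by
  obtain ⟨hr0, hs0, hs1, hs2, hs3, hs4⟩ := root_ne hroot
  obtain ⟨b0, b1, b2, b3, b4⟩ := hG.single
  rw [griffithsW]
  exact div_ne_zero (mul_ne_zero (Omega_ne_zero hr0 hs2 hG.q_pow b1 b2 b4 hG.c24
    (hG.c124) (by omega) (by omega)) (Lambda_ne_zero hr0 hs3 hs0 hs4 hs1 hG.q_pow b3 b0
      (hG.c03.congr (by ring)) (by omega)))
    (mul_ne_zero (mul_ne_zero (mul_ne_zero (xi_ne_zero' hs2 hs4 b2 b4 (by omega))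
      (xi_ne_zero' hs0 hs3 b0 b3 (by omega))) (pow_ne_zero _ (div_ne_zero hs1 hs0)))
      (pow_ne_zero _ (div_ne_zero hs4 hs1)))

end

section

/-- The rows of a square matrix that are orthogonal with nonzero norms separate vectors. -/
theorem eq_zero_of_orthogonal {ι : Type*} [Fintype ι] [DecidableEq ι] {A : ι → ι → ℂ}
    {w h f : ι → ℂ} (hh : ∀ i, h i ≠ 0)
    (hA : ∀ i k, ∑ p, w p * A i p * A k p = if i = k then h i else 0)
    (hf : ∀ i, ∑ p, A i p * f p = 0) : f = 0 := by
  have h1 : Matrix.of A * Matrix.of (fun p k => w p * A k p / h k) = 1 := by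
    ext i k
    have : ∑ p, A i p * (w p * A k p / h k) = (if i = k then h i else 0) / h k := by
      rw [← hA, Finset.sum_div]
      exact Finset.sum_congr rfl fun p _ => by ring
    rw [Matrix.mul_apply, Matrix.one_apply]
    simp only [Matrix.of_apply, this]
    split_ifs with hik
    · rw [hik, div_self (hh k)]
    · rw [zero_div]
  have h2 : Matrix.mulVec (Matrix.of A) f = 0 := funext hf
  rw [← Matrix.one_mulVec f, ← mul_eq_one_comm.1 h1, ← Matrix.mulVec_mulVec, h2,
    Matrix.mulVec_zero]

/-- The grid `x + y ≤ N`. -/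
def simplex (N : ℕ) : Finset (ℕ × ℕ) :=
  (Finset.range (N + 1)).sigma (fun x => Finset.range (N - x + 1)) |>.map
    (Equiv.sigmaEquivProd ℕ ℕ).toEmbedding

theorem mem_simplex {N : ℕ} {p : ℕ × ℕ} : p ∈ simplex N ↔ p.1 + p.2 ≤ N := by
  simp only [simplex, Finset.mem_map_equiv, Finset.mem_sigma, Finset.mem_range,
    Equiv.sigmaEquivProd_symm_apply]
  omega

theorem simplexSum_eq_sum (N : ℕ) (f : ℕ → ℕ → ℂ) :
    simplexSum N f = ∑ p : simplex N, f p.1.1 p.1.2 := by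
  rw [Finset.sum_coe_sort (simplex N) (fun p => f p.1 p.2), simplex, Finset.sum_map,
    Finset.sum_sigma, simplexSum]
  rfl

variable {r s0 s1 s2 s3 s4 : ℂ} {N M : ℕ}

theorem not_isOrthogonalFamily_griffiths
    (hroot : r ^ (2 * (M + 1) + 3) * s0 * s1 * s2 * s3 * s4 = 1)
    (hG : Admissible (r ^ 2) (s0 ^ 2) (s1 ^ 2) (s2 ^ 2) (s3 ^ 2) (s4 ^ 2) (M + 1))
    (hG' : Admissible (r ^ 2) (s4 ^ 2) (s1 ^ 2) (s3 ^ 2) (s2 ^ 2) (s0 ^ 2) (M + 1)) :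
    ¬ IsOrthogonalFamily (M + 1) (fun i j x y => griffiths r i j x y s1 s2 s3 s4 (M + 1)) := by
  rintro ⟨w, h, hh, horth⟩
  set W := griffithsW r s0 s1 s2 s3 s4 (M + 1) with hW
  set n := griffithsNorm r s0 s1 s2 s3 s4 (M + 1) with hn
  set g := fun i j x y => griffiths r i j x y s1 s2 s3 s4 (M + 1) with hg
  set g' := fun i j x y => griffiths r i j y x s1 s3 s2 s0 (M + 1) with hg'
  have hroot' : r ^ (2 * (M + 1) + 3) * s4 * s1 * s3 * s2 * s0 = 1 := by rw [← hroot]; ring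
  have prop {k l : ℕ} (hkl : k + l ≤ M + 1) {x y : ℕ} (hxy : x + y ≤ M + 1) :
      h k l * W x y * g' k l x y = n k l * w x y * g k l x y := by
    have := eq_zero_of_orthogonal (ι := simplex (M + 1)) (A := fun i p => g i.1.1 i.1.2 p.1.1 p.1.2)
      (w := fun p => w p.1.1 p.1.2) (h := fun i => h i.1.1 i.1.2)
      (f := fun p => h k l * W p.1.1 p.1.2 * g' k l p.1.1 p.1.2 -
        n k l * w p.1.1 p.1.2 * g k l p.1.1 p.1.2)
      (fun i => hh _ _ (mem_simplex.1 i.2)) (fun i k => ?_) (fun i => ?_)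
    · exact sub_eq_zero.1 (congrFun this ⟨(x, y), mem_simplex.2 hxy⟩)
    · rw [← simplexSum_eq_sum (M + 1) (fun x y => w x y * g i.1.1 i.1.2 x y * g k.1.1 k.1.2 x y),
        horth _ _ _ _ (mem_simplex.1 i.2) (mem_simplex.1 k.2)]
      simp only [← Prod.ext_iff, ← Subtype.ext_iff]
    · have e1 := griffiths_biorthogonal hroot hG hG' (mem_simplex.1 i.2) hkl
      have e2 := horth _ _ _ _ (mem_simplex.1 i.2) hkl
      rw [simplexSum_eq_sum] at e1 e2
      rw [← hW, ← hn] at e1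
      calc _ = h k l * (∑ p : simplex (M + 1), W p.1.1 p.1.2 * g i.1.1 i.1.2 p.1.1 p.1.2 *
              g' k l p.1.1 p.1.2) - n k l * (∑ p : simplex (M + 1), w p.1.1 p.1.2 *
              g i.1.1 i.1.2 p.1.1 p.1.2 * g k l p.1.1 p.1.2) := by
            rw [Finset.mul_sum, Finset.mul_sum, ← Finset.sum_sub_distrib]
            exact Finset.sum_congr rfl fun p _ => by ring
        _ = 0 := by
            rw [e1, e2]
            split_ifs with hc
            · rw [hc.1, hc.2]; ring
            · simp
  have c := griffiths_corner hroot hG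
  have c' := griffiths_corner hroot' hG'
  have z := griffiths_corner_ne_zero hroot hG
  have z' := griffiths_corner_ne_zero hroot' hG'
  obtain ⟨hr0, hs0, hs1, hs2, hs3, hs4⟩ := root_ne hroot
  have d0 : 1 - s0 ^ 2 * (r ^ 2) ^ (M + 1) ≠ 0 :=
    hG.single.1.ne (m := M + 1) (by omega) le_rfl rfl
  have d4 : 1 - s4 ^ 2 * (r ^ 2) ^ (M + 1) ≠ 0 :=
    hG'.single.1.ne (m := M + 1) (by omega) le_rfl rfl
  have d123 : 1 - r ^ 2 * s1 ^ 2 * s2 ^ 2 * s3 ^ 2 * (r ^ 2) ^ 2 ≠ 0 :=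
    hG.c123.ne (m := 2) le_rfl (by omega) rfl
  have p1 := prop (k := 0) (l := M + 1) (by omega) (x := 0) (y := M + 1) (by omega)
  have p2 := prop (k := 0) (l := M + 1) (by omega) (x := M + 1) (y := 0) (by omega)
  have p3 := prop (k := 0) (l := M) (by omega) (x := 0) (y := M + 1) (by omega)
  have p4 := prop (k := 0) (l := M) (by omega) (x := M + 1) (y := 0) (by omega)
  have k1 := hh 0 (M + 1) (by omega)
  have k2 := hh 0 M (by omega)
  have w1 : W 0 (M + 1) ≠ 0 := griffithsW_ne_zero hroot hG (by omega)
  have w2 : W (M + 1) 0 ≠ 0 := griffithsW_ne_zero hroot hG (by omega)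
  simp only [hg, hg'] at p1 p2 p3 p4
  have hc := hG.constr
  generalize griffiths r 0 (M + 1) (M + 1) 0 s1 s2 s3 s4 (M + 1) = a1 at *
  generalize griffiths r 0 M 0 (M + 1) s1 s2 s3 s4 (M + 1) = a2 at *
  generalize griffiths r 0 (M + 1) 0 (M + 1) s1 s2 s3 s4 (M + 1) = a3 at *
  generalize griffiths r 0 M (M + 1) 0 s1 s2 s3 s4 (M + 1) = a4 at *
  generalize griffiths r 0 (M + 1) (M + 1) 0 s1 s3 s2 s0 (M + 1) = b1 at *
  generalize griffiths r 0 M 0 (M + 1) s1 s3 s2 s0 (M + 1) = b2 at *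
  generalize griffiths r 0 (M + 1) 0 (M + 1) s1 s3 s2 s0 (M + 1) = b3 at *
  generalize griffiths r 0 M (M + 1) 0 s1 s3 s2 s0 (M + 1) = b4 at *
  have cross : b1 * a1 * (b2 * a2) = b3 * a3 * (b4 * a4) := by
    have : h 0 (M + 1) * h 0 M * W 0 (M + 1) * W (M + 1) 0 *
        (b1 * a1 * (b2 * a2) - b3 * a3 * (b4 * a4)) = 0 := by
      linear_combination a1 * a2 * (h 0 M * W (M + 1) 0 * b2) * p1 +
        a1 * a2 * (n 0 (M + 1) * w 0 (M + 1) * a3) * p4 -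
        a3 * a4 * (h 0 M * W 0 (M + 1) * b4) * p2 -
        a3 * a4 * (n 0 (M + 1) * w (M + 1) 0 * a1) * p3
    have := (mul_eq_zero.1 this).resolve_left (by positivity)
    exact sub_eq_zero.1 this
  refine mul_ne_zero (mul_ne_zero d123 (mul_ne_zero d0 d4)) (mul_ne_zero z z') ?_
  linear_combination (1 - s0 ^ 2 * (r ^ 2) ^ (M + 1)) * (1 - s4 ^ 2 * (r ^ 2) ^ (M + 1)) *
    (cross - a3 * a4 * b3 * b4 * hc) + r ^ 2 * s1 ^ 2 * s2 ^ 2 * s3 ^ 2 * (r ^ 2) ^ 2 *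
    (s0 ^ 2 * (r ^ 2) ^ (M + 1) * (1 - s4 ^ 2 * (r ^ 2) ^ (M + 1)) * (b3 * b4) * c -
      (1 - s4 ^ 2 * (r ^ 2) ^ (M + 1)) * (a1 * a2) * c')

end

end QGriffiths

end

open QGriffiths in
/-- Here `q = r ^ 2` and `cᵢ = sᵢ ^ 2`. -/
theorem mainTheorem5 (N : ℕ) (r s0 s1 s2 s3 s4 : ℂ)
    (hroot : r ^ (2 * N + 3) * s0 * s1 * s2 * s3 * s4 = 1)
    (hG : Admissible (r ^ 2) (s0 ^ 2) (s1 ^ 2) (s2 ^ 2) (s3 ^ 2) (s4 ^ 2) N)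
    (hG' : Admissible (r ^ 2) (s4 ^ 2) (s1 ^ 2) (s3 ^ 2) (s2 ^ 2) (s0 ^ 2) N) :
    (∀ i j k l : ℕ, i + j ≤ N → k + l ≤ N →
      simplexSum N (fun x y =>
        Omega r x s1 s2 s4 (N - y) * Lambda r y s3 s0 s4 s1 N /
            (xi r x s2 s4 * xi r y s0 s3 * (s1 / s0) ^ x * (s4 / s1) ^ y) *
          griffiths r i j x y s1 s2 s3 s4 N * griffiths r k l y x s1 s3 s2 s0 N) =
      (if i = k then 1 else 0) * (if j = l then 1 else 0) *
        (omega r j (s2 * s0 * s4 / s3) * omega r N (r * s1 * s2 * s3) / omega r i (s2 * s3)) *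
        (Omega r i s1 s2 s3 (N - j) * Lambda r j s4 s0 s3 s1 N /
          (xi r i s2 s3 * xi r j s0 s4))) ∧
    (1 ≤ N → ¬ IsOrthogonalFamily N (fun i j x y => griffiths r i j x y s1 s2 s3 s4 N)) := by
  refine ⟨fun i j k l hij hkl => ?_, fun hN => ?_⟩
  · refine (griffiths_biorthogonal hroot hG hG' hij hkl).trans ?_
    by_cases h1 : i = k <;> by_cases h2 : j = l <;> simp [h1, h2, griffithsNorm]
  · obtain ⟨M, rfl⟩ : ∃ M, N = M + 1 := ⟨N - 1, by omega⟩
    exact not_isOrthogonalFamily_griffiths hroot hG hG'
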